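/- Let $(\eta_t,\mathbb P_x)_{t\ge0,\,x\in\mathbb R^d}$ be a (jointly measurable) time-homogeneous Markov family in $\mathbb R^d$ with semigroup $T_tf(x)=\mathbb E_xf(\eta_t)$, such that (A1) for all $r,\varepsilon>0$, $\liminf_{s\downarrow0}\inf_{|x|\le r}\mathbb P_x(|\eta_s-x|<\varepsilon)=1$; (A2) every Schwartz function $\varphi\in\mathcal S(\mathbb R^d)$ lies in the domain of the infinitesimal operator of $(T_t)$ on $C_0(\mathbb R^d)$; (A3) for every $\varphi\in\mathcal S(\mathbb R^d)$, $T^\varphi_tf(x)=\mathbb E_x\big[\exp\big(\int_0^t\varphi(\eta_s)\,ds\big)f(\eta_t)\big]$ is a Feller semigroup, i.e. a strongly continuous semigroup of positive operators on $C_0(\mathbb R^d)$. Let $V>0$, $0<q<1/2$, $H>0$, $Q=V(1-2q)$, $T^Q_t=e^{-Qt}T_t$, $Q_0^S=Q^2/(4Vq)$, and let $\lambda$ be Lebesgue measure on $\mathbb R^d$. Let $N=(N_t)_{t\ge0}$ be the subcritical superprocess with immigration: the (jointly measurable) time-homogeneous measure-valued Markov process with $N_0=0$ and, for bounded measurable $f\ge0$,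 $$\mathbb E\big[e^{-\langle N_{s+t},f\rangle}\,\big|\,N_r,\ r\le s\big]=\exp\Big(-\langle N_s,H_tf\rangle-H\int_0^t\langle\lambda,H_rf\rangle\,dr\Big),\qquad H_tf=T^Q_tf-Vq\int_0^tT^Q_{t-s}\big[(H_sf)^2\big]\,ds .$$ Fix $\varphi\in\mathcal S(\mathbb R^d)$ with $\varphi\ge0$, $\varphi\not\equiv0$. With the norming $F_T=T$ put $$\langle Y_T(t),\varphi\rangle=\frac1{F_T}\int_0^{Tt}\langle N_s,\varphi\rangle\,ds,\qquad t\in[0,1].$$ For $\theta<\theta_0:=Q_0^S/\|\varphi\|_\infty$ let $v_\varphi(x,t,\theta)$ be the measurable, locally bounded in time solution of $$v_\varphi(x,t,\theta)=\int_0^tT^Q_{t-s}[\theta\varphi](x)\,ds+Vq\int_0^tT^Q_{t-s}\big[v_\varphi(\cdot,s,\theta)^2\big](x)\,ds ,$$ and put $v_\varphi(x,\theta)=\lim_{t\to\infty}v_\varphi(x,t,\theta)$ and $$A=\lim_{\theta\uparrow\theta_0}\int_{\mathbb R^d}\frac{\partial}{\partial\theta}v_\varphi(x,\theta)\,dx\in[0,\infty].$$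 For a finite signed Borel measure $\nu$ on $[0,1]$ let $\chi_\nu(s)=\nu((s,1])$. If $\sup_{s\in[0,1]}\chi_\nu(s)<\theta_0$ put $$\Lambda(\nu)=H\int_0^1\int_{\mathbb R^d}v_\varphi(x,\chi_\nu(t))\,dx\,dt\in[-\infty,\infty]$$ (the integral of the positive part minus that of the negative part, with $\infty-\infty:=-\infty$), and for $f\in\mathcal C([0,1],\mathbb R)$ put $$\Lambda^*(f)=\sup\Big\{\int_{[0,1]}f\,d\nu-\Lambda(\nu):\ \nu\text{ a finite signed Borel measure on }[0,1],\ \sup_{s}\chi_\nu(s)<\theta_0\Big\}.$$ Let $\mathcal C_{0,HA}$ be the set of $f\in\mathcal C([0,1],\mathbb R)$ that are differentiable on $[0,1]$ (one-sidedly at the end points) with $0<f'(t)<HA$ for all $t\in[0,1]$. Below, $\{\langle Y_T,\varphi\rangle\in U\}$ is the event that the path $t\mapsto\langle Y_T(t),\varphi\rangle$ on $[0,1]$ is finite and belongs to $U$. Conventions: $\log0=-\infty$, $\inf\emptyset=+\infty$. Then the following hold. 1. For every open set $U\subset\mathcal C([0,1],\mathbb R)$, $$\liminf_{T\to\infty}T^{-1}\log\mathbb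 P\big(\langle Y_T,\varphi\rangle\in U\big)\ \ge\ -\inf_{f\in U\cap\mathcal C_{0,HA}}\Lambda^*(f).$$ 2. Let $f\in\mathcal C_{0,HA}$, and let $B(f,r)$ be the open ball in $\mathcal C([0,1],\mathbb R)$ of radius $r$ centred at $f$. If $\Lambda^*(f)<\infty$, then for every $\delta>0$ there is $r>0$ such that $$\limsup_{T\to\infty}T^{-1}\log\mathbb P\big(\langle Y_T,\varphi\rangle\in B(f,r)\big)\ \le\ \delta-\Lambda^*(f).$$ If $\Lambda^*(f)=\infty$, then for every $m\in\mathbb R$ there is $r>0$ such that this $\limsup$ is at most $-m$. -/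

import Mathlib

open MeasureTheory ProbabilityTheory Filter Topology Set
open scoped ENNReal SchwartzMap ZeroAtInfty unitInterval

noncomputable section

namespace SuperLDP

/-- The state space `ℝ^d`. -/
abbrev E (d : ℕ) : Type := EuclideanSpace ℝ (Fin d)

/-! ### The motion -/

/-- A time-homogeneous Markov family `(η_t, P_x)` in `ℝ^d`, realised on one measurable space `S`.
Only times `t ≥ 0` are meaningful. Joint measurability of `(t, ω) ↦ η_t(ω)` is what makes
`∫_0^t φ(η_s) ds` a random variable. -/
structure MarkovFamily (d : ℕ) (S : Type*) [MeasurableSpace S] where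
  /-- the position at time `t` -/
  η : ℝ → S → E d
  /-- the law of the family started at `x` -/
  P : Kernel (E d) S
  isMarkovKernel : IsMarkovKernel P
  measurable_η : Measurable (Function.uncurry η)
  start : ∀ x, ∀ᵐ ω ∂(P x), η 0 ω = x
  /-- the Markov property with respect to the natural filtration:
  `P_x(η_{s+t} ∈ B | η_r, r ≤ s) = P_{η_s}(η_t ∈ B)` -/
  markov : ∀ (x : E d) (s t : ℝ), 0 ≤ s → 0 ≤ t → ∀ B : Set (E d), MeasurableSet B →
    ∀ F : Set S,
      MeasurableSet[⨆ r ∈ Icc (0 : ℝ) s, MeasurableSpace.comap (η r) inferInstance] F →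
      P x (F ∩ η (s + t) ⁻¹' B) = ∫⁻ ω in F, P (η s ω) (η t ⁻¹' B) ∂(P x)

variable {d : ℕ} {S : Type*} [MeasurableSpace S]

/-- The semigroup `T_t f(x) = E_x f(η_t)`. -/
def MarkovFamily.T (M : MarkovFamily d S) (t : ℝ) (f : E d → ℝ) (x : E d) : ℝ :=
  ∫ ω, f (M.η t ω) ∂(M.P x)

/-- The discounted semigroup `T_t^Q f(x) = e^{-Qt} T_t f(x)`. -/
def MarkovFamily.TQ (M : MarkovFamily d S) (Q t : ℝ) (f : E d → ℝ) (x : E d) : ℝ :=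
  Real.exp (-Q * t) * M.T t f x

/-- The Feynman–Kac semigroup `T_t^φ f(x) = E_x [exp(∫_0^t φ(η_s) ds) f(η_t)]`. -/
def MarkovFamily.feynmanKac (M : MarkovFamily d S) (φ : E d → ℝ) (t : ℝ) (f : E d → ℝ)
    (x : E d) : ℝ :=
  ∫ ω, Real.exp (∫ s in (0 : ℝ)..t, φ (M.η s ω)) * f (M.η t ω) ∂(M.P x)

/-- A Feller semigroup: a strongly continuous semigroup of positive operators on `C_0(ℝ^d)`.
Contractivity is not part of the definition, since Feynman–Kac semigroups with positive potentials
are not contractive. -/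
structure IsFellerSemigroup (G : ℝ → (E d → ℝ) → E d → ℝ) : Prop where
  maps_C0 : ∀ t, 0 ≤ t → ∀ f : C₀(E d, ℝ), ∃ g : C₀(E d, ℝ), ∀ x, G t f x = g x
  zero : ∀ f : C₀(E d, ℝ), G 0 f = f
  add : ∀ s t, 0 ≤ s → 0 ≤ t → ∀ f : C₀(E d, ℝ), G (s + t) f = G s (G t f)
  pos : ∀ t, 0 ≤ t → ∀ f : C₀(E d, ℝ), (∀ x, 0 ≤ f x) → ∀ x, 0 ≤ G t f x
  strongly_continuous : ∀ f : C₀(E d, ℝ), TendstoUniformly (fun t => G t f) f (𝓝[>] 0)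

/-- The family is almost uniformly stochastically continuous. -/
def MarkovFamily.UniformlyStochContinuous (M : MarkovFamily d S) : Prop :=
  ∀ r : ℝ, 0 < r → ∀ ε : ℝ, 0 < ε →
    liminf (fun s : ℝ => ⨅ x ∈ Metric.closedBall (0 : E d) r,
      M.P x {ω | M.η s ω ∈ Metric.ball x ε}) (𝓝[>] 0) = 1

/-- Schwartz functions belong to the domain of the infinitesimal operator of `T` on
`C_0(ℝ^d)`. -/
def MarkovFamily.SchwartzInDomain (M : MarkovFamily d S) : Prop :=
  ∀ φ : 𝓢(E d, ℝ), ∃ g : C₀(E d, ℝ),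
    TendstoUniformly (fun (t : ℝ) (x : E d) => (M.T t φ x - φ x) / t) g (𝓝[>] 0)

/-- For every Schwartz function `φ` the semigroup `T^φ` is a Feller semigroup. -/
def MarkovFamily.FeynmanKacFeller (M : MarkovFamily d S) : Prop :=
  ∀ φ : 𝓢(E d, ℝ), IsFellerSemigroup (M.feynmanKac φ)

/-! ### The integral equations -/

/-- The total rate `Q = V (1 - 2q)` of dying. -/
def Qrate (V q : ℝ) : ℝ := V * (1 - 2 * q)

/-- `w` is the (measurable, locally bounded in time) solution of
`w(t, x) = g(t, x) + c ∫_0^t T_{t-s}^Q [w(s, ·)^2](x) ds`, `t ≥ 0`. -/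
def IsMildSolution (M : MarkovFamily d S) (Q c : ℝ) (g w : ℝ → E d → ℝ) : Prop :=
  Measurable (Function.uncurry w) ∧
  (∀ t : ℝ, ∃ C : ℝ, ∀ s ∈ Icc 0 t, ∀ x, |w s x| ≤ C) ∧
  ∀ t : ℝ, 0 ≤ t → ∀ x : E d,
    w t x = g t x + c * ∫ s in (0 : ℝ)..t, M.TQ Q (t - s) (fun y => w s y ^ 2) x

/-! ### The superprocess -/

/-- `N` is, under `Pr`, the subcritical superprocess with immigration: a measurable measure-valued
process started from the null measure which is a time-homogeneous Markov process with transition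
Laplace functional
`E [exp(-⟨N_{s+t}, φ⟩) | N_r, r ≤ s] = exp(-⟨N_s, H_t φ⟩ - H ∫_0^t ⟨λ, H_r φ⟩ dr)`,
where `u(t, x) = H_t φ(x)` solves `H_t φ = T_t^Q φ - V q ∫_0^t T_{t-s}^Q [(H_s φ)^2] ds`.
The conditional expectation is expressed through its integrals over events `F` of the past. -/
structure IsSuperprocess (M : MarkovFamily d S) (V q H : ℝ) {Ω : Type*} [MeasurableSpace Ω]
    (Pr : Measure Ω) (N : ℝ → Ω → Measure (E d)) : Prop where
  measurable : Measurable (Function.uncurry N)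
  init : ∀ᵐ ω ∂Pr, N 0 ω = 0
  markov : ∀ φ : E d → ℝ, Measurable φ → (∀ x, 0 ≤ φ x) → (∃ C, ∀ x, φ x ≤ C) →
    ∀ u : ℝ → E d → ℝ,
      IsMildSolution M (Qrate V q) (-(V * q)) (fun t => M.TQ (Qrate V q) t φ) u →
      ∀ s t : ℝ, 0 ≤ s → 0 ≤ t → ∀ F : Set Ω,
        MeasurableSet[⨆ r ∈ Icc (0 : ℝ) s, MeasurableSpace.comap (N r) inferInstance] F →
        ∫⁻ ω in F, EReal.exp (-((∫⁻ x, ENNReal.ofReal (φ x) ∂(N (s + t) ω) : ℝ≥0∞) : EReal)) ∂Pr =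
        ∫⁻ ω in F, EReal.exp (-(((∫⁻ x, ENNReal.ofReal (u t x) ∂(N s ω)) +
          ENNReal.ofReal H * ∫⁻ r in Ioc 0 t, ∫⁻ x, ENNReal.ofReal (u r x) : ℝ≥0∞) : EReal)) ∂Pr

/-- The rescaled occupation time `⟨Y_T(t), φ⟩ = F_T⁻¹ ∫_0^{Tt} ⟨N_s, φ⟩ ds` of a nonnegative `φ`,
as an element of `[0, ∞]`. -/
def rescaledOccupation {Ω : Type*} (N : ℝ → Ω → Measure (E d)) (F : ℝ → ℝ) (φ : E d → ℝ)
    (T t : ℝ) (ω : Ω) : ℝ≥0∞ :=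
  (ENNReal.ofReal (F T))⁻¹ * ∫⁻ s in Ioc 0 (T * t), ∫⁻ x, ENNReal.ofReal (φ x) ∂(N s ω)

/-- The event that the path `t ↦ ⟨Y_T(t), φ⟩`, `t ∈ [0, 1]`, is (finite and) an element of the set
`U` of continuous functions. -/
def pathEvent {Ω : Type*} (N : ℝ → Ω → Measure (E d)) (F : ℝ → ℝ) (φ : E d → ℝ) (T : ℝ)
    (U : Set C(I, ℝ)) : Set Ω :=
  {ω | ∃ g ∈ U, ∀ t : I, ((rescaledOccupation N F φ T t ω : ℝ≥0∞) : EReal) = ((g t : ℝ) : EReal)}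

/-! ### The rate function -/

/-- The threshold `Q_0^S / ‖φ‖_∞`, where `Q_0^S = Q² / (4 V q)`. -/
def threshold (V q : ℝ) (φ : E d → ℝ) : ℝ :=
  Qrate V q ^ 2 / (4 * V * q) / ⨆ x, |φ x|

/-- The solution `v_φ(x, t, θ)` (as `vTime M V q φ θ t x`) of
`v(t) = ∫_0^t T_{t-s}^Q [θ φ] ds + V q ∫_0^t T_{t-s}^Q [v(s)^2] ds`. -/
def vTime (M : MarkovFamily d S) (V q : ℝ) (φ : E d → ℝ) (θ : ℝ) : ℝ → E d → ℝ :=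
  Classical.epsilon (IsMildSolution M (Qrate V q) (V * q)
    (fun t x => ∫ s in (0 : ℝ)..t, M.TQ (Qrate V q) (t - s) (fun y => θ * φ y) x))

/-- `v_φ(x, θ) = lim_{t → ∞} v_φ(x, t, θ)`. -/
def vLim (M : MarkovFamily d S) (V q : ℝ) (φ : E d → ℝ) (x : E d) (θ : ℝ) : ℝ :=
  limUnder atTop (fun t : ℝ => vTime M V q φ θ t x)

/-- `A = lim_{θ ↑ Q_0^S/‖φ‖_∞} ∫ (∂/∂θ) v_φ(x, θ) dx ∈ [0, ∞]`. -/
def slopeA (M : MarkovFamily d S) (V q : ℝ) (φ : E d → ℝ) : ℝ≥0∞ :=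
  limUnder (𝓝[<] threshold V q φ)
    (fun θ : ℝ => ∫⁻ x, ENNReal.ofReal (deriv (fun θ' : ℝ => vLim M V q φ x θ') θ))

/-- The integral of a real function with values in `[-∞, ∞]`: the integral of the positive part
minus that of the negative part. -/
def eIntegral {α : Type*} [MeasurableSpace α] (μ : Measure α) (f : α → ℝ) : EReal :=
  ((∫⁻ a, ENNReal.ofReal (f a) ∂μ : ℝ≥0∞) : EReal) -
    ((∫⁻ a, ENNReal.ofReal (-f a) ∂μ : ℝ≥0∞) : EReal)

/-- `χ_ν(s) = ν((s, 1])` for a finite signed measure `ν` on `[0, 1]`. -/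
def chi (ν : SignedMeasure I) (s : I) : ℝ := ν (Ioi s)

/-- `⟨f, ν⟩ = ∫ f dν`. -/
def pairing (f : C(I, ℝ)) (ν : SignedMeasure I) : ℝ :=
  ∫ t, f t ∂ν.toJordanDecomposition.posPart - ∫ t, f t ∂ν.toJordanDecomposition.negPart

/-- `Λ_φ(ν) = H ∫_0^1 ∫ v_φ(x, χ_ν(t)) dx dt`. -/
def Lam (M : MarkovFamily d S) (V q H : ℝ) (φ : E d → ℝ) (ν : SignedMeasure I) : EReal :=
  (H : EReal) * eIntegral ((volume : Measure I).prod (volume : Measure (E d)))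
    (fun p => vLim M V q φ p.2 (chi ν p.1))

/-- `Λ_φ^*(f) = sup {⟨f, ν⟩ - Λ_φ(ν) : sup χ_ν < Q_0^S/‖φ‖_∞}`. -/
def rate (M : MarkovFamily d S) (V q H : ℝ) (φ : E d → ℝ) (f : C(I, ℝ)) : EReal :=
  ⨆ ν ∈ {ν : SignedMeasure I | ⨆ s, chi ν s < threshold V q φ},
    ((pairing f ν : ℝ) : EReal) - Lam M V q H φ ν

/-- The set `C_{a,b}` of functions differentiable on `[0, 1]` (one-sidedly at the end points) all of
whose derivatives lie in `(a, b)`. -/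
def slopeSet (a b : EReal) : Set C(I, ℝ) :=
  {f | ∀ t : I, ∃ D : ℝ, HasDerivWithinAt (Set.IccExtend (zero_le_one' ℝ) f) D (Icc 0 1) t ∧
    a < (D : EReal) ∧ (D : EReal) < b}

/-- The set `C_{0,HA}`. -/
def admissiblePaths (M : MarkovFamily d S) (V q H : ℝ) (φ : E d → ℝ) : Set C(I, ℝ) :=
  slopeSet 0 ((ENNReal.ofReal H * slopeA M V q φ : ℝ≥0∞) : EReal)

/-- `T⁻¹ log p ∈ [-∞, ∞]` for a probability `p`. -/
def logScale (T : ℝ) (p : ℝ≥0∞) : EReal := ((T⁻¹ : ℝ) : EReal) * ENNReal.log p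

end SuperLDP

end

set_option linter.unusedSectionVars false

noncomputable section

/-! ### Transition kernels and locally bounded functions -/

namespace SuperLDP

open Real (exp)
open ENNReal (ofReal)
open Metric (closedBall)

/-! Put c = Vq and cut (0, T] into n equal cells, with occupation masses X_i. When the stationary
solutions at nonpositive parameters are integrable, the joint Laplace transform of the X_i at θ ≤ 0
is the exponential of H times the space-time integral of the solution v of v = ∫ T^Q(source + c v²)
whose source is θ_i φ on cell i, read in reversed time (`IsSuperprocess.laplace`,
`IsSuperprocess.integral_cubeMono_expMass`). The Laplace functional of the time integral comes from
the Markov property at finitely many times; since the process is only jointly measurable, Riemann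
sums are taken on a randomly shifted grid and averaged over the shift.

If θ_i ‖φ‖ < Q²/(4c), a constant β with 2cβ < Q is a supersolution, so the linearised equation keeps
a positive killing rate κ. Solutions forget their past at rate κ, v is close to the stationary limit
`blim` during most of each cell, and T⁻¹ times the exponent tends to (H/n) Σ_i ∫ blim(x, θ_i) dx
(`Setting.dist_blim`, `Setting.tendsto_integral_gsol`). What follows is an argument of Gärtner–Ellis
type for the vector (X_i): Chernoff bounds from above, and from below an exponential tilt at the
maximiser of the Legendre transform. Bounds on second differences of `blim` in θ supply the
differentiability.

Two obstacles remain. First, the process gives Laplace transforms only for θ ≤ 0, while tilting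
needs θ > 0. Instead of analytic continuation, exp(H ∫ v_θ) is shown to be a positive functional of
the exponentials e^{θ·z} (`ExpPos`, `expPos_branching`): c u² is the limit of an exponential
nonlinearity whose Picard iterates visibly preserve positivity. Riesz extension and Riesz–Markov
turn this into a measure on the cube [0, 1]^n, in the coordinates y_i = exp(-X_i), and uniqueness of
moments shows that the law is a reweighting of that measure (`ExpPos.exists_measure`,
`cube_measure_ext`). Second, `blim` at θ > 0 need not be integrable over the whole space. The
exponent is additive over the place of immigration, so the law factors into the contributions of a
large ball and of its complement. Only the ball is tilted; the complement contributes mass at most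
Tε per cell with a probability that is at least exp(-Tε) (`Setting.eventually_far`). An interior
maximiser exists on large balls because the slopes of the path lie strictly between 0 and HA
(`Setting.exists_maximizer`, `Setting.eventually_le_box`).

The rate function is compared with the discrete Legendre sums in both directions. A purely atomic
measure on the grid shows that every such sum is at most Λ* (`Setting.sum_le_rate`). Conversely, χ_ν
sampled at one well-chosen point of each cell recovers ⟨f, ν⟩ - Λ(ν) up to a small error
(`Setting.exists_grid`). Occupation paths and admissible paths are monotone, so closeness at grid
points is closeness in the uniform norm. If f(0) ≠ 0, or if `blim` at -1 has infinite integral, the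
rate is infinite and the probabilities of small balls vanish or decay faster than any exponential.
-/

variable {X : Type*} [MeasurableSpace X]

/-- A jointly measurable semigroup of Markov kernels `p (t, x)`, `t ≥ 0`. -/
structure IsTransition (p : Kernel (ℝ × X) X) : Prop where
  isMarkovKernel : IsMarkovKernel p
  zero : ∀ x, p (0, x) = Measure.dirac x
  add : ∀ s t x, 0 ≤ s → 0 ≤ t →
    p (s + t, x) =
      ((p.comap (fun y => (t, y)) (by fun_prop)) ∘ₖ (p.comap (fun y => (s, y)) (by fun_prop))) x

/-- The semigroup discounted at rate `l`. -/
def discounted (p : Kernel (ℝ × X) X) (l t : ℝ) (f : X → ℝ) (x : X) : ℝ :=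
  exp (-l * t) * ∫ y, f y ∂p (t, x)

/-- The Duhamel operator `∫_0^t e^{-l(t-s)} T_{t-s} g_s ds`. -/
def duhamel (p : Kernel (ℝ × X) X) (l : ℝ) (g : ℝ → X → ℝ) (t : ℝ) (x : X) : ℝ :=
  ∫ s in Ioc 0 t, discounted p l (t - s) (g s) x

/-- Measurable functions of time and space that are bounded on bounded time intervals. -/
structure LocBdd (g : ℝ → X → ℝ) : Prop where
  meas : Measurable (Function.uncurry g)
  bdd : ∀ t : ℝ, ∃ C : ℝ, ∀ s ∈ Icc 0 t, ∀ x, |g s x| ≤ C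

namespace LocBdd

variable {f g : ℝ → X → ℝ}

lemma bound (hf : LocBdd f) (t : ℝ) : ∃ C : ℝ, 0 < C ∧ ∀ s ∈ Icc 0 t, ∀ x, |f s x| ≤ C := by
  obtain ⟨C, hC⟩ := hf.bdd t
  exact ⟨max C 1, by positivity, fun s hs x => (hC s hs x).trans (le_max_left _ _)⟩

lemma meas_right (hf : LocBdd f) (t : ℝ) : Measurable (f t) :=
  hf.meas.comp measurable_prodMk_left

lemma of_bound (hf : Measurable (Function.uncurry f)) {C : ℝ} (hC : ∀ t x, |f t x| ≤ C) :
    LocBdd f := ⟨hf, fun _ => ⟨C, fun s _ x => hC s x⟩⟩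

lemma const (a : ℝ) : LocBdd (fun (_ : ℝ) (_ : X) => a) :=
  of_bound measurable_const (C := |a|) fun _ _ => le_rfl

lemma add (hf : LocBdd f) (hg : LocBdd g) : LocBdd (fun t x => f t x + g t x) :=
  ⟨hf.meas.add hg.meas, fun t => by
    obtain ⟨C, hC⟩ := hf.bdd t
    obtain ⟨D, hD⟩ := hg.bdd t
    exact ⟨C + D, fun s hs x => (abs_add_le _ _).trans (add_le_add (hC s hs x) (hD s hs x))⟩⟩

lemma neg (hf : LocBdd f) : LocBdd (fun t x => - f t x) :=
  ⟨hf.meas.neg, fun t => by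
    obtain ⟨C, hC⟩ := hf.bdd t
    exact ⟨C, fun s hs x => by rw [abs_neg]; exact hC s hs x⟩⟩

lemma sub (hf : LocBdd f) (hg : LocBdd g) : LocBdd (fun t x => f t x - g t x) := by
  simpa only [sub_eq_add_neg] using hf.add hg.neg

lemma mul (hf : LocBdd f) (hg : LocBdd g) : LocBdd (fun t x => f t x * g t x) :=
  ⟨hf.meas.mul hg.meas, fun t => by
    obtain ⟨C, hC0, hC⟩ := hf.bound t
    obtain ⟨D, hD0, hD⟩ := hg.bound t
    exact ⟨C * D, fun s hs x => by
      rw [abs_mul]; exact mul_le_mul (hC s hs x) (hD s hs x) (abs_nonneg _) hC0.le⟩⟩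

lemma const_mul (a : ℝ) (hf : LocBdd f) : LocBdd (fun t x => a * f t x) := (const a).mul hf

lemma sq (hf : LocBdd f) : LocBdd (fun t x => f t x ^ 2) := by
  simpa only [pow_two] using hf.mul hf

lemma shift (hf : LocBdd f) {r : ℝ} (hr : 0 ≤ r) : LocBdd (fun t x => f (r + t) x) :=
  ⟨hf.meas.comp ((measurable_const.add measurable_fst).prodMk measurable_snd), fun t => by
    obtain ⟨C, hC⟩ := hf.bdd (r + t)
    exact ⟨C, fun s hs x => hC _ ⟨add_nonneg hr hs.1, by linarith [hs.2]⟩ x⟩⟩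

lemma abs (hf : LocBdd f) : LocBdd (fun t x => |f t x|) :=
  ⟨hf.meas.abs, fun t => by
    obtain ⟨C, hC⟩ := hf.bdd t
    exact ⟨C, fun s hs x => by rw [abs_abs]; exact hC s hs x⟩⟩

end LocBdd

/-! ### Duhamel integrals: linearity, monotonicity and bounds -/

section

variable {p : Kernel (ℝ × X) X}

lemma integral_abs_le_of_bound {μ : Measure X} [IsProbabilityMeasure μ] {f : X → ℝ} {C : ℝ}
    (hC : ∀ x, |f x| ≤ C) : |∫ y, f y ∂μ| ≤ C := by
  have := norm_integral_le_of_norm_le_const (μ := μ) (f := f) (C := C)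
    (ae_of_all _ fun x => by simpa using hC x)
  simpa using this

lemma integrable_of_bound {Y : Type*} [MeasurableSpace Y] {μ : Measure Y} [IsFiniteMeasure μ]
    {f : Y → ℝ} (hf : Measurable f) {C : ℝ}
    (hC : ∀ x, |f x| ≤ C) : Integrable f μ :=
  Integrable.of_bound hf.aestronglyMeasurable C (ae_of_all _ fun x => by simpa using hC x)

lemma measurable_discounted_duhamel (hp : IsTransition p) (l : ℝ) {g : ℝ → X → ℝ}
    (hg : Measurable (Function.uncurry g)) :
    Measurable (fun q : (ℝ × X) × ℝ => discounted p l (q.1.1 - q.2) (g q.2) q.1.2) := by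
  have := hp.isMarkovKernel
  unfold discounted
  refine Measurable.mul (by fun_prop) ?_
  let κ : Kernel ((ℝ × X) × ℝ) X := p.comap (fun q => (q.1.1 - q.2, q.1.2)) (by fun_prop)
  have h := StronglyMeasurable.integral_kernel_prod_right (κ := κ)
    (f := fun (q : (ℝ × X) × ℝ) (y : X) => g q.2 y)
    (by
      apply Measurable.stronglyMeasurable
      exact hg.comp ((measurable_snd.comp measurable_fst).prodMk measurable_snd))
  exact h.measurable

lemma measurable_discounted (hp : IsTransition p) (l : ℝ) {f : X → ℝ} (hf : Measurable f) :
    Measurable (fun q : ℝ × X => discounted p l q.1 f q.2) := by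
  have := (measurable_discounted_duhamel hp l (g := fun _ => f) (hf.comp measurable_snd)).comp
    (f := fun q : ℝ × X => (q, (0 : ℝ))) (by fun_prop)
  simpa [Function.comp_def] using this

lemma discounted_bound (hp : IsTransition p) {l t C : ℝ} {f : X → ℝ} (hC : ∀ x, |f x| ≤ C) (x : X) :
    |discounted p l t f x| ≤ exp (-l * t) * C := by
  have := hp.isMarkovKernel
  unfold discounted
  rw [abs_mul, abs_of_pos (Real.exp_pos _)]
  exact mul_le_mul_of_nonneg_left (integral_abs_le_of_bound hC) (Real.exp_pos _).le

lemma locBdd_discounted (hp : IsTransition p) (l : ℝ) {f : X → ℝ} (hf : Measurable f) {C : ℝ}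
    (hC : ∀ x, |f x| ≤ C) : LocBdd (fun t x => discounted p l t f x) := by
  refine ⟨measurable_discounted hp l hf, fun t => ⟨exp (|l| * t) * |C|, fun s hs x => ?_⟩⟩
  refine (discounted_bound hp hC x).trans ?_
  refine mul_le_mul (Real.exp_le_exp.2 ?_) (le_abs_self C) ?_ (Real.exp_pos _).le
  · calc -l * s ≤ |l| * s := mul_le_mul_of_nonneg_right (neg_le_abs l) hs.1
      _ ≤ |l| * t := mul_le_mul_of_nonneg_left hs.2 (abs_nonneg l)
  · exact (abs_nonneg _).trans (hC x)

lemma duhamel_integrand_bound (hp : IsTransition p) (l : ℝ) {g : ℝ → X → ℝ} {t C : ℝ}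
    (hC : ∀ s ∈ Icc 0 t, ∀ x, |g s x| ≤ C) {s : ℝ} (hs : s ∈ Ioc 0 t) (x : X) :
    |discounted p l (t - s) (g s) x| ≤ exp (-l * (t - s)) * C :=
  discounted_bound hp (hC s ⟨hs.1.le, hs.2⟩) x

lemma duhamel_integrable (hp : IsTransition p) (l : ℝ) {g : ℝ → X → ℝ} (hg : LocBdd g) (t : ℝ)
    (x : X) : IntegrableOn (fun s => discounted p l (t - s) (g s) x) (Ioc 0 t) := by
  obtain ⟨C, hC0, hC⟩ := hg.bound t
  have hm : Measurable (fun s => discounted p l (t - s) (g s) x) :=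
    (measurable_discounted_duhamel hp l hg.meas).comp (f := fun s : ℝ => ((t, x), s)) (by fun_prop)
  refine Measure.integrableOn_of_bounded (M := exp (|l| * t) * C) (by simp)
    hm.aestronglyMeasurable ?_
  refine (ae_restrict_iff' measurableSet_Ioc).2 (ae_of_all _ fun s hs => ?_)
  rw [Real.norm_eq_abs]
  refine (duhamel_integrand_bound hp l hC hs x).trans ?_
  refine mul_le_mul_of_nonneg_right (Real.exp_le_exp.2 ?_) hC0.le
  calc -l * (t - s) ≤ |l| * (t - s) :=
        mul_le_mul_of_nonneg_right (neg_le_abs l) (by linarith [hs.2])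
    _ ≤ |l| * t := mul_le_mul_of_nonneg_left (by linarith [hs.1]) (abs_nonneg l)

lemma integral_exp_Ioc (l : ℝ) {t : ℝ} (ht : 0 ≤ t) :
    l * ∫ s in Ioc 0 t, exp (-l * (t - s)) = 1 - exp (-l * t) := by
  rw [← integral_const_mul, ← intervalIntegral.integral_of_le ht]
  have : ∀ s ∈ Set.uIcc 0 t, HasDerivAt (fun s => exp (-l * (t - s)))
      (l * exp (-l * (t - s))) s := by
    intro s _
    have h1 : HasDerivAt (fun s => -l * (t - s)) l s := by
      have := ((hasDerivAt_id s).const_sub t).const_mul (-l)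
      simpa using this
    simpa [mul_comm] using h1.exp
  rw [intervalIntegral.integral_eq_sub_of_hasDerivAt this (Continuous.intervalIntegrable (by fun_prop) _ _)]
  simp

lemma duhamel_add (hp : IsTransition p) (l : ℝ) {f g : ℝ → X → ℝ} (hf : LocBdd f) (hg : LocBdd g)
    (t : ℝ) (x : X) :
    duhamel p l (fun s y => f s y + g s y) t x = duhamel p l f t x + duhamel p l g t x := by
  have := hp.isMarkovKernel
  unfold duhamel
  rw [← integral_add (duhamel_integrable hp l hf t x) (duhamel_integrable hp l hg t x)]
  refine setIntegral_congr_fun measurableSet_Ioc fun s hs => ?_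
  obtain ⟨C, -, hC⟩ := hf.bound t
  obtain ⟨D, -, hD⟩ := hg.bound t
  have hs' : s ∈ Icc 0 t := ⟨hs.1.le, hs.2⟩
  simp only [discounted]
  rw [integral_add (integrable_of_bound (hf.meas_right s) (hC s hs'))
    (integrable_of_bound (hg.meas_right s) (hD s hs'))]
  ring

lemma duhamel_const_mul (p : Kernel (ℝ × X) X) (l a : ℝ) (f : ℝ → X → ℝ)
    (t : ℝ) (x : X) :
    duhamel p l (fun s y => a * f s y) t x = a * duhamel p l f t x := by
  unfold duhamel discounted
  rw [← integral_const_mul]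
  congr 1 with s
  rw [integral_const_mul]
  ring

lemma duhamel_neg (p : Kernel (ℝ × X) X) (l : ℝ) (f : ℝ → X → ℝ) (t : ℝ) (x : X) :
    duhamel p l (fun s y => - f s y) t x = - duhamel p l f t x := by
  simpa using duhamel_const_mul p l (-1) f t x

lemma duhamel_sub (hp : IsTransition p) (l : ℝ) {f g : ℝ → X → ℝ} (hf : LocBdd f) (hg : LocBdd g)
    (t : ℝ) (x : X) :
    duhamel p l (fun s y => f s y - g s y) t x = duhamel p l f t x - duhamel p l g t x := by
  simp only [sub_eq_add_neg]
  rw [duhamel_add hp l hf hg.neg, duhamel_neg]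

lemma duhamel_mono (hp : IsTransition p) (l : ℝ) {f g : ℝ → X → ℝ} (hf : LocBdd f) (hg : LocBdd g)
    {t : ℝ} (h : ∀ s ∈ Ioc 0 t, ∀ x, f s x ≤ g s x) (x : X) :
    duhamel p l f t x ≤ duhamel p l g t x := by
  have := hp.isMarkovKernel
  refine setIntegral_mono_on (duhamel_integrable hp l hf t x) (duhamel_integrable hp l hg t x)
    measurableSet_Ioc fun s hs => ?_
  obtain ⟨C, -, hC⟩ := hf.bound t
  obtain ⟨D, -, hD⟩ := hg.bound t
  have hs' : s ∈ Icc 0 t := ⟨hs.1.le, hs.2⟩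
  refine mul_le_mul_of_nonneg_left ?_ (Real.exp_pos _).le
  exact integral_mono (integrable_of_bound (hf.meas_right s) (hC s hs'))
    (integrable_of_bound (hg.meas_right s) (hD s hs')) (h s hs)

/-- End points are null, so agreement on the open interval suffices; this matters for solutions that
jump at the end of a segment. -/
lemma duhamel_congr (p : Kernel (ℝ × X) X) (l : ℝ) {f g : ℝ → X → ℝ}
    {t : ℝ} (h : ∀ s ∈ Ioo 0 t, ∀ x, f s x = g s x) (x : X) :
    duhamel p l f t x = duhamel p l g t x := by
  unfold duhamel
  rw [integral_Ioc_eq_integral_Ioo, integral_Ioc_eq_integral_Ioo]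
  refine setIntegral_congr_fun measurableSet_Ioo fun s hs => ?_
  simp only [discounted]
  rw [funext (h s hs)]

/-- The Duhamel operator applied to a function of time alone. -/
lemma duhamel_time (hp : IsTransition p) (l : ℝ) (h : ℝ → ℝ) (t : ℝ) (x : X) :
    duhamel p l (fun s _ => h s) t x = ∫ s in Ioc 0 t, exp (-l * (t - s)) * h s := by
  have := hp.isMarkovKernel
  simp [duhamel, discounted]

lemma duhamel_const (hp : IsTransition p) (l a : ℝ) {t : ℝ} (ht : 0 ≤ t) (x : X) :
    l * duhamel p l (fun _ _ => a) t x = a * (1 - exp (-l * t)) := by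
  rw [duhamel_time hp, integral_mul_const, ← mul_assoc, integral_exp_Ioc l ht]
  ring

lemma measurable_duhamel (hp : IsTransition p) (l : ℝ) {g : ℝ → X → ℝ}
    (hg : Measurable (Function.uncurry g)) :
    Measurable (Function.uncurry (duhamel p l g)) := by
  have h1 := measurable_discounted_duhamel hp l hg
  have h2 : Measurable (fun q : (ℝ × X) × ℝ =>
      (Ioc 0 q.1.1).indicator (fun s => discounted p l (q.1.1 - s) (g s) q.1.2) q.2) := by
    have : MeasurableSet {q : (ℝ × X) × ℝ | q.2 ∈ Ioc 0 q.1.1} := by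
      exact (measurableSet_lt measurable_const measurable_snd).inter
        (measurableSet_le measurable_snd (measurable_fst.comp measurable_fst))
    exact h1.indicator this
  have h4 := (h2.stronglyMeasurable.integral_prod_right' (ν := volume)).measurable
  convert h4 using 2 with q
  simp only [Function.uncurry, duhamel]
  rw [← integral_indicator measurableSet_Ioc]

lemma duhamel_of_nonpos (p : Kernel (ℝ × X) X) (l : ℝ) (g : ℝ → X → ℝ) {t : ℝ} (ht : t ≤ 0)
    (x : X) : duhamel p l g t x = 0 := by
  simp [duhamel, Ioc_eq_empty_of_le ht]

lemma duhamel_abs_le_duhamel (hp : IsTransition p) (l : ℝ) {f g : ℝ → X → ℝ} (hf : LocBdd f)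
    (hg : LocBdd g) {t : ℝ} (h : ∀ s ∈ Ioc 0 t, ∀ x, |f s x| ≤ g s x) (x : X) :
    |duhamel p l f t x| ≤ duhamel p l g t x := by
  rw [abs_le]
  constructor
  · rw [← duhamel_neg]
    exact duhamel_mono hp l hg.neg hf (fun s hs x => (abs_le.1 (h s hs x)).1) x
  · exact duhamel_mono hp l hf hg (fun s hs x => (abs_le.1 (h s hs x)).2) x

lemma duhamel_abs_le (hp : IsTransition p) {l : ℝ} (hl : 0 < l) {f : ℝ → X → ℝ} (hf : LocBdd f)
    {t C : ℝ} (hC0 : 0 ≤ C) (h : ∀ s ∈ Ioc 0 t, ∀ x, |f s x| ≤ C) (x : X) :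
    |duhamel p l f t x| ≤ C / l := by
  rcases le_total t 0 with ht | ht
  · rw [duhamel_of_nonpos p l f ht]; simpa using div_nonneg hC0 hl.le
  refine (duhamel_abs_le_duhamel hp l hf (LocBdd.const C) h x).trans ?_
  rw [le_div_iff₀ hl, mul_comm, duhamel_const hp l C ht]
  exact mul_le_of_le_one_right hC0 (by linarith [Real.exp_pos (-l * t)])

lemma locBdd_duhamel (hp : IsTransition p) (l : ℝ) {g : ℝ → X → ℝ} (hg : LocBdd g) :
    LocBdd (duhamel p l g) := by
  refine ⟨measurable_duhamel hp l hg.meas, fun t => ?_⟩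
  obtain ⟨C, hC0, hC⟩ := hg.bound t
  refine ⟨exp (|l| * t) * C * t, fun s hs x => ?_⟩
  have h1 : ∀ r ∈ Ioc 0 s, ‖discounted p l (s - r) (g r) x‖ ≤ exp (|l| * t) * C := by
    intro r hr
    rw [Real.norm_eq_abs]
    refine (duhamel_integrand_bound hp l (fun q hq x => hC q ⟨hq.1, hq.2.trans hs.2⟩ x) hr x).trans ?_
    refine mul_le_mul_of_nonneg_right (Real.exp_le_exp.2 ?_) hC0.le
    calc -l * (s - r) ≤ |l| * (s - r) :=
          mul_le_mul_of_nonneg_right (neg_le_abs l) (by linarith [hr.2])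
      _ ≤ |l| * t := mul_le_mul_of_nonneg_left (by linarith [hr.1, hs.2]) (abs_nonneg l)
  have h2 := norm_setIntegral_le_of_norm_le_const (μ := volume) (s := Ioc 0 s) (by simp) h1
  rw [Real.norm_eq_abs] at h2
  refine h2.trans ?_
  simp only [Measure.real, Real.volume_Ioc, sub_zero, ENNReal.toReal_ofReal hs.1]
  exact mul_le_mul_of_nonneg_left hs.2 (by positivity)

end

/-! ### Resolvent identities and restarting -/

variable {X : Type*} [MeasurableSpace X] {p : Kernel (ℝ × X) X}

lemma integral_exp_Icc (K : ℝ) {r t : ℝ} (hrt : r ≤ t) :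
    K * ∫ s in Ioc r t, exp (-K * (t - s)) = 1 - exp (-K * (t - r)) := by
  rw [← integral_const_mul, ← intervalIntegral.integral_of_le hrt]
  have : ∀ s ∈ Set.uIcc r t, HasDerivAt (fun s => exp (-K * (t - s)))
      (K * exp (-K * (t - s))) s := by
    intro s _
    have h1 : HasDerivAt (fun s => -K * (t - s)) K s := by
      have := ((hasDerivAt_id s).const_sub t).const_mul (-K)
      simpa using this
    simpa [mul_comm] using h1.exp
  rw [intervalIntegral.integral_eq_sub_of_hasDerivAt this
    (Continuous.intervalIntegrable (by fun_prop) _ _)]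
  simp

/-- Fubini: the double integral equals ∫ h(r) ∫_r^t K e^{-K(t-s)} ds dr = ∫ h(r)(1 - e^{-K(t-r)})
dr. This is the scalar form of the resolvent identity. -/
lemma integral_exp_smoothing (K : ℝ) {h : ℝ → ℝ} {t : ℝ} (hh : IntegrableOn h (Ioc 0 t)) :
    ∫ s in Ioc 0 t, h s = (∫ s in Ioc 0 t, exp (-K * (t - s)) * h s) +
      K * ∫ s in Ioc 0 t, exp (-K * (t - s)) * ∫ r in Ioc 0 s, h r := by
  have hexp : Continuous fun s : ℝ => exp (-K * (t - s)) := by fun_prop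
  have hexpi : IntegrableOn (fun s : ℝ => exp (-K * (t - s))) (Ioc 0 t) :=
    (hexp.integrableOn_Icc).mono_set Ioc_subset_Icc_self
  have hprod : Integrable (fun q : ℝ × ℝ => exp (-K * (t - q.1)) * h q.2)
      ((volume.restrict (Ioc 0 t)).prod (volume.restrict (Ioc 0 t))) := hexpi.mul_prod hh
  have hms : MeasurableSet {q : ℝ × ℝ | q.2 ≤ q.1} :=
    measurableSet_le measurable_snd measurable_fst
  have hprod' := hprod.indicator hms
  have e1 : ∀ s ∈ Ioc 0 t, exp (-K * (t - s)) * ∫ r in Ioc 0 s, h r =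
      ∫ r in Ioc 0 t, {q : ℝ × ℝ | q.2 ≤ q.1}.indicator
        (fun q : ℝ × ℝ => exp (-K * (t - q.1)) * h q.2) (s, r) := by
    intro s hs
    rw [← integral_const_mul, ← integral_indicator measurableSet_Ioc,
      ← integral_indicator measurableSet_Ioc]
    congr 1 with r
    by_cases h1 : r ∈ Ioc 0 s
    · have : r ∈ Ioc 0 t := ⟨h1.1, h1.2.trans hs.2⟩
      simp [h1, this, indicator, h1.2]
    · by_cases h2 : r ∈ Ioc 0 t
      · have : ¬ r ≤ s := fun h => h1 ⟨h2.1, h⟩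
        simp [indicator, this]
      · simp [h1, h2]
  rw [setIntegral_congr_fun measurableSet_Ioc e1, integral_integral_swap (f := fun s r =>
    {q : ℝ × ℝ | q.2 ≤ q.1}.indicator
      (fun q : ℝ × ℝ => exp (-K * (t - q.1)) * h q.2) (s, r)) hprod']
  have e2 : ∀ r ∈ Ioc 0 t, K * ∫ s in Ioc 0 t, {q : ℝ × ℝ | q.2 ≤ q.1}.indicator
        (fun q : ℝ × ℝ => exp (-K * (t - q.1)) * h q.2) (s, r) =
      h r - exp (-K * (t - r)) * h r := by
    intro r hr
    have : ∫ s in Ioc 0 t, {q : ℝ × ℝ | q.2 ≤ q.1}.indicator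
        (fun q : ℝ × ℝ => exp (-K * (t - q.1)) * h q.2) (s, r) =
        (∫ s in Ioc r t, exp (-K * (t - s))) * h r := by
      rw [← integral_mul_const, ← integral_Icc_eq_integral_Ioc (x := r),
        ← integral_indicator measurableSet_Ioc, ← integral_indicator measurableSet_Icc]
      congr 1 with s
      by_cases h1 : s ∈ Icc r t
      · have : s ∈ Ioc 0 t := ⟨hr.1.trans_le h1.1, h1.2⟩
        simp [indicator, this.1, h1.1, h1.2]
      · by_cases h2 : s ∈ Ioc 0 t
        · have : ¬ r ≤ s := fun h => h1 ⟨h, h2.2⟩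
          simp [indicator, this]
        · simp [h1, h2]
    rw [this, ← mul_assoc, integral_exp_Icc K hr.2]
    ring
  rw [← integral_const_mul, setIntegral_congr_fun measurableSet_Ioc e2,
    integral_sub hh]
  · ring
  · refine Integrable.bdd_mul (c := exp (|K| * |t|)) hh hexp.aestronglyMeasurable ?_
    refine (ae_restrict_iff' measurableSet_Ioc).2 (ae_of_all _ fun s hs => ?_)
    rw [Real.norm_eq_abs, abs_of_pos (Real.exp_pos _)]
    refine Real.exp_le_exp.2 ?_
    have h1 : 0 ≤ t - s := by linarith [hs.2]
    calc -K * (t - s) ≤ |K| * (t - s) := mul_le_mul_of_nonneg_right (neg_le_abs K) h1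
      _ ≤ |K| * |t| := mul_le_mul_of_nonneg_left (by linarith [hs.1, le_abs_self t]) (abs_nonneg K)

lemma discounted_discounted (hp : IsTransition p) (l : ℝ) {s t : ℝ} (hs : 0 ≤ s) (ht : 0 ≤ t)
    {f : X → ℝ} (hf : Measurable f) {C : ℝ} (hC : ∀ x, |f x| ≤ C) (x : X) :
    discounted p l s (discounted p l t f) x = discounted p l (s + t) f x := by
  have := hp.isMarkovKernel
  have key : ∫ y, f y ∂p (s + t, x) = ∫ y, ∫ z, f z ∂p (t, y) ∂p (s, x) := by
    rw [hp.add s t x hs ht, Kernel.integral_comp]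
    · rfl
    · exact integrable_of_bound hf hC
  unfold discounted
  rw [key, integral_const_mul, ← mul_assoc, ← Real.exp_add]
  congr 2
  ring

lemma discounted_add_rate (p : Kernel (ℝ × X) X) (l K t : ℝ) (f : X → ℝ) (x : X) :
    discounted p (l + K) t f x = exp (-K * t) * discounted p l t f x := by
  unfold discounted
  rw [← mul_assoc, ← Real.exp_add]
  congr 2
  ring

lemma discounted_zero (hp : IsTransition p) (l : ℝ) {f : X → ℝ} (hf : Measurable f) (x : X) :
    discounted p l 0 f x = f x := by
  simp [discounted, hp.zero, integral_dirac' _ _ hf.stronglyMeasurable]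

/-- The semigroup acts on a Duhamel integral. -/
lemma discounted_duhamel (hp : IsTransition p) (l : ℝ) {k : ℝ → X → ℝ} (hk : LocBdd k) {t τ : ℝ}
    (ht : 0 ≤ t) (x : X) :
    discounted p l t (duhamel p l k τ) x =
      ∫ s in Ioc 0 τ, discounted p l (t + τ - s) (k s) x := by
  have := hp.isMarkovKernel
  obtain ⟨C, hC0, hC⟩ := hk.bound τ
  have hm : Measurable (fun q : X × ℝ => discounted p l (τ - q.2) (k q.2) q.1) :=
    (measurable_discounted_duhamel hp l hk.meas).comp
      (f := fun q : X × ℝ => ((τ, q.1), q.2)) (by fun_prop)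
  have hswap : ∫ y, duhamel p l k τ y ∂p (t, x) =
      ∫ s in Ioc 0 τ, ∫ y, discounted p l (τ - s) (k s) y ∂p (t, x) := by
    unfold duhamel
    rw [integral_integral_swap]
    refine Integrable.of_bound hm.aestronglyMeasurable (exp (|l| * |τ|) * C) ?_
    have h1 : ((p (t, x)).prod (volume.restrict (Ioc 0 τ))) =
        ((p (t, x)).prod volume).restrict (univ ×ˢ Ioc 0 τ) := by
      rw [← Measure.prod_restrict, Measure.restrict_univ]
    rw [h1]
    refine (ae_restrict_iff' (MeasurableSet.univ.prod measurableSet_Ioc)).2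
      (ae_of_all _ fun q hq => ?_)
    have hq2 : q.2 ∈ Ioc 0 τ := hq.2
    rw [Real.norm_eq_abs]
    refine (duhamel_integrand_bound hp l hC hq2 q.1).trans ?_
    refine mul_le_mul_of_nonneg_right (Real.exp_le_exp.2 ?_) hC0.le
    have h1 : 0 ≤ τ - q.2 := by linarith [hq2.2]
    calc -l * (τ - q.2) ≤ |l| * (τ - q.2) := mul_le_mul_of_nonneg_right (neg_le_abs l) h1
      _ ≤ |l| * |τ| :=
        mul_le_mul_of_nonneg_left (by linarith [hq2.1, le_abs_self τ]) (abs_nonneg l)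
  rw [discounted, hswap, ← integral_const_mul]
  refine setIntegral_congr_fun measurableSet_Ioc fun s hs => ?_
  have := discounted_discounted hp l ht (sub_nonneg.2 hs.2) (hk.meas_right s)
    (hC s ⟨hs.1.le, hs.2⟩) x
  rw [show t + τ - s = t + (τ - s) by ring, ← this]
  rfl

/-- The resolvent identity. -/
lemma duhamel_resolvent (hp : IsTransition p) (l K : ℝ) {g : ℝ → X → ℝ} (hg : LocBdd g) (t : ℝ)
    (x : X) :
    duhamel p l g t x = duhamel p (l + K) g t x +
      K * duhamel p (l + K) (duhamel p l g) t x := by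
  -- For fixed t and x this is the scalar identity for s ↦ T_{t-s} g_s(x). By the semigroup
  -- property, the inner integral up to time s is T_{t-s} applied to the Duhamel integral at time s.
  have h := integral_exp_smoothing K (duhamel_integrable hp l hg t x)
  rw [duhamel, h]
  congr 1
  · refine setIntegral_congr_fun measurableSet_Ioc fun s _ => ?_
    simp only [discounted_add_rate]
  · congr 1
    refine setIntegral_congr_fun measurableSet_Ioc fun s hs => ?_
    simp only [discounted_add_rate]
    rw [discounted_duhamel hp l hg (sub_nonneg.2 hs.2)]
    simp

/-- The semigroup started at time `τ`. -/
def delayed (p : Kernel (ℝ × X) X) (l τ : ℝ) (f : X → ℝ) (t : ℝ) (x : X) : ℝ :=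
  if τ ≤ t then discounted p l (t - τ) f x else 0

lemma measurable_delayed (hp : IsTransition p) (l τ : ℝ) {f : X → ℝ} (hf : Measurable f) :
    Measurable (Function.uncurry (delayed p l τ f)) := by
  refine Measurable.ite (measurableSet_le measurable_const measurable_fst) ?_ measurable_const
  exact (measurable_discounted hp l hf).comp (f := fun q : ℝ × X => (q.1 - τ, q.2)) (by fun_prop)

lemma delayed_abs_le (hp : IsTransition p) {l τ : ℝ} (hl : 0 ≤ l) {f : X → ℝ} {C : ℝ}
    (hC0 : 0 ≤ C) (hC : ∀ x, |f x| ≤ C) (t : ℝ) (x : X) : |delayed p l τ f t x| ≤ C := by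
  unfold delayed
  split_ifs with h
  · refine (discounted_bound hp hC x).trans (mul_le_of_le_one_left hC0 ?_)
    exact Real.exp_le_one_iff.2 (by nlinarith)
  · simpa using hC0

lemma locBdd_delayed (hp : IsTransition p) (l : ℝ) {τ : ℝ} (hτ : 0 ≤ τ) {f : X → ℝ}
    (hf : Measurable f) {C : ℝ}
    (hC : ∀ x, |f x| ≤ C) : LocBdd (delayed p l τ f) := by
  refine ⟨measurable_delayed hp l τ hf, fun t => ?_⟩
  obtain ⟨D, hD0, hD⟩ := (locBdd_discounted hp l hf hC).bound t
  refine ⟨D, fun s hs x => ?_⟩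
  unfold delayed
  split_ifs with h
  · exact hD _ ⟨by linarith, by linarith [hs.2]⟩ x
  · simpa using hD0.le

lemma delayed_zero (p : Kernel (ℝ × X) X) (l : ℝ) (f : X → ℝ) {t : ℝ} (ht : 0 ≤ t) (x : X) :
    delayed p l 0 f t x = discounted p l t f x := by
  simp [delayed, ht]

/-- The delayed semigroup is the response to a unit atom at time τ, so it satisfies the resolvent
identity of a Duhamel integral. For s between τ and t the integrand is e^{-K(t-s)} T_{t-τ} f, and
nothing is contributed before τ. -/
lemma delayed_resolvent (hp : IsTransition p) (l K : ℝ) {τ : ℝ} (hτ : 0 ≤ τ) {f : X → ℝ}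
    (hf : Measurable f) {C : ℝ} (hC : ∀ x, |f x| ≤ C) {t : ℝ} (x : X) :
    delayed p l τ f t x = delayed p (l + K) τ f t x +
      K * duhamel p (l + K) (delayed p l τ f) t x := by
  by_cases h : τ ≤ t
  · have e : duhamel p (l + K) (delayed p l τ f) t x =
        (∫ s in Ioc τ t, exp (-K * (t - s))) * discounted p l (t - τ) f x := by
      rw [← integral_mul_const, ← integral_Icc_eq_integral_Ioc, duhamel,
        integral_Ioc_eq_integral_Ioo, integral_Icc_eq_integral_Ioo,
        ← integral_indicator measurableSet_Ioo, ← integral_indicator measurableSet_Ioo]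
      refine integral_congr_ae ?_
      have hτ0 : ∀ᵐ s : ℝ, s ≠ τ := by simp [ae_iff, measure_singleton]
      filter_upwards [hτ0] with s hsτ
      by_cases h1 : s ∈ Ioo τ t
      · have h2 : s ∈ Ioo 0 t := ⟨hτ.trans_lt h1.1, h1.2⟩
        rw [indicator_of_mem h1, indicator_of_mem h2, discounted_add_rate]
        congr 1
        have := discounted_discounted hp l (sub_nonneg.2 h1.2.le) (sub_nonneg.2 h1.1.le) hf hC x
        rw [show t - τ = t - s + (s - τ) by ring, ← this]
        congr 1
        ext y
        simp [delayed, h1.1.le]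
      · rw [indicator_of_notMem h1]
        by_cases h2 : s ∈ Ioo 0 t
        · have : ¬ τ ≤ s := fun h3 => h1 ⟨lt_of_le_of_ne h3 (Ne.symm hsτ), h2.2⟩
          rw [indicator_of_mem h2]
          simp [discounted, delayed, this]
        · rw [indicator_of_notMem h2]
    rw [e, ← mul_assoc, integral_exp_Icc K h]
    simp only [delayed, h, if_true, discounted_add_rate]
    ring
  · have : duhamel p (l + K) (delayed p l τ f) t x = duhamel p (l + K) (fun _ _ => 0) t x := by
      refine duhamel_congr p _ (fun s hs y => ?_) x
      simp [delayed, show ¬ τ ≤ s from fun h1 => h (h1.trans hs.2.le)]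
    rw [this]
    simp [delayed, h, duhamel, discounted]

/-- Restarting a Duhamel integral at time `τ`. -/
lemma duhamel_restart (hp : IsTransition p) (l : ℝ) {k : ℝ → X → ℝ} (hk : LocBdd k) {t τ : ℝ}
    (ht : 0 ≤ t) (hτ : 0 ≤ τ) (x : X) :
    duhamel p l k (τ + t) x = discounted p l t (duhamel p l k τ) x +
      duhamel p l (fun s => k (τ + s)) t x := by
  rw [discounted_duhamel hp l hk ht]
  have hi := duhamel_integrable hp l hk (τ + t) x
  have hu : Ioc 0 (τ + t) = Ioc 0 τ ∪ Ioc τ (τ + t) := by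
    rw [Ioc_union_Ioc_eq_Ioc hτ (by linarith)]
  unfold duhamel
  rw [hu, setIntegral_union (Ioc_disjoint_Ioc_of_le le_rfl) measurableSet_Ioc
    (hi.mono_set (hu ▸ subset_union_left)) (hi.mono_set (hu ▸ subset_union_right))]
  congr 1
  · simp only [add_comm t τ]
  · rw [← intervalIntegral.integral_of_le ht, ← intervalIntegral.integral_of_le (by linarith)]
    have := intervalIntegral.integral_comp_add_left (a := 0) (b := t)
      (fun s => discounted p l (τ + t - s) (k s) x) τ
    rw [add_zero] at this
    rw [← this]
    congr 1 with s
    congr 1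
    ring

/-! ### Linear mild equations: positivity, decay, and Picard iteration -/

variable {X : Type*} [MeasurableSpace X] {p : Kernel (ℝ × X) X}

lemma duhamel_exp (hp : IsTransition p) (l μ a : ℝ) {t : ℝ} (ht : 0 ≤ t) (x : X) :
    (l + μ) * duhamel p l (fun s _ => a * exp (μ * s)) t x =
      a * (exp (μ * t) - exp (-l * t)) := by
  rw [duhamel_time hp]
  have : ∀ s, exp (-l * (t - s)) * (a * exp (μ * s)) =
      a * exp (μ * t) * exp (-(l + μ) * (t - s)) := by
    intro s
    have h1 : exp (-l * (t - s)) * exp (μ * s) =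
        exp (μ * t) * exp (-(l + μ) * (t - s)) := by
      rw [← Real.exp_add, ← Real.exp_add]; congr 1; ring
    linear_combination a * h1
  simp only [this]
  rw [integral_const_mul, mul_left_comm, integral_exp_Ioc _ ht]
  have h2 : exp (μ * t) * exp (-(l + μ) * t) = exp (-l * t) := by
    rw [← Real.exp_add]; congr 1; ring
  linear_combination (-a) * h2

lemma locBdd_exp (a μ : ℝ) : LocBdd (fun (s : ℝ) (_ : X) => a * exp (μ * s)) := by
  refine ⟨by unfold Function.uncurry; fun_prop, fun t => ⟨|a| * exp (|μ| * t), fun s hs _ => ?_⟩⟩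
  rw [abs_mul, abs_of_pos (Real.exp_pos _)]
  refine mul_le_mul_of_nonneg_left (Real.exp_le_exp.2 ?_) (abs_nonneg a)
  calc μ * s ≤ |μ| * s := mul_le_mul_of_nonneg_right (le_abs_self μ) hs.1
    _ ≤ |μ| * t := mul_le_mul_of_nonneg_left hs.2 (abs_nonneg μ)

/-- A Volterra inequality with nonnegative kernel has only nonnegative supersolutions. -/
lemma nonneg_of_duhamel_le (hp : IsTransition p) (l : ℝ) {D w : ℝ → X → ℝ} (hD : LocBdd D)
    (hw : LocBdd w) {T : ℝ} (hw0 : ∀ t ∈ Icc 0 T, ∀ x, 0 ≤ w t x)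
    (h : ∀ t ∈ Icc 0 T, ∀ x, duhamel p l (fun s y => w s y * D s y) t x ≤ D t x) :
    ∀ t ∈ Icc 0 T, ∀ x, 0 ≤ D t x := by
  obtain ⟨C, hC0, hC⟩ := hD.bound T
  obtain ⟨B, hB0, hB⟩ := hw.bound T
  -- Against the weight e^{μ t} the Volterra operator has norm at most B / (l + μ) = 1/2, so every
  -- iteration halves the negative part.
  set μ : ℝ := 2 * B - l with hμ
  have main : ∀ n : ℕ, ∀ t ∈ Icc 0 T, ∀ x,
      -(C * exp (|μ| * T) * (1 / 2) ^ n * exp (μ * t)) ≤ D t x := by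
    intro n
    induction n with
    | zero =>
      intro t ht x
      have h1 := (abs_le.1 (hC t ht x)).1
      have h2 : 1 ≤ exp (|μ| * T) * exp (μ * t) := by
        rw [← Real.exp_add]
        refine Real.one_le_exp ?_
        have : -|μ| * t ≤ μ * t := mul_le_mul_of_nonneg_right (neg_abs_le μ) ht.1
        have h3 : |μ| * t ≤ |μ| * T := mul_le_mul_of_nonneg_left ht.2 (abs_nonneg μ)
        linarith
      have h3 := mul_le_mul_of_nonneg_left h2 hC0.le
      simp only [pow_zero, mul_one]
      linarith
    | succ n ih =>
      intro t ht x
      refine le_trans ?_ (h t ht x)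
      set a := C * exp (|μ| * T) * (1 / 2) ^ n with ha
      have ha0 : 0 ≤ a := by positivity
      have h1 : duhamel p l (fun s _ => (-(B * a)) * exp (μ * s)) t x ≤
          duhamel p l (fun s y => w s y * D s y) t x := by
        refine duhamel_mono hp l (locBdd_exp _ _) (hw.mul hD) (fun s hs y => ?_) x
        have hs' : s ∈ Icc 0 T := ⟨hs.1.le, hs.2.trans ht.2⟩
        have h2 := ih s hs' y
        have h3 := (le_abs_self _).trans (hB s hs' y)
        have h4 := hw0 s hs' y
        have h5 : 0 ≤ a * exp (μ * s) := by positivity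
        have h6 := mul_le_mul_of_nonneg_left h2 h4
        have h7 := mul_le_mul_of_nonneg_right h3 h5
        linarith
      refine le_trans ?_ h1
      have h8 := duhamel_exp hp l μ (-(B * a)) ht.1 x
      have h9 : l + μ = 2 * B := by rw [hμ]; ring
      rw [h9] at h8
      have h10 := Real.exp_pos (-l * t)
      have h11 : duhamel p l (fun s _ => (-(B * a)) * exp (μ * s)) t x =
          -(a / 2 * (exp (μ * t) - exp (-l * t))) := by
        have : (2 * B) * duhamel p l (fun s _ => (-(B * a)) * exp (μ * s)) t x =
          (2 * B) * (-(a / 2 * (exp (μ * t) - exp (-l * t)))) := by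
          rw [h8]; ring
        exact mul_left_cancel₀ (by positivity) this
      rw [h11, pow_succ, ← mul_assoc, ← ha]
      have := mul_nonneg ha0 h10.le
      linarith
  intro t ht x
  have hlim : Tendsto (fun n : ℕ => -(C * exp (|μ| * T) * (1 / 2) ^ n * exp (μ * t)))
      atTop (𝓝 (-(C * exp (|μ| * T) * 0 * exp (μ * t)))) :=
    (((tendsto_pow_atTop_nhds_zero_of_lt_one (by norm_num) (by norm_num)).const_mul _).mul_const _).neg
  simp only [mul_zero, zero_mul, neg_zero] at hlim
  exact le_of_tendsto' hlim fun n => main n t ht x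

/-- By the resolvent identity, extra killing at rate K is compensated by the source K D. A suitable
K makes a bounded potential nonnegative, or a quadratic nonlinearity well behaved on a given
interval. -/
lemma mild_shift (hp : IsTransition p) {l K : ℝ} {D k G GK : ℝ → X → ℝ} (hD : LocBdd D)
    (hk : LocBdd k) (hG : LocBdd G) {T : ℝ}
    (hGK : ∀ t ∈ Icc 0 T, ∀ x, G t x = GK t x + K * duhamel p (l + K) G t x)
    (h : ∀ t ∈ Icc 0 T, ∀ x, D t x = G t x + duhamel p l k t x) :
    ∀ t ∈ Icc 0 T, ∀ x, D t x = GK t x + duhamel p (l + K) (fun s y => k s y + K * D s y) t x := by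
  intro t ht x
  have h1 : duhamel p (l + K) D t x =
      duhamel p (l + K) G t x + duhamel p (l + K) (duhamel p l k) t x := by
    rw [← duhamel_add hp _ hG (locBdd_duhamel hp l hk)]
    exact duhamel_congr p _ (fun s hs y => h s ⟨hs.1.le, hs.2.le.trans ht.2⟩ y) x
  rw [duhamel_add hp _ hk (hD.const_mul K), duhamel_const_mul, h1, h t ht x, hGK t ht x,
    duhamel_resolvent hp l K hk]
  ring

/-- Positivity of solutions of linear mild equations with arbitrary bounded potential. -/
lemma nonneg_of_mild (hp : IsTransition p) (l : ℝ) {D w k : ℝ → X → ℝ} (hD : LocBdd D)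
    (hw : LocBdd w) (hk : LocBdd k) {f : X → ℝ} (hf : Measurable f) {Cf : ℝ}
    (hCf : ∀ x, |f x| ≤ Cf) (hf0 : ∀ x, 0 ≤ f x) {T : ℝ} (hk0 : ∀ t ∈ Icc 0 T, ∀ x, 0 ≤ k t x)
    (h : ∀ t ∈ Icc 0 T, ∀ x, D t x = discounted p l t f x +
      duhamel p l (fun s y => w s y * D s y + k s y) t x) :
    ∀ t ∈ Icc 0 T, ∀ x, 0 ≤ D t x := by
  -- K bounds |w| on [0, T], so the shifted potential w + K is nonnegative and the Volterra
  -- inequality applies.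
  obtain ⟨K, hK0, hK⟩ := hw.bound T
  have h1 := mild_shift (K := K) (G := fun t x => discounted p l t f x)
    (GK := fun t x => discounted p (l + K) t f x) hp hD ((hw.mul hD).add hk)
    (locBdd_discounted hp l hf hCf) (T := T) (fun t ht x => by
      have := delayed_resolvent hp l K le_rfl hf hCf (t := t) x
      rw [delayed_zero _ _ _ ht.1, delayed_zero _ _ _ ht.1] at this
      rw [this]
      congr 2
      exact duhamel_congr p _ (fun s hs y => delayed_zero _ _ _ hs.1.le y) x) h
  refine nonneg_of_duhamel_le hp (l + K) hD (hw.add (LocBdd.const K)) (T := T)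
    (fun t ht x => by linarith [(abs_le.1 (hK t ht x)).1]) (fun t ht x => ?_)
  rw [h1 t ht x]
  have h2 : 0 ≤ discounted p (l + K) t f x :=
    mul_nonneg (Real.exp_pos _).le (integral_nonneg hf0)
  refine le_trans ?_ (le_add_of_nonneg_left h2)
  refine duhamel_mono hp _ ((hw.add (LocBdd.const K)).mul hD)
    (((hw.mul hD).add hk).add (hD.const_mul K)) (fun s hs y => ?_) x
  have := hk0 s ⟨hs.1.le, hs.2.trans ht.2⟩ y
  linarith

lemma discounted_zero_fun (p : Kernel (ℝ × X) X) (l t : ℝ) (x : X) :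
    discounted p l t (fun _ => 0) x = 0 := by simp [discounted]

lemma nonneg_of_mild_zero (hp : IsTransition p) (l : ℝ) {D w k : ℝ → X → ℝ} (hD : LocBdd D)
    (hw : LocBdd w) (hk : LocBdd k) {T : ℝ} (hk0 : ∀ t ∈ Icc 0 T, ∀ x, 0 ≤ k t x)
    (h : ∀ t ∈ Icc 0 T, ∀ x, D t x = duhamel p l (fun s y => w s y * D s y + k s y) t x) :
    ∀ t ∈ Icc 0 T, ∀ x, 0 ≤ D t x :=
  nonneg_of_mild hp l hD hw hk (f := fun _ => 0) measurable_const (Cf := 0) (by simp) (by simp) hk0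
    (fun t ht x => by rw [discounted_zero_fun, zero_add]; exact h t ht x)

/-- Positivity applied to D and to -D. -/
lemma zero_of_mild (hp : IsTransition p) (l : ℝ) {D w : ℝ → X → ℝ} (hD : LocBdd D)
    (hw : LocBdd w) {T : ℝ}
    (h : ∀ t ∈ Icc 0 T, ∀ x, D t x = duhamel p l (fun s y => w s y * D s y) t x) :
    ∀ t ∈ Icc 0 T, ∀ x, D t x = 0 := by
  intro t ht x
  refine le_antisymm ?_ ?_
  · have := nonneg_of_mild_zero hp l hD.neg hw (LocBdd.const 0) (T := T) (by simp)
      (fun t ht x => by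
        rw [h t ht x, ← duhamel_neg]
        congr 1
        ext s y
        ring) t ht x
    linarith
  · exact nonneg_of_mild_zero hp l hD hw (LocBdd.const 0) (T := T) (by simp)
      (fun t ht x => by
        rw [h t ht x]
        congr 1
        ext s y
        ring) t ht x

/-- The right-hand side solves the shifted equation too, by `mild_shift`; the difference then solves
a homogeneous linear equation and vanishes. -/
lemma mild_unshift (hp : IsTransition p) {l K : ℝ} {D k G GK : ℝ → X → ℝ} (hD : LocBdd D)
    (hk : LocBdd k) (hG : LocBdd G) {T : ℝ}
    (hGK : ∀ t ∈ Icc 0 T, ∀ x, G t x = GK t x + K * duhamel p (l + K) G t x)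
    (h : ∀ t ∈ Icc 0 T, ∀ x, D t x = GK t x +
      duhamel p (l + K) (fun s y => k s y + K * D s y) t x) :
    ∀ t ∈ Icc 0 T, ∀ x, D t x = G t x + duhamel p l k t x := by
  have hD' : LocBdd (fun t x => G t x + duhamel p l k t x) := hG.add (locBdd_duhamel hp l hk)
  have h1 := mild_shift hp hD' hk hG hGK (fun t _ x => rfl)
  have h2 := zero_of_mild hp (l + K) (hD.sub hD') (LocBdd.const K) (T := T) (fun t ht x => by
    rw [h t ht x, h1 t ht x, add_sub_add_left_eq_sub,
      ← duhamel_sub hp _ (hk.add (hD.const_mul K)) (hk.add (hD'.const_mul K))]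
    congr 1
    ext s y
    ring)
  intro t ht x
  linarith [h2 t ht x]

/-- Exponential decay of the influence of the initial condition. -/
lemma mild_decay (hp : IsTransition p) (l κ : ℝ) {D w : ℝ → X → ℝ} (hD : LocBdd D)
    (hw : LocBdd w) {f : X → ℝ} (hf : Measurable f) {B : ℝ} (hB : ∀ x, |f x| ≤ B) {T : ℝ}
    (hwκ : ∀ t ∈ Icc 0 T, ∀ x, w t x ≤ l - κ)
    (h : ∀ t ∈ Icc 0 T, ∀ x, D t x = discounted p l t f x +
      duhamel p l (fun s y => w s y * D s y) t x) :
    ∀ t ∈ Icc 0 T, ∀ x, |D t x| ≤ B * exp (-κ * t) := by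
  have := hp.isMarkovKernel
  have hE := locBdd_exp (X := X) B (-κ)
  -- B e^{-κt} is the exact solution for the constant potential l - κ and initial value B. As w ≤ l
  -- - κ, it dominates D and -D.
  have eqE : ∀ t ∈ Icc 0 T, ∀ x : X, B * exp (-κ * t) = discounted p l t (fun _ => B) x +
      duhamel p l (fun s _ => (l - κ) * (B * exp (-κ * s))) t x := by
    intro t ht x
    rw [duhamel_const_mul, sub_eq_add_neg, duhamel_exp hp l (-κ) B ht.1]
    simp only [discounted, integral_const, probReal_univ, smul_eq_mul]
    ring
  have key : ∀ sg : ℝ, (sg = 1 ∨ sg = -1) → ∀ t ∈ Icc 0 T, ∀ x,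
      0 ≤ B * exp (-κ * t) + sg * D t x := by
    intro sg hsg
    have hBf : ∀ x, |B + sg * f x| ≤ |B| + |B| := fun x => by
      refine (abs_add_le _ _).trans (add_le_add le_rfl ?_)
      rw [abs_mul, show |sg| = 1 by rcases hsg with h | h <;> simp [h], one_mul]
      exact (hB x).trans (le_abs_self B)
    refine nonneg_of_mild hp l (hE.add (hD.const_mul sg)) hw
      (((LocBdd.const (l - κ)).sub hw).mul hE) (f := fun x => B + sg * f x)
      (measurable_const.add (hf.const_mul sg)) hBf (fun x => ?_) (fun t ht x => ?_)
      (fun t ht x => ?_)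
    · rcases hsg with h | h <;> subst h <;> linarith [(abs_le.1 (hB x)).1, (abs_le.1 (hB x)).2]
    · have hB0 : 0 ≤ B := (abs_nonneg _).trans (hB x)
      exact mul_nonneg (by linarith [hwκ t ht x]) (by positivity)
    · have e1 : discounted p l t (fun x => B + sg * f x) x =
          discounted p l t (fun _ => B) x + sg * discounted p l t f x := by
        simp only [discounted]
        rw [integral_add (integrable_const _) ((integrable_of_bound hf hB).const_mul sg),
          integral_const_mul]
        ring
      rw [eqE t ht x, h t ht x, e1, mul_add, ← duhamel_const_mul]
      have e2 := duhamel_add hp l ((LocBdd.const (l - κ)).mul hE)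
        ((hw.mul hD).const_mul sg) t x
      have e3 : (fun s y => w s y * (B * exp (-κ * s) + sg * D s y) +
          (l - κ - w s y) * (B * exp (-κ * s))) =
          fun s y => (l - κ) * (B * exp (-κ * s)) + sg * (w s y * D s y) := by
        ext s y; ring
      rw [e3, e2]
      ring
  intro t ht x
  rw [abs_le]
  constructor
  · linarith [key 1 (Or.inl rfl) t ht x]
  · linarith [key (-1) (Or.inr rfl) t ht x]

/-- Uniform bound on solutions of linear mild equations with a source. -/
lemma mild_source_bound (hp : IsTransition p) {l κ : ℝ} (hκ : 0 < κ) {D w k : ℝ → X → ℝ}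
    (hD : LocBdd D) (hw : LocBdd w) (hk : LocBdd k) {B : ℝ} {T : ℝ} (hB0 : 0 ≤ B)
    (hB : ∀ t ∈ Icc 0 T, ∀ x, |k t x| ≤ B)
    (hwκ : ∀ t ∈ Icc 0 T, ∀ x, w t x ≤ l - κ)
    (h : ∀ t ∈ Icc 0 T, ∀ x, D t x = duhamel p l (fun s y => w s y * D s y + k s y) t x) :
    ∀ t ∈ Icc 0 T, ∀ x, |D t x| ≤ B / κ := by
  have := hp.isMarkovKernel
  set E := B / κ with hE
  have hE0 : 0 ≤ E := by positivity
  have hEκ : E * κ = B := by rw [hE]; field_simp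
  -- The constant E = B/κ is a stationary supersolution, because l E = (l - κ) E + B.
  have eqE : ∀ t ∈ Icc 0 T, ∀ x : X, E = discounted p l t (fun _ => E) x +
      duhamel p l (fun s _ => l * E) t x := by
    intro t ht x
    rw [duhamel_const_mul, duhamel_const hp l E ht.1]
    simp only [discounted, integral_const, probReal_univ, smul_eq_mul]
    ring
  have key : ∀ sg : ℝ, (sg = 1 ∨ sg = -1) → ∀ t ∈ Icc 0 T, ∀ x, 0 ≤ E + sg * D t x := by
    intro sg hsg
    refine nonneg_of_mild hp l ((LocBdd.const E).add (hD.const_mul sg)) hw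
      ((((LocBdd.const (l - κ)).sub hw).mul (LocBdd.const E)).add
        ((LocBdd.const B).add (hk.const_mul sg))) (f := fun x => E)
      measurable_const (Cf := |E|) (fun _ => le_rfl) (fun x => hE0) (fun t ht x => ?_)
      (fun t ht x => ?_)
    · refine add_nonneg (mul_nonneg (by linarith [hwκ t ht x]) hE0) ?_
      rcases hsg with h | h <;> subst h <;>
        linarith [(abs_le.1 (hB t ht x)).1, (abs_le.1 (hB t ht x)).2]
    · conv_lhs => rw [eqE t ht x, h t ht x]
      have e2 := duhamel_add hp l ((LocBdd.const l).mul (LocBdd.const E))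
        (((hw.mul hD).add hk).const_mul sg) t x
      have e3 : (fun s y => w s y * (E + sg * D s y) + ((l - κ - w s y) * E + (B + sg * k s y))) =
          fun s y => l * E + sg * (w s y * D s y + k s y) := by
        ext s y
        linear_combination (-1 : ℝ) * hEκ
      rw [e3, e2, duhamel_const_mul _ _ sg]
      ring
  intro t ht x
  rw [abs_le]
  constructor
  · linarith [key 1 (Or.inl rfl) t ht x]
  · linarith [key (-1) (Or.inr rfl) t ht x]

/-- Picard iterates for `v = G + A F(v)`. -/
def picard (p : Kernel (ℝ × X) X) (l : ℝ) (F : ℝ → ℝ) (G v₀ : ℝ → X → ℝ) : ℕ → ℝ → X → ℝ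
  | 0 => v₀
  | n + 1 => fun t x => G t x + duhamel p l (fun s y => F (picard p l F G v₀ n s y)) t x

/-- Existence for `v = G + A F(v)` by contraction. -/
lemma exists_picard_limit (hp : IsTransition p) {l : ℝ} (hl : 0 < l) {F : ℝ → ℝ}
    (hF : Measurable F) {q m₁ m₂ : ℝ} (hq : 0 ≤ q) (hql : q < l)
    (hLip : ∀ u ∈ Icc m₁ m₂, ∀ v ∈ Icc m₁ m₂, |F u - F v| ≤ q * |u - v|)
    {G a b v₀ : ℝ → X → ℝ} (hG : Measurable (Function.uncurry G))
    (hv₀ : Measurable (Function.uncurry v₀)) (hav : ∀ t x, a t x ≤ v₀ t x)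
    (hvb : ∀ t x, v₀ t x ≤ b t x) (ha : ∀ t x, m₁ ≤ a t x) (hb : ∀ t x, b t x ≤ m₂)
    (inv : ∀ v : ℝ → X → ℝ, Measurable (Function.uncurry v) → (∀ t x, a t x ≤ v t x) →
      (∀ t x, v t x ≤ b t x) → LocBdd (fun s y => F (v s y)) → ∀ t x,
      a t x ≤ G t x + duhamel p l (fun s y => F (v s y)) t x ∧
      G t x + duhamel p l (fun s y => F (v s y)) t x ≤ b t x) :
    ∃ v : ℝ → X → ℝ, Measurable (Function.uncurry v) ∧ (∀ t x, a t x ≤ v t x) ∧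
      (∀ t x, v t x ≤ b t x) ∧
      (∀ t x, v t x = G t x + duhamel p l (fun s y => F (v s y)) t x) ∧
      ∀ t x, Tendsto (fun n => picard p l F G v₀ n t x) atTop (𝓝 (v t x)) := by
  have hFL : ∀ v : ℝ → X → ℝ, Measurable (Function.uncurry v) → (∀ t x, a t x ≤ v t x) →
      (∀ t x, v t x ≤ b t x) → LocBdd (fun s y => F (v s y)) := by
    intro v hv h1 h2
    refine LocBdd.of_bound (C := |F m₁| + q * |m₂ - m₁|) (hF.comp hv) fun t x => ?_
    have hv1 : m₁ ≤ v t x := (ha t x).trans (h1 t x)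
    have hv2 : v t x ≤ m₂ := (h2 t x).trans (hb t x)
    have h3 := hLip (v t x) ⟨hv1, hv2⟩ m₁ ⟨le_rfl, hv1.trans hv2⟩
    have h4 : |v t x - m₁| ≤ |m₂ - m₁| := abs_le_abs_of_nonneg (by linarith) (by linarith)
    have h5 := mul_le_mul_of_nonneg_left h4 hq
    have h6 := abs_sub_abs_le_abs_sub (F (v t x)) (F m₁)
    linarith
  set P := picard p l F G v₀ with hP
  have props : ∀ n, Measurable (Function.uncurry (P n)) ∧ (∀ t x, a t x ≤ P n t x) ∧
      (∀ t x, P n t x ≤ b t x) := by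
    intro n
    induction n with
    | zero => exact ⟨hv₀, hav, hvb⟩
    | succ n ih =>
      obtain ⟨h1, h2, h3⟩ := ih
      have h4 := hFL _ h1 h2 h3
      exact ⟨hG.add (measurable_duhamel hp l h4.meas), fun t x => (inv _ h1 h2 h3 h4 t x).1,
        fun t x => (inv _ h1 h2 h3 h4 t x).2⟩
  have hmem : ∀ n t x, P n t x ∈ Icc m₁ m₂ := fun n t x =>
    ⟨(ha t x).trans ((props n).2.1 t x), ((props n).2.2 t x).trans (hb t x)⟩
  -- The Duhamel operator has supremum norm at most 1/l. With a q-Lipschitz nonlinearity and q < l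
  -- the iteration contracts by q/l on the whole time axis at once.
  have contr : ∀ u v : ℝ → X → ℝ, LocBdd (fun s y => F (u s y)) → LocBdd (fun s y => F (v s y)) →
      (∀ t x, u t x ∈ Icc m₁ m₂) → (∀ t x, v t x ∈ Icc m₁ m₂) → ∀ C : ℝ, 0 ≤ C →
      (∀ t x, |u t x - v t x| ≤ C) → ∀ t x,
      |duhamel p l (fun s y => F (u s y)) t x - duhamel p l (fun s y => F (v s y)) t x| ≤
        C * (q / l) := by
    intro u v hu hv hum hvm C hC0 hC t x
    rw [← duhamel_sub hp l hu hv]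
    refine (duhamel_abs_le hp hl (hu.sub hv) (C := q * C) (by positivity) (fun s _ y => ?_) x).trans
      (le_of_eq (by ring))
    exact (hLip _ (hum s y) _ (hvm s y)).trans (mul_le_mul_of_nonneg_left (hC s y) hq)
  have hFP : ∀ n, LocBdd (fun s y => F (P n s y)) := fun n =>
    hFL _ (props n).1 (props n).2.1 (props n).2.2
  have hql' : q / l < 1 := (div_lt_one hl).2 hql
  have hql0 : 0 ≤ q / l := by positivity
  have step : ∀ n t x, dist (P n t x) (P (n + 1) t x) ≤ |m₂ - m₁| * (q / l) ^ n := by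
    intro n
    induction n with
    | zero =>
      intro t x
      rw [pow_zero, mul_one, Real.dist_eq]
      have h1 := hmem 0 t x
      have h2 := hmem 1 t x
      refine (abs_le.2 ⟨?_, ?_⟩).trans (le_abs_self _)
      · linarith [h1.1, h2.2]
      · linarith [h1.2, h2.1]
    | succ n ih =>
      intro t x
      have h1 := contr (P n) (P (n + 1)) (hFP n) (hFP (n + 1)) (hmem n) (hmem (n + 1)) _
        (by positivity) ih t x
      rw [Real.dist_eq]
      have h2 : P (n + 1) t x - P (n + 1 + 1) t x =
        duhamel p l (fun s y => F (P n s y)) t x - duhamel p l (fun s y => F (P (n + 1) s y)) t x := by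
        simp only [hP, picard]; ring
      rw [h2]
      refine h1.trans (le_of_eq ?_)
      rw [pow_succ]; ring
  have hlim : ∀ t x, ∃ y, Tendsto (fun n => P n t x) atTop (𝓝 y) := fun t x =>
    cauchySeq_tendsto_of_complete (cauchySeq_of_le_geometric _ _ hql' fun n => step n t x)
  choose v hv using hlim
  have hvmeas : Measurable (Function.uncurry v) :=
    measurable_of_tendsto_metrizable (fun n => (props n).1)
      (tendsto_pi_nhds.2 fun z => hv z.1 z.2)
  have hva : ∀ t x, a t x ≤ v t x := fun t x =>
    ge_of_tendsto' (hv t x) fun n => (props n).2.1 t x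
  have hvb' : ∀ t x, v t x ≤ b t x := fun t x =>
    le_of_tendsto' (hv t x) fun n => (props n).2.2 t x
  refine ⟨v, hvmeas, hva, hvb', fun t x => ?_, hv⟩
  have hdist : ∀ n t x, |P n t x - v t x| ≤ |m₂ - m₁| * (q / l) ^ n / (1 - q / l) := fun n t x =>
    dist_le_of_le_geometric_of_tendsto _ _ hql' (fun n => step n t x) (hv t x) n
  have hFv := hFL v hvmeas hva hvb'
  have h1 : Tendsto (fun n => P (n + 1) t x) atTop
      (𝓝 (G t x + duhamel p l (fun s y => F (v s y)) t x)) := by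
    rw [tendsto_iff_dist_tendsto_zero]
    refine squeeze_zero (fun _ => dist_nonneg)
      (g := fun n => |m₂ - m₁| * (q / l) ^ n / (1 - q / l) * (q / l)) (fun n => ?_) ?_
    · rw [Real.dist_eq]
      simp only [hP, picard, add_sub_add_left_eq_sub]
      exact contr (P n) v (hFP n) hFv (hmem n)
        (fun t x => ⟨(ha t x).trans (hva t x), (hvb' t x).trans (hb t x)⟩) _
        (div_nonneg (by positivity) (by linarith)) (hdist n) t x
    · have := ((tendsto_pow_atTop_nhds_zero_of_lt_one hql0 hql').const_mul |m₂ - m₁|).div_const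
        (1 - q / l) |>.mul_const (q / l)
      simpa using this
  exact tendsto_nhds_unique ((tendsto_add_atTop_iff_nat 1).2 (hv t x)) h1

/-! ### Existence for absorbing and branching equations; exponential approximation -/

variable {X : Type*} [MeasurableSpace X] {p : Kernel (ℝ × X) X}

/-- Existence for the absorbing equation `w = g - c A(w²)`. -/
lemma exists_absorbing (hp : IsTransition p) {Q c m K : ℝ} (hQ : 0 < Q) (hc : 0 ≤ c) (hm : 0 ≤ m)
    (hK : K = 2 * c * m) {g gK : ℝ → X → ℝ} (hg : Measurable (Function.uncurry g))
    (hgK : Measurable (Function.uncurry gK)) (hg0 : ∀ t x, 0 ≤ g t x) (hgm : ∀ t x, g t x ≤ m)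
    (hgK0 : ∀ t x, 0 ≤ gK t x)
    (hres : ∀ t x, g t x = gK t x + K * duhamel p (Q + K) g t x) :
    ∃ w : ℝ → X → ℝ, Measurable (Function.uncurry w) ∧ (∀ t x, 0 ≤ w t x) ∧
      (∀ t x, w t x ≤ g t x) ∧
      ∀ t, 0 ≤ t → ∀ x, w t x = g t x + duhamel p Q (fun s y => -(c * w s y ^ 2)) t x := by
  have hK0 : 0 ≤ K := by rw [hK]; positivity
  have hgL : LocBdd g := LocBdd.of_bound hg (C := m) fun t x => by
    rw [abs_of_nonneg (hg0 t x)]; exact hgm t x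
  -- On [0, m] and with K = 2cm, the function K u - c u² lies between 0 and K u and is K-Lipschitz.
  -- Hence the order interval between 0 and g is invariant and the killing rate Q + K beats the
  -- Lipschitz constant.
  obtain ⟨w, hw, hw0, hwg, hweq, -⟩ := exists_picard_limit hp (l := Q + K) (by linarith)
    (F := fun u => K * u - c * u ^ 2) (by fun_prop) (q := K) (m₁ := 0) (m₂ := m) hK0
    (by linarith) (fun u hu v hv => by
      have h1 : K * u - c * u ^ 2 - (K * v - c * v ^ 2) = (K - c * (u + v)) * (u - v) := by ring
      rw [h1, abs_mul]
      refine mul_le_mul_of_nonneg_right (abs_le.2 ⟨?_, ?_⟩) (abs_nonneg _)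
      · have := mul_le_mul_of_nonneg_left (add_le_add hu.2 hv.2) hc
        linarith
      · have := mul_nonneg hc (add_nonneg hu.1 hv.1)
        linarith)
    (G := gK) (a := fun _ _ => 0) (b := g) (v₀ := fun _ _ => 0) hgK measurable_const
    (fun _ _ => le_rfl) hg0 (fun _ _ => le_rfl) hgm (fun v hv hv0 hvg hFL t x => by
      constructor
      · refine add_nonneg (hgK0 t x) ?_
        have := duhamel_mono hp (Q + K) (LocBdd.const 0) hFL (t := t) (fun s _ y => ?_) x
        · simpa [duhamel, discounted] using this
        · have h1 := hv0 s y
          have h2 := (hvg s y).trans (hgm s y)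
          have : 0 ≤ v s y * (K - c * v s y) := mul_nonneg h1 (by nlinarith)
          show (0 : ℝ) ≤ K * v s y - c * v s y ^ 2
          linarith
      · rw [hres t x, ← duhamel_const_mul]
        refine add_le_add le_rfl (duhamel_mono hp _ hFL (hgL.const_mul K) (fun s _ y => ?_) x)
        have := mul_le_mul_of_nonneg_left (hvg s y) hK0
        have := mul_nonneg hc (sq_nonneg (v s y))
        linarith)
  refine ⟨w, hw, hw0, hwg, fun t ht x => ?_⟩
  have hwL : LocBdd w := LocBdd.of_bound hw (C := m) fun t x => by
    rw [abs_of_nonneg (hw0 t x)]; exact (hwg t x).trans (hgm t x)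
  refine mild_unshift (K := K) (T := t) hp hwL ((hwL.sq).const_mul c).neg hgL
    (fun s _ y => hres s y) (fun s _ y => ?_) t ⟨ht, le_rfl⟩ x
  rw [hweq s y]
  congr 2
  ext s y
  ring

/-- The initial condition enters as an atom at time 0. Being cut off at negative times, this source
is bounded on the whole axis. -/
lemma exists_absorbing_initial (hp : IsTransition p) {Q c m : ℝ} (hQ : 0 < Q) (hc : 0 ≤ c)
    {f : X → ℝ} (hf : Measurable f) (hf0 : ∀ x, 0 ≤ f x) (hfm : ∀ x, f x ≤ m) :
    ∃ w : ℝ → X → ℝ, LocBdd w ∧ (∀ t x, 0 ≤ w t x) ∧ (∀ t x, w t x ≤ max m 0) ∧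
      ∀ t, 0 ≤ t → ∀ x, w t x = discounted p Q t f x +
        duhamel p Q (fun s y => -(c * w s y ^ 2)) t x := by
  have hm0 : 0 ≤ max m 0 := le_max_right _ _
  have hfab : ∀ x, |f x| ≤ max m 0 := fun x => by
    rw [abs_of_nonneg (hf0 x)]; exact (hfm x).trans (le_max_left _ _)
  have hnn : ∀ l t x, 0 ≤ delayed p l 0 f t x := fun l t x => by
    unfold delayed
    split_ifs
    · exact mul_nonneg (Real.exp_pos _).le (integral_nonneg hf0)
    · exact le_rfl
  have hle : ∀ t x, delayed p Q 0 f t x ≤ max m 0 := fun t x =>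
    (le_abs_self _).trans (delayed_abs_le hp hQ.le hm0 hfab t x)
  obtain ⟨w, hw, hw0, hwg, hweq⟩ := exists_absorbing hp hQ hc hm0 rfl
    (g := delayed p Q 0 f) (gK := delayed p (Q + 2 * c * max m 0) 0 f) (measurable_delayed hp _ _ hf)
    (measurable_delayed hp _ _ hf) (hnn _) hle (hnn _)
    (fun t x => delayed_resolvent hp Q _ le_rfl hf hfab x)
  refine ⟨w, LocBdd.of_bound hw (C := max m 0) fun t x => ?_, hw0, fun t x =>
    (hwg t x).trans (hle t x), fun t ht x => ?_⟩
  · rw [abs_of_nonneg (hw0 t x)]; exact (hwg t x).trans (hle t x)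
  · rw [hweq t ht x, delayed_zero _ _ _ ht]

/-- Existence for `v = A(sg + F(v))` between two constants. -/
lemma exists_bounded_solution (hp : IsTransition p) {l : ℝ} (hl : 0 < l) {F : ℝ → ℝ}
    (hF : Measurable F) {q m β : ℝ} (hq : 0 ≤ q) (hql : q < l) (hm : 0 ≤ m) (hβ : 0 ≤ β)
    (hLip : ∀ u ∈ Icc (-m) β, ∀ v ∈ Icc (-m) β, |F u - F v| ≤ q * |u - v|)
    {sg : ℝ → X → ℝ} (hsg : LocBdd sg)
    (hlow : ∀ t x, ∀ v ∈ Icc (-m) β, -(l * m) ≤ sg t x + F v)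
    (hup : ∀ t x, ∀ v ∈ Icc (-m) β, sg t x + F v ≤ l * β) :
    ∃ v : ℝ → X → ℝ, Measurable (Function.uncurry v) ∧ (∀ t x, -m ≤ v t x) ∧ (∀ t x, v t x ≤ β) ∧
      (∀ t x, v t x = duhamel p l (fun s y => sg s y + F (v s y)) t x) ∧
      ∀ t x, Tendsto (fun n => picard p l F (duhamel p l sg) (fun _ _ => 0) n t x) atTop
        (𝓝 (v t x)) := by
  obtain ⟨v, hv, hva, hvb, hveq, hlim⟩ := exists_picard_limit hp hl hF (m₁ := -m) (m₂ := β)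
    hq hql hLip (G := duhamel p l sg) (a := fun _ _ => -m) (b := fun _ _ => β)
    (v₀ := fun _ _ => 0) (measurable_duhamel hp l hsg.meas) measurable_const
    (fun _ _ => by simpa using hm) (fun _ _ => hβ) (fun _ _ => le_rfl) (fun _ _ => le_rfl)
    (fun v hv h1 h2 hFL t x => by
      rw [← duhamel_add hp l hsg hFL]
      rcases le_total t 0 with ht | ht
      · rw [duhamel_of_nonpos _ _ _ ht]
        exact ⟨by simpa using hm, hβ⟩
      · have e := Real.exp_pos (-l * t)
        constructor
        · refine le_trans ?_ (duhamel_mono hp l (LocBdd.const (-(l * m))) (hsg.add hFL)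
            (fun s _ y => hlow s y _ ⟨h1 s y, h2 s y⟩) x)
          have := duhamel_const hp l (-(l * m)) ht x
          have h3 : duhamel p l (fun _ _ => -(l * m)) t x = -m * (1 - exp (-l * t)) :=
            mul_left_cancel₀ hl.ne' (by rw [this]; ring)
          rw [h3]
          nlinarith
        · refine le_trans (duhamel_mono hp l (hsg.add hFL) (LocBdd.const (l * β))
            (fun s _ y => hup s y _ ⟨h1 s y, h2 s y⟩) x) ?_
          have := duhamel_const hp l (l * β) ht x
          have h3 : duhamel p l (fun _ _ => l * β) t x = β * (1 - exp (-l * t)) :=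
            mul_left_cancel₀ hl.ne' (by rw [this]; ring)
          rw [h3]
          nlinarith)
  refine ⟨v, hv, hva, hvb, fun t x => ?_, hlim⟩
  rw [hveq t x]
  have hvL : LocBdd (fun s y => F (v s y)) := by
    refine LocBdd.of_bound (C := |F (-m)| + q * (m + β)) (hF.comp hv) fun t x => ?_
    have h3 := hLip (v t x) ⟨hva t x, hvb t x⟩ (-m) ⟨le_rfl, by linarith⟩
    have h4 : |v t x - -m| ≤ m + β := by
      rw [abs_of_nonneg (by linarith [hva t x])]; linarith [hvb t x]
    have h5 := mul_le_mul_of_nonneg_left h4 hq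
    have h6 := abs_sub_abs_le_abs_sub (F (v t x)) (F (-m))
    linarith
  rw [duhamel_add hp l hsg hvL]

/-- Existence for the branching equation `v = A(sg + c v²)` with a subcritical source. -/
lemma exists_subcritical (hp : IsTransition p) {Q c β s₁ sb : ℝ} (hQ : 0 < Q) (hc : 0 < c)
    (hβ : 0 ≤ β) (hβQ : 2 * c * β < Q) (hs₁ : s₁ + c * β ^ 2 ≤ Q * β) (hsb : 0 ≤ sb)
    {sg : ℝ → X → ℝ} (hsgm : Measurable (Function.uncurry sg)) (hsg : ∀ t x, |sg t x| ≤ sb)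
    (hsg₁ : ∀ t x, sg t x ≤ s₁) :
    ∃ v : ℝ → X → ℝ, Measurable (Function.uncurry v) ∧ (∀ t x, -(sb / Q) ≤ v t x) ∧
      (∀ t x, v t x ≤ β) ∧
      ∀ t, 0 ≤ t → ∀ x, v t x = duhamel p Q (fun s y => sg s y + c * v s y ^ 2) t x := by
  set m := sb / Q with hm
  have hm0 : 0 ≤ m := by positivity
  have hmQ : Q * m = sb := by rw [hm]; field_simp
  -- This shift makes u ↦ K u + c u² nondecreasing on [-m, β] with Lipschitz constant at most K +
  -- 2cβ < Q + K. The hypothesis on s₁ says that β is a supersolution.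
  set K := 2 * c * m with hK
  have hK0 : 0 ≤ K := by positivity
  have hsgL : LocBdd sg := LocBdd.of_bound hsgm hsg
  obtain ⟨v, hv, hva, hvb, hveq, -⟩ := exists_bounded_solution hp (l := Q + K) (by linarith)
    (F := fun u => K * u + c * u ^ 2) (by fun_prop) (q := K + 2 * c * β) (by positivity)
    (by linarith) hm0 hβ (fun u hu v hv => by
      have h1 : K * u + c * u ^ 2 - (K * v + c * v ^ 2) = (K + c * (u + v)) * (u - v) := by ring
      rw [h1, abs_mul]
      refine mul_le_mul_of_nonneg_right (abs_le.2 ⟨?_, ?_⟩) (abs_nonneg _)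
      · have := mul_le_mul_of_nonneg_left (add_le_add hu.1 hv.1) hc.le
        have : 0 ≤ c * β := by positivity
        linarith
      · have := mul_le_mul_of_nonneg_left (add_le_add hu.2 hv.2) hc.le
        linarith) hsgL (fun t x v hv => by
      have h1 := (abs_le.1 (hsg t x)).1
      have h2 := mul_le_mul_of_nonneg_left hv.1 hK0
      have h3 := mul_nonneg hc.le (sq_nonneg v)
      show -((Q + K) * m) ≤ sg t x + (K * v + c * v ^ 2)
      linarith) (fun t x v hv => by
      have h1 := hsg₁ t x
      have h2 : K * v + c * v ^ 2 ≤ K * β + c * β ^ 2 := by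
        have : 0 ≤ (β - v) * (K + c * (β + v)) := by
          refine mul_nonneg (by linarith [hv.2]) ?_
          have := mul_le_mul_of_nonneg_left hv.1 hc.le
          have : 0 ≤ c * β := by positivity
          have : 0 ≤ c * m := by positivity
          linarith
        linarith
      show sg t x + (K * v + c * v ^ 2) ≤ (Q + K) * β
      linarith)
  refine ⟨v, hv, hva, hvb, fun t ht x => ?_⟩
  have hvL : LocBdd v := LocBdd.of_bound hv (C := max m β) fun t x =>
    abs_le.2 ⟨by linarith [hva t x, le_max_left m β], (hvb t x).trans (le_max_right _ _)⟩
  have := mild_unshift (l := Q) (K := K) (T := t) (G := fun _ _ => 0) (GK := fun _ _ => 0) hp hvL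
    (hsgL.add (hvL.sq.const_mul c)) (LocBdd.const 0)
    (fun s _ y => by simp [duhamel, discounted]) (fun s _ y => by
      rw [zero_add, hveq s y]
      congr 1
      ext s y
      ring) t ⟨ht, le_rfl⟩ x
  rw [this, zero_add]

/-- The exponential nonlinearity approximating `2 c u / ε + c u ^ 2`. -/
def expBranch (c ε u : ℝ) : ℝ := 2 * c / ε ^ 2 * (exp (ε * u) - 1)

/-- Second-order Taylor expansion of the exponential. The linear part 2cu/ε is cancelled by raising
the killing rate by 2c/ε, so in the shifted equation `expBranch` stands for c u². -/
lemma expBranch_error {c ε u : ℝ} (hc : 0 ≤ c) (hε : 0 < ε) (hu : |ε * u| ≤ 1) :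
    |expBranch c ε u - (2 * c / ε * u + c * u ^ 2)| ≤ c * ε * |u| ^ 3 := by
  have h1 := Real.exp_bound hu (n := 3) (by norm_num)
  have h2 : expBranch c ε u - (2 * c / ε * u + c * u ^ 2) = 2 * c / ε ^ 2 *
      (exp (ε * u) - ∑ m ∈ Finset.range 3, (ε * u) ^ m / (m.factorial : ℝ)) := by
    simp only [expBranch, Finset.sum_range_succ, Finset.sum_range_zero, Nat.factorial]
    push_cast
    field_simp
    ring
  rw [h2, abs_mul, abs_of_nonneg (show 0 ≤ 2 * c / ε ^ 2 by positivity)]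
  refine (mul_le_mul_of_nonneg_left h1 (by positivity)).trans ?_
  rw [abs_mul, abs_of_pos hε, mul_pow]
  have : 0 ≤ c * ε * |u| ^ 3 := by positivity
  calc 2 * c / ε ^ 2 * (ε ^ 3 * |u| ^ 3 * (((3 : ℕ).succ : ℝ) / (((3 : ℕ).factorial : ℝ) * (3 : ℕ))))
      = (4 / 9) * (c * ε * |u| ^ 3) := by
        simp only [Nat.factorial]
        push_cast
        field_simp
        ring
    _ ≤ c * ε * |u| ^ 3 := by linarith

/-- The Picard iterates for the exponential nonlinearity converge, and their limits approximate
the solution of the branching equation. -/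
lemma expBranch_scheme (hp : IsTransition p) {Q c β s₁ : ℝ} (hQ : 0 < Q) (hc : 0 < c)
    (hβ : 0 ≤ β) (hβQ : 2 * c * β < Q) (hs₁ : s₁ + c * β ^ 2 < Q * β) :
    ∃ ε₀ : ℝ, 0 < ε₀ ∧ ∀ sb : ℝ, 0 ≤ sb → ∃ C : ℝ, ∃ ε₁ > 0, ∀ ε, 0 < ε → ε < ε₀ →
      ∀ sg : ℝ → X → ℝ, Measurable (Function.uncurry sg) → (∀ t x, |sg t x| ≤ sb) →
      (∀ t x, sg t x ≤ s₁) → ∃ V : ℝ → X → ℝ,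
        (∀ t x, Tendsto (fun n => picard p (Q + 2 * c / ε) (expBranch c ε)
          (duhamel p (Q + 2 * c / ε) sg) (fun _ _ => 0) n t x) atTop (𝓝 (V t x))) ∧
        ∀ v : ℝ → X → ℝ, Measurable (Function.uncurry v) → (∀ t x, -(sb / Q) ≤ v t x) →
          (∀ t x, v t x ≤ β) →
          (∀ t, 0 ≤ t → ∀ x, v t x = duhamel p Q (fun s y => sg s y + c * v s y ^ 2) t x) →
          ε < ε₁ → ∀ t, 0 ≤ t → ∀ x, |V t x - v t x| ≤ C * ε := by
  -- For ε < ε₀ the constant β stays a supersolution, and the Lipschitz constant (2c/ε) e^{εβ} below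
  -- β stays under the killing rate Q + 2c/ε. Only β, s₁, Q and c enter, so ε₀ is uniform over
  -- sources that are very negative. The size bound sb affects only ε₁ and C, which control the
  -- approximation error.
  obtain ⟨ε₀, hε₀, hA, hB, hC⟩ : ∃ ε₀ : ℝ, 0 < ε₀ ∧ ε₀ * β ≤ 1 ∧
      s₁ + c * β ^ 2 + c * ε₀ * β ^ 3 ≤ Q * β ∧ 2 * c * β + 2 * c * ε₀ * β ^ 2 < Q := by
    have h1 : Tendsto (fun e : ℝ => e * β) (𝓝[>] 0) (𝓝 (0 * β)) :=
      (Continuous.tendsto (by fun_prop) 0).mono_left nhdsWithin_le_nhds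
    have h2 : Tendsto (fun e : ℝ => s₁ + c * β ^ 2 + c * e * β ^ 3) (𝓝[>] 0)
        (𝓝 (s₁ + c * β ^ 2 + c * 0 * β ^ 3)) :=
      (Continuous.tendsto (by fun_prop) 0).mono_left nhdsWithin_le_nhds
    have h3 : Tendsto (fun e : ℝ => 2 * c * β + 2 * c * e * β ^ 2) (𝓝[>] 0)
        (𝓝 (2 * c * β + 2 * c * 0 * β ^ 2)) :=
      (Continuous.tendsto (by fun_prop) 0).mono_left nhdsWithin_le_nhds
    have := (h1.eventually_lt_const (by simp : (0 : ℝ) * β < 1)).and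
      ((h2.eventually_lt_const (by simpa using hs₁)).and
        ((h3.eventually_lt_const (by simpa using hβQ)).and self_mem_nhdsWithin))
    obtain ⟨e, h1, h2, h3, h4⟩ := this.exists
    exact ⟨e, h4, h1.le, h2.le, h3⟩
  refine ⟨ε₀, hε₀, fun sb hsb => ?_⟩
  set m := sb / Q with hm
  have hm0 : 0 ≤ m := by positivity
  have hmQ : Q * m = sb := by rw [hm]; field_simp
  set M := max m β with hM
  have hM0 : 0 ≤ M := hm0.trans (le_max_left _ _)
  refine ⟨c * M ^ 3 / (Q - 2 * c * β), 1 / (M + 1), by positivity, fun ε hε hεε₀ sg hsgm hsg hsg₁ => ?_⟩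
  set K := 2 * c / ε with hK
  have hK0 : 0 ≤ K := by positivity
  have hKε : K * ε = 2 * c := by rw [hK]; field_simp
  have hsgL : LocBdd sg := LocBdd.of_bound hsgm hsg
  have hεβ : ε * β ≤ 1 := (mul_le_mul_of_nonneg_right hεε₀.le hβ).trans hA
  have hεβ0 : 0 ≤ ε * β := by positivity
  have hFmono : Monotone (expBranch c ε) := fun u v huv => by
    unfold expBranch
    have : exp (ε * u) ≤ exp (ε * v) :=
      Real.exp_le_exp.2 (mul_le_mul_of_nonneg_left huv hε.le)
    exact mul_le_mul_of_nonneg_left (by linarith) (by positivity)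
  have hFm : Measurable (expBranch c ε) := by unfold expBranch; fun_prop
  have hexpβ : K * exp (ε * β) < Q + K := by
    have h1 : |exp (ε * β) - 1 - ε * β| ≤ (ε * β) ^ 2 :=
      Real.abs_exp_sub_one_sub_id_le (by rw [abs_of_nonneg hεβ0]; exact hεβ)
    have h2 := mul_le_mul_of_nonneg_left (abs_le.1 h1).2 hK0
    have h3 : c * ε * β ^ 2 ≤ c * ε₀ * β ^ 2 :=
      mul_le_mul_of_nonneg_right (mul_le_mul_of_nonneg_left hεε₀.le hc.le) (sq_nonneg β)
    have h4 : K * (ε * β) = 2 * c * β := by rw [← mul_assoc, hKε]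
    have h5 : K * (ε * β) ^ 2 = 2 * c * ε * β ^ 2 := by
      rw [show K * (ε * β) ^ 2 = (K * ε) * (ε * β ^ 2) by ring, hKε]; ring
    linarith
  have hLip' : ∀ u v : ℝ, v ≤ u → u ≤ β →
      expBranch c ε u - expBranch c ε v ≤ K * exp (ε * β) * (u - v) := by
    intro u v hvu hu
    have h1 : exp (ε * v) ≥ exp (ε * u) * (1 + (ε * v - ε * u)) := by
      have := Real.add_one_le_exp (ε * v - ε * u)
      have h2 : exp (ε * v) = exp (ε * u) * exp (ε * v - ε * u) := by
        rw [← Real.exp_add]; congr 1; ring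
      rw [h2]
      exact mul_le_mul_of_nonneg_left (by linarith) (Real.exp_pos _).le
    have h2 : expBranch c ε u - expBranch c ε v =
        2 * c / ε ^ 2 * (exp (ε * u) - exp (ε * v)) := by unfold expBranch; ring
    have h3 : exp (ε * u) - exp (ε * v) ≤ exp (ε * u) * (ε * (u - v)) := by linarith
    have h4 : exp (ε * u) * (ε * (u - v)) ≤ exp (ε * β) * (ε * (u - v)) :=
      mul_le_mul_of_nonneg_right (Real.exp_le_exp.2 (mul_le_mul_of_nonneg_left hu hε.le))
        (mul_nonneg hε.le (by linarith))
    rw [h2]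
    refine (mul_le_mul_of_nonneg_left (h3.trans h4) (by positivity)).trans (le_of_eq ?_)
    rw [hK]; field_simp
  obtain ⟨V, hV, hVa, hVb, hVeq, hVlim⟩ := exists_bounded_solution hp (l := Q + K) (by linarith)
    (F := expBranch c ε) hFm (q := K * exp (ε * β)) (by positivity) hexpβ hm0 hβ
    (fun u hu v hv => by
      rcases le_total u v with h | h
      · rw [abs_sub_comm, abs_sub_comm u, abs_of_nonneg (by linarith [hFmono h]),
          abs_of_nonneg (by linarith)]
        exact hLip' v u h hv.2
      · rw [abs_of_nonneg (by linarith [hFmono h]), abs_of_nonneg (by linarith)]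
        exact hLip' u v h hu.2) hsgL
    (fun t x v hv => by
      have h1 := (abs_le.1 (hsg t x)).1
      -- From e^x ≥ 1 + x; the lower barrier -m therefore needs no smallness of ε.
      have h2 : K * v ≤ expBranch c ε v := by
        have := Real.add_one_le_exp (ε * v)
        have h3 : K * v = 2 * c / ε ^ 2 * (ε * v) := by rw [hK]; field_simp
        rw [h3]
        exact mul_le_mul_of_nonneg_left (by linarith) (by positivity)
      have h3 := mul_le_mul_of_nonneg_left hv.1 hK0
      linarith)
    (fun t x v hv => by
      have h1 := hsg₁ t x
      have h2 := hFmono hv.2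
      have h3 := (abs_le.1 (expBranch_error (u := β) hc.le hε (by rw [abs_of_nonneg hεβ0]; exact hεβ))).2
      rw [abs_of_nonneg hβ] at h3
      have h4 : c * ε * β ^ 3 ≤ c * ε₀ * β ^ 3 :=
        mul_le_mul_of_nonneg_right (mul_le_mul_of_nonneg_left hεε₀.le hc.le) (by positivity)
      linarith)
  refine ⟨V, hVlim, fun v hv hva hvb hveq hεε₁ t ht x => ?_⟩
  have hbd : ∀ u : ℝ, -m ≤ u → u ≤ β → |u| ≤ M := fun u h1 h2 =>
    abs_le.2 ⟨by linarith [le_max_left m β], h2.trans (le_max_right _ _)⟩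
  have hvL : LocBdd v := LocBdd.of_bound hv (C := M) fun t x => hbd _ (hva t x) (hvb t x)
  have hVL : LocBdd V := LocBdd.of_bound hV (C := M) fun t x => hbd _ (hVa t x) (hVb t x)
  -- The Taylor remainder becomes the source of the linear equation for V - v. Its potential K + c(V
  -- + v) stays below the killing rate Q + K by Q - 2cβ, so the difference is of order ε.
  set err : ℝ → X → ℝ := fun t x => expBranch c ε (V t x) - (K * V t x + c * V t x ^ 2) with herr
  have herrb : ∀ t x, |err t x| ≤ c * ε * M ^ 3 := by
    intro t x
    have h1 := hbd _ (hVa t x) (hVb t x)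
    have h2 : |ε * V t x| ≤ 1 := by
      rw [abs_mul, abs_of_pos hε]
      calc ε * |V t x| ≤ 1 / (M + 1) * (M + 1) :=
            mul_le_mul hεε₁.le (by linarith) (abs_nonneg _) (by positivity)
        _ = 1 := by field_simp
    refine (expBranch_error hc.le hε h2).trans ?_
    exact mul_le_mul_of_nonneg_left (pow_le_pow_left₀ (abs_nonneg _) h1 3) (by positivity)
  have herrL : LocBdd err := by
    refine LocBdd.of_bound ?_ herrb
    exact (hFm.comp hV).sub ((hV.const_mul K).add ((hV.pow_const 2).const_mul c))
  have hvK := mild_shift (l := Q) (K := K) (T := t) (G := fun _ _ => 0) (GK := fun _ _ => 0) hp hvL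
    (hsgL.add (hvL.sq.const_mul c)) (LocBdd.const 0)
    (fun s _ y => by simp [duhamel, discounted])
    (fun s hs y => by rw [zero_add]; exact hveq s hs.1 y)
  have := mild_source_bound hp (l := Q + K) (κ := Q - 2 * c * β) (by linarith)
    (hVL.sub hvL) ((LocBdd.const K).add ((hVL.add hvL).const_mul c)) herrL
    (B := c * ε * M ^ 3) (T := t) (by positivity) (fun s _ y => herrb s y)
    (fun s _ y => by
      have := mul_le_mul_of_nonneg_left (add_le_add (hVb s y) (hvb s y)) hc.le
      linarith)
    (fun s hs y => by
      have e1 : (fun s y => (K + c * (V s y + v s y)) * (V s y - v s y) + err s y) =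
          fun s y => (sg s y + K * V s y + c * V s y ^ 2 + err s y) -
            (sg s y + c * v s y ^ 2 + K * v s y) := by ext s y; ring
      have hL1 : LocBdd (fun s y => sg s y + K * V s y + c * V s y ^ 2 + err s y) :=
        ((hsgL.add (hVL.const_mul K)).add (hVL.sq.const_mul c)).add herrL
      have hL2 : LocBdd (fun s y => sg s y + c * v s y ^ 2 + K * v s y) :=
        (hsgL.add (hvL.sq.const_mul c)).add (hvL.const_mul K)
      rw [e1, duhamel_sub hp _ hL1 hL2, hvK s hs y, zero_add, hVeq s y]
      congr 2
      ext s y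
      simp only [herr]
      ring) t ⟨ht, le_rfl⟩ x
  refine this.trans (le_of_eq ?_)
  ring

/-! ### Functions that integrate exponentials against a positive functional -/

/-- `G` pairs nonnegatively with every finite combination of exponentials `θ ↦ e^{θ·z}`,
`θ ≤ θ₀`, that is nonnegative on the orthant `z ≥ 0`. -/
def ExpPos {n : ℕ} (θ₀ : Fin n → ℝ) (G : (Fin n → ℝ) → ℝ) : Prop :=
  ∀ (s : Finset (Fin n → ℝ)) (a : (Fin n → ℝ) → ℝ), (∀ θ ∈ s, θ ≤ θ₀) →
    (∀ z : Fin n → ℝ, 0 ≤ z → 0 ≤ ∑ θ ∈ s, a θ * exp (∑ i, θ i * z i)) →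
    0 ≤ ∑ θ ∈ s, a θ * G θ

namespace ExpPos

variable {n : ℕ} {θ₀ : Fin n → ℝ} {F G : (Fin n → ℝ) → ℝ}

lemma congr (hG : ExpPos θ₀ G) (h : ∀ θ ≤ θ₀, F θ = G θ) : ExpPos θ₀ F := by
  intro s a hs hz
  rw [Finset.sum_congr rfl fun θ hθ => by rw [h θ (hs θ hθ)]]
  exact hG s a hs hz

lemma exp_dot {z : Fin n → ℝ} (hz : 0 ≤ z) :
    ExpPos θ₀ (fun θ => exp (∑ i, θ i * z i)) := fun _ _ _ h => h z hz

lemma const {b : ℝ} (hb : 0 ≤ b) : ExpPos θ₀ (fun _ => b) := by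
  intro s a _ h
  have := h 0 le_rfl
  simp only [Pi.zero_apply, mul_zero, Finset.sum_const_zero, Real.exp_zero, mul_one] at this
  rw [← Finset.sum_mul]
  exact mul_nonneg this hb

/-- This mirrors convolution of measures. The orthant is closed under addition, so for fixed z the
combination with coefficients a_θ e^{θ·z} is again nonnegative on it. Pairing with G gives a
function that is nonnegative in z, to which the positivity of F applies. -/
lemma mul (hF : ExpPos θ₀ F) (hG : ExpPos θ₀ G) : ExpPos θ₀ (fun θ => F θ * G θ) := by
  intro s a hs h
  have := hF s (fun θ => a θ * G θ) hs (fun z hz => by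
    have := hG s (fun θ => a θ * exp (∑ i, θ i * z i)) hs (fun z' hz' => by
      have := h (z + z') (add_nonneg hz hz')
      simpa only [Pi.add_apply, mul_add, Finset.sum_add_distrib, Real.exp_add, mul_assoc] using this)
    refine this.trans (le_of_eq (Finset.sum_congr rfl fun θ _ => by ring)))
  exact this.trans (le_of_eq (Finset.sum_congr rfl fun θ _ => by ring))

lemma const_mul {b : ℝ} (hb : 0 ≤ b) (hG : ExpPos θ₀ G) : ExpPos θ₀ (fun θ => b * G θ) :=
  (const hb).mul hG

lemma add (hF : ExpPos θ₀ F) (hG : ExpPos θ₀ G) : ExpPos θ₀ (fun θ => F θ + G θ) := by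
  intro s a hs h
  simp only [mul_add, Finset.sum_add_distrib]
  exact add_nonneg (hF s a hs h) (hG s a hs h)

lemma pow (hG : ExpPos θ₀ G) (k : ℕ) : ExpPos θ₀ (fun θ => G θ ^ k) := by
  induction k with
  | zero => simpa using const (θ₀ := θ₀) zero_le_one
  | succ k ih => simpa only [pow_succ] using ih.mul hG

lemma of_tendsto {ι : Type*} {l : Filter ι} [l.NeBot] {g : ι → (Fin n → ℝ) → ℝ}
    (hg : ∀ᶠ k in l, ExpPos θ₀ (g k)) (h : ∀ θ ≤ θ₀, Tendsto (fun k => g k θ) l (𝓝 (G θ))) :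
    ExpPos θ₀ G := by
  intro s a hs hz
  have h1 : Tendsto (fun k => ∑ θ ∈ s, a θ * g k θ) l (𝓝 (∑ θ ∈ s, a θ * G θ)) :=
    tendsto_finsetSum _ fun θ hθ => (h θ (hs θ hθ)).const_mul _
  exact ge_of_tendsto h1 (hg.mono fun k hk => hk s a hs hz)

/-- The limit of (1 + G/k)^k, each of which is positive by sums and products. -/
protected lemma exp (hG : ExpPos θ₀ G) : ExpPos θ₀ (fun θ => exp (G θ)) := by
  refine of_tendsto (l := atTop) (g := fun (k : ℕ) θ => (1 + G θ / k) ^ k)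
    (Eventually.of_forall fun k => ?_) (fun θ _ => Real.tendsto_one_add_div_pow_exp _)
  refine ((const zero_le_one).add ?_).pow k
  simpa only [div_eq_inv_mul] using const_mul (b := (k : ℝ)⁻¹) (by positivity) hG

lemma integral {Y : Type*} [MeasurableSpace Y] {μ : Measure Y} {g : (Fin n → ℝ) → Y → ℝ}
    (hg : ∀ᵐ y ∂μ, ExpPos θ₀ (fun θ => g θ y)) (hi : ∀ θ ≤ θ₀, Integrable (g θ) μ) :
    ExpPos θ₀ (fun θ => ∫ y, g θ y ∂μ) := by
  intro s a hs hz
  have : ∑ θ ∈ s, a θ * ∫ y, g θ y ∂μ = ∫ y, ∑ θ ∈ s, a θ * g θ y ∂μ := by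
    rw [integral_finsetSum _ fun θ hθ => (hi θ (hs θ hθ)).const_mul _]
    simp only [integral_const_mul]
  rw [this]
  exact integral_nonneg_of_ae (hg.mono fun y hy => hy s a hs hz)

/-- If all powers `e^{λ v(y)}` are positive in this sense then so is `e^{∫ v}`. -/
lemma exp_integral {Y : Type*} [MeasurableSpace Y] {μ : Measure Y} [IsFiniteMeasure μ]
    {v : (Fin n → ℝ) → Y → ℝ}
    (hv : ∀ᵐ y ∂μ, ∀ r : ℝ, 0 ≤ r → ExpPos θ₀ (fun θ => exp (r * v θ y)))
    (hm : ∀ θ ≤ θ₀, Measurable (v θ)) (hb : ∀ θ ≤ θ₀, ∃ C, ∀ y, |v θ y| ≤ C) :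
    ExpPos θ₀ (fun θ => exp (∫ y, v θ y ∂μ)) := by
  set e : ℕ → ℝ := fun k => 1 / ((k : ℝ) + 1) with he
  have he0 : ∀ k, 0 < e k := fun k => by positivity
  have hel : Tendsto e atTop (𝓝 0) := tendsto_one_div_add_atTop_nhds_zero_nat
  have hbi : ∀ θ ≤ θ₀, ∀ k, Integrable (fun y => exp (e k * v θ y)) μ := by
    intro θ hθ k
    obtain ⟨C, hC⟩ := hb θ hθ
    refine integrable_of_bound (C := exp (e k * C)) (((hm θ hθ).const_mul _).exp) fun y => ?_
    rw [abs_of_pos (Real.exp_pos _)]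
    exact Real.exp_le_exp.2 (mul_le_mul_of_nonneg_left ((le_abs_self _).trans (hC y)) (he0 k).le)
  -- ∫ v is the limit of e_k⁻¹ ∫ (e^{e_k v} - 1). The integral of e^{e_k v} is positive by
  -- hypothesis, and the subtracted constant only contributes a positive factor after
  -- exponentiation.
  refine of_tendsto (l := atTop)
    (g := fun k θ => exp (-(e k)⁻¹ * μ.real univ) *
      exp ((e k)⁻¹ * ∫ y, exp (e k * v θ y) ∂μ)) (Eventually.of_forall fun k => ?_)
    (fun θ hθ => ?_)
  · refine const_mul (Real.exp_pos _).le (ExpPos.exp (const_mul (inv_pos.2 (he0 k)).le ?_))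
    exact integral (hv.mono fun y hy => hy _ (he0 k).le) (fun θ hθ => hbi θ hθ k)
  · obtain ⟨C, hC⟩ := hb θ hθ
    have hC0 : 0 ≤ |C| := abs_nonneg C
    simp only [← Real.exp_add]
    refine (Real.continuous_exp.tendsto _).comp ?_
    have h1 : ∀ k, -(e k)⁻¹ * μ.real univ + (e k)⁻¹ * ∫ y, exp (e k * v θ y) ∂μ =
        ∫ y, (e k)⁻¹ * (exp (e k * v θ y) - 1) ∂μ := by
      intro k
      rw [integral_const_mul, integral_sub (hbi θ hθ k) (integrable_const _)]
      simp
      ring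
    simp only [h1]
    have hvi : Integrable (v θ) μ := integrable_of_bound (hm θ hθ) hC
    rw [tendsto_iff_dist_tendsto_zero]
    have hev : ∀ᶠ k in atTop, e k * |C| ≤ 1 := by
      have := hel.mul_const |C|
      rw [zero_mul] at this
      exact this.eventually_le_const zero_lt_one
    refine squeeze_zero' (Eventually.of_forall fun _ => dist_nonneg)
      (g := fun k => e k * |C| ^ 2 * μ.real univ) (hev.mono fun k hk => ?_) ?_
    · have hint : Integrable (fun y => (e k)⁻¹ * (exp (e k * v θ y) - 1)) μ :=
        ((hbi θ hθ k).sub (integrable_const _)).const_mul _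
      rw [Real.dist_eq, ← integral_sub hint hvi]
      rw [← Real.norm_eq_abs]
      refine norm_integral_le_of_norm_le_const (μ := μ) (C := e k * |C| ^ 2) (ae_of_all _ fun y => ?_)
      have h2 : |v θ y| ≤ |C| := (hC y).trans (le_abs_self C)
      have h3 : |e k * v θ y| ≤ 1 := by
        rw [abs_mul, abs_of_pos (he0 k)]
        exact (mul_le_mul_of_nonneg_left h2 (he0 k).le).trans hk
      have h4 := Real.abs_exp_sub_one_sub_id_le h3
      have h5 : (e k)⁻¹ * (exp (e k * v θ y) - 1) - v θ y =
          (e k)⁻¹ * (exp (e k * v θ y) - 1 - e k * v θ y) := by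
        have := (he0 k).ne'
        field_simp
      rw [Real.norm_eq_abs]
      show |(e k)⁻¹ * (exp (e k * v θ y) - 1) - v θ y| ≤ _
      rw [h5, abs_mul, abs_of_pos (inv_pos.2 (he0 k))]
      calc (e k)⁻¹ * |exp (e k * v θ y) - 1 - e k * v θ y| ≤ (e k)⁻¹ * (e k * v θ y) ^ 2 :=
            mul_le_mul_of_nonneg_left h4 (inv_pos.2 (he0 k)).le
        _ = e k * |v θ y| ^ 2 := by
            have := (he0 k).ne'
            rw [sq_abs]
            field_simp
        _ ≤ e k * |C| ^ 2 := mul_le_mul_of_nonneg_left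
            (pow_le_pow_left₀ (abs_nonneg _) h2 2) (he0 k).le
    · have := (hel.mul_const (|C| ^ 2)).mul_const (μ.real univ)
      simpa using this

end ExpPos

/-- The monomial `∏ y_i ^ u_i` on the cube. -/
def cubeMono {n : ℕ} (u : Fin n → NNReal) : C(Fin n → I, ℝ) where
  toFun y := ∏ i, ((y i : ℝ)) ^ ((u i : ℝ))
  continuous_toFun := by
    refine continuous_finsetProd _ fun i _ => ?_
    exact Continuous.rpow_const (by fun_prop) fun _ => Or.inr (u i).2

lemma cubeMono_apply {n : ℕ} (u : Fin n → NNReal) (y : Fin n → I) :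
    cubeMono u y = ∏ i, ((y i : ℝ)) ^ ((u i : ℝ)) := rfl

lemma cubeMono_zero {n : ℕ} : cubeMono (0 : Fin n → NNReal) = 1 := by
  ext y
  simp [cubeMono_apply]

lemma cubeMono_add {n : ℕ} (u v : Fin n → NNReal) :
    cubeMono (u + v) = cubeMono u * cubeMono v := by
  ext y
  simp only [cubeMono_apply, ContinuousMap.mul_apply, ← Finset.prod_mul_distrib]
  refine Finset.prod_congr rfl fun i _ => ?_
  rw [Pi.add_apply, NNReal.coe_add]
  exact Real.rpow_add_of_nonneg (y i).2.1 (u i).2 (v i).2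

/-- A positive function of exponents is represented by a finite measure on the cube. -/
lemma ExpPos.exists_measure {n : ℕ} {θ₀ : Fin n → ℝ} {G : (Fin n → ℝ) → ℝ} (hG : ExpPos θ₀ G) :
    ∃ μ : Measure (Fin n → I), IsFiniteMeasure μ ∧
      ∀ u : Fin n → NNReal, ∫ y, cubeMono u y ∂μ = G (fun i => θ₀ i - u i) := by
  classical
  set L₁ : ((Fin n → NNReal) →₀ ℝ) →ₗ[ℝ] C(Fin n → I, ℝ) := Finsupp.linearCombination ℝ cubeMono
    with hL₁
  set L₂ : ((Fin n → NNReal) →₀ ℝ) →ₗ[ℝ] ℝ :=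
    Finsupp.linearCombination ℝ (fun u => G (fun i => θ₀ i - u i)) with hL₂
  -- With y_i = e^{-z_i}, a combination of monomials in y is, after multiplication by e^{θ₀·z}, a
  -- combination of exponentials e^{θ·z} with θ ≤ θ₀. Thus positivity of G becomes positivity of a
  -- functional on monomials. Applied to c and -c, it also shows that the functional is well defined
  -- on their span.
  have pos : ∀ c, 0 ≤ L₁ c → 0 ≤ L₂ c := by
    intro c hc
    set τ : (Fin n → NNReal) → (Fin n → ℝ) := fun u i => θ₀ i - u i with hτ
    have hinj : Function.Injective τ := by
      intro u v huv
      ext i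
      have := congrFun huv i
      simp only [hτ] at this
      linarith
    set inv : (Fin n → ℝ) → (Fin n → NNReal) := fun θ i => (θ₀ i - θ i).toNNReal with hinv
    have hiv : ∀ u, inv (τ u) = u := fun u => by ext i; simp [hinv, hτ]
    have key := hG (c.support.image τ) (fun θ => c (inv θ)) (by
      intro θ hθ
      obtain ⟨u, -, rfl⟩ := Finset.mem_image.1 hθ
      intro i
      simp [hτ]) (by
      intro z hz
      rw [Finset.sum_image fun _ _ _ _ h => hinj h]
      have hy : ∀ i, exp (-z i) ∈ Icc (0 : ℝ) 1 := fun i =>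
        ⟨(Real.exp_pos _).le, Real.exp_le_one_iff.2 (by simpa using hz i)⟩
      have h1 : 0 ≤ (L₁ c) (fun i => ⟨exp (-z i), hy i⟩) := hc _
      rw [hL₁, Finsupp.linearCombination_apply, Finsupp.sum, ContinuousMap.sum_apply] at h1
      have h2 : ∑ u ∈ c.support, c (inv (τ u)) * exp (∑ i, τ u i * z i) =
          exp (∑ i, θ₀ i * z i) *
          ∑ u ∈ c.support, (c u • cubeMono u) (fun i => ⟨exp (-z i), hy i⟩) := by
        rw [Finset.mul_sum]
        refine Finset.sum_congr rfl fun u _ => ?_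
        rw [hiv]
        simp only [ContinuousMap.smul_apply, cubeMono_apply, smul_eq_mul, ← Real.exp_mul]
        rw [← Real.exp_sum, mul_left_comm, ← Real.exp_add, ← Finset.sum_add_distrib]
        congr 2
        refine Finset.sum_congr rfl fun i _ => ?_
        simp only [hτ]
        ring
      rw [h2]
      exact mul_nonneg (Real.exp_pos _).le h1)
    rw [Finset.sum_image fun _ _ _ _ h => hinj h] at key
    rw [hL₂, Finsupp.linearCombination_apply, Finsupp.sum]
    refine key.trans (le_of_eq (Finset.sum_congr rfl fun u _ => ?_))
    rw [hiv, smul_eq_mul]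
  have hker : LinearMap.ker L₁ ≤ LinearMap.ker L₂ := by
    intro c hc
    rw [LinearMap.mem_ker] at hc ⊢
    refine le_antisymm ?_ (pos c (by rw [hc]))
    have := pos (-c) (by rw [map_neg, hc, neg_zero])
    rw [map_neg] at this
    linarith
  set f : C(Fin n → I, ℝ) →ₗ.[ℝ] ℝ :=
    ⟨LinearMap.range L₁, ((LinearMap.ker L₁).liftQ L₂ hker).comp
      (L₁.quotKerEquivRange.symm : _ →ₗ[ℝ] _)⟩ with hf
  have hfL : ∀ c (h : L₁ c ∈ LinearMap.range L₁), f ⟨L₁ c, h⟩ = L₂ c := by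
    intro c h
    show ((LinearMap.ker L₁).liftQ L₂ hker) (L₁.quotKerEquivRange.symm ⟨L₁ c, h⟩) = L₂ c
    rw [LinearMap.quotKerEquivRange_symm_apply_image, Submodule.mkQ_apply, Submodule.liftQ_apply]
  -- The span contains the constants, which dominate every continuous function on the compact cube.
  -- The functional therefore extends positively to all of them and is represented by a finite
  -- measure.
  obtain ⟨g, hgf, hgpos⟩ := riesz_extension (PointedCone.positive ℝ C(Fin n → I, ℝ)) f
    (by
      rintro ⟨_, c, rfl⟩ hx
      exact (pos c hx).trans_eq (hfL c ⟨c, rfl⟩).symm)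
    (by
      intro y
      refine ⟨⟨L₁ (Finsupp.single 0 ‖y‖), ⟨_, rfl⟩⟩, ?_⟩
      rw [PointedCone.mem_positive]
      intro z
      have := (abs_le.1 (y.norm_coe_le_norm z)).1
      have h2 : L₁ (Finsupp.single 0 ‖y‖) = ‖y‖ • (1 : C(Fin n → I, ℝ)) := by
        simp only [hL₁, Finsupp.linearCombination_single, cubeMono_zero]
      show (0 : ℝ) ≤ (L₁ (Finsupp.single 0 ‖y‖)) z + y z
      rw [h2]
      show (0 : ℝ) ≤ ‖y‖ * 1 + y z
      linarith)
  let Λ₀ : CompactlySupportedContinuousMap (Fin n → I) ℝ →ₗ[ℝ] ℝ :=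
    { toFun := fun h => g h.toContinuousMap
      map_add' := fun a b => by rw [← map_add]; rfl
      map_smul' := fun r a => by rw [RingHom.id_apply, ← map_smul]; rfl }
  let Λ := PositiveLinearMap.mk₀ Λ₀ (fun x hx => hgpos _ (fun z => show (0 : ℝ) ≤ x z from CompactlySupportedContinuousMap.le_def.1 hx z))
  refine ⟨RealRMK.rieszMeasure Λ, inferInstance, fun u => ?_⟩
  have h1 := RealRMK.integral_rieszMeasure Λ
    (CompactlySupportedContinuousMap.continuousMapEquiv (cubeMono u))
  have h2 : Λ (CompactlySupportedContinuousMap.continuousMapEquiv (cubeMono u)) =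
      g (cubeMono u) := rfl
  rw [h2] at h1
  have h3 : cubeMono u = L₁ (Finsupp.single u 1) := by
    simp [hL₁, Finsupp.linearCombination_single]
  have h4 : g (L₁ (Finsupp.single u 1)) = L₂ (Finsupp.single u 1) :=
    (hgf ⟨L₁ (Finsupp.single u 1), ⟨_, rfl⟩⟩).trans (hfL _ ⟨_, rfl⟩)
  rw [← h3] at h4
  refine h1.trans (h4.trans ?_)
  simp [hL₂, Finsupp.linearCombination_single]

/-- Finite measures on the cube are determined by their monomial moments. -/
lemma cube_measure_ext {n : ℕ} {μ ν : Measure (Fin n → I)} [IsFiniteMeasure μ] [IsFiniteMeasure ν]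
    (h : ∀ u : Fin n → NNReal, ∫ y, cubeMono u y ∂μ = ∫ y, cubeMono u y ∂ν) : μ = ν := by
  have hint : ∀ (ρ : Measure (Fin n → I)) [IsFiniteMeasure ρ] (f : C(Fin n → I, ℝ)),
      Integrable f ρ := fun ρ _ f =>
    Integrable.of_bound f.continuous.aestronglyMeasurable ‖f‖ (ae_of_all _ f.norm_coe_le_norm)
  -- Monomials are closed under multiplication, so the algebra they generate is their linear span.
  -- It contains the coordinates and separates points, and Stone–Weierstrass applies.
  let S : Submonoid C(Fin n → I, ℝ) :=
    { carrier := range cubeMono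
      one_mem' := ⟨0, cubeMono_zero⟩
      mul_mem' := by
        rintro _ _ ⟨u, rfl⟩ ⟨v, rfl⟩
        exact ⟨u + v, cubeMono_add u v⟩ }
  set A := Algebra.adjoin ℝ (S : Set C(Fin n → I, ℝ)) with hA
  have hAeq : ∀ f ∈ A, ∫ y, f y ∂μ = ∫ y, f y ∂ν := by
    intro f hf
    have hf' : f ∈ Submodule.span ℝ (S : Set C(Fin n → I, ℝ)) := by
      have := Algebra.adjoin_eq_span (R := ℝ) (S : Set C(Fin n → I, ℝ))
      rw [Submonoid.closure_eq] at this
      rw [← this]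
      exact hf
    induction hf' using Submodule.span_induction with
    | mem x hx => obtain ⟨u, rfl⟩ := hx; exact h u
    | zero => simp
    | add x y hx hy h1 h2 =>
      have hx' : x ∈ A := by
        rw [hA, ← Subalgebra.mem_toSubmodule, Algebra.adjoin_eq_span, Submonoid.closure_eq]
        exact hx
      have hy' : y ∈ A := by
        rw [hA, ← Subalgebra.mem_toSubmodule, Algebra.adjoin_eq_span, Submonoid.closure_eq]
        exact hy
      simp only [ContinuousMap.add_apply]
      rw [integral_add (hint μ x) (hint μ y), integral_add (hint ν x) (hint ν y), h1 hx', h2 hy']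
    | smul a x hx h1 =>
      have hx' : x ∈ A := by
        rw [hA, ← Subalgebra.mem_toSubmodule, Algebra.adjoin_eq_span, Submonoid.closure_eq]
        exact hx
      simp only [ContinuousMap.smul_apply, smul_eq_mul, integral_const_mul]
      rw [h1 hx']
  have hsep : A.SeparatesPoints := by
    intro x y hxy
    obtain ⟨i, hi⟩ := Function.ne_iff.1 hxy
    refine ⟨_, ⟨cubeMono (Pi.single i 1), Algebra.subset_adjoin ⟨_, rfl⟩, rfl⟩, ?_⟩
    have : ∀ z : Fin n → I, cubeMono (Pi.single i 1) z = z i := by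
      intro z
      rw [cubeMono_apply, Finset.prod_eq_single i]
      · simp
      · intro j _ hj
        simp [Pi.single_eq_of_ne hj]
      · simp
    show cubeMono (Pi.single i 1) x ≠ cubeMono (Pi.single i 1) y
    rw [this, this]
    exact fun h => hi (Subtype.ext h)
  have htop := ContinuousMap.subalgebra_topologicalClosure_eq_top_of_separatesPoints A hsep
  refine ext_of_forall_integral_eq_of_IsFiniteMeasure fun f => ?_
  have hf : f.toContinuousMap ∈ A.topologicalClosure := by rw [htop]; trivial
  have hf2 : f.toContinuousMap ∈ closure (A : Set C(Fin n → I, ℝ)) := hf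
  rw [Metric.mem_closure_iff] at hf2
  set m := μ.real univ + ν.real univ with hm
  have hm0 : 0 ≤ m := by positivity
  have key : ∀ ε : ℝ, 0 < ε → |∫ x, f x ∂μ - ∫ x, f x ∂ν| ≤ ε * m := by
    intro ε hε
    obtain ⟨g, hgA, hg⟩ := hf2 ε hε
    have hb : ∀ x, ‖f x - g x‖ ≤ ε := fun x =>
      ((ContinuousMap.dist_apply_le_dist (f := f.toContinuousMap) (g := g) x)).trans hg.le
    have h1 : ∀ (ρ : Measure (Fin n → I)) [IsFiniteMeasure ρ],
        |∫ x, f x ∂ρ - ∫ x, g x ∂ρ| ≤ ε * ρ.real univ := by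
      intro ρ _
      have hif : Integrable (fun x => f x) ρ := hint ρ f.toContinuousMap
      rw [← integral_sub hif (hint ρ g)]
      exact norm_integral_le_of_norm_le_const (ae_of_all _ hb)
    have h2 := h1 μ
    have h3 := h1 ν
    have h4 := hAeq g hgA
    rw [h4] at h2
    have h5 : ∫ x, f x ∂μ - ∫ x, f x ∂ν =
      (∫ x, f x ∂μ - ∫ x, g x ∂ν) - (∫ x, f x ∂ν - ∫ x, g x ∂ν) := by ring
    rw [h5, hm, mul_add]
    exact (abs_sub _ _).trans (add_le_add h2 h3)
  have h0 : |∫ x, f x ∂μ - ∫ x, f x ∂ν| ≤ 0 := by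
    have hlim : Tendsto (fun ε : ℝ => ε * m) (𝓝[>] 0) (𝓝 (0 * m)) :=
      (Continuous.tendsto (by fun_prop) 0).mono_left nhdsWithin_le_nhds
    rw [zero_mul] at hlim
    exact ge_of_tendsto hlim (eventually_nhdsWithin_of_forall fun ε hε => key ε hε)
  exact sub_eq_zero.1 (abs_nonpos_iff.1 h0)

variable {X : Type*} [MeasurableSpace X] {p : Kernel (ℝ × X) X}

/-! ### The branching equation -/

/-- `v` is a locally bounded solution of `v = A(sg + c v²)`. -/
structure Branching (p : Kernel (ℝ × X) X) (Q c : ℝ) (sg v : ℝ → X → ℝ) : Prop where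
  locBdd : LocBdd v
  eq : ∀ t, 0 ≤ t → ∀ x, v t x = duhamel p Q (fun s y => sg s y + c * v s y ^ 2) t x

/-- The difference of two solutions solves a linear equation. -/
lemma Branching.sub_eq (hp : IsTransition p) {Q c : ℝ} {sg₁ sg₂ v₁ v₂ : ℝ → X → ℝ}
    (hsg₁ : LocBdd sg₁) (hsg₂ : LocBdd sg₂) (h₁ : Branching p Q c sg₁ v₁)
    (h₂ : Branching p Q c sg₂ v₂) {t : ℝ} (ht : 0 ≤ t) (x : X) :
    v₁ t x - v₂ t x = duhamel p Q (fun s y => (c * (v₁ s y + v₂ s y)) * (v₁ s y - v₂ s y) +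
      (sg₁ s y - sg₂ s y)) t x := by
  rw [h₁.eq t ht x, h₂.eq t ht x, ← duhamel_sub hp Q (hsg₁.add (h₁.locBdd.sq.const_mul c))
    (hsg₂.add (h₂.locBdd.sq.const_mul c))]
  congr 1
  funext s y
  ring

lemma Branching.unique (hp : IsTransition p) {Q c : ℝ} {sg v₁ v₂ : ℝ → X → ℝ}
    (hsg : LocBdd sg) (h₁ : Branching p Q c sg v₁) (h₂ : Branching p Q c sg v₂) {t : ℝ}
    (ht : 0 ≤ t) (x : X) : v₁ t x = v₂ t x := by
  have := zero_of_mild hp Q (h₁.locBdd.sub h₂.locBdd)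
    ((h₁.locBdd.add h₂.locBdd).const_mul c) (T := t) (fun s hs y => by
      rw [Branching.sub_eq hp hsg hsg h₁ h₂ hs.1 y]
      congr 1
      funext s y
      ring) t ⟨ht, le_rfl⟩ x
  linarith

/-- Comparison of solutions. -/
lemma Branching.mono (hp : IsTransition p) {Q c : ℝ} {sg₁ sg₂ v₁ v₂ : ℝ → X → ℝ}
    (hsg₁ : LocBdd sg₁) (hsg₂ : LocBdd sg₂) (h₁ : Branching p Q c sg₁ v₁)
    (h₂ : Branching p Q c sg₂ v₂) {t : ℝ} (ht : 0 ≤ t)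
    (hle : ∀ s ∈ Icc 0 t, ∀ y, sg₁ s y ≤ sg₂ s y) (x : X) : v₁ t x ≤ v₂ t x := by
  have := nonneg_of_mild_zero hp Q (h₂.locBdd.sub h₁.locBdd)
    ((h₂.locBdd.add h₁.locBdd).const_mul c) (hsg₂.sub hsg₁) (T := t)
    (fun s hs y => sub_nonneg.2 (hle s hs y)) (fun s hs y =>
      Branching.sub_eq hp hsg₂ hsg₁ h₂ h₁ hs.1 y) t ⟨ht, le_rfl⟩ x
  linarith

lemma Branching.zero (p : Kernel (ℝ × X) X) (Q c : ℝ) :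
    Branching p Q c (fun _ _ => 0) (fun _ _ => 0) where
  locBdd := LocBdd.const 0
  eq := fun t _ x => by simp [duhamel, discounted]

/-- The condition is that the discriminant D² = Q² - 4cs₁ of cβ² - Qβ + s₁ be positive. The witness
is the midpoint of the smaller root (Q - D)/(2c) and the vertex Q/(2c), so both inequalities are
strict. -/
lemma exists_subcritical_bound {Q c s₁ : ℝ} (hQ : 0 < Q) (hc : 0 < c) (hs₀ : 0 ≤ s₁)
    (hs₁ : s₁ < Q ^ 2 / (4 * c)) : ∃ β : ℝ, 0 ≤ β ∧ 2 * c * β < Q ∧ s₁ + c * β ^ 2 < Q * β := by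
  have h1 : s₁ * (4 * c) < Q ^ 2 := by rwa [lt_div_iff₀ (by positivity)] at hs₁
  have h2 : 0 < Q ^ 2 - 4 * c * s₁ := by linarith
  set D := Real.sqrt (Q ^ 2 - 4 * c * s₁) with hD
  have hD0 : 0 < D := Real.sqrt_pos.2 h2
  have hD2 : D ^ 2 = Q ^ 2 - 4 * c * s₁ := Real.sq_sqrt h2.le
  have hDQ : D ≤ Q := by
    refine abs_le_of_sq_le_sq' ?_ hQ.le |>.2
    nlinarith [mul_nonneg hc.le hs₀]
  refine ⟨(Q - D / 2) / (2 * c), by apply div_nonneg <;> linarith, ?_, ?_⟩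
  · field_simp
    linarith
  · have h3 : Q * ((Q - D / 2) / (2 * c)) - c * ((Q - D / 2) / (2 * c)) ^ 2 =
        (Q ^ 2 - D ^ 2 / 4) / (4 * c) := by
      field_simp
      ring
    have h4 : s₁ = (Q ^ 2 - D ^ 2) / (4 * c) := by
      rw [hD2]
      field_simp
      ring
    have h5 : (Q ^ 2 - D ^ 2) / (4 * c) < (Q ^ 2 - D ^ 2 / 4) / (4 * c) := by
      apply div_lt_div_of_pos_right _ (by positivity)
      nlinarith
    linarith

/-- Existence and bounds for subcritical sources. -/
lemma exists_branching (hp : IsTransition p) {Q c β s₁ sb : ℝ} (hQ : 0 < Q) (hc : 0 < c)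
    (hβ : 0 ≤ β) (hβQ : 2 * c * β < Q) (hs₁ : s₁ + c * β ^ 2 ≤ Q * β) (hsb : 0 ≤ sb)
    {sg : ℝ → X → ℝ} (hsgm : Measurable (Function.uncurry sg)) (hsg : ∀ t x, |sg t x| ≤ sb)
    (hsg₁ : ∀ t x, sg t x ≤ s₁) :
    ∃ v, Branching p Q c sg v ∧ ∀ t x, -(sb / Q) ≤ v t x ∧ v t x ≤ β := by
  obtain ⟨v, hvm, hv1, hv2, hv3⟩ := exists_subcritical hp hQ hc hβ hβQ hs₁ hsb hsgm hsg hsg₁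
  refine ⟨v, ⟨LocBdd.of_bound hvm (C := max (sb / Q) β) fun t x => abs_le.2 ⟨?_, ?_⟩, hv3⟩,
    fun t x => ⟨hv1 t x, hv2 t x⟩⟩
  · linarith [hv1 t x, le_max_left (sb / Q) β]
  · exact (hv2 t x).trans (le_max_right _ _)

lemma Branching.bounds (hp : IsTransition p) {Q c β s₁ sb : ℝ} (hQ : 0 < Q) (hc : 0 < c)
    (hβ : 0 ≤ β) (hβQ : 2 * c * β < Q) (hs₁ : s₁ + c * β ^ 2 ≤ Q * β) (hsb : 0 ≤ sb)
    {sg v : ℝ → X → ℝ} (hsgm : Measurable (Function.uncurry sg)) (hsg : ∀ t x, |sg t x| ≤ sb)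
    (hsg₁ : ∀ t x, sg t x ≤ s₁) (hv : Branching p Q c sg v) {t : ℝ} (ht : 0 ≤ t) (x : X) :
    -(sb / Q) ≤ v t x ∧ v t x ≤ β := by
  obtain ⟨v', hv', hb⟩ := exists_branching hp hQ hc hβ hβQ hs₁ hsb hsgm hsg hsg₁
  rw [Branching.unique hp (LocBdd.of_bound hsgm hsg) hv hv' ht x]
  exact hb t x

/-! ### Exponential positivity of the solutions -/

variable {n : ℕ}

protected lemma LocBdd.exp {g : ℝ → X → ℝ} (hg : LocBdd g) : LocBdd (fun t x => exp (g t x)) where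
  meas := hg.meas.exp
  bdd := fun t => by
    obtain ⟨C, -, hC⟩ := hg.bound t
    refine ⟨exp C, fun s hs x => ?_⟩
    rw [abs_of_pos (Real.exp_pos _)]
    exact Real.exp_le_exp.2 ((le_abs_self _).trans (hC s hs x))

lemma ExpPos.duhamel (hp : IsTransition p) (l : ℝ) {θ₀ : Fin n → ℝ}
    {g : (Fin n → ℝ) → ℝ → X → ℝ} (hg : ∀ θ, LocBdd (g θ)) {t : ℝ}
    (h : ∀ s ∈ Ioc 0 t, ∀ y, ExpPos θ₀ (fun θ => g θ s y)) (x : X) :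
    ExpPos θ₀ (fun θ => SuperLDP.duhamel p l (g θ) t x) := by
  have := hp.isMarkovKernel
  refine ExpPos.integral ?_ fun θ _ => duhamel_integrable hp l (hg θ) t x
  refine (ae_restrict_mem measurableSet_Ioc).mono fun s hs => ?_
  refine ExpPos.const_mul (Real.exp_pos _).le (ExpPos.integral (ae_of_all _ (h s hs)) fun θ _ => ?_)
  obtain ⟨C, -, hC⟩ := (hg θ).bound t
  exact integrable_of_bound ((hg θ).meas_right s) (hC s ⟨hs.1.le, hs.2⟩)

/-- The source `(∑ θ_i χ_i(s)) φ(y)`. -/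
def source (χ : Fin n → ℝ → ℝ) (φ : X → ℝ) (θ : Fin n → ℝ) (s : ℝ) (y : X) : ℝ :=
  (∑ i, θ i * χ i s) * φ y

lemma measurable_source {χ : Fin n → ℝ → ℝ} (hχ : ∀ i, Measurable (χ i)) {φ : X → ℝ}
    (hφ : Measurable φ) (θ : Fin n → ℝ) : Measurable (Function.uncurry (source χ φ θ)) := by
  refine Measurable.mul (Finset.measurable_sum _ fun i _ => ?_) (hφ.comp measurable_snd)
  exact ((hχ i).comp measurable_fst).const_mul _

lemma source_abs_le {χ : Fin n → ℝ → ℝ} (hχ0 : ∀ i s, 0 ≤ χ i s) (hχ1 : ∀ s, ∑ i, χ i s ≤ 1)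
    {φ : X → ℝ} {Φ : ℝ} (hφ0 : ∀ y, 0 ≤ φ y) (hφ : ∀ y, φ y ≤ Φ) (θ : Fin n → ℝ) (s : ℝ) (y : X) :
    |source χ φ θ s y| ≤ (∑ i, |θ i|) * Φ := by
  rw [source, abs_mul, abs_of_nonneg (hφ0 y)]
  refine mul_le_mul ((Finset.abs_sum_le_sum_abs _ _).trans (Finset.sum_le_sum fun i _ => ?_))
    (hφ y) (hφ0 y) (Finset.sum_nonneg fun i _ => abs_nonneg _)
  rw [abs_mul, abs_of_nonneg (hχ0 i s)]
  refine mul_le_of_le_one_right (abs_nonneg _) ((Finset.single_le_sum (f := fun j => χ j s)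
    (fun j _ => hχ0 j s) (Finset.mem_univ i)).trans (hχ1 s))

lemma source_le {χ : Fin n → ℝ → ℝ} (hχ0 : ∀ i s, 0 ≤ χ i s) (hχ1 : ∀ s, ∑ i, χ i s ≤ 1)
    {φ : X → ℝ} {Φ : ℝ} (hφ0 : ∀ y, 0 ≤ φ y) (hφ : ∀ y, φ y ≤ Φ) {θ : Fin n → ℝ} {b : ℝ}
    (hb : 0 ≤ b) (hθ : ∀ i, θ i ≤ b) (s : ℝ) (y : X) : source χ φ θ s y ≤ b * Φ := by
  have h1 : ∑ i, θ i * χ i s ≤ b := by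
    calc ∑ i, θ i * χ i s ≤ ∑ i, b * χ i s :=
          Finset.sum_le_sum fun i _ => mul_le_mul_of_nonneg_right (hθ i) (hχ0 i s)
      _ = b * ∑ i, χ i s := by rw [Finset.mul_sum]
      _ ≤ b := mul_le_of_le_one_right hb (hχ1 s)
  exact (mul_le_mul_of_nonneg_right h1 (hφ0 y)).trans (mul_le_mul_of_nonneg_left (hφ y) hb)

lemma locBdd_source {χ : Fin n → ℝ → ℝ} (hχ : ∀ i, Measurable (χ i)) (hχ0 : ∀ i s, 0 ≤ χ i s)
    (hχ1 : ∀ s, ∑ i, χ i s ≤ 1) {φ : X → ℝ} (hφm : Measurable φ) {Φ : ℝ} (hφ0 : ∀ y, 0 ≤ φ y)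
    (hφ : ∀ y, φ y ≤ Φ) (θ : Fin n → ℝ) : LocBdd (source χ φ θ) :=
  LocBdd.of_bound (measurable_source hχ hφm θ) (source_abs_le hχ0 hχ1 hφ0 hφ θ)

lemma expBranch_eq (c ε u : ℝ) :
    expBranch c ε u = 2 * c / ε ^ 2 * exp (ε * u) + -(2 * c / ε ^ 2) := by
  rw [expBranch]; ring

lemma locBdd_picard (hp : IsTransition p) (l c ε : ℝ) {G : ℝ → X → ℝ} (hG : LocBdd G) (k : ℕ) :
    LocBdd (picard p l (expBranch c ε) G (fun _ _ => 0) k) := by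
  induction k with
  | zero => exact LocBdd.const 0
  | succ k ih =>
    refine hG.add (locBdd_duhamel hp l ?_)
    simp only [expBranch_eq]
    exact ((ih.const_mul ε).exp.const_mul _).add (LocBdd.const _)

/-- Induction on k. The next iterate is a linear form in θ with nonnegative coefficients, plus a
nonnegative multiple of the Duhamel integral of e^{ε·iterate}, minus a term free of θ.
Exponentiating each piece preserves positivity. The induction must cover all r ≥ 0, because the step
uses r = ε; it is also why an exponential nonlinearity is used. -/
lemma expPos_picard (hp : IsTransition p) (l : ℝ) {c ε : ℝ} (hc : 0 ≤ c) (hε : 0 < ε)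
    {θ₀ : Fin n → ℝ} {χ : Fin n → ℝ → ℝ} (hχ : ∀ i, Measurable (χ i)) (hχ0 : ∀ i s, 0 ≤ χ i s)
    (hχ1 : ∀ s, ∑ i, χ i s ≤ 1) {φ : X → ℝ} (hφm : Measurable φ) {Φ : ℝ} (hφ0 : ∀ y, 0 ≤ φ y)
    (hφ : ∀ y, φ y ≤ Φ) (k : ℕ) : ∀ r : ℝ, 0 ≤ r → ∀ t x, ExpPos θ₀ (fun θ => exp (r *
      picard p l (expBranch c ε) (duhamel p l (source χ φ θ)) (fun _ _ => 0) k t x)) := by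
  have hlb : ∀ θ, LocBdd (duhamel p l (source χ φ θ)) := fun θ =>
    locBdd_duhamel hp l (locBdd_source hχ hχ0 hχ1 hφm hφ0 hφ θ)
  have hχle : ∀ i s, χ i s ≤ 1 := fun i s => (Finset.single_le_sum (f := fun j => χ j s)
    (fun j _ => hχ0 j s) (Finset.mem_univ i)).trans (hχ1 s)
  have hχφ : ∀ i, LocBdd (fun s y => χ i s * φ y) := fun i =>
    LocBdd.of_bound (((hχ i).comp measurable_fst).mul (hφm.comp measurable_snd)) (C := 1 * Φ)
      fun s y => by
        rw [abs_of_nonneg (mul_nonneg (hχ0 i s) (hφ0 y))]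
        exact mul_le_mul (hχle i s) (hφ y) (hφ0 y) zero_le_one
  induction k with
  | zero => intro r _ t x; simpa [picard] using ExpPos.const (θ₀ := θ₀) zero_le_one
  | succ k ih =>
    intro r hr t x
    have hk : ∀ θ, LocBdd (picard p l (expBranch c ε) (duhamel p l (source χ φ θ))
      (fun _ _ => 0) k) := fun θ => locBdd_picard hp l c ε (hlb θ) k
    have h1 : ∀ θ, duhamel p l (source χ φ θ) t x =
        ∑ i, θ i * duhamel p l (fun s y => χ i s * φ y) t x := by
      intro θ
      have h2 : ∀ s : Finset (Fin n), LocBdd (fun s' y => ∑ i ∈ s, θ i * (χ i s' * φ y)) ∧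
          duhamel p l (fun s' y => ∑ i ∈ s, θ i * (χ i s' * φ y)) t x =
          ∑ i ∈ s, θ i * duhamel p l (fun s y => χ i s * φ y) t x := by
        intro s
        induction s using Finset.induction_on with
        | empty => exact ⟨by simpa using LocBdd.const 0, by simp [duhamel, discounted]⟩
        | insert a s ha ihs =>
          simp only [Finset.sum_insert ha]
          refine ⟨((hχφ a).const_mul _).add ihs.1, ?_⟩
          rw [duhamel_add hp l ((hχφ a).const_mul _) ihs.1, duhamel_const_mul, ihs.2]
      rw [← (h2 Finset.univ).2]
      congr 1
      funext s y
      rw [source, Finset.sum_mul]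
      exact Finset.sum_congr rfl fun i _ => by ring
    set a := 2 * c / ε ^ 2 with ha
    have ha0 : 0 ≤ a := by positivity
    have hkε : ∀ θ, LocBdd (fun s y => exp (ε * picard p l (expBranch c ε)
        (duhamel p l (source χ φ θ)) (fun _ _ => 0) k s y)) := fun θ => ((hk θ).const_mul ε).exp
    have h3 : ∀ θ, picard p l (expBranch c ε) (duhamel p l (source χ φ θ)) (fun _ _ => 0) (k + 1) t
        x = (∑ i, θ i * duhamel p l (fun s y => χ i s * φ y) t x) +
          (a * duhamel p l (fun s y => exp (ε * picard p l (expBranch c ε)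
            (duhamel p l (source χ φ θ)) (fun _ _ => 0) k s y)) t x +
            duhamel p l (fun _ _ => -a) t x) := by
      intro θ
      rw [← h1, ← duhamel_const_mul, ← duhamel_add hp l ((hkε θ).const_mul a) (LocBdd.const _)]
      simp only [picard, expBranch_eq, ha]
    have h4 : ∀ i, 0 ≤ duhamel p l (fun s y => χ i s * φ y) t x := by
      intro i
      have := duhamel_mono hp l (LocBdd.const 0) (hχφ i) (t := t)
        (fun s _ y => mul_nonneg (hχ0 i s) (hφ0 y)) x
      refine le_trans (le_of_eq ?_) this
      simp [duhamel, discounted]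
    have h5 := (ExpPos.exp_dot (θ₀ := θ₀)
      (z := fun i => r * duhamel p l (fun s y => χ i s * φ y) t x)
      (fun i => mul_nonneg hr (h4 i))).mul ((ExpPos.exp (ExpPos.const_mul (mul_nonneg hr ha0)
        (ExpPos.duhamel hp l hkε (t := t) (fun s _ y => ih ε hε.le s y) x))).mul
        (ExpPos.const (Real.exp_pos (r * duhamel p l (fun _ _ => -a) t x)).le))
    refine h5.congr fun θ _ => ?_
    rw [h3 θ, ← Real.exp_add, ← Real.exp_add]
    congr 1
    have : ∑ i, θ i * (r * duhamel p l (fun s y => χ i s * φ y) t x) =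
        r * ∑ i, θ i * duhamel p l (fun s y => χ i s * φ y) t x := by
      rw [Finset.mul_sum]
      exact Finset.sum_congr rfl fun i _ => by ring
    rw [this]
    ring

/-- Exponentials of the solutions of the branching equation are exponentially positive. -/
lemma expPos_branching (hp : IsTransition p) {Q c b Φ : ℝ} (hQ : 0 < Q) (hc : 0 < c) (hb : 0 ≤ b)
    (hbΦ : b * Φ < Q ^ 2 / (4 * c)) {χ : Fin n → ℝ → ℝ} (hχ : ∀ i, Measurable (χ i))
    (hχ0 : ∀ i s, 0 ≤ χ i s) (hχ1 : ∀ s, ∑ i, χ i s ≤ 1) {φ : X → ℝ} (hφm : Measurable φ)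
    (hφ0 : ∀ y, 0 ≤ φ y) (hφ : ∀ y, φ y ≤ Φ) {v : (Fin n → ℝ) → ℝ → X → ℝ}
    (hv : ∀ θ, (∀ i, θ i ≤ b) → Branching p Q c (source χ φ θ) (v θ)) {r t : ℝ} (hr : 0 ≤ r)
    (ht : 0 ≤ t) (x : X) :
    ExpPos (fun _ => b) (fun θ => exp (r * v θ t x)) := by
  have hΦ : 0 ≤ Φ := (hφ0 x).trans (hφ x)
  obtain ⟨β, hβ, hβQ, hs₁⟩ := exists_subcritical_bound hQ hc (mul_nonneg hb hΦ) hbΦ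
  obtain ⟨ε₀, hε₀, H⟩ := expBranch_scheme hp hQ hc hβ hβQ hs₁
  have hsb : ∀ θ : Fin n → ℝ, 0 ≤ (∑ i, |θ i|) * Φ := fun θ =>
    mul_nonneg (Finset.sum_nonneg fun i _ => abs_nonneg _) hΦ
  have key : ∀ θ : Fin n → ℝ, (∀ i, θ i ≤ b) → ∃ V : ℝ → ℝ,
      (∀ ε, 0 < ε → ε < ε₀ → Tendsto (fun k => picard p (Q + 2 * c / ε) (expBranch c ε)
          (duhamel p (Q + 2 * c / ε) (source χ φ θ)) (fun _ _ => 0) k t x) atTop (𝓝 (V ε))) ∧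
      Tendsto V (𝓝[>] 0) (𝓝 (v θ t x)) := by
    intro θ hθ
    obtain ⟨C, ε₁, hε₁, h⟩ := H _ (hsb θ)
    have hm := measurable_source hχ hφm θ
    have habs := source_abs_le hχ0 hχ1 hφ0 hφ θ
    have hle := source_le hχ0 hχ1 hφ0 hφ hb hθ
    obtain ⟨v', hv', hv'b⟩ := exists_branching hp hQ hc hβ hβQ hs₁.le (hsb θ) hm habs hle
    have hvv : v θ t x = v' t x := Branching.unique hp (LocBdd.of_bound hm habs) (hv θ hθ) hv' ht x
    have : ∀ ε, ∃ V : ℝ, 0 < ε → ε < ε₀ →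
        Tendsto (fun k => picard p (Q + 2 * c / ε) (expBranch c ε)
          (duhamel p (Q + 2 * c / ε) (source χ φ θ)) (fun _ _ => 0) k t x) atTop (𝓝 V) ∧
        (ε < ε₁ → |V - v θ t x| ≤ C * ε) := by
      intro ε
      by_cases hε : 0 < ε ∧ ε < ε₀
      · obtain ⟨V, hV1, hV2⟩ := h ε hε.1 hε.2 _ hm habs hle
        refine ⟨V t x, fun _ _ => ⟨hV1 t x, fun h1 => ?_⟩⟩
        rw [hvv]
        exact hV2 v' hv'.locBdd.meas (fun t x => (hv'b t x).1) (fun t x => (hv'b t x).2) hv'.eq h1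
          t ht x
      · exact ⟨0, fun h1 h2 => absurd ⟨h1, h2⟩ hε⟩
    choose V hV using this
    refine ⟨V, fun ε h1 h2 => (hV ε h1 h2).1, ?_⟩
    rw [tendsto_iff_dist_tendsto_zero]
    have hlim : Tendsto (fun ε : ℝ => C * ε) (𝓝[>] 0) (𝓝 (C * 0)) :=
      (Continuous.tendsto (by fun_prop) 0).mono_left nhdsWithin_le_nhds
    rw [mul_zero] at hlim
    refine squeeze_zero' (Eventually.of_forall fun _ => dist_nonneg) ?_ hlim
    filter_upwards [Ioo_mem_nhdsGT hε₀, Ioo_mem_nhdsGT hε₁] with ε h1 h2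
    exact (hV ε h1.1 h1.2).2 h2.2
  have hex : ∀ θ : Fin n → ℝ, ∃ V : ℝ → ℝ, (∀ i, θ i ≤ b) →
      (∀ ε, 0 < ε → ε < ε₀ → Tendsto (fun k => picard p (Q + 2 * c / ε) (expBranch c ε)
          (duhamel p (Q + 2 * c / ε) (source χ φ θ)) (fun _ _ => 0) k t x) atTop (𝓝 (V ε))) ∧
      Tendsto V (𝓝[>] 0) (𝓝 (v θ t x)) := by
    intro θ
    by_cases h : ∀ i, θ i ≤ b
    · obtain ⟨V, hV⟩ := key θ h
      exact ⟨V, fun _ => hV⟩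
    · exact ⟨0, fun h' => absurd h' h⟩
  choose V hV using hex
  -- Two limits: first in the number of iterations, then ε → 0. Positivity at a fixed ε involves
  -- combinations of arbitrary θ ≤ b, which is why ε₀ must not depend on θ.
  refine ExpPos.of_tendsto (l := 𝓝[>] (0 : ℝ)) (g := fun ε θ => exp (r * V θ ε)) ?_
    fun θ hθ => (Real.continuous_exp.tendsto _).comp ((hV θ hθ).2.const_mul r)
  filter_upwards [Ioo_mem_nhdsGT hε₀] with ε hε
  refine ExpPos.of_tendsto (l := atTop) (Eventually.of_forall fun k =>
    expPos_picard hp (Q + 2 * c / ε) hc.le hε.1 hχ hχ0 hχ1 hφm hφ0 hφ k r hr t x) fun θ hθ => ?_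
  exact (Real.continuous_exp.tendsto _).comp (((hV θ hθ).1 ε hε.1 hε.2).const_mul r)

lemma expPos_exp_integral_branching (hp : IsTransition p) {Q c b Φ : ℝ} (hQ : 0 < Q) (hc : 0 < c)
    (hb : 0 ≤ b) (hbΦ : b * Φ < Q ^ 2 / (4 * c)) {χ : Fin n → ℝ → ℝ} (hχ : ∀ i, Measurable (χ i))
    (hχ0 : ∀ i s, 0 ≤ χ i s) (hχ1 : ∀ s, ∑ i, χ i s ≤ 1) {φ : X → ℝ} (hφm : Measurable φ)
    (hφ0 : ∀ y, 0 ≤ φ y) (hφ : ∀ y, φ y ≤ Φ) {v : (Fin n → ℝ) → ℝ → X → ℝ}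
    (hv : ∀ θ, (∀ i, θ i ≤ b) → Branching p Q c (source χ φ θ) (v θ)) {H T : ℝ} (hH : 0 ≤ H)
    {μ : Measure X} [IsFiniteMeasure μ] :
    ExpPos (fun _ => b) (fun θ => exp (H * ∫ q in Ioc 0 T ×ˢ univ, v θ q.1 q.2
      ∂(volume.prod μ))) := by
  have hfin : IsFiniteMeasure ((volume.prod μ).restrict (Ioc 0 T ×ˢ (univ : Set X))) :=
    ⟨by
      rw [Measure.restrict_apply_univ, Measure.prod_prod]
      exact ENNReal.mul_lt_top (by simp) (measure_lt_top _ _)⟩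
  set ρ := ((volume.prod μ).restrict (Ioc 0 T ×ˢ (univ : Set X))) with hρ
  rcases le_or_gt T 0 with hT | hT
  · have : ρ = 0 := by rw [hρ, Ioc_eq_empty (by simpa using hT)]; simp
    simp only [this, integral_zero_measure, mul_zero, Real.exp_zero]
    exact ExpPos.const zero_le_one
  -- The solutions are bounded only on bounded times; clamping time to [0, T] gives globally bounded
  -- integrands that agree on the domain of integration.
  have hclamp : ∀ s : ℝ, max (min s T) 0 ∈ Icc 0 T := fun s =>
    ⟨le_max_right _ _, max_le (min_le_right _ _) hT.le⟩
  have h := ExpPos.exp_integral (θ₀ := fun _ : Fin n => b) (μ := ρ)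
    (v := fun θ (q : ℝ × X) => H * v θ (max (min q.1 T) 0) q.2)
    (ae_of_all _ fun q r hr => by
      simpa only [mul_assoc] using expPos_branching hp hQ hc hb hbΦ hχ hχ0 hχ1 hφm hφ0 hφ hv
        (mul_nonneg hr hH) (hclamp q.1).1 q.2)
    (fun θ hθ => Measurable.const_mul ((hv θ hθ).locBdd.meas.comp
      (((measurable_fst.min measurable_const).max measurable_const).prodMk measurable_snd)) _)
    (fun θ hθ => by
      obtain ⟨C, -, hC⟩ := (hv θ hθ).locBdd.bound T
      refine ⟨H * C, fun q => ?_⟩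
      rw [abs_mul, abs_of_nonneg hH]
      exact mul_le_mul_of_nonneg_left (hC _ (hclamp q.1) _) hH)
  refine h.congr fun θ hθ => ?_
  rw [← integral_const_mul]
  congr 1
  refine setIntegral_congr_fun (measurableSet_Ioc.prod MeasurableSet.univ) fun q hq => ?_
  have h1 : max (min q.1 T) 0 = q.1 := by rw [min_eq_left hq.1.2, max_eq_left hq.1.1.le]
  simp only [h1]

/-! ### The transition kernel of the motion -/

section Transition

variable {d : ℕ} {S : Type*} [MeasurableSpace S]

/-- The transition kernel `p (t, x) = P_x (η_t ∈ ·)`. -/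
def MarkovFamily.transition (M : MarkovFamily d S) : Kernel (ℝ × E d) (E d) :=
  ((Kernel.deterministic Prod.fst measurable_fst) ×ₖ (M.P.comap Prod.snd measurable_snd)).map
    (Function.uncurry M.η)

lemma MarkovFamily.transition_eq (M : MarkovFamily d S) (t : ℝ) (x : E d) :
    M.transition (t, x) = (M.P x).map (M.η t) := by
  have := M.isMarkovKernel
  rw [MarkovFamily.transition, Kernel.map_apply _ M.measurable_η, Kernel.prod_apply,
    Kernel.deterministic_apply, Kernel.comap_apply, Measure.dirac_prod,
    Measure.map_map M.measurable_η (by fun_prop)]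
  rfl

lemma MarkovFamily.measurable_eta (M : MarkovFamily d S) (t : ℝ) : Measurable (M.η t) :=
  M.measurable_η.comp (measurable_const.prodMk measurable_id)

lemma MarkovFamily.isTransition (M : MarkovFamily d S) : IsTransition M.transition where
  isMarkovKernel := by
    have := M.isMarkovKernel
    exact Kernel.IsMarkovKernel.map _ M.measurable_η
  zero x := by
    have := M.isMarkovKernel
    rw [M.transition_eq, Measure.map_congr (g := fun _ => x) (M.start x), Measure.map_const]
    simp
  add s t x hs ht := by
    have := M.isMarkovKernel
    ext B hB
    rw [M.transition_eq, Measure.map_apply (M.measurable_eta _) hB, Kernel.comp_apply' _ _ _ hB]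
    have h := M.markov x s t hs ht B hB univ MeasurableSet.univ
    rw [univ_inter, Measure.restrict_univ] at h
    rw [h, Kernel.comap_apply, M.transition_eq, lintegral_map (Kernel.measurable_coe _ hB)
      (M.measurable_eta s)]
    refine lintegral_congr fun ω => ?_
    rw [Kernel.comap_apply, M.transition_eq, Measure.map_apply (M.measurable_eta _) hB]

lemma MarkovFamily.TQ_eq (M : MarkovFamily d S) (Q t : ℝ) {f : E d → ℝ} (hf : Measurable f) :
    M.TQ Q t f = discounted M.transition Q t f := by
  funext x
  rw [MarkovFamily.TQ, MarkovFamily.T, discounted, M.transition_eq,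
    integral_map (M.measurable_eta t).aemeasurable hf.aestronglyMeasurable]

lemma MarkovFamily.duhamel_eq (M : MarkovFamily d S) (Q : ℝ) {g : ℝ → E d → ℝ}
    (hg : ∀ s, Measurable (g s)) {t : ℝ} (ht : 0 ≤ t) (x : E d) :
    ∫ s in (0 : ℝ)..t, M.TQ Q (t - s) (g s) x = duhamel M.transition Q g t x := by
  rw [intervalIntegral.integral_of_le ht, duhamel]
  simp only [M.TQ_eq Q _ (hg _)]

lemma isMildSolution_iff (M : MarkovFamily d S) (Q c : ℝ) (g w : ℝ → E d → ℝ) :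
    IsMildSolution M Q c g w ↔ LocBdd w ∧ ∀ t, 0 ≤ t → ∀ x,
      w t x = g t x + c * duhamel M.transition Q (fun s y => w s y ^ 2) t x := by
  constructor
  · rintro ⟨h1, h2, h3⟩
    have h : LocBdd w := ⟨h1, h2⟩
    refine ⟨h, fun t ht x => ?_⟩
    rw [h3 t ht x, M.duhamel_eq Q (fun s => h.sq.meas_right s) ht x]
  · rintro ⟨h, h3⟩
    refine ⟨h.meas, h.bdd, fun t ht x => ?_⟩
    rw [h3 t ht x, M.duhamel_eq Q (fun s => h.sq.meas_right s) ht x]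

lemma isMildSolution_branching_iff (M : MarkovFamily d S) (Q c : ℝ) {f : E d → ℝ}
    (hf : Measurable f) {C : ℝ} (hC : ∀ x, |f x| ≤ C) (w : ℝ → E d → ℝ) :
    IsMildSolution M Q c (fun t x => ∫ s in (0 : ℝ)..t, M.TQ Q (t - s) f x) w ↔
      Branching M.transition Q c (fun _ => f) w := by
  rw [isMildSolution_iff]
  have hf' : LocBdd (fun _ : ℝ => f) := LocBdd.of_bound (hf.comp measurable_snd) fun _ => hC
  have key : LocBdd w → ∀ t, 0 ≤ t → ∀ x, (∫ s in (0 : ℝ)..t, M.TQ Q (t - s) f x) +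
      c * duhamel M.transition Q (fun s y => w s y ^ 2) t x =
      duhamel M.transition Q (fun s y => f y + c * w s y ^ 2) t x := by
    intro hw t ht x
    rw [duhamel_add M.isTransition Q hf' (hw.sq.const_mul c), duhamel_const_mul,
      M.duhamel_eq Q (g := fun _ => f) (fun _ => hf) ht x]
  constructor
  · rintro ⟨h1, h2⟩
    exact ⟨h1, fun t ht x => (h2 t ht x).trans (key h1 t ht x)⟩
  · rintro ⟨h1, h2⟩
    exact ⟨h1, fun t ht x => (h2 t ht x).trans (key h1 t ht x).symm⟩

end Transition

/-! ### The negative exponential on `[0, ∞]` -/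

/-- `e^{-x}` for `x ∈ [0, ∞]`. -/
def nexp (x : ℝ≥0∞) : ℝ≥0∞ := EReal.exp (-(x : EReal))

lemma nexp_top : nexp ⊤ = 0 := by simp [nexp]

lemma nexp_zero : nexp 0 = 1 := by simp [nexp]

lemma nexp_ofReal {r : ℝ} (hr : 0 ≤ r) : nexp (ofReal r) = ofReal (exp (-r)) := by
  rw [nexp, EReal.coe_ennreal_ofReal, max_eq_left hr, ← EReal.coe_neg, EReal.exp_coe]

lemma nexp_anti : Antitone nexp := fun x y h => by
  unfold nexp
  exact EReal.exp_monotone (EReal.neg_le_neg_iff.2 (by exact_mod_cast h))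

lemma nexp_le_one (x : ℝ≥0∞) : nexp x ≤ 1 := nexp_zero ▸ nexp_anti (zero_le : 0 ≤ x)

lemma nexp_ne_top (x : ℝ≥0∞) : nexp x ≠ ⊤ := ((nexp_le_one x).trans_lt ENNReal.one_lt_top).ne

lemma nexp_add (x y : ℝ≥0∞) : nexp (x + y) = nexp x * nexp y := by
  rcases eq_or_ne x ⊤ with rfl | hx
  · simp [nexp_top]
  rcases eq_or_ne y ⊤ with rfl | hy
  · simp [nexp_top]
  lift x to NNReal using hx
  lift y to NNReal using hy
  rw [← ENNReal.coe_add, ← ENNReal.ofReal_coe_nnreal, ← ENNReal.ofReal_coe_nnreal,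
    ← ENNReal.ofReal_coe_nnreal, nexp_ofReal (by positivity), nexp_ofReal (by positivity),
    nexp_ofReal (by positivity), ← ENNReal.ofReal_mul (Real.exp_pos _).le, ← Real.exp_add]
  congr 2
  push_cast
  ring

lemma continuous_nexp : Continuous nexp :=
  ENNReal.continuous_exp.comp (continuous_coe_ennreal_ereal.neg)

lemma measurable_nexp : Measurable nexp := continuous_nexp.measurable

/-- The tangent line inequality for `nexp`. -/
lemma nexp_tangent {a : ℝ≥0∞} (ha : a ≠ ⊤) (r : ℝ≥0∞) :
    nexp a * (1 + a) ≤ nexp r + nexp a * r := by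
  rcases eq_or_ne r ⊤ with rfl | hr
  · lift a to NNReal using ha
    rw [ENNReal.mul_top]
    · simp
    · rw [← ENNReal.ofReal_coe_nnreal, nexp_ofReal (by positivity)]
      simp [Real.exp_pos]
  lift a to NNReal using ha
  lift r to NNReal using hr
  rw [← ENNReal.ofReal_coe_nnreal (p := a), ← ENNReal.ofReal_coe_nnreal (p := r),
    nexp_ofReal (by positivity), nexp_ofReal (by positivity), ← ENNReal.ofReal_one,
    ← ENNReal.ofReal_add (by norm_num) (by positivity), ← ENNReal.ofReal_mul (by positivity),
    ← ENNReal.ofReal_mul (by positivity), ← ENNReal.ofReal_add (by positivity) (by positivity)]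
  refine ENNReal.ofReal_le_ofReal ?_
  have h1 := Real.add_one_le_exp ((a : ℝ) - r)
  have h2 : exp (-(r : ℝ)) = exp (-a) * exp (a - r) := by
    rw [← Real.exp_add]; congr 1; ring
  rw [h2]
  nlinarith [Real.exp_pos (-(a : ℝ))]

/-- Jensen's inequality for `nexp`. -/
lemma nexp_lintegral_le {Y : Type*} [MeasurableSpace Y] {μ : Measure Y} [IsProbabilityMeasure μ]
    {f : Y → ℝ≥0∞} (hf : Measurable f) : nexp (∫⁻ y, f y ∂μ) ≤ ∫⁻ y, nexp (f y) ∂μ := by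
  rcases eq_or_ne (∫⁻ y, f y ∂μ) ⊤ with h | h
  · rw [h, nexp_top]; exact zero_le
  set a := ∫⁻ y, f y ∂μ with ha
  have h1 : ∫⁻ _, nexp a * (1 + a) ∂μ ≤ ∫⁻ y, (nexp (f y) + nexp a * f y) ∂μ :=
    lintegral_mono fun y => nexp_tangent h (f y)
  have hm : Measurable fun y => nexp (f y) := measurable_nexp.comp hf
  rw [lintegral_const, measure_univ, mul_one, lintegral_add_left hm,
    lintegral_const_mul _ hf, ← ha, mul_add, mul_one] at h1
  exact (ENNReal.add_le_add_iff_right (ENNReal.mul_ne_top (nexp_ne_top a) h)).1 h1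

/-- `nexp` is `1`-Lipschitz. -/
lemma nexp_le_add (x y : ℝ≥0∞) : nexp x ≤ nexp (x + y) + y := by
  rcases eq_or_ne x ⊤ with rfl | hx
  · rw [nexp_top]; exact zero_le
  have h := nexp_tangent hx (x + y)
  have h2 : nexp x + nexp x * x ≤ nexp (x + y) + y + nexp x * x := by
    calc nexp x + nexp x * x = nexp x * (1 + x) := by rw [mul_add, mul_one]
      _ ≤ nexp (x + y) + nexp x * (x + y) := h
      _ = nexp (x + y) + nexp x * y + nexp x * x := by rw [mul_add]; ring
      _ ≤ nexp (x + y) + y + nexp x * x := by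
        gcongr
        exact mul_le_of_le_one_left zero_le (nexp_le_one x)
  exact (ENNReal.add_le_add_iff_right (ENNReal.mul_ne_top (nexp_ne_top x) hx)).1 h2

/-! ### A parameter carried along by the motion -/

section Frozen

variable {X : Type*} [MeasurableSpace X] {p : Kernel (ℝ × X) X}

/-- The motion on `X × ℝ` that leaves the second coordinate fixed. -/
def frozen (p : Kernel (ℝ × X) X) : Kernel (ℝ × (X × ℝ)) (X × ℝ) :=
  (p.comap (fun q : ℝ × (X × ℝ) => (q.1, q.2.1)) (by fun_prop)) ×ₖ
    (Kernel.deterministic (fun q : ℝ × (X × ℝ) => q.2.2) (by fun_prop))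

lemma frozen_apply (hp : IsTransition p) (t : ℝ) (x : X) (z : ℝ) :
    frozen p (t, (x, z)) = (p (t, x)).map (fun y => (y, z)) := by
  have := hp.isMarkovKernel
  rw [frozen, Kernel.prod_apply, Kernel.deterministic_apply, Kernel.comap_apply,
    Measure.prod_dirac]

/-- The shift of the time grid is carried as a frozen coordinate of the motion. The solutions for
all shifts are then obtained at once, jointly measurable in the shift. -/
lemma isTransition_frozen (hp : IsTransition p) : IsTransition (frozen p) where
  isMarkovKernel := by
    have := hp.isMarkovKernel
    unfold frozen
    infer_instance
  zero := by
    rintro ⟨x, z⟩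
    rw [frozen_apply hp, hp.zero, Measure.map_dirac' (by fun_prop)]
  add := by
    rintro s t ⟨x, z⟩ hs ht
    ext B hB
    have hm : Measurable (fun y : X => (y, z)) := by fun_prop
    rw [frozen_apply hp, Measure.map_apply hm hB, hp.add s t x hs ht,
      Kernel.comp_apply' _ _ _ (hm hB), Kernel.comp_apply' _ _ _ hB, Kernel.comap_apply,
      Kernel.comap_apply, frozen_apply hp, lintegral_map (Kernel.measurable_coe _ hB) hm]
    refine lintegral_congr fun y => ?_
    rw [Kernel.comap_apply, Kernel.comap_apply, frozen_apply hp, Measure.map_apply hm hB]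

lemma discounted_frozen (hp : IsTransition p) (l t : ℝ) {f : X × ℝ → ℝ} (hf : Measurable f)
    (x : X) (z : ℝ) :
    discounted (frozen p) l t f (x, z) = discounted p l t (fun y => f (y, z)) x := by
  rw [discounted, discounted, frozen_apply hp, integral_map (by fun_prop)
    hf.aestronglyMeasurable]

lemma duhamel_frozen (hp : IsTransition p) (l : ℝ) {g : ℝ → X × ℝ → ℝ}
    (hg : Measurable (Function.uncurry g)) (t : ℝ) (x : X) (z : ℝ) :
    duhamel (frozen p) l g t (x, z) = duhamel p l (fun s y => g s (y, z)) t x := by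
  rw [duhamel, duhamel]
  refine integral_congr_ae (ae_of_all _ fun s => ?_)
  exact discounted_frozen hp l _ (f := g s) (hg.comp (measurable_const.prodMk measurable_id)) x z

end Frozen

/-! ### Solutions with atoms between two consecutive atoms -/

section Segment

variable {X : Type*} [MeasurableSpace X] {p : Kernel (ℝ × X) X}

lemma discounted_add (hp : IsTransition p) (l t : ℝ) {f g : X → ℝ} (hf : Measurable f)
    (hg : Measurable g) {C D : ℝ} (hC : ∀ x, |f x| ≤ C) (hD : ∀ x, |g x| ≤ D) (x : X) :
    discounted p l t (fun y => f y + g y) x = discounted p l t f x + discounted p l t g x := by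
  have := hp.isMarkovKernel
  rw [discounted, discounted, discounted, integral_add (integrable_of_bound hf hC)
    (integrable_of_bound hg hD), mul_add]

lemma discounted_const_mul (p : Kernel (ℝ × X) X) (l t a : ℝ) (f : X → ℝ) (x : X) :
    discounted p l t (fun y => a * f y) x = a * discounted p l t f x := by
  rw [discounted, discounted, integral_const_mul]
  ring

lemma discounted_sum (hp : IsTransition p) (l t : ℝ) {ι : Type*} (s : Finset ι) {f : ι → X → ℝ}
    (hf : ∀ i ∈ s, Measurable (f i)) (hC : ∀ i ∈ s, ∃ C, ∀ x, |f i x| ≤ C) (x : X) :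
    discounted p l t (fun y => ∑ i ∈ s, f i y) x = ∑ i ∈ s, discounted p l t (f i) x := by
  have := hp.isMarkovKernel
  rw [discounted, integral_finsetSum, Finset.mul_sum]
  · rfl
  · intro i hi
    obtain ⟨C, hC⟩ := hC i hi
    exact integrable_of_bound (hf i hi) hC

lemma delayed_restart (hp : IsTransition p) (l : ℝ) {τ s t : ℝ} (hτ : τ ≤ s) (ht : 0 ≤ t)
    {f : X → ℝ} (hf : Measurable f) {C : ℝ} (hC : ∀ x, |f x| ≤ C) (x : X) :
    delayed p l τ f (s + t) x = discounted p l t (delayed p l τ f s) x := by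
  have h1 : delayed p l τ f s = discounted p l (s - τ) f := by
    funext y; rw [delayed, if_pos hτ]
  rw [h1, discounted_discounted hp l ht (sub_nonneg.2 hτ) hf hC, delayed, if_pos (by linarith)]
  congr 1
  ring

/-- No atom lies strictly inside the segment: either the delayed semigroup has started by time s and
is merely continued, or it is still zero. An atom at the end point s + gap shows up there as a jump
by f. -/
lemma delayed_segment (hp : IsTransition p) (l : ℝ) {τ s gap t : ℝ} (hgap : 0 < gap)
    (hno : τ ≤ s ∨ s + gap ≤ τ) (ht : t ∈ Icc 0 gap)
    {f : X → ℝ} (hf : Measurable f) {C : ℝ} (hC : ∀ x, |f x| ≤ C) (x : X) :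
    delayed p l τ f (s + t) x = discounted p l t (delayed p l τ f s) x +
      if τ = s + t ∧ t = gap then f x else 0 := by
  rcases hno with h | h
  · rw [delayed_restart hp l h ht.1 hf hC, if_neg, add_zero]
    rintro ⟨h1, h2⟩
    linarith
  · have h1 : delayed p l τ f s = fun _ => 0 := by
      funext y; rw [delayed, if_neg (by linarith)]
    rw [h1, discounted_zero_fun, zero_add, delayed]
    rcases lt_or_eq_of_le ht.2 with h2 | h2
    · rw [if_neg (by linarith), if_neg (by rintro ⟨-, h3⟩; linarith)]
    · by_cases h3 : τ = s + t
      · rw [if_pos h3.le, if_pos ⟨h3, h2⟩, h3, sub_self, discounted_zero hp l hf]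
      · rw [if_neg, if_neg (fun h4 => h3 h4.1)]
        intro h4
        exact h3 (le_antisymm h4 (by linarith))

/-- Between two consecutive atoms, the solution with atoms follows the absorbing flow. -/
lemma absorbing_segment (hp : IsTransition p) {Q c : ℝ} (hQ : 0 < Q) (hc : 0 ≤ c) {n : ℕ}
    {a τ : ℕ → ℝ} (hτ : ∀ k < n, 0 ≤ τ k) {φ : X → ℝ} (hφ : Measurable φ) {Φ : ℝ}
    (hΦ : ∀ x, |φ x| ≤ Φ) {W : ℝ → X → ℝ} (hW : LocBdd W) (hW0 : ∀ t x, 0 ≤ W t x)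
    (heq : ∀ t, 0 ≤ t → ∀ x, W t x = ∑ k ∈ Finset.range n, a k * delayed p Q (τ k) φ t x +
      duhamel p Q (fun s y => -(c * W s y ^ 2)) t x)
    {s gap : ℝ} (hs : 0 ≤ s) (hgap : 0 < gap) (hno : ∀ k < n, τ k ≤ s ∨ s + gap ≤ τ k) :
    ∃ u : ℝ → X → ℝ, LocBdd u ∧ (∀ t x, 0 ≤ u t x) ∧
      (∀ t, 0 ≤ t → ∀ x, u t x = discounted p Q t (W s) x +
        duhamel p Q (fun s y => -(c * u s y ^ 2)) t x) ∧
      (∀ t ∈ Ico 0 gap, ∀ x, W (s + t) x = u t x) ∧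
      ∀ x, W (s + gap) x = u gap x +
        ∑ k ∈ Finset.range n, if τ k = s + gap then a k * φ x else 0 := by
  have := hp.isMarkovKernel
  obtain ⟨C, hC0, hC⟩ := hW.bound s
  have hCs : ∀ x, W s x ≤ C := fun x => (le_abs_self _).trans (hC s ⟨hs, le_rfl⟩ x)
  obtain ⟨u, hu, hu0, -, hueq⟩ := exists_absorbing_initial hp hQ hc (hW.meas_right s) (hW0 s) hCs
  have hWn : LocBdd (fun s y => -(c * W s y ^ 2)) := (hW.sq.const_mul c).neg
  have hWsn : LocBdd (fun t y => -(c * W (s + t) y ^ 2)) := ((hW.shift hs).sq.const_mul c).neg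
  have hun : LocBdd (fun s y => -(c * u s y ^ 2)) := (hu.sq.const_mul c).neg
  have hGm : ∀ k ∈ Finset.range n, Measurable (fun x => a k * delayed p Q (τ k) φ s x) :=
    fun k hk => ((locBdd_delayed hp Q (hτ k (Finset.mem_range.1 hk)) hφ hΦ).meas_right s).const_mul _
  have hGb : ∀ k ∈ Finset.range n, ∃ C, ∀ x, |a k * delayed p Q (τ k) φ s x| ≤ C := by
    intro k hk
    obtain ⟨C, -, hC⟩ := ((locBdd_delayed hp Q (hτ k (Finset.mem_range.1 hk)) hφ hΦ).const_mul
      (a k)).bound s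
    exact ⟨C, hC s ⟨hs, le_rfl⟩⟩
  have hGm' : Measurable (fun x => ∑ k ∈ Finset.range n, a k * delayed p Q (τ k) φ s x) :=
    Finset.measurable_sum _ hGm
  have hGb' : ∃ C, ∀ x, |∑ k ∈ Finset.range n, a k * delayed p Q (τ k) φ s x| ≤ C := by
    choose! B hB using hGb
    exact ⟨∑ k ∈ Finset.range n, B k, fun x => (Finset.abs_sum_le_sum_abs _ _).trans
      (Finset.sum_le_sum fun k hk => hB k hk x)⟩
  obtain ⟨CG, hCG⟩ := hGb'
  obtain ⟨CD, -, hCD⟩ := (locBdd_duhamel hp Q hWn).bound s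
  -- The equation restarted at time s. Both the atomic part and the Duhamel part at s are absorbed
  -- into the semigroup acting on W s; only atoms at the end point remain.
  have key : ∀ t ∈ Icc 0 gap, ∀ x, W (s + t) x = discounted p Q t (W s) x +
      duhamel p Q (fun t y => -(c * W (s + t) y ^ 2)) t x +
      ∑ k ∈ Finset.range n, if τ k = s + t ∧ t = gap then a k * φ x else 0 := by
    intro t ht x
    have h1 : discounted p Q t (W s) x =
        discounted p Q t (fun x => ∑ k ∈ Finset.range n, a k * delayed p Q (τ k) φ s x) x +
        discounted p Q t (duhamel p Q (fun s y => -(c * W s y ^ 2)) s) x := by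
      rw [← discounted_add hp Q t hGm' ((locBdd_duhamel hp Q hWn).meas_right s) hCG
        (hCD s ⟨hs, le_rfl⟩)]
      congr 1
      funext y
      exact heq s hs y
    rw [h1, discounted_sum hp Q t _ hGm hGb, heq (s + t) (add_nonneg hs ht.1) x,
      duhamel_restart hp Q hWn ht.1 hs]
    have h2 : ∑ k ∈ Finset.range n, a k * delayed p Q (τ k) φ (s + t) x =
        ∑ k ∈ Finset.range n, discounted p Q t (fun y => a k * delayed p Q (τ k) φ s y) x +
        ∑ k ∈ Finset.range n, if τ k = s + t ∧ t = gap then a k * φ x else 0 := by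
      rw [← Finset.sum_add_distrib]
      refine Finset.sum_congr rfl fun k hk => ?_
      rw [delayed_segment hp Q hgap (hno k (Finset.mem_range.1 hk)) ht hφ hΦ, mul_add,
        discounted_const_mul, mul_ite, mul_zero]
    rw [h2]
    ring
  have hsame : ∀ t ∈ Ico 0 gap, ∀ x, W (s + t) x = u t x := by
    intro t ht x
    have := zero_of_mild hp Q (D := fun t x => W (s + t) x - u t x)
      (w := fun t x => -(c * (W (s + t) x + u t x))) ((hW.shift hs).sub hu)
      (((hW.shift hs).add hu).const_mul c).neg (T := t) (fun r hr y => by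
        have h0 : ∑ k ∈ Finset.range n, (if τ k = s + r ∧ r = gap then a k * φ y else 0) = 0 :=
          Finset.sum_eq_zero fun k _ => if_neg fun h => by linarith [h.2, hr.2, ht.2]
        rw [key r ⟨hr.1, hr.2.trans ht.2.le⟩ y, hueq r hr.1 y, h0, add_zero,
          add_sub_add_left_eq_sub, ← duhamel_sub hp Q hWsn hun]
        congr 1
        funext s' y'
        ring) t ⟨ht.1, le_rfl⟩ x
    simpa [sub_eq_zero] using this
  refine ⟨u, hu, hu0, hueq, hsame, fun x => ?_⟩
  rw [key gap ⟨hgap.le, le_rfl⟩ x, hueq gap hgap.le x,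
    duhamel_congr p Q (f := fun t y => -(c * W (s + t) y ^ 2)) (g := fun s y => -(c * u s y ^ 2))
      (fun r hr y => by rw [hsame r ⟨hr.1.le, hr.2⟩ y])]
  simp only [and_true]

end Segment

/-! ### The Markov property and Laplace functionals at finitely many times -/

section Chain

variable {d : ℕ} {S : Type*} [MeasurableSpace S] {M : MarkovFamily d S} {V q H : ℝ}
  {Ω : Type*} [MeasurableSpace Ω] {Pr : Measure Ω} {N : ℝ → Ω → Measure (E d)}

/-- The past of the process up to time `s`. -/
abbrev past (N : ℝ → Ω → Measure (E d)) (s : ℝ) : MeasurableSpace Ω :=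
  ⨆ r ∈ Icc (0 : ℝ) s, MeasurableSpace.comap (N r) inferInstance

lemma IsSuperprocess.measurable_apply (hN : IsSuperprocess M V q H Pr N) (s : ℝ) :
    Measurable (N s) := hN.measurable.comp (measurable_const.prodMk measurable_id)

lemma IsSuperprocess.past_le (hN : IsSuperprocess M V q H Pr N) (s : ℝ) :
    past N s ≤ (inferInstance : MeasurableSpace Ω) :=
  iSup₂_le fun r _ => (hN.measurable_apply r).comap_le

lemma measurable_past {r s : ℝ} (hr : r ∈ Icc 0 s) {f : E d → ℝ≥0∞} (hf : Measurable f) :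
    Measurable[past N s] (fun ω => ∫⁻ x, f x ∂(N r ω)) := by
  have h1 : Measurable[MeasurableSpace.comap (N r) inferInstance]
      (fun ω => ∫⁻ x, f x ∂(N r ω)) :=
    (Measure.measurable_lintegral hf).comp (comap_measurable (N r))
  exact h1.mono (le_iSup₂_of_le r hr le_rfl) le_rfl

lemma IsSuperprocess.measurable_pair (hN : IsSuperprocess M V q H Pr N) {f : E d → ℝ≥0∞}
    (hf : Measurable f) : Measurable (fun q : ℝ × Ω => ∫⁻ x, f x ∂(N q.1 q.2)) :=
  (Measure.measurable_lintegral hf).comp hN.measurable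

/-- The Markov property with a function of the past. -/
lemma IsSuperprocess.step [IsProbabilityMeasure Pr] (hN : IsSuperprocess M V q H Pr N)
    {f : E d → ℝ} (hf : Measurable f)
    (hf0 : ∀ x, 0 ≤ f x) {C : ℝ} (hC : ∀ x, f x ≤ C) {u : ℝ → E d → ℝ} (hu : LocBdd u)
    (hueq : ∀ t, 0 ≤ t → ∀ x, u t x = discounted M.transition (Qrate V q) t f x +
      duhamel M.transition (Qrate V q) (fun s y => -(V * q * u s y ^ 2)) t x)
    {s t : ℝ} (hs : 0 ≤ s) (ht : 0 ≤ t) {G : Ω → ℝ≥0∞} (hG : Measurable[past N s] G) :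
    ∫⁻ ω, G ω * nexp (∫⁻ x, ofReal (f x) ∂(N (s + t) ω)) ∂Pr =
    ∫⁻ ω, G ω * nexp ((∫⁻ x, ofReal (u t x) ∂(N s ω)) +
      ofReal H * ∫⁻ r in Ioc 0 t, ∫⁻ x, ofReal (u r x)) ∂Pr := by
  have hmild : IsMildSolution M (Qrate V q) (-(V * q)) (fun t => M.TQ (Qrate V q) t f) u := by
    rw [isMildSolution_iff]
    refine ⟨hu, fun t ht x => ?_⟩
    rw [hueq t ht x, M.TQ_eq _ _ hf, ← duhamel_const_mul]
    congr 2
    funext s y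
    ring
  have hm := hN.past_le s
  set A : Ω → ℝ≥0∞ := fun ω => nexp (∫⁻ x, ofReal (f x) ∂(N (s + t) ω)) with hA
  set B : Ω → ℝ≥0∞ := fun ω => nexp ((∫⁻ x, ofReal (u t x) ∂(N s ω)) +
      ofReal H * ∫⁻ r in Ioc 0 t, ∫⁻ x, ofReal (u r x)) with hB
  have hAm : Measurable A := measurable_nexp.comp
    ((Measure.measurable_lintegral hf.ennreal_ofReal).comp (hN.measurable_apply _))
  have hBm : Measurable B := measurable_nexp.comp
    (((Measure.measurable_lintegral (hu.meas_right t).ennreal_ofReal).comp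
      (hN.measurable_apply _)).add_const _)
  have hev : ∀ F, MeasurableSet[past N s] F → ∫⁻ ω in F, A ω ∂Pr = ∫⁻ ω in F, B ω ∂Pr :=
    fun F hF => hN.markov f hf hf0 ⟨C, hC⟩ u hmild s t hs ht F hF
  -- The Markov property, known on events of the past, says that the two weighted measures agree on
  -- the past σ-algebra. They then integrate every past-measurable G alike.
  have htrim : (Pr.withDensity A).trim hm = (Pr.withDensity B).trim hm := by
    refine @Measure.ext _ (past N s) _ _ fun F hF => ?_
    rw [trim_measurableSet_eq hm hF, trim_measurableSet_eq hm hF, withDensity_apply _ (hm F hF),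
      withDensity_apply _ (hm F hF), hev F hF]
  have hGm : Measurable G := hG.mono hm le_rfl
  have h1 : ∀ D : Ω → ℝ≥0∞, Measurable D → ∫⁻ ω, G ω * D ω ∂Pr =
      ∫⁻ ω, G ω ∂((Pr.withDensity D).trim hm) := by
    intro D hD
    rw [lintegral_trim hm hG, lintegral_withDensity_eq_lintegral_mul _ hD hGm]
    simp only [Pi.mul_apply, mul_comm]
  rw [h1 A hAm, h1 B hBm, htrim]

/-- The joint Laplace functional at finitely many times. -/
lemma IsSuperprocess.chain [IsProbabilityMeasure Pr] (hN : IsSuperprocess M V q H Pr N)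
    (hQ : 0 < Qrate V q) (hc : 0 ≤ V * q) {n : ℕ}
    {a t : ℕ → ℝ} {T : ℝ} (ha : ∀ k, 0 ≤ a k) (ht0 : 0 < t 0) (ht : ∀ k < n, t k < t (k + 1))
    (htn : t n = T) {φ : E d → ℝ} (hφ : Measurable φ) (hφ0 : ∀ x, 0 ≤ φ x) {Φ : ℝ}
    (hΦ : ∀ x, φ x ≤ Φ) {W : ℝ → E d → ℝ} (hW : LocBdd W) (hW0 : ∀ t x, 0 ≤ W t x)
    (heq : ∀ r, 0 ≤ r → ∀ x, W r x =
      ∑ k ∈ Finset.range n, a k * delayed M.transition (Qrate V q) (T - t k) φ r x +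
      duhamel M.transition (Qrate V q) (fun s y => -(V * q * W s y ^ 2)) r x) :
    ∫⁻ ω, nexp (∑ k ∈ Finset.range n, ofReal (a k) *
      ∫⁻ x, ofReal (φ x) ∂(N (t k) ω)) ∂Pr =
    nexp (ofReal H * ∫⁻ r in Ioc 0 T, ∫⁻ x, ofReal (W r x)) := by
  have hp := M.isTransition
  have hΦa : ∀ x, |φ x| ≤ Φ := fun x => by rw [abs_of_nonneg (hφ0 x)]; exact hΦ x
  have hlt : ∀ i j, i < j → j ≤ n → t i < t j := by
    intro i j hij
    induction j, hij using Nat.le_induction with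
    | base => intro h; exact ht i h
    | succ j hj ih => intro h; exact (ih (by omega)).trans (ht j h)
  have hle : ∀ i j, i ≤ j → j ≤ n → t i ≤ t j := fun i j hij hj => by
    rcases hij.eq_or_lt with h | h
    · rw [h]
    · exact (hlt i j h hj).le
  have hτ0 : ∀ k < n, 0 ≤ T - t k := fun k hk => by
    have := hle k n hk.le le_rfl
    linarith
  have htpos : ∀ k ≤ n, 0 < t k := fun k hk => ht0.trans_le (hle 0 k (by omega) hk)
  have hsplit : ∀ s gap : ℝ, 0 ≤ s → 0 < gap → ∀ u : ℝ → E d → ℝ,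
      (∀ r ∈ Ico 0 gap, ∀ x, W (s + r) x = u r x) →
      (∫⁻ r in Ioc 0 (s + gap), ∫⁻ x, ofReal (W r x)) =
      (∫⁻ r in Ioc 0 s, ∫⁻ x, ofReal (W r x)) +
      ∫⁻ r in Ioc 0 gap, ∫⁻ x, ofReal (u r x) := by
    intro s gap hs hgap u hu
    rw [← Ioc_union_Ioc_eq_Ioc hs (by linarith : s ≤ s + gap), lintegral_union measurableSet_Ioc
      (Ioc_disjoint_Ioc_of_le le_rfl)]
    congr 1
    have h1 : (fun r => s + r) ⁻¹' (Ioc s (s + gap)) = Ioc 0 gap := by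
      ext r; simp
    have h2 := (measurePreserving_add_left (volume : Measure ℝ) s).setLIntegral_comp_preimage_emb
      (measurableEmbedding_addLeft s) (fun r => ∫⁻ x, ofReal (W r x)) (Ioc s (s + gap))
    -- W and u agree only before the jump at the end of the segment, and that end point is null.
    rw [← h2, h1, ← restrict_Ioo_eq_restrict_Ioc]
    refine setLIntegral_congr_fun measurableSet_Ioo fun r hr => ?_
    simp only [hu r ⟨hr.1.le, hr.2⟩]
  have hWb : ∀ s, 0 ≤ s → ∃ C, ∀ x, W s x ≤ C := fun s hs => by
    obtain ⟨C, -, hC⟩ := hW.bound s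
    exact ⟨C, fun x => (le_abs_self _).trans (hC s ⟨hs, le_rfl⟩ x)⟩
  -- Backward induction along the times: all masses from t j on, including the atom at t j itself,
  -- are encoded in W at the remaining time T - t j. At j = n nothing is left, since W 0 = 0. Each
  -- Markov step removes one atom and collects the immigration over one gap.
  have main : ∀ m, ∀ j, j + m = n → ∫⁻ ω, nexp (∑ k ∈ Finset.range n, ofReal (a k) *
      ∫⁻ x, ofReal (φ x) ∂(N (t k) ω)) ∂Pr =
      ∫⁻ ω, nexp ((∑ k ∈ Finset.range j, ofReal (a k) *
        ∫⁻ x, ofReal (φ x) ∂(N (t k) ω)) +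
        ∫⁻ x, ofReal (W (T - t j) x) ∂(N (t j) ω)) *
        nexp (ofReal H * ∫⁻ r in Ioc 0 (T - t j), ∫⁻ x, ofReal (W r x)) ∂Pr := by
    intro m
    induction m with
    | zero =>
      intro j hj
      obtain rfl : j = n := by omega
      rw [htn, sub_self]
      have h0 : ∀ x, W 0 x = 0 := by
        intro x
        rw [heq 0 le_rfl x, duhamel_of_nonpos _ _ _ le_rfl, add_zero]
        refine Finset.sum_eq_zero fun k hk => ?_
        have := hlt k j (Finset.mem_range.1 hk) le_rfl
        rw [delayed, if_neg (by linarith), mul_zero]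
      simp [h0, nexp_zero]
    | succ m ih =>
      intro j hj
      rw [ih (j + 1) (by omega)]
      have hjn : j < n := by omega
      have hgap : 0 < t (j + 1) - t j := sub_pos.2 (ht j hjn)
      have hs : 0 ≤ T - t (j + 1) := by
        have := hle (j + 1) n hjn le_rfl
        linarith
      have hsg : T - t (j + 1) + (t (j + 1) - t j) = T - t j := by ring
      obtain ⟨u, hu, hu0, hueq, hsame, hend⟩ := absorbing_segment hp hQ hc hτ0 hφ hΦa hW hW0 heq
        hs hgap (fun k hk => by
          rcases le_or_gt k j with h | h
          · right; have := hle k j h hjn.le; linarith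
          · left; have := hle (j + 1) k h hk.le; linarith)
      obtain ⟨C, hC⟩ := hWb _ hs
      have hsum : ∀ x, (∑ k ∈ Finset.range n, if T - t k = T - t (j + 1) + (t (j + 1) - t j) then
          a k * φ x else 0) = a j * φ x := by
        intro x
        rw [Finset.sum_eq_single j, if_pos (by ring)]
        · intro k hk hkj
          refine if_neg fun h => ?_
          rcases lt_or_gt_of_ne hkj with h1 | h1
          · have := hlt k j h1 hjn.le; linarith
          · have := hlt j k h1 (Finset.mem_range.1 hk).le; linarith
        · intro h; exact absurd (Finset.mem_range.2 hjn) h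
      have hGm : Measurable[past N (t j)] (fun ω => nexp (∑ k ∈ Finset.range (j + 1),
          ofReal (a k) * ∫⁻ x, ofReal (φ x) ∂(N (t k) ω))) := by
        refine measurable_nexp.comp (Finset.measurable_sum _ fun k hk => ?_)
        have hk' : k ≤ j := Nat.lt_succ_iff.1 (Finset.mem_range.1 hk)
        exact (measurable_past ⟨(htpos k (hk'.trans hjn.le)).le, hle k j hk' hjn.le⟩
          hφ.ennreal_ofReal).const_mul _
      have hstep := hN.step (hW.meas_right _) (hW0 _) hC hu hueq (htpos j hjn.le).le hgap.le hGm
      rw [show t j + (t (j + 1) - t j) = t (j + 1) by ring] at hstep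
      simp only [nexp_add]
      have hm1 : Measurable fun ω => nexp (∑ k ∈ Finset.range (j + 1), ofReal (a k) *
          ∫⁻ x, ofReal (φ x) ∂(N (t k) ω)) * nexp (∫⁻ x, ofReal
            (W (T - t (j + 1)) x) ∂(N (t (j + 1)) ω)) :=
        (hGm.mono (hN.past_le _) le_rfl).mul (measurable_nexp.comp
          ((Measure.measurable_lintegral (hW.meas_right _).ennreal_ofReal).comp
            (hN.measurable_apply _)))
      rw [lintegral_mul_const _ hm1, hstep, ← lintegral_mul_const]
      · refine lintegral_congr fun ω => ?_
        rw [← nexp_add, ← nexp_add, ← nexp_add, ← nexp_add]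
        congr 1
        rw [← hsg, hsplit _ _ hs hgap u hsame, mul_add, Finset.sum_range_succ]
        have h1 : ∫⁻ x, ofReal (W (T - t (j + 1) + (t (j + 1) - t j)) x) ∂(N (t j) ω) =
            (∫⁻ x, ofReal (u (t (j + 1) - t j) x) ∂(N (t j) ω)) +
            ofReal (a j) * ∫⁻ x, ofReal (φ x) ∂(N (t j) ω) := by
          rw [← lintegral_const_mul _ hφ.ennreal_ofReal,
            ← lintegral_add_left (hu.meas_right _).ennreal_ofReal]
          refine lintegral_congr fun x => ?_
          rw [hend x, hsum x, ENNReal.ofReal_add (hu0 _ _) (mul_nonneg (ha j) (hφ0 x)),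
            ENNReal.ofReal_mul (ha j)]
        rw [h1]
        ring
      · exact (hGm.mono (hN.past_le _) le_rfl).mul (measurable_nexp.comp
          (((Measure.measurable_lintegral (hu.meas_right _).ennreal_ofReal).comp
            (hN.measurable_apply _)).add_const _))
  rw [main n 0 (by omega)]
  have hs : 0 ≤ T - t 0 := by
    have := hle 0 n (by omega) le_rfl
    linarith
  obtain ⟨u, hu, hu0, hueq, hsame, -⟩ := absorbing_segment hp hQ hc hτ0 hφ hΦa hW hW0 heq hs ht0
    (fun k hk => by left; have := hle 0 k (by omega) hk.le; linarith)
  obtain ⟨C, hC⟩ := hWb _ hs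
  have hstep := hN.step (hW.meas_right _) (hW0 _) hC hu hueq le_rfl ht0.le
    (G := fun _ => 1) (@measurable_const _ _ _ (past N 0) _)
  simp only [one_mul, zero_add] at hstep
  simp only [Finset.range_zero, Finset.sum_empty, zero_add]
  rw [lintegral_mul_const]
  · rw [hstep]
    have h1 : ∫⁻ ω, nexp ((∫⁻ x, ofReal (u (t 0) x) ∂(N 0 ω)) + ofReal H *
        ∫⁻ r in Ioc 0 (t 0), ∫⁻ x, ofReal (u r x)) ∂Pr =
        ∫⁻ _, nexp (ofReal H * ∫⁻ r in Ioc 0 (t 0), ∫⁻ x, ofReal (u r x)) ∂Pr := by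
      refine lintegral_congr_ae (hN.init.mono fun ω hω => ?_)
      simp only [hω, lintegral_zero_measure, zero_add]
    rw [h1, lintegral_const, measure_univ, mul_one, ← nexp_add, ← mul_add]
    have := hsplit _ _ hs ht0 u hsame
    rw [sub_add_cancel] at this
    rw [this, add_comm]
  · exact measurable_nexp.comp ((Measure.measurable_lintegral
      (hW.meas_right _).ennreal_ofReal).comp (hN.measurable_apply _))

end Chain

/-! ### Riemann sums with a random shift -/

/-- The uniform distribution on `(0, h)`. -/
def unif (h : ℝ) : Measure ℝ := (ofReal h)⁻¹ • volume.restrict (Ioo 0 h)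

lemma isProbabilityMeasure_unif {h : ℝ} (hh : 0 < h) : IsProbabilityMeasure (unif h) := by
  constructor
  rw [unif, Measure.smul_apply, Measure.restrict_apply_univ, Real.volume_Ioo, sub_zero, smul_eq_mul,
    ENNReal.inv_mul_cancel (by simpa using hh) ENNReal.ofReal_ne_top]

lemma ae_unif {h : ℝ} : ∀ᵐ z ∂(unif h), z ∈ Ioo 0 h :=
  Measure.ae_smul_measure (ae_restrict_mem measurableSet_Ioo) _

lemma integral_unif {h : ℝ} (hh : 0 < h) (f : ℝ → ℝ) :
    ∫ z, f z ∂(unif h) = h⁻¹ * ∫ z in (0 : ℝ)..h, f z := by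
  rw [unif, integral_smul_measure, intervalIntegral.integral_of_le hh.le,
    integral_Ioc_eq_integral_Ioo, ENNReal.toReal_inv, ENNReal.toReal_ofReal hh.le, smul_eq_mul]

lemma lintegral_unif_sum {h : ℝ} (hh : 0 < h) {f : ℝ → ℝ≥0∞} (hf : Measurable f) (n : ℕ) :
    ∫⁻ z, ∑ k ∈ Finset.range n, ofReal h * f (k * h + z) ∂(unif h) =
      ∫⁻ s in Ioc 0 (n * h), f s := by
  have h0 : ofReal h ≠ 0 := by simpa using hh
  have hfk : ∀ k : ℕ, Measurable fun z => f (k * h + z) := fun k => hf.comp (by fun_prop)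
  rw [lintegral_finsetSum _ fun k _ => (hfk k).const_mul _]
  induction n with
  | zero => simp
  | succ n ih =>
    rw [Finset.sum_range_succ, ih]
    have h1 : (fun r => n * h + r) ⁻¹' (Ioc (n * h) (n * h + h)) = Ioc 0 h := by
      ext r; simp
    have h2 := (measurePreserving_add_left (volume : Measure ℝ)
      (n * h)).setLIntegral_comp_preimage_emb
      (measurableEmbedding_addLeft (n * h)) f (Ioc (n * h) (n * h + h))
    rw [unif, lintegral_smul_measure, lintegral_const_mul _ (hfk n),
      restrict_Ioo_eq_restrict_Ioc, ← h1, h2, smul_eq_mul, ← mul_assoc,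
      ENNReal.inv_mul_cancel h0 ENNReal.ofReal_ne_top, one_mul]
    have h3 : ((n + 1 : ℕ) : ℝ) * h = n * h + h := by push_cast; ring
    have h4 : Ioc 0 ((n : ℝ) * h + h) = Ioc 0 (n * h) ∪ Ioc (n * h) (n * h + h) :=
      (Ioc_union_Ioc_eq_Ioc (by positivity) (by linarith)).symm
    rw [h3, h4, lintegral_union measurableSet_Ioc (Ioc_disjoint_Ioc_of_le le_rfl)]

lemma intervalIntegrable_of_bound {f : ℝ → ℝ} (hf : Measurable f) {m : ℝ} (hm : ∀ s, |f s| ≤ m)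
    (a b : ℝ) : IntervalIntegrable f volume a b :=
  (intervalIntegrable_const (c := m)).mono_fun hf.aestronglyMeasurable
    (ae_of_all _ fun s => (hm s).trans (le_abs_self m))

lemma sum_integral_grid {h : ℝ} {f : ℝ → ℝ} (hf : ∀ a b, IntervalIntegrable f volume a b) (n : ℕ) :
    ∑ k ∈ Finset.range n, ∫ z in (0 : ℝ)..h, f (k * h + z) = ∫ s in (0 : ℝ)..(n * h), f s := by
  have h1 := intervalIntegral.sum_integral_adjacent_intervals (μ := volume) (f := f)
    (a := fun k : ℕ => k * h) (n := n) fun k _ => hf _ _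
  simp only [Nat.cast_zero, zero_mul] at h1
  rw [← h1]
  refine Finset.sum_congr rfl fun k _ => ?_
  rw [intervalIntegral.integral_comp_add_left, add_zero]
  congr 1
  push_cast
  ring

lemma integral_unif_sum {h : ℝ} (hh : 0 < h) {f : ℝ → ℝ}
    (hf : ∀ a b, IntervalIntegrable f volume a b) (n : ℕ) :
    ∫ z, ∑ k ∈ Finset.range n, h * f (k * h + z) ∂(unif h) = ∫ s in (0 : ℝ)..(n * h), f s := by
  have hi : ∀ k : ℕ, IntervalIntegrable (fun z => f (k * h + z)) volume 0 h := fun k => by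
    simpa using (hf (k * h) (k * h + h)).comp_add_left (k * h)
  rw [integral_unif hh, intervalIntegral.integral_finsetSum fun k _ => (hi k).const_mul h]
  simp only [intervalIntegral.integral_const_mul]
  rw [← Finset.mul_sum, sum_integral_grid hf, ← mul_assoc, inv_mul_cancel₀ hh.ne', one_mul]

/-- Randomly shifted Riemann sums converge in mean. -/
lemma tendsto_riemann {f : ℝ → ℝ} (hf : Measurable f) {m : ℝ} (hm : ∀ s, |f s| ≤ m) {T : ℝ}
    (hT : 0 < T) :
    Tendsto (fun n : ℕ => ∫ z, |∑ k ∈ Finset.range (n + 1), T / (n + 1) * f (k * (T / (n + 1)) + z) -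
      ∫ s in (0 : ℝ)..T, f s| ∂(unif (T / (n + 1)))) atTop (𝓝 0) := by
  have hfi := intervalIntegrable_of_bound hf hm
  rw [Metric.tendsto_atTop]
  intro ε₀ hε₀
  -- The total error below is ε + (Tε + ε), which is less than 2(T + 3) ε = ε₀.
  set ε := ε₀ / (2 * (T + 3)) with hε
  have hε0 : 0 < ε := by positivity
  have hfI : Integrable (indicator (Ioc 0 T) f) := by
    rw [integrable_indicator_iff measurableSet_Ioc]
    exact (intervalIntegrable_iff_integrableOn_Ioc_of_le hT.le).1 (hfi 0 T)
  -- A continuous compactly supported g close to f in L¹. Averaging the shifted sums of |f - g|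
  -- gives exactly ∫ |f - g|, and for g the sums converge uniformly in the shift.
  obtain ⟨g, hgs, hg1, hgc, hgi⟩ := hfI.exists_hasCompactSupport_integral_sub_le hε0
  have hgI : ∀ a b, IntervalIntegrable g volume a b := fun a b => hgc.intervalIntegrable a b
  have hguc := hgs.uniformContinuous_of_continuous hgc
  rw [Metric.uniformContinuous_iff] at hguc
  obtain ⟨η, hη, hgη⟩ := hguc ε hε0
  obtain ⟨n₀, hn₀⟩ := exists_nat_gt (T / η)
  refine ⟨n₀, fun n hn => ?_⟩
  set h := T / ((n : ℝ) + 1) with hh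
  have hn1 : (0 : ℝ) < (n : ℝ) + 1 := by positivity
  have hh0 : 0 < h := by positivity
  have hNh : ((n + 1 : ℕ) : ℝ) * h = T := by rw [hh]; push_cast; field_simp
  have hhη : h < η := by
    rw [hh, div_lt_iff₀ hn1]
    rw [div_lt_iff₀ hη] at hn₀
    have : (n₀ : ℝ) ≤ n := by exact_mod_cast hn
    nlinarith
  have := isProbabilityMeasure_unif hh0
  have hfg : ∀ a b, IntervalIntegrable (fun s => |f s - g s|) volume a b :=
    fun a b => ((hfi a b).sub (hgI a b)).abs
  have hd : ∫ s in (0 : ℝ)..T, |f s - g s| ≤ ε := by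
    refine le_trans ?_ hg1
    rw [intervalIntegral.integral_of_le hT.le, ← integral_indicator measurableSet_Ioc]
    refine integral_mono_of_nonneg (ae_of_all _ fun s => indicator_nonneg (fun _ _ => abs_nonneg _) s)
      (hfI.sub hgi).norm (ae_of_all _ fun s => ?_)
    by_cases hs : s ∈ Ioc 0 T
    · simp only [indicator_of_mem hs, Real.norm_eq_abs, le_refl]
    · simp only [indicator_of_notMem hs]; exact norm_nonneg _
  have hgR : ∀ z ∈ Ioo 0 h, |∑ k ∈ Finset.range (n + 1), h * g (k * h + z) -
      ∫ s in (0 : ℝ)..T, g s| ≤ T * ε := by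
    intro z hz
    rw [← hNh, ← sum_integral_grid hgI, ← Finset.sum_sub_distrib]
    refine (Finset.abs_sum_le_sum_abs _ _).trans ?_
    have : ∀ k ∈ Finset.range (n + 1), |h * g (k * h + z) - ∫ z in (0 : ℝ)..h, g (k * h + z)| ≤
        h * ε := by
      intro k _
      have hgk : IntervalIntegrable (fun z => g (k * h + z)) volume 0 h :=
        (hgc.comp (by fun_prop)).intervalIntegrable _ _
      have h1 : h * g (k * h + z) - ∫ z in (0 : ℝ)..h, g (k * h + z) =
          ∫ y in (0 : ℝ)..h, (g (k * h + z) - g (k * h + y)) := by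
        rw [intervalIntegral.integral_sub intervalIntegrable_const hgk]
        simp
      rw [h1]
      have h2 := intervalIntegral.norm_integral_le_of_norm_le_const (a := 0) (b := h) (C := ε)
        (f := fun y => g (k * h + z) - g (k * h + y)) fun y hy => by
          rw [uIoc_of_le hh0.le] at hy
          have := hgη (a := k * h + z) (b := k * h + y) (by
            rw [Real.dist_eq, add_sub_add_left_eq_sub, abs_lt]
            constructor <;> linarith [hz.1, hz.2, hy.1, hy.2])
          exact this.le
      rw [sub_zero, abs_of_pos hh0, mul_comm ε] at h2
      exact h2
    refine (Finset.sum_le_sum this).trans ?_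
    rw [Finset.sum_const, Finset.card_range, nsmul_eq_mul, ← mul_assoc]
  have hbound : ∀ z ∈ Ioo 0 h, |∑ k ∈ Finset.range (n + 1), h * f (k * h + z) -
      ∫ s in (0 : ℝ)..T, f s| ≤ ∑ k ∈ Finset.range (n + 1), h * |f (k * h + z) - g (k * h + z)| +
        (T * ε + ε) := by
    intro z hz
    have h1 : ∑ k ∈ Finset.range (n + 1), h * f (k * h + z) - ∫ s in (0 : ℝ)..T, f s =
        (∑ k ∈ Finset.range (n + 1), h * (f (k * h + z) - g (k * h + z))) +
        ((∑ k ∈ Finset.range (n + 1), h * g (k * h + z) - ∫ s in (0 : ℝ)..T, g s) -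
        ∫ s in (0 : ℝ)..T, (f s - g s)) := by
      rw [intervalIntegral.integral_sub (hfi 0 T) (hgI 0 T)]
      simp only [mul_sub, Finset.sum_sub_distrib]
      ring
    rw [h1]
    refine (abs_add_le _ _).trans (add_le_add ((Finset.abs_sum_le_sum_abs _ _).trans
      (le_of_eq (Finset.sum_congr rfl fun k _ => by rw [abs_mul, abs_of_pos hh0]))) ?_)
    refine (abs_sub _ _).trans (add_le_add (hgR z hz) ?_)
    exact (intervalIntegral.abs_integral_le_integral_abs hT.le).trans hd
  have hk : ∀ k : ℕ, IntervalIntegrable (fun z => |f (k * h + z) - g (k * h + z)|) volume 0 h :=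
    fun k => by simpa using (hfg (k * h) (k * h + h)).comp_add_left (k * h)
  have hsumI : Integrable (fun z => ∑ k ∈ Finset.range (n + 1), h * |f (k * h + z) - g (k * h + z)|)
      (unif h) := by
    refine Integrable.smul_measure ?_ (by simpa using hh0)
    have : IntervalIntegrable (fun z => ∑ k ∈ Finset.range (n + 1),
        h * |f (k * h + z) - g (k * h + z)|) volume 0 h := by
      have := IntervalIntegrable.sum (Finset.range (n + 1))
        (f := fun (k : ℕ) z => h * |f (k * h + z) - g (k * h + z)|) fun k _ => (hk k).const_mul h
      simpa only [Finset.sum_fn] using this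
    exact ((intervalIntegrable_iff_integrableOn_Ioc_of_le hh0.le).1 this).mono_set Ioo_subset_Ioc_self
  have hfin : ∫ z, |∑ k ∈ Finset.range (n + 1), h * f (k * h + z) -
      ∫ s in (0 : ℝ)..T, f s| ∂(unif h) ≤ ε + (T * ε + ε) := by
    calc _ ≤ ∫ z, (∑ k ∈ Finset.range (n + 1), h * |f (k * h + z) - g (k * h + z)| +
          (T * ε + ε)) ∂(unif h) :=
          integral_mono_of_nonneg (ae_of_all _ fun _ => abs_nonneg _)
            (hsumI.add (integrable_const _)) (ae_unif.mono hbound)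
      _ = (∫ s in (0 : ℝ)..T, |f s - g s|) + (T * ε + ε) := by
          rw [integral_add hsumI (integrable_const _), integral_unif_sum hh0 hfg, hNh]
          simp
      _ ≤ _ := by linarith
  rw [Real.dist_eq, sub_zero, abs_of_nonneg (integral_nonneg fun _ => abs_nonneg _)]
  refine hfin.trans_lt ?_
  have : ε + (T * ε + ε) < (2 * (T + 3)) * ε := by nlinarith
  rw [hε] at this ⊢
  rwa [mul_div_cancel₀ _ (by positivity)] at this

/-! ### Averaging absorbing equations -/

section Average

variable {X : Type*} [MeasurableSpace X] {p : Kernel (ℝ × X) X}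

lemma duhamel_average (hp : IsTransition p) (l : ℝ) {ν : Measure ℝ} [IsProbabilityMeasure ν]
    {W : ℝ → X × ℝ → ℝ} (hW : LocBdd W) (t : ℝ) (x : X) :
    duhamel p l (fun s y => ∫ z, W s (y, z) ∂ν) t x =
      ∫ z, duhamel p l (fun s y => W s (y, z)) t x ∂ν := by
  have := hp.isMarkovKernel
  obtain ⟨C, hC0, hC⟩ := hW.bound t
  have h1 : ∀ s ∈ Ioc 0 t, discounted p l (t - s) (fun y => ∫ z, W s (y, z) ∂ν) x =
      ∫ z, discounted p l (t - s) (fun y => W s (y, z)) x ∂ν := by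
    intro s hs
    simp only [discounted]
    rw [integral_const_mul, integral_integral_swap]
    exact integrable_of_bound ((hW.meas_right s)) fun q => hC s ⟨hs.1.le, hs.2⟩ q
  have h2 : duhamel p l (fun s y => ∫ z, W s (y, z) ∂ν) t x =
      ∫ s in Ioc 0 t, ∫ z, discounted p l (t - s) (fun y => W s (y, z)) x ∂ν :=
    setIntegral_congr_fun measurableSet_Ioc h1
  have hm : Measurable fun q : (ℝ × X) × ℝ × ℝ =>
      discounted (frozen p) l (q.1.1 - q.2.1) (W q.2.1) (q.1.2, q.2.2) :=
    (measurable_discounted_duhamel (isTransition_frozen hp) l hW.meas).comp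
      (g := fun q : ((ℝ × (X × ℝ)) × ℝ) => discounted (frozen p) l (q.1.1 - q.2) (W q.2) q.1.2)
      (f := fun q : (ℝ × X) × ℝ × ℝ => ((q.1.1, (q.1.2, q.2.2)), q.2.1)) (by fun_prop)
  rw [h2, integral_integral_swap]
  · rfl
  · have hae : ∀ᵐ q ∂((volume.restrict (Ioc 0 t)).prod ν), q.1 ∈ Ioc 0 t :=
      Measure.quasiMeasurePreserving_fst.ae (ae_restrict_mem measurableSet_Ioc)
    have hm2 : Measurable (Function.uncurry fun s z =>
        discounted p l (t - s) (fun y => W s (y, z)) x) := by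
      have h4 : (Function.uncurry fun s z => discounted p l (t - s) (fun y => W s (y, z)) x) =
          fun q : ℝ × ℝ => discounted (frozen p) l (t - q.1) (W q.1) (x, q.2) := by
        funext q
        exact (discounted_frozen hp l _ (hW.meas_right q.1) x q.2).symm
      rw [h4]
      exact hm.comp (f := fun q : ℝ × ℝ => ((t, x), q)) (by fun_prop)
    refine Integrable.of_bound hm2.aestronglyMeasurable (exp (|l| * t) * C)
      (hae.mono fun q hq => ?_)
    refine (discounted_bound hp (fun y => hC q.1 ⟨hq.1.le, hq.2⟩ (y, q.2)) x).trans ?_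
    refine mul_le_mul_of_nonneg_right (Real.exp_le_exp.2 ?_) hC0.le
    have h5 := neg_abs_le l
    have h6 : 0 ≤ t - q.1 := sub_nonneg.2 hq.2
    have h7 : 0 ≤ |l| := abs_nonneg l
    nlinarith [hq.1]

lemma locBdd_average {ν : Measure ℝ} [IsProbabilityMeasure ν] {W : ℝ → X × ℝ → ℝ} (hW : LocBdd W) :
    LocBdd (fun t x => ∫ z, W t (x, z) ∂ν) where
  meas := by
    have h1 : Measurable fun q : (ℝ × X) × ℝ => W q.1.1 (q.1.2, q.2) :=
      hW.meas.comp (f := fun q : (ℝ × X) × ℝ => (q.1.1, (q.1.2, q.2))) (by fun_prop)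
    exact (h1.stronglyMeasurable.integral_prod_right' (ν := ν)).measurable
  bdd := fun t => by
    obtain ⟨C, -, hC⟩ := hW.bound t
    refine ⟨C, fun s hs x => ?_⟩
    refine (norm_integral_le_of_norm_le_const (μ := ν) (f := fun z => W s (x, z)) (C := C)
      (ae_of_all _ fun z => hC s hs (x, z))).trans_eq (by simp)

lemma LocBdd.lift {w : ℝ → X → ℝ} (hw : LocBdd w) : LocBdd (fun t (q : X × ℝ) => w t q.1) where
  meas := hw.meas.comp (f := fun q : ℝ × (X × ℝ) => (q.1, q.2.1)) (by fun_prop)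
  bdd := fun t => by
    obtain ⟨C, -, hC⟩ := hw.bound t
    exact ⟨C, fun s hs x => hC s hs x.1⟩

lemma LocBdd.section_left {W : ℝ → X × ℝ → ℝ} (hW : LocBdd W) (z : ℝ) :
    LocBdd (fun t x => W t (x, z)) where
  meas := hW.meas.comp (f := fun q : ℝ × X => (q.1, (q.2, z))) (by fun_prop)
  bdd := fun t => by
    obtain ⟨C, -, hC⟩ := hW.bound t
    exact ⟨C, fun s hs x => hC s hs (x, z)⟩

lemma LocBdd.integrable_section {W : ℝ → X × ℝ → ℝ} (hW : LocBdd W) {ν : Measure ℝ}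
    [IsProbabilityMeasure ν] {t : ℝ} (ht : 0 ≤ t) (x : X) : Integrable (fun z => W t (x, z)) ν := by
  obtain ⟨C, -, hC⟩ := hW.bound t
  exact integrable_of_bound ((hW.meas_right t).comp (by fun_prop)) fun z => hC t ⟨ht, le_rfl⟩ (x, z)

/-- The average of solutions of absorbing equations is a subsolution. -/
lemma average_le (hp : IsTransition p) {Q c : ℝ} (hc : 0 ≤ c) {ν : Measure ℝ}
    [IsProbabilityMeasure ν] {W G : ℝ → X × ℝ → ℝ} (hW : LocBdd W) (hG : LocBdd G)
    (hWeq : ∀ t, 0 ≤ t → ∀ x z, W t (x, z) = G t (x, z) +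
      duhamel p Q (fun s y => -(c * W s (y, z) ^ 2)) t x)
    {w g : ℝ → X → ℝ} (hw : LocBdd w) {T : ℝ}
    (hweq : ∀ t ∈ Icc 0 T, ∀ x, w t x = g t x + duhamel p Q (fun s y => -(c * w s y ^ 2)) t x)
    (hg : ∀ t ∈ Icc 0 T, ∀ x, ∫ z, G t (x, z) ∂ν = g t x) :
    ∀ t ∈ Icc 0 T, ∀ x, ∫ z, W t (x, z) ∂ν ≤ w t x := by
  have hW2 : LocBdd (fun s q => -(c * W s q ^ 2)) := (hW.sq.const_mul c).neg
  have hA := locBdd_average (ν := ν) hW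
  have hA2 := locBdd_average (ν := ν) hW.sq
  have hAn := locBdd_average (ν := ν) hW2
  have hvar : ∀ t, 0 ≤ t → ∀ x, (∫ z, W t (x, z) ∂ν) ^ 2 ≤ ∫ z, W t (x, z) ^ 2 ∂ν := by
    intro t ht x
    set a := ∫ z, W t (x, z) ∂ν with ha
    have h1 : 0 ≤ ∫ z, (W t (x, z) - a) ^ 2 ∂ν := integral_nonneg fun _ => sq_nonneg _
    have h2 : ∫ z, (W t (x, z) - a) ^ 2 ∂ν = ∫ z, W t (x, z) ^ 2 ∂ν - 2 * a * a + a ^ 2 := by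
      have h3 : (fun z => (W t (x, z) - a) ^ 2) =
          fun z => W t (x, z) ^ 2 - 2 * a * W t (x, z) + a ^ 2 := by funext z; ring
      have hi1 : Integrable (fun z => W t (x, z) ^ 2) ν := hW.sq.integrable_section ht x
      have hi2 : Integrable (fun z => 2 * a * W t (x, z)) ν :=
        (hW.integrable_section ht x).const_mul _
      have hi3 : Integrable (fun z => W t (x, z) ^ 2 - 2 * a * W t (x, z)) ν := hi1.sub hi2
      rw [h3, integral_add hi3 (integrable_const _), integral_sub hi1 hi2,
        integral_const_mul]
      simp [ha]
    nlinarith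
  have hmul : LocBdd (fun s (q : X × ℝ) => W s q ^ 2) := hW.sq
  intro t ht x
  -- The difference of w and the average solves a linear equation whose source is c times the
  -- variance over the shift, hence nonnegative.
  have key := nonneg_of_mild_zero hp Q (D := fun t x => w t x - ∫ z, W t (x, z) ∂ν)
    (w := fun t x => -(c * (w t x + ∫ z, W t (x, z) ∂ν)))
    (k := fun t x => c * |∫ z, W t (x, z) ^ 2 ∂ν - (∫ z, W t (x, z) ∂ν) ^ 2|) (T := T)
    (hw.sub hA) ((hw.add hA).const_mul c).neg ((hA2.sub hA.sq).abs.const_mul c)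
    (fun s _ y => mul_nonneg hc (abs_nonneg _)) (fun s hs y => by
      have hi := hG.integrable_section (ν := ν) hs.1 y
      have hi2 : Integrable (fun z => duhamel p Q (fun s y => -(c * W s (y, z) ^ 2)) s y) ν := by
        have h5 := (hW.integrable_section (ν := ν) hs.1 y).sub hi
        refine h5.congr (ae_of_all _ fun z => ?_)
        simp [hWeq s hs.1 y z]
      have h4 : ∫ z, W s (y, z) ∂ν = g s y +
          duhamel p Q (fun s y => ∫ z, -(c * W s (y, z) ^ 2) ∂ν) s y := by
        rw [duhamel_average hp Q hW2, ← hg s hs y, ← integral_add hi hi2]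
        exact integral_congr_ae (ae_of_all _ fun z => hWeq s hs.1 y z)
      rw [hweq s hs y, h4, add_sub_add_left_eq_sub, ← duhamel_sub hp Q (hw.sq.const_mul c).neg hAn]
      refine duhamel_congr p Q (fun r hr y' => ?_) y
      rw [abs_of_nonneg (sub_nonneg.2 (hvar r hr.1.le y')), integral_neg, integral_const_mul]
      ring) t ht x
  linarith

/-- The mean distance of solutions of absorbing equations is controlled by the mean distance of
their sources. -/
lemma average_dist_le (hp : IsTransition p) {Q c m : ℝ} (hc : 0 ≤ c) (hm : 0 ≤ m) {ν : Measure ℝ}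
    [IsProbabilityMeasure ν] {W G : ℝ → X × ℝ → ℝ} (hW : LocBdd W) (hG : LocBdd G)
    (hWeq : ∀ t, 0 ≤ t → ∀ x z, W t (x, z) = G t (x, z) +
      duhamel p Q (fun s y => -(c * W s (y, z) ^ 2)) t x)
    {w g : ℝ → X → ℝ} (hw : LocBdd w) (hg : LocBdd g) {T : ℝ}
    (hweq : ∀ t ∈ Icc 0 T, ∀ x, w t x = g t x + duhamel p Q (fun s y => -(c * w s y ^ 2)) t x)
    (hWm : ∀ t ∈ Icc 0 T, ∀ q, |W t q| ≤ m) (hwm : ∀ t ∈ Icc 0 T, ∀ x, |w t x| ≤ m) :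
    ∀ t ∈ Icc 0 T, ∀ x, ∫ z, |W t (x, z) - w t x| ∂ν ≤ ∫ z, |G t (x, z) - g t x| ∂ν +
      2 * c * m * duhamel p (Q - 2 * c * m) (fun s y => ∫ z, |G s (y, z) - g s y| ∂ν) t x := by
  set C := 2 * c * m with hC
  have hC0 : 0 ≤ C := by positivity
  have hdL : LocBdd (fun t (q : X × ℝ) => |W t q - w t q.1|) := (hW.sub hw.lift).abs
  have heL : LocBdd (fun t (q : X × ℝ) => |G t q - g t q.1|) := (hG.sub hg.lift).abs
  set e : ℝ → X → ℝ := fun s y => ∫ z, |G s (y, z) - g s y| ∂ν with he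
  have heB : LocBdd e := locBdd_average heL
  set δ : ℝ → X → ℝ := fun s y => ∫ z, |W s (y, z) - w s y| ∂ν with hδ
  have hδB : LocBdd δ := locBdd_average hdL
  have h1 : ∀ t ∈ Icc 0 T, ∀ x, δ t x ≤ e t x + C * duhamel p Q δ t x := by
    intro t ht x
    have h2 : ∀ z, |W t (x, z) - w t x| ≤ |G t (x, z) - g t x| +
        duhamel p Q (fun s y => C * |W s (y, z) - w s y|) t x := by
      intro z
      have hWz := hW.section_left z
      rw [hWeq t ht.1 x z, hweq t ht x]
      have h3 : G t (x, z) + duhamel p Q (fun s y => -(c * W s (y, z) ^ 2)) t x -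
          (g t x + duhamel p Q (fun s y => -(c * w s y ^ 2)) t x) = (G t (x, z) - g t x) +
          duhamel p Q (fun s y => -(c * W s (y, z) ^ 2) - -(c * w s y ^ 2)) t x := by
        rw [duhamel_sub hp Q (hWz.sq.const_mul c).neg (hw.sq.const_mul c).neg]
        ring
      rw [h3]
      refine (abs_add_le _ _).trans (add_le_add le_rfl ?_)
      refine duhamel_abs_le_duhamel hp Q ((hWz.sq.const_mul c).neg.sub (hw.sq.const_mul c).neg)
        ((hWz.sub hw).abs.const_mul C) (fun s hs y => ?_) x
      have hs' : s ∈ Icc 0 T := ⟨hs.1.le, hs.2.trans ht.2⟩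
      have h4 : -(c * W s (y, z) ^ 2) - -(c * w s y ^ 2) =
          -(c * (W s (y, z) + w s y)) * (W s (y, z) - w s y) := by ring
      rw [h4, abs_mul, abs_neg, abs_mul, abs_of_nonneg hc]
      refine mul_le_mul_of_nonneg_right ?_ (abs_nonneg _)
      have := (abs_add_le (W s (y, z)) (w s y)).trans (add_le_add (hWm s hs' _) (hwm s hs' y))
      nlinarith
    have hi1 : Integrable (fun z => |G t (x, z) - g t x|) ν := heL.integrable_section ht.1 x
    have hDL : LocBdd (duhamel (frozen p) Q (fun t q => C * |W t q - w t q.1|)) :=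
      locBdd_duhamel (isTransition_frozen hp) Q (hdL.const_mul C)
    have hi2 : Integrable (fun z => duhamel p Q (fun s y => C * |W s (y, z) - w s y|) t x) ν := by
      refine (hDL.integrable_section ht.1 x).congr (ae_of_all _ fun z => ?_)
      exact duhamel_frozen hp Q (hdL.const_mul C).meas t x z
    calc δ t x ≤ ∫ z, (|G t (x, z) - g t x| +
          duhamel p Q (fun s y => C * |W s (y, z) - w s y|) t x) ∂ν :=
          integral_mono (hdL.integrable_section ht.1 x) (hi1.add hi2) h2
      _ = _ := by
        rw [integral_add hi1 hi2, ← duhamel_average hp Q (hdL.const_mul C), ← duhamel_const_mul]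
        simp only [integral_const_mul]
        rfl
  -- A Gronwall bound. By the resolvent identity y solves y = e + C·A(y) exactly, with A the Duhamel
  -- operator, while δ satisfies the corresponding inequality; positivity of y - δ follows.
  set y : ℝ → X → ℝ := fun t x => e t x + C * duhamel p (Q - C) e t x with hy
  have hdeB := locBdd_duhamel hp (Q - C) heB
  have hyB : LocBdd y := heB.add (hdeB.const_mul C)
  have hyeq : ∀ t x, y t x = e t x + C * duhamel p Q y t x := by
    intro t x
    have h5 := duhamel_resolvent hp (Q - C) C heB t x
    rw [sub_add_cancel] at h5
    rw [hy]
    simp only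
    rw [duhamel_add hp Q heB (hdeB.const_mul C), duhamel_const_mul, ← h5]
  intro t ht x
  have := nonneg_of_duhamel_le hp Q (D := fun t x => y t x - δ t x) (w := fun _ _ => C) (T := T)
    (hyB.sub hδB) (LocBdd.const C) (fun _ _ _ => hC0) (fun s hs x' => by
      rw [duhamel_const_mul, duhamel_sub hp Q hyB hδB]
      have h6 := h1 s hs x'
      have h7 := hyeq s x'
      nlinarith) t ht x
  linarith

lemma tendsto_duhamel (hp : IsTransition p) (l : ℝ) {f : ℕ → ℝ → X → ℝ} {g : ℝ → X → ℝ}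
    (hf : ∀ n, LocBdd (f n)) {t C : ℝ} (hC : ∀ n, ∀ s ∈ Icc 0 t, ∀ x, |f n s x| ≤ C)
    (hlim : ∀ s ∈ Icc 0 t, ∀ x, Tendsto (fun n => f n s x) atTop (𝓝 (g s x))) (x : X) :
    Tendsto (fun n => duhamel p l (f n) t x) atTop (𝓝 (duhamel p l g t x)) := by
  have := hp.isMarkovKernel
  rcases le_or_gt t 0 with ht | ht
  · simp only [duhamel_of_nonpos _ _ _ ht]; exact tendsto_const_nhds
  refine tendsto_integral_of_dominated_convergence (fun s => exp (-l * (t - s)) * C)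
    (fun n => (duhamel_integrable hp l (hf n) t x).aestronglyMeasurable) ?_ (fun n => ?_) ?_
  · exact (Continuous.integrableOn_Icc (by fun_prop)).mono_set Ioc_subset_Icc_self
  · exact (ae_restrict_mem measurableSet_Ioc).mono fun s hs =>
      duhamel_integrand_bound hp l (hC n) hs x
  · refine (ae_restrict_mem measurableSet_Ioc).mono fun s hs => ?_
    refine Tendsto.const_mul _ (tendsto_integral_of_dominated_convergence (fun _ => C)
      (fun n => ((hf n).meas_right s).aestronglyMeasurable) (integrable_const _)
      (fun n => ae_of_all _ (hC n s ⟨hs.1.le, hs.2⟩))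
      (ae_of_all _ fun y => hlim s ⟨hs.1.le, hs.2⟩ y))

lemma locBdd_sum {ι : Type*} (s : Finset ι) {f : ι → ℝ → X → ℝ} (hf : ∀ i ∈ s, LocBdd (f i)) :
    LocBdd (fun t x => ∑ i ∈ s, f i t x) := by
  classical
  induction s using Finset.induction_on with
  | empty => simpa using LocBdd.const 0
  | insert a s ha ih =>
    simp only [Finset.sum_insert ha]
    exact (hf a (Finset.mem_insert_self _ _)).add
      (ih fun i hi => hf i (Finset.mem_insert_of_mem hi))

lemma duhamel_sum (hp : IsTransition p) (l : ℝ) {ι : Type*} (s : Finset ι) {f : ι → ℝ → X → ℝ}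
    (hf : ∀ i ∈ s, LocBdd (f i)) (t : ℝ) (x : X) :
    duhamel p l (fun r y => ∑ i ∈ s, f i r y) t x = ∑ i ∈ s, duhamel p l (f i) t x := by
  classical
  induction s using Finset.induction_on with
  | empty => simp [duhamel, discounted]
  | insert a s ha ih =>
    have h := fun i hi => hf i (Finset.mem_insert_of_mem (a := i) hi)
    simp only [Finset.sum_insert ha]
    rw [duhamel_add hp l (hf a (Finset.mem_insert_self _ _)) (locBdd_sum s h), ih h]

lemma measurable_delayed_param (hp : IsTransition p) (l : ℝ) {φ : X → ℝ} (hφ : Measurable φ)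
    {Y : Type*} [MeasurableSpace Y] {τ t : Y → ℝ} {x : Y → X} (hτ : Measurable τ)
    (ht : Measurable t) (hx : Measurable x) :
    Measurable fun y => delayed p l (τ y) φ (t y) (x y) := by
  refine Measurable.ite (measurableSet_le hτ ht) ?_ measurable_const
  exact (measurable_discounted hp l hφ).comp (f := fun y => (t y - τ y, x y))
    ((ht.sub hτ).prodMk hx)

/-- Existence of solutions with atoms at randomly shifted grid points. -/
lemma exists_shifted (hp : IsTransition p) {Q c h T b Φ : ℝ} (hQ : 0 < Q) (hc : 0 ≤ c) (hh : 0 < h)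
    {n : ℕ} (hT : n * h = T) {ρ : ℝ → ℝ} (hρ : Measurable ρ) (hρ0 : ∀ s, 0 ≤ ρ s)
    (hρb : ∀ s, ρ s ≤ b) {φ : X → ℝ} (hφ : Measurable φ) (hφ0 : ∀ x, 0 ≤ φ x)
    (hΦ : ∀ x, φ x ≤ Φ) (hb0 : 0 ≤ b) (hΦ0 : 0 ≤ Φ) :
    ∃ G W : ℝ → X × ℝ → ℝ, LocBdd G ∧ LocBdd W ∧ (∀ t q, |G t q| ≤ T * (b * Φ)) ∧
      (∀ t q, 0 ≤ W t q) ∧ (∀ t q, W t q ≤ T * (b * Φ)) ∧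
      (∀ t, 0 ≤ t → ∀ x z, W t (x, z) = G t (x, z) +
        duhamel p Q (fun s y => -(c * W s (y, z) ^ 2)) t x) ∧
      ∀ t x, ∀ z ∈ Ioo 0 h, G t (x, z) = ∑ k ∈ Finset.range n,
        h * (ρ (k * h + z) * delayed p Q (T - (k * h + z)) φ t x) := by
  have hT0 : 0 ≤ T := hT ▸ by positivity
  -- The source is switched off for shifts outside (0, h). Inside, every delay T - (kh + z) with k <
  -- n is nonnegative, so the resolvent identity holds atom by atom.
  set g : ℝ → ℝ → X × ℝ → ℝ := fun l t q => (Ioo 0 h).indicator (fun z => ∑ k ∈ Finset.range n,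
        h * (ρ (k * h + z) * delayed p l (T - (k * h + z)) φ t q.1)) q.2 with hg
  have hΦa : ∀ x, |φ x| ≤ Φ := fun x => by rw [abs_of_nonneg (hφ0 x)]; exact hΦ x
  have hterm0 : ∀ l τ t x, 0 ≤ delayed p l τ φ t x := by
    intro l τ t x
    rw [delayed]
    split_ifs
    · exact mul_nonneg (Real.exp_pos _).le (integral_nonneg hφ0)
    · exact le_rfl
  have hg0 : ∀ l t q, 0 ≤ g l t q := fun l t q => indicator_nonneg (fun z _ =>
    Finset.sum_nonneg fun k _ => mul_nonneg hh.le (mul_nonneg (hρ0 _) (hterm0 _ _ _ _))) _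
  have hgm : ∀ l, 0 ≤ l → ∀ t q, g l t q ≤ T * (b * Φ) := by
    intro l hl t q
    by_cases hz : q.2 ∈ Ioo 0 h
    swap
    · simp only [hg, indicator_of_notMem hz]; positivity
    simp only [hg, indicator_of_mem hz]
    calc _ ≤ ∑ k ∈ Finset.range n, h * (b * Φ) := Finset.sum_le_sum fun k _ => by
          refine mul_le_mul_of_nonneg_left (mul_le_mul (hρb _) ?_ (hterm0 _ _ _ _) hb0) hh.le
          exact (le_abs_self _).trans (delayed_abs_le hp hl hΦ0 hΦa t q.1)
      _ = T * (b * Φ) := by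
          rw [Finset.sum_const, Finset.card_range, nsmul_eq_mul, ← hT]
          ring
  have hgmeas : ∀ l, Measurable (Function.uncurry (g l)) := by
    intro l
    have h1 : Measurable fun q : ℝ × (X × ℝ) => ∑ k ∈ Finset.range n,
        h * (ρ (k * h + q.2.2) * delayed p l (T - (k * h + q.2.2)) φ q.1 q.2.1) := by
      refine Finset.measurable_sum _ fun k _ => Measurable.const_mul (Measurable.mul
        (hρ.comp (by fun_prop)) ?_) _
      exact measurable_delayed_param hp l hφ (τ := fun q : ℝ × (X × ℝ) => T - (k * h + q.2.2))
        (t := fun q => q.1) (x := fun q => q.2.1) (by fun_prop) (by fun_prop) (by fun_prop)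
    have h2 : Function.uncurry (g l) = ((fun q : ℝ × (X × ℝ) => q.2.2) ⁻¹' (Ioo 0 h)).indicator
        (fun q : ℝ × (X × ℝ) => ∑ k ∈ Finset.range n,
        h * (ρ (k * h + q.2.2) * delayed p l (T - (k * h + q.2.2)) φ q.1 q.2.1)) := by
      funext q
      simp only [Function.uncurry, hg, indicator, mem_preimage]
    rw [h2]
    exact h1.indicator ((measurable_snd.comp measurable_snd) measurableSet_Ioo)
  have hgL : ∀ l, 0 ≤ l → LocBdd (g l) := fun l hl => LocBdd.of_bound (hgmeas l)
    fun t q => by rw [abs_of_nonneg (hg0 l t q)]; exact hgm l hl t q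
  set m := T * (b * Φ) with hm
  have hm0 : 0 ≤ m := by positivity
  set K := 2 * c * m with hK
  have hK0 : 0 ≤ K := by positivity
  have hres : ∀ t q, g Q t q = g (Q + K) t q + K * duhamel (frozen p) (Q + K) (g Q) t q := by
    rintro t ⟨x, z⟩
    rw [duhamel_frozen hp _ (hgmeas Q)]
    by_cases hz : z ∈ Ioo 0 h
    · simp only [hg, indicator_of_mem hz]
      have hτ : ∀ k ∈ Finset.range n, 0 ≤ T - (k * h + z) := by
        intro k hk
        have : ((k + 1 : ℕ) : ℝ) ≤ n := by exact_mod_cast Finset.mem_range.1 hk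
        push_cast at this
        rw [← hT]
        nlinarith [hz.2]
      have hL : ∀ k ∈ Finset.range n, LocBdd (delayed p Q (T - (k * h + z)) φ) := fun k hk =>
        locBdd_delayed hp Q (hτ k hk) hφ hΦa
      rw [duhamel_sum hp (Q + K) (Finset.range n)
        (f := fun k s y => h * (ρ (k * h + z) * delayed p Q (T - (k * h + z)) φ s y))
        (fun k hk => ((hL k hk).const_mul _).const_mul _), Finset.mul_sum, ← Finset.sum_add_distrib]
      refine Finset.sum_congr rfl fun k hk => ?_
      rw [duhamel_const_mul, duhamel_const_mul, delayed_resolvent hp Q K (hτ k hk) hφ hΦa]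
      ring
    · simp only [hg, indicator_of_notMem hz]
      simp [duhamel, discounted]
  obtain ⟨W, hWm, hW0, hWg, hWeq⟩ := exists_absorbing (isTransition_frozen hp) hQ hc hm0 hK
    (hgmeas Q) (hgmeas (Q + K)) (hg0 Q) (hgm Q hQ.le) (hg0 _) hres
  have hWle : ∀ t q, W t q ≤ m := fun t q => (hWg t q).trans (hgm Q hQ.le t q)
  have hWL : LocBdd W := LocBdd.of_bound hWm fun t q => by
    rw [abs_of_nonneg (hW0 t q)]; exact hWle t q
  refine ⟨g Q, W, hgL Q hQ.le, hWL, fun t q => by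
    rw [abs_of_nonneg (hg0 Q t q)]; exact hgm Q hQ.le t q, hW0, hWle, fun t ht x z => ?_,
    fun t x z hz => ?_⟩
  · rw [hWeq t ht (x, z), duhamel_frozen hp Q (hWL.sq.const_mul c).neg.meas]
  · simp only [hg, indicator_of_mem hz]

/-- The atoms average to the continuous source. -/
lemma integral_delayed_eq_duhamel (p : Kernel (ℝ × X) X) (Q : ℝ) {T : ℝ} (ρ : ℝ → ℝ)
    (φ : X → ℝ) {t : ℝ} (ht : t ∈ Icc 0 T) (x : X) :
    ∫ s in (0 : ℝ)..T, ρ s * delayed p Q (T - s) φ t x =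
      duhamel p Q (fun s y => ρ (T - s) * φ y) t x := by
  have h1 := intervalIntegral.integral_comp_sub_left (a := 0) (b := T)
    (fun s => ρ s * delayed p Q (T - s) φ t x) T
  simp only [sub_sub_cancel, sub_self, sub_zero] at h1
  rw [← h1, intervalIntegral.integral_of_le (ht.1.trans ht.2), duhamel]
  have h2 : ∀ s ∈ Ioc 0 T \ Ioc 0 t, ρ (T - s) * delayed p Q s φ t x = 0 := fun s hs => by
    rw [delayed, if_neg (fun h => hs.2 ⟨hs.1.1, h⟩), mul_zero]
  rw [setIntegral_eq_of_subset_of_forall_sdiff_eq_zero measurableSet_Ioc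
    (Ioc_subset_Ioc_right ht.2) h2]
  refine setIntegral_congr_fun measurableSet_Ioc fun s hs => ?_
  rw [delayed, if_pos hs.2, discounted_const_mul]

end Average

/-! ### The Laplace functional of the occupation process -/

section Laplace

variable {d : ℕ} {S : Type*} [MeasurableSpace S] {M : MarkovFamily d S} {V q H : ℝ}
  {Ω : Type*} [MeasurableSpace Ω] {Pr : Measure Ω} {N : ℝ → Ω → Measure (E d)}

/-- Lebesgue measure on `(0, T] × B`. -/
def slab (T : ℝ) (B : Set (E d)) : Measure (ℝ × E d) :=
  (volume.restrict (Ioc 0 T)).prod (volume.restrict B)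

lemma slab_eq_restrict (T : ℝ) (B : Set (E d)) :
    slab T B = (slab T univ).restrict (univ ×ˢ B) := by
  rw [slab, slab, Measure.restrict_univ, ← Measure.prod_restrict, Measure.restrict_univ]

lemma slab_le (T : ℝ) (B : Set (E d)) : slab T B ≤ slab T univ :=
  slab_eq_restrict T B ▸ Measure.restrict_le_self

lemma isFiniteMeasure_slab (T : ℝ) {B : Set (E d)} (hB : volume B ≠ ⊤) :
    IsFiniteMeasure (slab T B) := by
  have : IsFiniteMeasure ((volume : Measure (E d)).restrict B) :=
    ⟨by rw [Measure.restrict_apply_univ]; exact hB.lt_top⟩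
  unfold slab
  infer_instance

instance (T : ℝ) (B : Set (E d)) : SFinite (slab T B) := by
  unfold slab
  infer_instance

lemma ae_slab (T : ℝ) (B : Set (E d)) : ∀ᵐ y ∂(slab T B), y.1 ∈ Ioc 0 T :=
  Measure.quasiMeasurePreserving_fst.ae (ae_restrict_mem measurableSet_Ioc)

lemma lintegral_slab {T : ℝ} {B : Set (E d)} {f : ℝ × E d → ℝ≥0∞} (hf : Measurable f) :
    ∫⁻ y, f y ∂(slab T B) = ∫⁻ r in Ioc 0 T, ∫⁻ x in B, f (r, x) :=
  lintegral_prod _ hf.aemeasurable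

lemma tendsto_lintegral_slab (T : ℝ) {f : ℝ × E d → ℝ≥0∞} (hf : Measurable f) :
    Tendsto (fun n : ℕ => ∫⁻ y, f y ∂(slab T (closedBall (0 : E d) n))) atTop
      (𝓝 (∫⁻ y, f y ∂(slab T univ))) := by
  have hm : ∀ n : ℕ, MeasurableSet ((univ : Set ℝ) ×ˢ (closedBall (0 : E d) n)) := fun n =>
    MeasurableSet.univ.prod Metric.isClosed_closedBall.measurableSet
  simp only [slab_eq_restrict T (closedBall _ _), ← lintegral_indicator (hm _)]
  refine lintegral_tendsto_of_tendsto_of_monotone (fun n => (hf.indicator (hm n)).aemeasurable)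
    (ae_of_all _ fun y a b hab => ?_) (ae_of_all _ fun y => ?_)
  · refine indicator_le_indicator_of_subset (prod_mono_right
      (Metric.closedBall_subset_closedBall (by exact_mod_cast hab))) (fun _ => zero_le) y
  · obtain ⟨n₀, hn₀⟩ := exists_nat_ge ‖y.2‖
    refine tendsto_const_nhds.congr' ((eventually_ge_atTop n₀).mono fun n hn => ?_)
    refine (indicator_of_mem (s := (univ : Set ℝ) ×ˢ closedBall (0 : E d) n) ⟨trivial, ?_⟩ f).symm
    rw [mem_closedBall_zero_iff]
    exact hn₀.trans (by exact_mod_cast hn)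

/-- The Laplace transform of a Riemann sum. -/
lemma IsSuperprocess.riemann_laplace [IsProbabilityMeasure Pr] (hN : IsSuperprocess M V q H Pr N)
    (hQ : 0 < Qrate V q) (hc : 0 ≤ V * q) {h T : ℝ} {n : ℕ} (hT : n * h = T)
    {ρ : ℝ → ℝ} (hρ0 : ∀ s, 0 ≤ ρ s) {φ : E d → ℝ} (hφ : Measurable φ) (hφ0 : ∀ x, 0 ≤ φ x)
    {Φ : ℝ} (hΦ : ∀ x, φ x ≤ Φ) {G W : ℝ → E d × ℝ → ℝ} (hW : LocBdd W) (hW0 : ∀ t q, 0 ≤ W t q)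
    (hWeq : ∀ t, 0 ≤ t → ∀ x z, W t (x, z) = G t (x, z) +
        duhamel M.transition (Qrate V q) (fun s y => -(V * q * W s (y, z) ^ 2)) t x)
    (hG : ∀ t x, ∀ z ∈ Ioo 0 h, G t (x, z) = ∑ k ∈ Finset.range n,
        h * (ρ (k * h + z) * delayed M.transition (Qrate V q) (T - (k * h + z)) φ t x))
    {z : ℝ} (hz : z ∈ Ioo 0 h) (hn : 0 < n) :
    ∫⁻ ω, nexp (∑ k ∈ Finset.range n, ofReal h * (ofReal (ρ (k * h + z)) *
      ∫⁻ x, ofReal (φ x) ∂(N (k * h + z) ω))) ∂Pr =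
    nexp (ofReal H * ∫⁻ y, ofReal (W y.1 (y.2, z)) ∂(slab T univ)) := by
  have hh : 0 < h := hz.1.trans hz.2
  have hkT : ∀ k < n, (k : ℝ) * h + z < T := by
    intro k hk
    have : ((k + 1 : ℕ) : ℝ) ≤ n := by exact_mod_cast hk
    push_cast at this
    rw [← hT]
    nlinarith [hz.2]
  -- The truncation leaves the grid points with k < n unchanged and makes the n-th time equal to T,
  -- as `chain` requires.
  set t : ℕ → ℝ := fun k => min (k * h + z) T with ht
  have htk : ∀ k < n, t k = k * h + z := fun k hk => min_eq_left (hkT k hk).le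
  have hWz : LocBdd (fun t x => W t (x, z)) := hW.section_left z
  have := hN.chain hQ hc (n := n) (a := fun k => h * ρ (t k)) (t := t) (T := T)
    (fun k => mul_nonneg hh.le (hρ0 _)) (by rw [htk 0 hn]; simpa using hz.1)
    (fun k hk => by
      rw [htk k hk]
      refine lt_min ?_ (hkT k hk)
      push_cast
      linarith)
    (by
      refine min_eq_right ?_
      rw [hT]
      linarith [hz.1]) hφ hφ0 hΦ hWz (fun t x => hW0 t (x, z)) (fun r hr x => by
      rw [hWeq r hr x z, hG r x z hz]
      congr 1
      refine Finset.sum_congr rfl fun k hk => ?_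
      rw [htk k (Finset.mem_range.1 hk), mul_assoc])
  have hsl := lintegral_slab (T := T) (B := univ) (f := fun y => ofReal (W y.1 (y.2, z)))
    hWz.meas.ennreal_ofReal
  rw [Measure.restrict_univ] at hsl
  rw [hsl, ← this]
  refine lintegral_congr fun ω => ?_
  congr 1
  refine Finset.sum_congr rfl fun k hk => ?_
  rw [htk k (Finset.mem_range.1 hk), ENNReal.ofReal_mul hh.le, mul_assoc]

lemma le_of_le_add_tendsto {a b : ℝ≥0∞} {ε : ℕ → ℝ≥0∞} (h : ∀ n, a ≤ b + ε n)
    (hε : Tendsto ε atTop (𝓝 0)) : a ≤ b := by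
  have := hε.const_add b
  rw [add_zero] at this
  exact ge_of_tendsto' this h

/-- The mean error of the randomly shifted Riemann sums of `f ∧ m`. -/
def riemannError (T : ℝ) (m : ℕ) (f : ℝ → ℝ≥0∞) (n : ℕ) : ℝ≥0∞ :=
  ∫⁻ z, ofReal |∑ k ∈ Finset.range (n + 1), T / (n + 1) *
    (min (f (k * (T / (n + 1)) + z)) m).toReal - (∫⁻ s in Ioc 0 T, min (f s) m).toReal|
    ∂(unif (T / (n + 1)))

/-- Riemann sums converge in mean for bounded functions only, so f is truncated at m. Truncation
lowers the sum and raises its negative exponential, which suffices for an upper bound. `nexp` being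
1-Lipschitz turns the mean error of the sum into the error term. -/
lemma riemannError_spec {f : ℝ → ℝ≥0∞} (hf : Measurable f) {T : ℝ} (hT : 0 < T) (m : ℕ) :
    Tendsto (riemannError T m f) atTop (𝓝 0) ∧
    (∀ n, riemannError T m f n ≤ ofReal (2 * (T * m))) ∧
    ∀ n : ℕ, ∫⁻ z, nexp (∑ k ∈ Finset.range (n + 1), ofReal (T / (n + 1)) *
        f (k * (T / (n + 1)) + z)) ∂(unif (T / (n + 1))) ≤
      nexp (∫⁻ s in Ioc 0 T, min (f s) m) + riemannError T m f n := by
  set fm : ℝ → ℝ := fun s => (min (f s) m).toReal with hfm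
  have hmtop : (m : ℝ≥0∞) ≠ ⊤ := ENNReal.natCast_ne_top m
  have hfm1 : Measurable fm := (hf.min measurable_const).ennreal_toReal
  have hfmb : ∀ s, |fm s| ≤ m := fun s => by
    rw [abs_of_nonneg ENNReal.toReal_nonneg]
    have := ENNReal.toReal_mono hmtop (min_le_right (f s) m)
    simpa using this
  have hfmo : ∀ s, ofReal (fm s) = min (f s) m := fun s =>
    ENNReal.ofReal_toReal (ne_top_of_le_ne_top hmtop (min_le_right _ _))
  set J : ℝ := (∫⁻ s in Ioc 0 T, min (f s) m).toReal with hJ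
  have hJlt : ∫⁻ s in Ioc 0 T, min (f s) m ≠ ⊤ := by
    refine ((lintegral_mono fun s => min_le_right (f s) m).trans_lt ?_).ne
    rw [setLIntegral_const]
    exact ENNReal.mul_lt_top hmtop.lt_top (by simp)
  have hJo : ofReal J = ∫⁻ s in Ioc 0 T, min (f s) m := ENNReal.ofReal_toReal hJlt
  have hJi : ∫ s in (0 : ℝ)..T, fm s = J := by
    rw [intervalIntegral.integral_of_le hT.le, hJ]
    exact integral_toReal (hf.min measurable_const).aemeasurable
      (ae_of_all _ fun s => (min_le_right _ _).trans_lt hmtop.lt_top)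
  have hh : ∀ n : ℕ, 0 < T / ((n : ℝ) + 1) := fun n => by positivity
  have hpr := fun n : ℕ => isProbabilityMeasure_unif (hh n)
  set D : ℕ → ℝ → ℝ := fun n z => |∑ k ∈ Finset.range (n + 1),
    T / (n + 1) * fm (k * (T / (n + 1)) + z) - J| with hD
  have hDe : ∀ n, riemannError T m f n = ∫⁻ z, ofReal (D n z) ∂(unif (T / (n + 1))) :=
    fun n => rfl
  have hDm : ∀ n, Measurable (D n) := by
    intro n
    have h1 : Measurable fun z : ℝ => ∑ k ∈ Finset.range (n + 1),
        T / (n + 1) * fm (k * (T / (n + 1)) + z) :=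
      Finset.measurable_sum _ fun k _ => (hfm1.comp (by fun_prop)).const_mul _
    exact (h1.sub measurable_const).abs
  have hDb : ∀ n z, |D n z| ≤ 2 * (T * m) := by
    intro n z
    rw [hD, abs_abs]
    refine (abs_sub _ _).trans ?_
    have h1 : |∑ k ∈ Finset.range (n + 1), T / (n + 1) * fm (k * (T / (n + 1)) + z)| ≤ T * m := by
      refine (Finset.abs_sum_le_sum_abs _ _).trans ?_
      calc _ ≤ ∑ k ∈ Finset.range (n + 1), T / (n + 1) * m := Finset.sum_le_sum fun k _ => by
            rw [abs_mul, abs_of_pos (hh n)]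
            exact mul_le_mul_of_nonneg_left (hfmb _) (hh n).le
        _ = T * m := by
            rw [Finset.sum_const, Finset.card_range, nsmul_eq_mul]
            push_cast
            field_simp
    have h2 : |J| ≤ T * m := by
      rw [← hJi, ← Real.norm_eq_abs]
      have := intervalIntegral.norm_integral_le_of_norm_le_const (a := 0) (b := T) (C := m)
        (f := fm) fun s _ => hfmb s
      rw [sub_zero, abs_of_pos hT] at this
      linarith
    linarith
  have hDlim : Tendsto (fun n : ℕ => ∫ z, D n z ∂(unif (T / (n + 1)))) atTop (𝓝 0) := by
    simp only [hD, ← hJi]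
    exact tendsto_riemann hfm1 hfmb hT
  refine ⟨?_, fun n => ?_, fun n => ?_⟩
  · have h1 : ∀ n : ℕ, riemannError T m f n = ofReal (∫ z, D n z ∂(unif (T / (n + 1)))) := by
      intro n
      have := hpr n
      rw [hDe, ofReal_integral_eq_lintegral_ofReal (integrable_of_bound (hDm n) (hDb n))
        (ae_of_all _ fun z => abs_nonneg _)]
    refine Tendsto.congr (fun n => (h1 n).symm) ?_
    rw [← ENNReal.ofReal_zero]
    exact (ENNReal.continuous_ofReal.tendsto 0).comp hDlim
  · have := hpr n
    rw [hDe]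
    refine (lintegral_mono fun z => ENNReal.ofReal_le_ofReal
      ((le_abs_self _).trans (hDb n z))).trans ?_
    rw [lintegral_const, measure_univ, mul_one]
  · have := hpr n
    have h2 : ∫⁻ z, (nexp (∫⁻ s in Ioc 0 T, min (f s) m) + ofReal (D n z))
        ∂(unif (T / (n + 1))) = nexp (∫⁻ s in Ioc 0 T, min (f s) m) + riemannError T m f n := by
      rw [lintegral_add_left measurable_const, lintegral_const, measure_univ, mul_one, hDe]
    rw [← h2]
    refine lintegral_mono fun z => ?_
    set R := ∑ k ∈ Finset.range (n + 1), T / (n + 1) * fm (k * (T / (n + 1)) + z) with hR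
    have hR0 : 0 ≤ R := Finset.sum_nonneg fun k _ => mul_nonneg (hh n).le ENNReal.toReal_nonneg
    have h3 : ofReal R ≤ ∑ k ∈ Finset.range (n + 1), ofReal (T / (n + 1)) *
        f (k * (T / (n + 1)) + z) := by
      rw [hR, ENNReal.ofReal_sum_of_nonneg fun k _ => mul_nonneg (hh n).le ENNReal.toReal_nonneg]
      refine Finset.sum_le_sum fun k _ => ?_
      rw [ENNReal.ofReal_mul (hh n).le, hfmo]
      gcongr
      exact min_le_left _ _
    refine (nexp_anti h3).trans ((nexp_le_add _ (ofReal |R - J|)).trans ?_)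
    refine add_le_add (nexp_anti ?_) le_rfl
    rw [← hJo, ← ENNReal.ofReal_add hR0 (abs_nonneg _)]
    refine ENNReal.ofReal_le_ofReal ?_
    have := neg_abs_le (R - J)
    linarith

lemma riemann_upper [IsProbabilityMeasure Pr] {f : Ω → ℝ → ℝ≥0∞}
    (hf : Measurable (Function.uncurry f)) {T : ℝ} (hT : 0 < T) (m : ℕ) :
    ∃ ε : ℕ → ℝ≥0∞, Tendsto ε atTop (𝓝 0) ∧ ∀ n : ℕ,
      ∫⁻ ω, ∫⁻ z, nexp (∑ k ∈ Finset.range (n + 1), ofReal (T / (n + 1)) *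
        f ω (k * (T / (n + 1)) + z)) ∂(unif (T / (n + 1))) ∂Pr ≤
      ∫⁻ ω, nexp (∫⁻ s in Ioc 0 T, min (f ω s) m) ∂Pr + ε n := by
  have hf1 : ∀ ω, Measurable (f ω) := fun ω => hf.comp measurable_prodMk_left
  have hJm : Measurable fun ω => ∫⁻ s in Ioc 0 T, min (f ω s) m := Measurable.lintegral_prod_right
    (f := fun ω s => min (f ω s) (m : ℝ≥0∞)) (hf.min measurable_const)
  refine ⟨fun n => ∫⁻ ω, riemannError T m (f ω) n ∂Pr, ?_, fun n => ?_⟩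
  · have h0 : (0 : ℝ≥0∞) = ∫⁻ _, 0 ∂Pr := by simp
    rw [h0]
    refine tendsto_lintegral_of_dominated_convergence (fun _ => ofReal (2 * (T * m)))
      (fun n => ?_) (fun n => ae_of_all _ fun ω => (riemannError_spec (hf1 ω) hT m).2.1 n)
      (by rw [lintegral_const]; exact ENNReal.mul_ne_top ENNReal.ofReal_ne_top (measure_ne_top _ _))
      (ae_of_all _ fun ω => (riemannError_spec (hf1 ω) hT m).1)
    have := isProbabilityMeasure_unif (h := T / ((n : ℝ) + 1)) (by positivity)
    have h1 : Measurable fun y : Ω × ℝ => ∑ k ∈ Finset.range (n + 1), T / (n + 1) *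
        (min (f y.1 (k * (T / (n + 1)) + y.2)) (m : ℝ≥0∞)).toReal :=
      Finset.measurable_sum _ fun k _ => ((hf.comp
        (f := fun y : Ω × ℝ => (y.1, k * (T / (n + 1)) + y.2)) (by fun_prop)).min
          measurable_const).ennreal_toReal.const_mul _
    exact Measurable.lintegral_prod_right (f := fun ω z => ofReal |∑ k ∈
      Finset.range (n + 1), T / (n + 1) * (min (f ω (k * (T / (n + 1)) + z)) (m : ℝ≥0∞)).toReal -
      (∫⁻ s in Ioc 0 T, min (f ω s) m).toReal|)
      ((h1.sub (hJm.ennreal_toReal.comp measurable_fst)).abs.ennreal_ofReal)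
  · have hm1 : Measurable fun ω => nexp (∫⁻ s in Ioc 0 T, min (f ω s) m) := measurable_nexp.comp hJm
    rw [← lintegral_add_left hm1]
    exact lintegral_mono fun ω => (riemannError_spec (hf1 ω) hT m).2.2 n

set_option maxHeartbeats 1600000 in
/-- The Laplace functional of the occupation process. -/
theorem IsSuperprocess.laplace [IsProbabilityMeasure Pr] (hN : IsSuperprocess M V q H Pr N)
    (hQ : 0 < Qrate V q) (hc : 0 ≤ V * q) {T b Φ : ℝ} (hT : 0 < T) {ρ : ℝ → ℝ} (hρ : Measurable ρ)
    (hρ0 : ∀ s, 0 ≤ ρ s) (hρb : ∀ s, ρ s ≤ b) {φ : E d → ℝ} (hφ : Measurable φ)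
    (hφ0 : ∀ x, 0 ≤ φ x) (hΦ : ∀ x, φ x ≤ Φ) {w : ℝ → E d → ℝ} (hw : LocBdd w)
    (hweq : ∀ t ∈ Icc 0 T, ∀ x, w t x = duhamel M.transition (Qrate V q)
      (fun s y => ρ (T - s) * φ y) t x +
      duhamel M.transition (Qrate V q) (fun s y => -(V * q * w s y ^ 2)) t x) :
    ∫⁻ ω, nexp (∫⁻ s in Ioc 0 T, ofReal (ρ s) *
      ∫⁻ x, ofReal (φ x) ∂(N s ω)) ∂Pr =
    nexp (ofReal H * ∫⁻ y, ofReal (w y.1 y.2) ∂(slab T univ)) := by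
  have hp := M.isTransition
  have hb0 : 0 ≤ b := (hρ0 0).trans (hρb 0)
  have hΦ0 : 0 ≤ Φ := (hφ0 0).trans (hΦ 0)
  set p := M.transition with hpdef
  set Q := Qrate V q with hQdef
  set c := V * q with hcdef
  set f : Ω → ℝ → ℝ≥0∞ := fun ω s => ofReal (ρ s) * ∫⁻ x, ofReal (φ x) ∂(N s ω)
    with hf
  have hfm : Measurable (Function.uncurry f) :=
    ((hρ.comp measurable_snd).ennreal_ofReal).mul
      ((hN.measurable_pair hφ.ennreal_ofReal).comp measurable_swap)
  have hh : ∀ n : ℕ, 0 < T / ((n : ℝ) + 1) := fun n => by positivity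
  have hTn : ∀ n : ℕ, ((n + 1 : ℕ) : ℝ) * (T / ((n : ℝ) + 1)) = T := fun n => by
    push_cast; field_simp
  have hpr := fun n : ℕ => isProbabilityMeasure_unif (hh n)
  choose G W hG hW hGb hW0 hWb hWeq hGeq using fun n : ℕ =>
    exists_shifted hp hQ hc (hh n) (hTn n) hρ hρ0 hρb hφ hφ0 hΦ hb0 hΦ0
  -- L n is the Laplace transform of the Riemann sum with n + 1 points, averaged over the shift.
  -- Each side of the claimed identity is shown to be the greatest lower bound of the L n: it is
  -- below every L n by Jensen's inequality, and every common lower bound is below it by a limit n →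
  -- ∞.
  set L : ℕ → ℝ≥0∞ := fun n => ∫⁻ ω, ∫⁻ z, nexp (∑ k ∈ Finset.range (n + 1),
    ofReal (T / (n + 1)) * f ω (k * (T / (n + 1)) + z)) ∂(unif (T / (n + 1))) ∂Pr with hL
  have hSm : ∀ n : ℕ, Measurable fun y : Ω × ℝ => ∑ k ∈ Finset.range (n + 1),
      ofReal (T / (n + 1)) * f y.1 (k * (T / (n + 1)) + y.2) := fun n =>
    Finset.measurable_sum _ fun k _ => (hfm.comp
      (f := fun y : Ω × ℝ => (y.1, k * (T / (n + 1)) + y.2)) (by fun_prop)).const_mul _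
  have hLeq : ∀ n : ℕ, L n = ∫⁻ z, nexp (ofReal H *
      ∫⁻ y, ofReal (W n y.1 (y.2, z)) ∂(slab T univ)) ∂(unif (T / (n + 1))) := by
    intro n
    have := hpr n
    rw [hL]
    simp only
    rw [lintegral_lintegral_swap (f := fun ω z => nexp (∑ k ∈ Finset.range (n + 1),
      ofReal (T / (n + 1)) * f ω (k * (T / (n + 1)) + z)))
      (measurable_nexp.comp (hSm n)).aemeasurable]
    refine lintegral_congr_ae (ae_unif.mono fun z hz => ?_)
    exact hN.riemann_laplace hQ hc (hTn n) hρ0 hφ hφ0 hΦ (hW n) (hW0 n) (hWeq n) (hGeq n) hz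
      (Nat.succ_pos n)
  set g : ℝ → E d → ℝ := duhamel p Q (fun s y => ρ (T - s) * φ y) with hg
  have hsrc : LocBdd (fun s y => ρ (T - s) * φ y) := by
    refine LocBdd.of_bound (C := b * Φ) ((hρ.comp (by fun_prop)).mul (hφ.comp measurable_snd))
      fun t x => ?_
    rw [abs_of_nonneg (mul_nonneg (hρ0 _) (hφ0 x))]
    exact mul_le_mul (hρb _) (hΦ x) (hφ0 x) hb0
  have hgL : LocBdd g := locBdd_duhamel hp Q hsrc
  have hFm : ∀ t x, Measurable fun s => ρ s * delayed p Q (T - s) φ t x := fun t x =>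
    hρ.mul (measurable_delayed_param hp Q hφ (by fun_prop) measurable_const measurable_const)
  have hFb : ∀ t x s, |ρ s * delayed p Q (T - s) φ t x| ≤ b * Φ := by
    intro t x s
    rw [abs_mul, abs_of_nonneg (hρ0 s)]
    refine mul_le_mul (hρb s) (delayed_abs_le hp hQ.le hΦ0 (fun x => ?_) t x) (abs_nonneg _) hb0
    rw [abs_of_nonneg (hφ0 x)]; exact hΦ x
  have hGavg : ∀ n : ℕ, ∀ t ∈ Icc 0 T, ∀ x, ∫ z, G n t (x, z) ∂(unif (T / (n + 1))) = g t x := by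
    intro n t ht x
    rw [hg, ← integral_delayed_eq_duhamel p Q ρ φ ht x]
    have h1 := integral_unif_sum (hh n) (intervalIntegrable_of_bound (hFm t x) (hFb t x)) (n + 1)
    rw [hTn] at h1
    rw [← h1]
    exact integral_congr_ae (ae_unif.mono fun z hz => hGeq n t x z hz)
  have hWn : ∀ n : ℕ, Measurable fun y : ℝ × (ℝ × E d) => W n y.2.1 (y.2.2, y.1) := fun n =>
    (hW n).meas.comp (f := fun y : ℝ × (ℝ × E d) => (y.2.1, (y.2.2, y.1))) (by fun_prop)
  have hwm : Measurable fun y : ℝ × E d => w y.1 y.2 := hw.meas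
  -- the lower bound by Jensen's inequality
  have lower : ∀ n : ℕ,
      nexp (ofReal H * ∫⁻ y, ofReal (w y.1 y.2) ∂(slab T univ)) ≤ L n := by
    intro n
    have := hpr n
    rw [hLeq]
    refine le_trans ?_ (nexp_lintegral_le ?_)
    · refine nexp_anti ?_
      rw [lintegral_const_mul' _ _ ENNReal.ofReal_ne_top,
        lintegral_lintegral_swap (f := fun z (y : ℝ × E d) => ofReal (W n y.1 (y.2, z)))
        (hWn n).ennreal_ofReal.aemeasurable]
      gcongr ofReal H * ?_
      refine lintegral_mono_ae ((ae_slab T univ).mono fun y hy => ?_)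
      have hy' : y.1 ∈ Icc 0 T := Ioc_subset_Icc_self hy
      rw [← ofReal_integral_eq_lintegral_ofReal ((hW n).integrable_section hy'.1 y.2)
        (ae_of_all _ fun z => hW0 n _ _)]
      exact ENNReal.ofReal_le_ofReal (average_le hp hc (hW n) (hG n) (hWeq n) hw hweq (hGavg n)
        y.1 hy' y.2)
    · exact (Measurable.lintegral_prod_right (f := fun z (y : ℝ × E d) => ofReal (W n y.1 (y.2, z)))
        (hWn n).ennreal_ofReal).const_mul _
  have lowerE : ∀ n : ℕ, ∫⁻ ω, nexp (∫⁻ s in Ioc 0 T, f ω s) ∂Pr ≤ L n := by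
    intro n
    have := hpr n
    refine lintegral_mono fun ω => ?_
    have h1 := lintegral_unif_sum (hh n) (f := f ω)
      (hfm.comp (measurable_const.prodMk measurable_id)) (n + 1)
    rw [hTn] at h1
    rw [← h1]
    exact nexp_lintegral_le ((hSm n).comp (measurable_const.prodMk measurable_id))
  -- the upper bound through the truncated paths
  have upperE : ∀ a, (∀ n, a ≤ L n) → a ≤ ∫⁻ ω, nexp (∫⁻ s in Ioc 0 T, f ω s) ∂Pr := by
    intro a ha
    have h1 : ∀ m : ℕ, a ≤ ∫⁻ ω, nexp (∫⁻ s in Ioc 0 T, min (f ω s) m) ∂Pr := by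
      intro m
      obtain ⟨ε, hε, hle⟩ := riemann_upper (Pr := Pr) hfm hT m
      exact le_of_le_add_tendsto (fun n => (ha n).trans (hle n)) hε
    have h2 : Tendsto (fun m : ℕ => ∫⁻ ω, nexp (∫⁻ s in Ioc 0 T, min (f ω s) m) ∂Pr) atTop
        (𝓝 (∫⁻ ω, nexp (∫⁻ s in Ioc 0 T, f ω s) ∂Pr)) := by
      refine tendsto_lintegral_of_dominated_convergence (fun _ => 1) (fun m =>
        measurable_nexp.comp (Measurable.lintegral_prod_right
          (f := fun ω s => min (f ω s) (m : ℝ≥0∞)) (hfm.min measurable_const)))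
        (fun m => ae_of_all _ fun ω => nexp_le_one _) (by simp) (ae_of_all _ fun ω => ?_)
      refine (continuous_nexp.tendsto _).comp ?_
      have hfω : Measurable (f ω) := hfm.comp (measurable_const.prodMk measurable_id)
      refine lintegral_tendsto_of_tendsto_of_monotone
        (fun m => (hfω.min measurable_const).aemeasurable)
        (ae_of_all _ fun s i j hij => min_le_min_left _ (by exact_mod_cast hij))
        (ae_of_all _ fun s => ?_)
      have := (tendsto_const_nhds (x := f ω s)).min ENNReal.tendsto_nat_nhds_top
      rwa [min_top_right] at this
    exact ge_of_tendsto' h2 h1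
  -- the upper bound through the equation
  set m := max (T * (b * Φ)) (Classical.choose (hw.bound T)) with hm
  have hwmb : ∀ t ∈ Icc 0 T, ∀ x, |w t x| ≤ m := fun t ht x =>
    ((Classical.choose_spec (hw.bound T)).2 t ht x).trans (le_max_right _ _)
  have hm0 : 0 ≤ m := (Classical.choose_spec (hw.bound T)).1.le.trans (le_max_right _ _)
  have hWmb : ∀ n, ∀ t ∈ Icc 0 T, ∀ y, |W n t y| ≤ m := fun n t _ y => by
    rw [abs_of_nonneg (hW0 n t y)]; exact (hWb n t y).trans (le_max_left _ _)
  set δ : ℕ → ℝ → E d → ℝ := fun n t x => ∫ z, |W n t (x, z) - w t x| ∂(unif (T / (n + 1))) with hδ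
  set e : ℕ → ℝ → E d → ℝ := fun n t x => ∫ z, |G n t (x, z) - g t x| ∂(unif (T / (n + 1))) with he
  have heL : ∀ n, LocBdd (e n) := fun n => by
    have := hpr n
    exact locBdd_average ((hG n).sub hgL.lift).abs
  have hδL : ∀ n, LocBdd (δ n) := fun n => by
    have := hpr n
    exact locBdd_average ((hW n).sub hw.lift).abs
  have he0 : ∀ t ∈ Icc 0 T, ∀ x, Tendsto (fun n => e n t x) atTop (𝓝 0) := by
    intro t ht x
    refine (tendsto_riemann (hFm t x) (hFb t x) hT).congr fun n => ?_
    refine integral_congr_ae (ae_unif.mono fun z hz => ?_)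
    simp only
    rw [hGeq n t x z hz, hg, ← integral_delayed_eq_duhamel p Q ρ φ ht x]
  obtain ⟨Cg, -, hCg⟩ := hgL.bound T
  have heb : ∀ n, ∀ s ∈ Icc 0 T, ∀ x, |e n s x| ≤ T * (b * Φ) + Cg := by
    intro n s hs x
    have := hpr n
    refine integral_abs_le_of_bound fun z => ?_
    rw [abs_abs]
    exact (abs_sub _ _).trans (add_le_add (hGb n s _) (hCg s hs x))
  have hδ0 : ∀ t ∈ Icc 0 T, ∀ x, Tendsto (fun n => δ n t x) atTop (𝓝 0) := by
    intro t ht x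
    have h1 := tendsto_duhamel hp (Q - 2 * c * m) (g := fun _ _ => 0) heL
      (t := t) (fun n s hs => heb n s ⟨hs.1, hs.2.trans ht.2⟩)
      (fun s hs y => he0 s ⟨hs.1, hs.2.trans ht.2⟩ y) x
    have h2 : duhamel p (Q - 2 * c * m) (fun _ _ => 0) t x = 0 := by simp [duhamel, discounted]
    rw [h2] at h1
    have h3 := (he0 t ht x).add (h1.const_mul (2 * c * m))
    rw [mul_zero, add_zero] at h3
    refine squeeze_zero (fun n => integral_nonneg fun _ => abs_nonneg _) (fun n => ?_) h3
    have := hpr n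
    exact average_dist_le hp hc hm0 (hW n) (hG n) (hWeq n) hw hgL hweq (hWmb n) hwmb t ht x
  have upper : ∀ B : Set (E d), volume B ≠ ⊤ → ∀ a, (∀ n, a ≤ L n) → a ≤
      nexp (ofReal H * ∫⁻ y, ofReal (w y.1 y.2) ∂(slab T B)) := by
    intro B hB a ha
    have hfin := isFiniteMeasure_slab T hB
    refine le_of_le_add_tendsto (ε := fun n => ofReal H *
      ∫⁻ y, ofReal (δ n y.1 y.2) ∂(slab T B)) (fun n => (ha n).trans ?_) ?_
    · have := hpr n
      have hDm : Measurable fun y : ℝ × (ℝ × E d) => |W n y.2.1 (y.2.2, y.1) - w y.2.1 y.2.2| :=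
        ((hWn n).sub (hwm.comp measurable_snd)).abs
      have h1 : ofReal H * ∫⁻ y, ofReal (δ n y.1 y.2) ∂(slab T B) =
          ∫⁻ z, ofReal H * ∫⁻ y, ofReal |W n y.1 (y.2, z) - w y.1 y.2| ∂(slab T B)
            ∂(unif (T / (n + 1))) := by
        rw [lintegral_const_mul' _ _ ENNReal.ofReal_ne_top,
          lintegral_lintegral_swap (f := fun z (y : ℝ × E d) =>
            ofReal |W n y.1 (y.2, z) - w y.1 y.2|) hDm.ennreal_ofReal.aemeasurable]
        congr 1
        refine lintegral_congr_ae ((ae_slab T B).mono fun y hy => ?_)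
        exact ofReal_integral_eq_lintegral_ofReal
          (((hW n).sub hw.lift).abs.integrable_section hy.1.le y.2)
          (ae_of_all _ fun z => abs_nonneg _)
      rw [hLeq, h1]
      set J := nexp (ofReal H * ∫⁻ y, ofReal (w y.1 y.2) ∂(slab T B)) with hJ
      have h2 : J + ∫⁻ z, ofReal H * ∫⁻ y, ofReal |W n y.1 (y.2, z) - w y.1 y.2|
          ∂(slab T B) ∂(unif (T / (n + 1))) = ∫⁻ z, (J + ofReal H *
            ∫⁻ y, ofReal |W n y.1 (y.2, z) - w y.1 y.2| ∂(slab T B))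
            ∂(unif (T / (n + 1))) := by
        rw [lintegral_add_left measurable_const]
        simp
      rw [h2]
      refine lintegral_mono fun z => ?_
      have hWz : Measurable fun y : ℝ × E d => W n y.1 (y.2, z) :=
        (hWn n).comp (measurable_const.prodMk measurable_id)
      refine (nexp_anti (mul_le_mul_right (lintegral_mono' (slab_le T B) le_rfl) _)).trans
        ((nexp_le_add _ (ofReal H * ∫⁻ y, ofReal |W n y.1 (y.2, z) - w y.1 y.2|
          ∂(slab T B))).trans ?_)
      gcongr
      refine nexp_anti ?_
      rw [← mul_add, ← lintegral_add_left hWz.ennreal_ofReal]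
      gcongr with y
      rw [← ENNReal.ofReal_add (hW0 n _ _) (abs_nonneg _)]
      refine ENNReal.ofReal_le_ofReal ?_
      have := neg_abs_le (W n y.1 (y.2, z) - w y.1 y.2)
      linarith
    · have h3 : Tendsto (fun n => ∫⁻ y, ofReal (δ n y.1 y.2) ∂(slab T B)) atTop
          (𝓝 (∫⁻ _, 0 ∂(slab T B))) := by
        refine tendsto_lintegral_of_dominated_convergence (fun _ => ofReal (2 * m))
          (fun n => (hδL n).meas.ennreal_ofReal)
          (fun n => (ae_slab T B).mono fun y hy => ENNReal.ofReal_le_ofReal ?_)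
          (by simp [ENNReal.mul_eq_top, measure_ne_top])
          ((ae_slab T B).mono fun y hy => ?_)
        · have := hpr n
          have hy' : y.1 ∈ Icc 0 T := Ioc_subset_Icc_self hy
          refine (le_abs_self _).trans (integral_abs_le_of_bound fun z => ?_)
          rw [abs_abs]
          refine (abs_sub _ _).trans ?_
          linarith [hWmb n y.1 hy' (y.2, z), hwmb y.1 hy' y.2]
        · rw [← ENNReal.ofReal_zero]
          exact (ENNReal.continuous_ofReal.tendsto 0).comp (hδ0 y.1 (Ioc_subset_Icc_self hy) y.2)
      rw [lintegral_zero] at h3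
      have := ENNReal.Tendsto.const_mul h3 (Or.inr (ENNReal.ofReal_ne_top (r := H)))
      rwa [mul_zero] at this
  refine le_antisymm ?_ (upperE _ lower)
  have h4 := ENNReal.Tendsto.const_mul (tendsto_lintegral_slab T hwm.ennreal_ofReal)
    (Or.inr (ENNReal.ofReal_ne_top (r := H)))
  refine ge_of_tendsto' ((continuous_nexp.tendsto _).comp h4) fun n => ?_
  exact upper _ (by exact measure_closedBall_lt_top.ne) _ lowerE

end Laplace

/-! ### Stationary limits of the branching equation -/

section Limits

variable {X : Type*} [MeasurableSpace X] {p : Kernel (ℝ × X) X}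

/-- Standing assumptions on the motion, the rates and the test function. -/
structure Setting (p : Kernel (ℝ × X) X) (Q c Φ : ℝ) (φ : X → ℝ) : Prop where
  hp : IsTransition p
  hQ : 0 < Q
  hc : 0 < c
  meas : Measurable φ
  nonneg : ∀ x, 0 ≤ φ x
  le : ∀ x, φ x ≤ Φ
  hΦ : 0 ≤ Φ

/-- The solution with constant source `θ φ`. -/
def bsol (p : Kernel (ℝ × X) X) (Q c : ℝ) (φ : X → ℝ) (θ : ℝ) : ℝ → X → ℝ :=
  Classical.epsilon (Branching p Q c (fun _ y => θ * φ y))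

/-- Its limit for large times. -/
def blim (p : Kernel (ℝ × X) X) (Q c : ℝ) (φ : X → ℝ) (x : X) (θ : ℝ) : ℝ :=
  limUnder atTop (fun t : ℝ => bsol p Q c φ θ t x)

namespace Setting

variable {Q c Φ a b θ : ℝ} {φ : X → ℝ}

lemma source_locBdd (h : Setting p Q c Φ φ) {r : ℝ → ℝ} (hr : Measurable r)
    (hab : ∀ s, -a ≤ r s ∧ r s ≤ b) : LocBdd (fun s y => r s * φ y) := by
  refine LocBdd.of_bound (C := max a b * Φ) ((hr.comp measurable_fst).mul
    (h.meas.comp measurable_snd)) fun s y => ?_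
  rw [abs_mul, abs_of_nonneg (h.nonneg y)]
  have h1 : |r s| ≤ max a b := abs_le.2 ⟨by linarith [(hab s).1, le_max_left a b],
    (hab s).2.trans (le_max_right _ _)⟩
  exact mul_le_mul h1 (h.le y) (h.nonneg y) ((abs_nonneg _).trans h1)

/-- Existence and uniform bounds for sources with values in `[-a φ, b φ]`. -/
lemma uniform (h : Setting p Q c Φ φ) (ha : 0 ≤ a) (hb : 0 ≤ b) (hbΦ : b * Φ < Q ^ 2 / (4 * c)) :
    ∃ B κ : ℝ, 0 < B ∧ 0 < κ ∧ ∀ r : ℝ → ℝ, Measurable r → (∀ s, -a ≤ r s ∧ r s ≤ b) →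
      (∃ v, Branching p Q c (fun s y => r s * φ y) v) ∧
      ∀ v, Branching p Q c (fun s y => r s * φ y) v → ∀ t, 0 ≤ t → ∀ x,
        |v t x| ≤ B ∧ 2 * c * v t x ≤ Q - κ := by
  have hΦ := h.hΦ
  obtain ⟨β, hβ, hβQ, hs⟩ := exists_subcritical_bound h.hQ h.hc (mul_nonneg hb hΦ) hbΦ
  have hsb : 0 ≤ max a b * Φ := mul_nonneg (ha.trans (le_max_left _ _)) hΦ
  have hQ := h.hQ
  have hsbQ : 0 ≤ max a b * Φ / Q := by positivity
  refine ⟨max a b * Φ / Q + β + 1, Q - 2 * c * β, by positivity, by linarith, fun r hr hab => ?_⟩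
  have hm : Measurable (Function.uncurry fun s y => r s * φ y) :=
    (hr.comp measurable_fst).mul (h.meas.comp measurable_snd)
  have habs : ∀ s y, |r s * φ y| ≤ max a b * Φ := fun s y => by
    rw [abs_mul, abs_of_nonneg (h.nonneg y)]
    exact mul_le_mul (abs_le.2 ⟨by linarith [(hab s).1, le_max_left a b],
      (hab s).2.trans (le_max_right _ _)⟩) (h.le y) (h.nonneg y) (ha.trans (le_max_left _ _))
  have hle : ∀ s y, r s * φ y ≤ b * Φ := fun s y =>
    (mul_le_mul_of_nonneg_right (hab s).2 (h.nonneg y)).trans (mul_le_mul_of_nonneg_left (h.le y) hb)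
  obtain ⟨v, hv, -⟩ := exists_branching h.hp h.hQ h.hc hβ hβQ hs.le hsb hm habs hle
  refine ⟨⟨v, hv⟩, fun v hv t ht x => ?_⟩
  obtain ⟨h1, h2⟩ := hv.bounds h.hp h.hQ h.hc hβ hβQ hs.le hsb hm habs hle ht x
  refine ⟨abs_le.2 ⟨by linarith, by linarith⟩, ?_⟩
  have := h.hc
  rw [sub_sub_cancel]
  gcongr

lemma sub_of_le (h : Setting p Q c Φ φ) (hθ : θ * Φ < Q ^ 2 / (4 * c)) :
    max θ 0 * Φ < Q ^ 2 / (4 * c) := by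
  have hQ := h.hQ
  have hc := h.hc
  rcases le_total θ 0 with h1 | h1
  · rw [max_eq_right h1, zero_mul]; positivity
  · rwa [max_eq_left h1]

lemma bsol_spec (h : Setting p Q c Φ φ) (hθ : θ * Φ < Q ^ 2 / (4 * c)) :
    Branching p Q c (fun _ y => θ * φ y) (bsol p Q c φ θ) := by
  obtain ⟨B, κ, -, -, H⟩ := h.uniform (a := max (-θ) 0) (le_max_right _ _) (le_max_right θ 0)
    (h.sub_of_le hθ)
  exact Classical.epsilon_spec (H (fun _ => θ) measurable_const fun s =>
    ⟨by linarith [le_max_left (-θ) 0], le_max_left _ _⟩).1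

/-- Restarting a solution at time `τ`. -/
lemma restart_eq (h : Setting p Q c Φ φ) {r r' : ℝ → ℝ} {v v' : ℝ → X → ℝ} {τ T : ℝ} (hτ : 0 ≤ τ)
    (hr : LocBdd (fun s y => r s * φ y)) (hr' : LocBdd (fun s y => r' s * φ y))
    (hv : Branching p Q c (fun s y => r s * φ y) v)
    (hv' : Branching p Q c (fun s y => r' s * φ y) v')
    (heq : ∀ s ∈ Ioo 0 T, r (τ + s) = r' s) {t : ℝ} (ht : t ∈ Icc 0 T) (x : X) :
    v (τ + t) x - v' t x = discounted p Q t (v τ) x +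
      duhamel p Q (fun s y => (c * (v (τ + s) y + v' s y)) * (v (τ + s) y - v' s y)) t x := by
  have hk : LocBdd (fun s y => r s * φ y + c * v s y ^ 2) := hr.add (hv.locBdd.sq.const_mul c)
  have h1 : v τ = duhamel p Q (fun s y => r s * φ y + c * v s y ^ 2) τ := funext (hv.eq τ hτ)
  rw [hv.eq _ (add_nonneg hτ ht.1), duhamel_restart h.hp Q hk ht.1 hτ, ← h1, hv'.eq t ht.1,
    add_sub_assoc, ← duhamel_sub h.hp Q (hk.shift hτ) (hr'.add (hv'.locBdd.sq.const_mul c))]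
  congr 1
  refine duhamel_congr p Q (fun s hs y => ?_) x
  rw [heq s ⟨hs.1, hs.2.trans_le ht.2⟩]
  ring

/-- While the sources agree, the difference solves a linear equation with potential c(v + v') ≤ Q -
κ, so the value at the restart is forgotten at rate κ. -/
lemma restart_dist (h : Setting p Q c Φ φ) {B κ : ℝ} {r r' : ℝ → ℝ} {v v' : ℝ → X → ℝ} {τ T : ℝ}
    (hτ : 0 ≤ τ) (hr : LocBdd (fun s y => r s * φ y)) (hr' : LocBdd (fun s y => r' s * φ y))
    (hv : Branching p Q c (fun s y => r s * φ y) v)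
    (hv' : Branching p Q c (fun s y => r' s * φ y) v')
    (hvB : ∀ t, 0 ≤ t → ∀ x, |v t x| ≤ B ∧ 2 * c * v t x ≤ Q - κ)
    (hvB' : ∀ t, 0 ≤ t → ∀ x, |v' t x| ≤ B ∧ 2 * c * v' t x ≤ Q - κ)
    (heq : ∀ s ∈ Ioo 0 T, r (τ + s) = r' s) {t : ℝ} (ht : t ∈ Icc 0 T) (x : X) :
    |v (τ + t) x - v' t x| ≤ B * exp (-κ * t) :=
  mild_decay h.hp Q κ ((hv.locBdd.shift hτ).sub hv'.locBdd)
    (((hv.locBdd.shift hτ).add hv'.locBdd).const_mul c) (hv.locBdd.meas_right τ)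
    (fun x => (hvB τ hτ x).1) (fun t ht x => by
      have h1 := (hvB (τ + t) (add_nonneg hτ ht.1) x).2
      have h2 := (hvB' t ht.1 x).2
      linarith)
    (fun _ ht x => h.restart_eq hτ hr hr' hv hv' heq ht x) t ht x

/-- Solutions converge to the stationary limit exponentially fast while the source is constant. -/
lemma dist_blim (h : Setting p Q c Φ φ) (ha : 0 ≤ a) (hb : 0 ≤ b)
    (hbΦ : b * Φ < Q ^ 2 / (4 * c)) :
    ∃ B κ : ℝ, 0 < B ∧ 0 < κ ∧ (∀ θ ∈ Icc (-a) b, ∀ x, |blim p Q c φ x θ| ≤ B) ∧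
      (∀ θ ∈ Icc (-a) b, ∀ x, Tendsto (fun t => bsol p Q c φ θ t x) atTop (𝓝 (blim p Q c φ x θ))) ∧
      (∀ θ ∈ Icc (-a) b, ∀ t, 0 ≤ t → ∀ x,
        |bsol p Q c φ θ t x| ≤ B ∧ 2 * c * bsol p Q c φ θ t x ≤ Q - κ) ∧
      ∀ r : ℝ → ℝ, Measurable r → (∀ s, -a ≤ r s ∧ r s ≤ b) → ∀ v,
        Branching p Q c (fun s y => r s * φ y) v →
        ∀ θ τ T, 0 ≤ τ → (∀ s ∈ Ioo τ T, r s = θ) → θ ∈ Icc (-a) b →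
        ∀ t ∈ Icc τ T, ∀ x, |v t x - blim p Q c φ x θ| ≤ 2 * B * exp (-κ * (t - τ)) := by
  obtain ⟨B, κ, hB, hκ, H⟩ := h.uniform ha hb hbΦ
  have hsp : ∀ θ ∈ Icc (-a) b, Branching p Q c (fun _ y => θ * φ y) (bsol p Q c φ θ) :=
    fun θ hθ => h.bsol_spec ((mul_le_mul_of_nonneg_right hθ.2 h.hΦ).trans_lt hbΦ)
  have hL : ∀ θ ∈ Icc (-a) b, LocBdd (fun (_ : ℝ) y => θ * φ y) := fun θ hθ =>
    h.source_locBdd (r := fun _ => θ) measurable_const fun _ => hθ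
  have hbd : ∀ θ ∈ Icc (-a) b, ∀ t, 0 ≤ t → ∀ x,
      |bsol p Q c φ θ t x| ≤ B ∧ 2 * c * bsol p Q c φ θ t x ≤ Q - κ := fun θ hθ =>
    (H (fun _ => θ) measurable_const fun _ => hθ).2 _ (hsp θ hθ)
  have hexp : Tendsto (fun t : ℝ => B * exp (-κ * t)) atTop (𝓝 0) := by
    have := (Real.tendsto_exp_neg_atTop_nhds_zero.comp (tendsto_id.const_mul_atTop hκ)).const_mul B
    rw [mul_zero] at this
    refine this.congr fun t => ?_
    simp
  have hd : ∀ θ ∈ Icc (-a) b, ∀ τ, 0 ≤ τ → ∀ t, 0 ≤ t → ∀ x,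
      |bsol p Q c φ θ (τ + t) x - bsol p Q c φ θ t x| ≤ B * exp (-κ * t) :=
    fun θ hθ τ hτ t ht x => h.restart_dist hτ (r := fun _ => θ) (r' := fun _ => θ) (hL θ hθ)
      (hL θ hθ) (hsp θ hθ) (hsp θ hθ) (hbd θ hθ) (hbd θ hθ) (fun _ _ => rfl) (T := t)
      ⟨ht, le_rfl⟩ x
  have hlim : ∀ θ ∈ Icc (-a) b, ∀ x,
      Tendsto (fun t => bsol p Q c φ θ t x) atTop (𝓝 (blim p Q c φ x θ)) := by
    intro θ hθ x
    refine tendsto_nhds_limUnder ?_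
    refine cauchy_map_iff_exists_tendsto.1 (Metric.cauchy_iff.2 ⟨inferInstance, fun ε hε => ?_⟩)
    obtain ⟨t₀, ht₀⟩ := ((hexp.eventually_lt_const (half_pos hε)).and
      (eventually_ge_atTop 0)).exists
    refine ⟨(fun t => bsol p Q c φ θ t x) '' Ici t₀, image_mem_map (Ici_mem_atTop t₀), ?_⟩
    rintro _ ⟨s, hs, rfl⟩ _ ⟨t, ht, rfl⟩
    have h1 := hd θ hθ (s - t₀) (sub_nonneg.2 hs) t₀ ht₀.2 x
    have h2 := hd θ hθ (t - t₀) (sub_nonneg.2 ht) t₀ ht₀.2 x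
    rw [sub_add_cancel] at h1 h2
    rw [Real.dist_eq]
    have h3 : bsol p Q c φ θ s x - bsol p Q c φ θ t x =
      (bsol p Q c φ θ s x - bsol p Q c φ θ t₀ x) - (bsol p Q c φ θ t x - bsol p Q c φ θ t₀ x) := by
      ring
    rw [h3]
    refine (abs_sub _ _).trans_lt ?_
    linarith [ht₀.1]
  have hd2 : ∀ θ ∈ Icc (-a) b, ∀ t, 0 ≤ t → ∀ x,
      |bsol p Q c φ θ t x - blim p Q c φ x θ| ≤ B * exp (-κ * t) := by
    intro θ hθ t ht x
    have h1 : Tendsto (fun τ : ℝ => |bsol p Q c φ θ t x - bsol p Q c φ θ (τ + t) x|) atTop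
        (𝓝 |bsol p Q c φ θ t x - blim p Q c φ x θ|) :=
      (tendsto_const_nhds.sub ((hlim θ hθ x).comp (tendsto_atTop_add_const_right _ t tendsto_id))).abs
    refine le_of_tendsto h1 ((eventually_ge_atTop 0).mono fun τ hτ => ?_)
    rw [abs_sub_comm]
    exact hd θ hθ τ hτ t ht x
  refine ⟨B, κ, hB, hκ, fun θ hθ x => le_of_tendsto (hlim θ hθ x).abs
    ((eventually_ge_atTop 0).mono fun t ht => (hbd θ hθ t ht x).1), hlim, hbd, ?_⟩
  intro r hr hab v hv θ τ T hτ heq hθ t ht x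
  have h1 := h.restart_dist hτ (r' := fun _ => θ) (T := T - τ) (h.source_locBdd hr hab) (hL θ hθ) hv
    (hsp θ hθ) ((H r hr hab).2 v hv) (hbd θ hθ)
    (fun s hs => heq _ ⟨by linarith [hs.1], by linarith [hs.2]⟩) (t := t - τ)
    ⟨sub_nonneg.2 ht.1, by linarith [ht.2]⟩ x
  rw [add_sub_cancel] at h1
  have h2 := hd2 θ hθ (t - τ) (sub_nonneg.2 ht.1) x
  calc |v t x - blim p Q c φ x θ| ≤ |v t x - bsol p Q c φ θ (t - τ) x| +
        |bsol p Q c φ θ (t - τ) x - blim p Q c φ x θ| := abs_sub_le _ _ _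
    _ ≤ _ := by linarith

lemma tendsto_bsol (h : Setting p Q c Φ φ) (hθ : θ * Φ < Q ^ 2 / (4 * c)) (x : X) :
    Tendsto (fun t => bsol p Q c φ θ t x) atTop (𝓝 (blim p Q c φ x θ)) := by
  obtain ⟨B, κ, -, -, -, H, -⟩ := h.dist_blim (a := max (-θ) 0) (le_max_right _ _) (le_max_right θ 0)
    (h.sub_of_le hθ)
  exact H θ ⟨by linarith [le_max_left (-θ) 0], le_max_left _ _⟩ x

lemma measurable_blim (h : Setting p Q c Φ φ) (hθ : θ * Φ < Q ^ 2 / (4 * c)) :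
    Measurable (fun x => blim p Q c φ x θ) := by
  refine measurable_of_tendsto_metrizable (f := fun (n : ℕ) x => bsol p Q c φ θ n x)
    (fun n => (h.bsol_spec hθ).locBdd.meas_right _) (tendsto_pi_nhds.2 fun x => ?_)
  exact (h.tendsto_bsol hθ x).comp tendsto_natCast_atTop_atTop

lemma const_locBdd (h : Setting p Q c Φ φ) (θ : ℝ) : LocBdd (fun (_ : ℝ) y => θ * φ y) :=
  h.source_locBdd (r := fun _ => θ) (a := -θ) (b := θ) measurable_const fun _ => by simp

lemma bsol_zero (h : Setting p Q c Φ φ) {t : ℝ} (ht : 0 ≤ t) (x : X) : bsol p Q c φ 0 t x = 0 := by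
  have hQ := h.hQ
  have hc := h.hc
  have h0 : Branching p Q c (fun _ y => 0 * φ y) (fun _ _ => 0) := by
    simpa only [zero_mul] using Branching.zero p Q c
  exact Branching.unique h.hp (h.const_locBdd 0) (h.bsol_spec (by rw [zero_mul]; positivity)) h0 ht x

lemma blim_zero (h : Setting p Q c Φ φ) (x : X) : blim p Q c φ x 0 = 0 := by
  have hQ := h.hQ
  have hc := h.hc
  refine tendsto_nhds_unique (h.tendsto_bsol (by rw [zero_mul]; positivity) x) ?_
  exact tendsto_const_nhds.congr' ((eventually_ge_atTop 0).mono fun t ht => (h.bsol_zero ht x).symm)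

lemma lt_of_le (h : Setting p Q c Φ φ) (hb : b * Φ < Q ^ 2 / (4 * c)) (hθ : θ ≤ b) :
    θ * Φ < Q ^ 2 / (4 * c) := (mul_le_mul_of_nonneg_right hθ h.hΦ).trans_lt hb

lemma bsol_mono (h : Setting p Q c Φ φ) (hb : b * Φ < Q ^ 2 / (4 * c)) (hθ : θ ≤ b) {t : ℝ}
    (ht : 0 ≤ t) (x : X) : bsol p Q c φ θ t x ≤ bsol p Q c φ b t x :=
  Branching.mono h.hp (h.const_locBdd θ) (h.const_locBdd b) (h.bsol_spec (h.lt_of_le hb hθ))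
    (h.bsol_spec hb) ht (fun _ _ y => mul_le_mul_of_nonneg_right hθ (h.nonneg y)) x

lemma blim_mono (h : Setting p Q c Φ φ) (hb : b * Φ < Q ^ 2 / (4 * c)) (hθ : θ ≤ b) (x : X) :
    blim p Q c φ x θ ≤ blim p Q c φ x b :=
  le_of_tendsto_of_tendsto (h.tendsto_bsol (h.lt_of_le hb hθ) x) (h.tendsto_bsol hb x)
    ((eventually_ge_atTop 0).mono fun _ ht => h.bsol_mono hb hθ ht x)

lemma neg_sub (h : Setting p Q c Φ φ) (ha : 0 ≤ a) : -a * Φ < Q ^ 2 / (4 * c) := by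
  have hQ := h.hQ
  have hc := h.hc
  have : 0 < Q ^ 2 / (4 * c) := by positivity
  nlinarith [mul_nonneg ha h.hΦ]

lemma blim_nonneg (h : Setting p Q c Φ φ) (hb : b * Φ < Q ^ 2 / (4 * c)) (hb0 : 0 ≤ b) (x : X) :
    0 ≤ blim p Q c φ x b := h.blim_zero x ▸ h.blim_mono hb hb0 x

lemma blim_nonpos (h : Setting p Q c Φ φ) (hθ : θ ≤ 0) (x : X) : blim p Q c φ x θ ≤ 0 := by
  have := h.neg_sub (le_refl 0)
  rw [neg_zero] at this
  exact h.blim_zero x ▸ h.blim_mono this hθ x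

/-- Nonnegative constant sources give solutions increasing in time, nonpositive ones give
decreasing solutions. -/
lemma bsol_envelope (h : Setting p Q c Φ φ) (hθ : θ * Φ < Q ^ 2 / (4 * c)) {t : ℝ}
    (ht : 0 ≤ t) (x : X) : (0 ≤ θ → bsol p Q c φ θ t x ≤ blim p Q c φ x θ) ∧
      (θ ≤ 0 → blim p Q c φ x θ ≤ bsol p Q c φ θ t x) := by
  have hs := h.bsol_spec hθ
  have hL := h.const_locBdd θ
  have hQ := h.hQ
  have hc := h.hc
  have h0 : (0 : ℝ) * Φ < Q ^ 2 / (4 * c) := by rw [zero_mul]; positivity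
  have hlim : ∀ x, Tendsto (fun τ : ℝ => bsol p Q c φ θ (τ + t) x) atTop
      (𝓝 (blim p Q c φ x θ)) := fun x =>
    (h.tendsto_bsol hθ x).comp (tendsto_atTop_add_const_right _ t tendsto_id)
  have key : ∀ τ, 0 ≤ τ → ∀ s ∈ Icc 0 t, ∀ x, bsol p Q c φ θ (τ + s) x - bsol p Q c φ θ s x =
      discounted p Q s (bsol p Q c φ θ τ) x + duhamel p Q (fun s y => (c * (bsol p Q c φ θ (τ + s) y +
        bsol p Q c φ θ s y)) * (bsol p Q c φ θ (τ + s) y - bsol p Q c φ θ s y)) s x :=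
    fun τ hτ s hs' x => h.restart_eq hτ (r := fun _ => θ) (r' := fun _ => θ) hL hL hs hs
      (fun _ _ => rfl) hs' x
  constructor
  · intro hθ0
    refine ge_of_tendsto (hlim x) ((eventually_ge_atTop 0).mono fun τ hτ => ?_)
    obtain ⟨C, -, hC⟩ := hs.locBdd.bound τ
    have := nonneg_of_mild h.hp Q ((hs.locBdd.shift hτ).sub hs.locBdd)
      (((hs.locBdd.shift hτ).add hs.locBdd).const_mul c) (LocBdd.const 0) (hs.locBdd.meas_right τ)
      (hC τ ⟨hτ, le_rfl⟩) (fun y => h.bsol_zero hτ y ▸ h.bsol_mono hθ hθ0 hτ y) (T := t)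
      (fun _ _ _ => le_rfl) (fun s hs' y => by simpa only [add_zero] using key τ hτ s hs' y)
      t ⟨ht, le_rfl⟩ x
    linarith
  · intro hθ0
    refine le_of_tendsto (hlim x) ((eventually_ge_atTop 0).mono fun τ hτ => ?_)
    obtain ⟨C, -, hC⟩ := hs.locBdd.bound τ
    have hm := hs.locBdd.meas_right τ
    have := nonneg_of_mild h.hp Q ((hs.locBdd.shift hτ).sub hs.locBdd).neg
      (((hs.locBdd.shift hτ).add hs.locBdd).const_mul c) (LocBdd.const 0)
      (f := fun y => -bsol p Q c φ θ τ y) hm.neg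
      (fun y => by rw [abs_neg]; exact hC τ ⟨hτ, le_rfl⟩ y)
      (fun y => neg_nonneg.2 (h.bsol_zero hτ y ▸ h.bsol_mono h0 hθ0 hτ y)) (T := t)
      (fun _ _ _ => le_rfl) (fun s hs' y => by
        rw [key τ hτ s hs' y, neg_add, ← duhamel_neg]
        congr 1
        · simp only [discounted, integral_neg]; ring
        · congr 1
          funext s y
          ring) t ⟨ht, le_rfl⟩ x
    linarith

/-- Comparison with the constant parameters -a and b, whose solutions are monotone in time and hence
lie within their stationary limits. The bounds do not depend on time and serve as dominating
functions. -/
lemma envelope (h : Setting p Q c Φ φ) (ha : 0 ≤ a) (hb : 0 ≤ b) (hbΦ : b * Φ < Q ^ 2 / (4 * c))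
    {r : ℝ → ℝ} (hr : Measurable r) (hab : ∀ s, -a ≤ r s ∧ r s ≤ b) {v : ℝ → X → ℝ}
    (hv : Branching p Q c (fun s y => r s * φ y) v) {t : ℝ} (ht : 0 ≤ t) (x : X) :
    blim p Q c φ x (-a) ≤ v t x ∧ v t x ≤ blim p Q c φ x b := by
  have hL := h.source_locBdd hr hab
  constructor
  · refine ((h.bsol_envelope (h.neg_sub ha) ht x).2 (by linarith)).trans ?_
    exact Branching.mono h.hp (h.const_locBdd _) hL (h.bsol_spec (h.neg_sub ha)) hv ht
      (fun s _ y => mul_le_mul_of_nonneg_right (hab s).1 (h.nonneg y)) x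
  · refine le_trans ?_ ((h.bsol_envelope hbΦ ht x).1 hb)
    exact Branching.mono h.hp hL (h.const_locBdd _) hv (h.bsol_spec hbΦ) ht
      (fun s _ y => mul_le_mul_of_nonneg_right (hab s).2 (h.nonneg y)) x

/-- The deviation from linearity in the parameter. -/
lemma convex_eq (h : Setting p Q c Φ φ) {θ₁ θ₂ l : ℝ} (h₁ : θ₁ * Φ < Q ^ 2 / (4 * c))
    (h₂ : θ₂ * Φ < Q ^ 2 / (4 * c)) (h₃ : (l * θ₁ + (1 - l) * θ₂) * Φ < Q ^ 2 / (4 * c)) {t : ℝ}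
    (ht : 0 ≤ t) (x : X) :
    l * bsol p Q c φ θ₁ t x + (1 - l) * bsol p Q c φ θ₂ t x -
      bsol p Q c φ (l * θ₁ + (1 - l) * θ₂) t x =
    duhamel p Q (fun s y => c * (l * bsol p Q c φ θ₁ s y + (1 - l) * bsol p Q c φ θ₂ s y +
      bsol p Q c φ (l * θ₁ + (1 - l) * θ₂) s y) * (l * bsol p Q c φ θ₁ s y +
        (1 - l) * bsol p Q c φ θ₂ s y - bsol p Q c φ (l * θ₁ + (1 - l) * θ₂) s y) +
      c * (l * (1 - l)) * (bsol p Q c φ θ₁ s y - bsol p Q c φ θ₂ s y) ^ 2) t x := by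
  have e₁ := h.bsol_spec h₁
  have e₂ := h.bsol_spec h₂
  have e₃ := h.bsol_spec h₃
  have l₁ := (h.const_locBdd θ₁).add (e₁.locBdd.sq.const_mul c)
  have l₂ := (h.const_locBdd θ₂).add (e₂.locBdd.sq.const_mul c)
  rw [e₁.eq t ht x, e₂.eq t ht x, e₃.eq t ht x, ← duhamel_const_mul, ← duhamel_const_mul,
    ← duhamel_add h.hp Q (l₁.const_mul l) (l₂.const_mul (1 - l)),
    ← duhamel_sub h.hp Q ((l₁.const_mul l).add (l₂.const_mul (1 - l)))
      ((h.const_locBdd _).add (e₃.locBdd.sq.const_mul c))]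
  congr 1
  funext s y
  ring

/-- In `convex_eq` the source c l(1 - l)(v₁ - v₂)² is nonnegative, hence so is the deviation from
linearity. -/
lemma blim_convex (h : Setting p Q c Φ φ) {θ₁ θ₂ l : ℝ} (h₁ : θ₁ * Φ < Q ^ 2 / (4 * c))
    (h₂ : θ₂ * Φ < Q ^ 2 / (4 * c)) (hl : l ∈ Icc (0 : ℝ) 1) (x : X) :
    blim p Q c φ x (l * θ₁ + (1 - l) * θ₂) ≤
      l * blim p Q c φ x θ₁ + (1 - l) * blim p Q c φ x θ₂ := by
  have hl' : 0 ≤ 1 - l := sub_nonneg.2 hl.2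
  have h₃ : (l * θ₁ + (1 - l) * θ₂) * Φ < Q ^ 2 / (4 * c) := by
    refine h.lt_of_le (b := max θ₁ θ₂) ?_ ?_
    · rcases max_choice θ₁ θ₂ with e | e <;> rw [e] <;> assumption
    · nlinarith [le_max_left θ₁ θ₂, le_max_right θ₁ θ₂, hl.1]
  have e₁ := (h.bsol_spec h₁).locBdd
  have e₂ := (h.bsol_spec h₂).locBdd
  have e₃ := (h.bsol_spec h₃).locBdd
  have e := (e₁.const_mul l).add (e₂.const_mul (1 - l))
  refine le_of_tendsto_of_tendsto (h.tendsto_bsol h₃ x) (((h.tendsto_bsol h₁ x).const_mul l).add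
    ((h.tendsto_bsol h₂ x).const_mul (1 - l))) ((eventually_ge_atTop 0).mono fun t ht => ?_)
  have := nonneg_of_mild_zero h.hp Q (e.sub e₃) ((e.add e₃).const_mul c)
    ((e₁.sub e₂).sq.const_mul (c * (l * (1 - l)))) (T := t)
    (fun s _ y => mul_nonneg (mul_nonneg h.hc.le (mul_nonneg hl.1 hl')) (sq_nonneg _))
    (fun s hs y => h.convex_eq h₁ h₂ h₃ hs.1 y) t ⟨ht, le_rfl⟩ x
  linarith

/-- Both bounds hold at finite times by `mild_source_bound`. The difference of two solutions has
source (θ₁ - θ₂)φ. The midpoint deviation has source (c/4)(v₁ - v₂)², which is of order s² by the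
first bound; this is what makes the limit differentiable in θ. -/
lemma blim_lipschitz (h : Setting p Q c Φ φ) (ha : 0 ≤ a) (hb : 0 ≤ b)
    (hbΦ : b * Φ < Q ^ 2 / (4 * c)) : ∃ C : ℝ, 0 ≤ C ∧
      (∀ θ₁ ∈ Icc (-a) b, ∀ θ₂ ∈ Icc (-a) b, ∀ x,
        |blim p Q c φ x θ₁ - blim p Q c φ x θ₂| ≤ C * |θ₁ - θ₂|) ∧
      ∀ θ s, θ + s ∈ Icc (-a) b → θ - s ∈ Icc (-a) b → ∀ x,
        blim p Q c φ x (θ + s) + blim p Q c φ x (θ - s) - 2 * blim p Q c φ x θ ≤ C * s ^ 2 := by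
  obtain ⟨B, κ, hB, hκ, -, -, hbd, -⟩ := h.dist_blim ha hb hbΦ
  have hc := h.hc
  have hΦ := h.hΦ
  have lip : ∀ θ₁ ∈ Icc (-a) b, ∀ θ₂ ∈ Icc (-a) b, ∀ t, 0 ≤ t → ∀ x,
      |bsol p Q c φ θ₁ t x - bsol p Q c φ θ₂ t x| ≤ |θ₁ - θ₂| * Φ / κ := by
    intro θ₁ h₁ θ₂ h₂ t ht x
    have s₁ := h.bsol_spec (h.lt_of_le hbΦ h₁.2)
    have s₂ := h.bsol_spec (h.lt_of_le hbΦ h₂.2)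
    refine mild_source_bound (l := Q) h.hp hκ (s₁.locBdd.sub s₂.locBdd)
      ((s₁.locBdd.add s₂.locBdd).const_mul c) ((h.const_locBdd θ₁).sub (h.const_locBdd θ₂))
      (T := t) (by positivity) (fun s _ y => ?_) (fun s hs y => ?_)
      (fun s hs y => Branching.sub_eq h.hp (h.const_locBdd θ₁) (h.const_locBdd θ₂) s₁ s₂ hs.1 y)
      t ⟨ht, le_rfl⟩ x
    · rw [← sub_mul, abs_mul, abs_of_nonneg (h.nonneg y)]
      exact mul_le_mul_of_nonneg_left (h.le y) (abs_nonneg _)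
    · linarith [(hbd θ₁ h₁ s hs.1 y).2, (hbd θ₂ h₂ s hs.1 y).2]
  have hC1 : 0 ≤ Φ / κ := by positivity
  have hC2 : 0 ≤ 2 * (c * (2 * (Φ / κ)) ^ 2 / κ) := by positivity
  refine ⟨Φ / κ + 2 * (c * (2 * (Φ / κ)) ^ 2 / κ), by positivity, fun θ₁ h₁ θ₂ h₂ x => ?_,
    fun θ s h₁ h₂ x => ?_⟩
  · have h1 := (((h.tendsto_bsol (h.lt_of_le hbΦ h₁.2) x).sub
      (h.tendsto_bsol (h.lt_of_le hbΦ h₂.2) x)).abs)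
    refine (le_of_tendsto h1 ((eventually_ge_atTop 0).mono fun t ht => lip θ₁ h₁ θ₂ h₂ t ht x)).trans
      ?_
    rw [mul_div_assoc, mul_comm]
    exact mul_le_mul_of_nonneg_right (by linarith) (abs_nonneg _)
  · have hθ : (1 / 2 : ℝ) * (θ + s) + (1 - 1 / 2) * (θ - s) = θ := by ring
    have hθm : θ ∈ Icc (-a) b := ⟨by linarith [h₁.1, h₂.1], by linarith [h₁.2, h₂.2]⟩
    have b₁ := h.lt_of_le hbΦ h₁.2
    have b₂ := h.lt_of_le hbΦ h₂.2
    have b₃ := h.lt_of_le hbΦ hθm.2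
    have e₁ := (h.bsol_spec b₁).locBdd
    have e₂ := (h.bsol_spec b₂).locBdd
    have e₃ := (h.bsol_spec b₃).locBdd
    have e := (e₁.const_mul (1 / 2)).add (e₂.const_mul (1 - 1 / 2))
    have h1 := ((h.tendsto_bsol b₁ x).const_mul (1 / 2 : ℝ)).add
      ((h.tendsto_bsol b₂ x).const_mul (1 - 1 / 2 : ℝ)) |>.sub (h.tendsto_bsol b₃ x)
    have h2 := le_of_tendsto h1 (b := c * (2 * (Φ / κ)) ^ 2 * s ^ 2 / κ)
      ((eventually_ge_atTop 0).mono fun t ht => (le_abs_self _).trans (mild_source_bound (l := Q) h.hp hκ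
        (e.sub e₃) ((e.add e₃).const_mul c)
        ((e₁.sub e₂).sq.const_mul (c * (1 / 2 * (1 - 1 / 2)))) (T := t)
        (by positivity) (fun r hr y => ?_) (fun r hr y => ?_) (fun r hr y => ?_) t ⟨ht, le_rfl⟩ x))
    · have h3 : 0 ≤ Φ / κ * s ^ 2 := by positivity
      have h4 : c * (2 * (Φ / κ)) ^ 2 * s ^ 2 / κ = c * (2 * (Φ / κ)) ^ 2 / κ * s ^ 2 := by ring
      rw [h4] at h2
      linarith
    · have h3 := lip _ h₁ _ h₂ r hr.1 y
      have h4 : θ + s - (θ - s) = 2 * s := by ring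
      have h5 : |2 * s| * Φ / κ = 2 * (Φ / κ) * |s| := by rw [abs_mul, abs_two]; ring
      rw [h4, h5] at h3
      rw [abs_of_nonneg (by positivity), ← sq_abs (_ - _)]
      have h6 := pow_le_pow_left₀ (abs_nonneg _) h3 2
      rw [mul_pow, sq_abs s] at h6
      have h7 := mul_le_mul_of_nonneg_left h6 hc.le
      have h8 := mul_nonneg hc.le (sq_nonneg |bsol p Q c φ (θ + s) r y - bsol p Q c φ (θ - s) r y|)
      nlinarith
    · linarith [(hbd _ h₁ r hr.1 y).2, (hbd _ h₂ r hr.1 y).2, (hbd _ hθm r hr.1 y).2]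
    · have := h.convex_eq (l := 1 / 2) b₁ b₂ (by rw [hθ]; exact b₃) hr.1 y
      rw [hθ] at this
      exact this

/-- The limit grows at most like a square root for negative parameters. -/
lemma blim_lower (h : Setting p Q c Φ φ) {u : ℝ} (hu : 0 ≤ u) (x : X) :
    -Real.sqrt (u * Φ / c) ≤ blim p Q c φ x (-u) := by
  have hc := h.hc
  have hQ := h.hQ
  have hΦ := h.hΦ
  have hs := h.bsol_spec (h.neg_sub hu)
  -- Since c m² = uΦ, the constant -m is a subsolution: the source of m + v is Qm + (c m² - uφ) ≥ 0.
  set m := Real.sqrt (u * Φ / c) with hm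
  have hm0 : 0 ≤ m := Real.sqrt_nonneg _
  have hm2 : c * m ^ 2 = u * Φ := by rw [hm, Real.sq_sqrt (by positivity)]; field_simp
  refine ge_of_tendsto (h.tendsto_bsol (h.neg_sub hu) x) ((eventually_ge_atTop 0).mono fun t ht => ?_)
  have hsrc := (h.const_locBdd (-u)).add (hs.locBdd.sq.const_mul c)
  have := nonneg_of_mild h.hp Q (D := fun t x => m + bsol p Q c φ (-u) t x)
    (w := fun t x => c * (bsol p Q c φ (-u) t x - m)) (k := fun _ x => Q * m + (c * m ^ 2 - u * φ x))
    ((LocBdd.const m).add hs.locBdd) ((hs.locBdd.sub (LocBdd.const m)).const_mul c)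
    ((LocBdd.const (Q * m)).add ((LocBdd.const (c * m ^ 2)).sub (h.const_locBdd u)))
    (f := fun _ => m) measurable_const (Cf := m) (fun _ => (abs_of_nonneg hm0).le) (fun _ => hm0)
    (T := t) (fun s _ y => by
      have := mul_le_mul_of_nonneg_left (h.le y) hu
      rw [hm2]
      have := mul_nonneg hQ.le hm0
      linarith) (fun s hs' y => by
      have h1 : discounted p Q s (fun _ => m) y = exp (-Q * s) * m := by
        have := h.hp.isMarkovKernel
        simp [discounted]
      have h2 := duhamel_const h.hp Q m hs'.1 y
      rw [← duhamel_const_mul] at h2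
      rw [h1, hs.eq s hs'.1 y]
      have h3 : (fun (s : ℝ) (y : X) => c * (bsol p Q c φ (-u) s y - m) *
          (m + bsol p Q c φ (-u) s y) + (Q * m + (c * m ^ 2 - u * φ y))) =
          fun s y => Q * m + (-u * φ y + c * bsol p Q c φ (-u) s y ^ 2) := by
        funext s y
        ring
      rw [h3, duhamel_add h.hp Q (LocBdd.const _) hsrc, h2]
      ring) t ⟨ht, le_rfl⟩ x
  linarith

end Setting

end Limits

/-! ### Convexity in the parameter -/

section Slope

variable {X : Type*} [MeasurableSpace X] {p : Kernel (ℝ × X) X} {Q c Φ a b θ : ℝ} {φ : X → ℝ}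

/-- A convex function has one-sided derivatives in the interior. The second difference divided by t
bounds the gap between them, and here it is O(t). -/
lemma differentiableAt_of_convexOn_of_le {f : ℝ → ℝ} {s : Set ℝ} {x C : ℝ} (hf : ConvexOn ℝ s f)
    (hx : x ∈ interior s)
    (h : ∀ᶠ t in 𝓝[>] (0 : ℝ), f (x + t) + f (x - t) - 2 * f x ≤ C * t ^ 2) :
    DifferentiableAt ℝ f x := by
  have hR := hf.hasDerivWithinAt_rightDeriv_of_mem_interior hx
  have hL := hf.hasDerivWithinAt_leftDeriv_of_mem_interior hx
  have hs : s ∈ 𝓝 x := mem_interior_iff_mem_nhds.1 hx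
  have t1 : Tendsto (fun t : ℝ => x + t) (𝓝[>] 0) (𝓝 x) := by
    have : Tendsto (fun t : ℝ => x + t) (𝓝 0) (𝓝 (x + 0)) :=
      Continuous.tendsto (by fun_prop) 0
    rw [add_zero] at this
    exact this.mono_left nhdsWithin_le_nhds
  have t2 : Tendsto (fun t : ℝ => x - t) (𝓝[>] 0) (𝓝 x) := by
    have : Tendsto (fun t : ℝ => x - t) (𝓝 0) (𝓝 (x - 0)) :=
      Continuous.tendsto (by fun_prop) 0
    rw [sub_zero] at this
    exact this.mono_left nhdsWithin_le_nhds
  have key : derivWithin f (Ioi x) x - derivWithin f (Iio x) x ≤ 0 := by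
    have t3 : Tendsto (fun t : ℝ => C * t) (𝓝[>] 0) (𝓝 0) := by
      have : Tendsto (fun t : ℝ => C * t) (𝓝 0) (𝓝 (C * 0)) :=
      Continuous.tendsto (by fun_prop) 0
      rw [mul_zero] at this
      exact this.mono_left nhdsWithin_le_nhds
    refine ge_of_tendsto t3 ?_
    filter_upwards [h, t1 hs, t2 hs, self_mem_nhdsWithin] with t ht h1 h2 (h0 : 0 < t)
    have e1 := hf.rightDeriv_le_slope_of_mem_interior hx h1 (by linarith)
    have e2 := hf.slope_le_leftDeriv_of_mem_interior h2 hx (by linarith)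
    rw [slope_def_field] at e1 e2
    have e3 : (f (x + t) - f x) / (x + t - x) - (f x - f (x - t)) / (x - (x - t)) ≤ C * t := by
      rw [add_sub_cancel_left, sub_sub_cancel, ← sub_div, div_le_iff₀ h0]
      nlinarith
    linarith
  have e : derivWithin f (Ioi x) x = derivWithin f (Iio x) x :=
    le_antisymm (by linarith) (hf.leftDeriv_le_rightDeriv_of_mem_interior hx)
  rw [← e] at hL
  have := hL.union hR
  rw [Iio_union_Ioi, compl_eq_univ_sdiff, hasDerivWithinAt_sdiff_singleton,
    hasDerivWithinAt_univ] at this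
  exact this.differentiableAt

namespace Setting

/-- The admissible parameters. -/
lemma isOpen_param (Q c Φ : ℝ) : IsOpen {θ : ℝ | θ * Φ < Q ^ 2 / (4 * c)} :=
  isOpen_lt (by fun_prop) continuous_const

lemma convexOn_blim (h : Setting p Q c Φ φ) (x : X) :
    ConvexOn ℝ {θ | θ * Φ < Q ^ 2 / (4 * c)} (blim p Q c φ x) := by
  refine ⟨?_, fun θ₁ h₁ θ₂ h₂ l m hl hm hlm => ?_⟩
  · refine Set.OrdConnected.convex ⟨fun x hx y hy z hz => h.lt_of_le hy hz.2⟩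
  · obtain rfl : m = 1 - l := by linarith
    exact h.blim_convex h₁ h₂ ⟨hl, by linarith⟩ x

lemma differentiableAt_blim (h : Setting p Q c Φ φ) (hθ : θ * Φ < Q ^ 2 / (4 * c)) (x : X) :
    DifferentiableAt ℝ (blim p Q c φ x) θ := by
  obtain ⟨ε, hε, hb⟩ := Metric.isOpen_iff.1 (isOpen_param Q c Φ) θ hθ
  have hbΦ : max (θ + ε / 2) 0 * Φ < Q ^ 2 / (4 * c) := by
    rcases max_choice (θ + ε / 2) 0 with e | e <;> rw [e]
    · refine hb ?_
      rw [Metric.mem_ball, Real.dist_eq, add_sub_cancel_left, abs_of_pos (by linarith)]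
      linarith
    · simpa using h.neg_sub le_rfl
  obtain ⟨C, -, -, hC⟩ := h.blim_lipschitz (a := |θ| + ε) (by positivity) (le_max_right _ _) hbΦ
  refine differentiableAt_of_convexOn_of_le (h.convexOn_blim x)
    ((isOpen_param Q c Φ).interior_eq.symm ▸ hθ) (C := C) ?_
  filter_upwards [Ioo_mem_nhdsGT (show (0 : ℝ) < ε / 2 by linarith)] with t ht
  have h1 := neg_abs_le θ
  have h2 := le_max_left (θ + ε / 2) 0
  exact hC θ t ⟨by linarith [ht.1], by linarith [ht.2]⟩
    ⟨by linarith [ht.2], by linarith [ht.1]⟩ x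

lemma deriv_blim_mono (h : Setting p Q c Φ φ) {θ₁ θ₂ : ℝ} (h₂ : θ₂ * Φ < Q ^ 2 / (4 * c))
    (h₁₂ : θ₁ ≤ θ₂) (x : X) : deriv (blim p Q c φ x) θ₁ ≤ deriv (blim p Q c φ x) θ₂ :=
  (h.convexOn_blim x).monotoneOn_deriv (fun _ hθ => h.differentiableAt_blim hθ x)
    (h.lt_of_le h₂ h₁₂) h₂ h₁₂

lemma deriv_blim_mul_le (h : Setting p Q c Φ φ) {θ₁ θ₂ : ℝ} (h₂ : θ₂ * Φ < Q ^ 2 / (4 * c))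
    (h₁₂ : θ₁ < θ₂) (x : X) :
    deriv (blim p Q c φ x) θ₁ * (θ₂ - θ₁) ≤ blim p Q c φ x θ₂ - blim p Q c φ x θ₁ := by
  have h₁ := h.lt_of_le h₂ h₁₂.le
  have := (h.convexOn_blim x).deriv_le_slope h₁ h₂ h₁₂ (h.differentiableAt_blim h₁ x)
  rwa [slope_def_field, le_div_iff₀ (by linarith)] at this

/-- The limit of the integrated slopes is attained from below. -/
lemma exists_slope (h : Setting p Q c Φ φ) {μ : Measure X} {θ₀ : ℝ} (h₀ : 0 < θ₀)
    (hθ₀ : ∀ θ < θ₀, θ * Φ < Q ^ 2 / (4 * c)) {α : ℝ≥0∞}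
    (hα : α < limUnder (𝓝[<] θ₀) fun θ => ∫⁻ x, ofReal (deriv (blim p Q c φ x) θ) ∂μ) :
    ∃ θ, 0 < θ ∧ θ < θ₀ ∧ α < ∫⁻ x, ofReal (deriv (blim p Q c φ x) θ) ∂μ := by
  -- By convexity the integrated derivative increases with θ, so the left limit exists and
  -- `limUnder` returns it.
  have hm : MonotoneOn (fun θ => ∫⁻ x, ofReal (deriv (blim p Q c φ x) θ) ∂μ) (Iio θ₀) :=
    fun θ₁ _ θ₂ h₂ h₁₂ => lintegral_mono fun x =>
      ENNReal.ofReal_le_ofReal (h.deriv_blim_mono (hθ₀ _ h₂) h₁₂ x)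
  have ht := hm.tendsto_nhdsLT (OrderTop.bddAbove _)
  rw [ht.limUnder_eq] at hα
  have h1 := (ht.eventually (lt_mem_nhds hα)).and (Ioo_mem_nhdsLT h₀)
  obtain ⟨θ, h2, h3⟩ := h1.exists
  exact ⟨θ, h3.1, h3.2, h2⟩

end Setting

end Slope

/-! ### Piecewise constant sources -/

section Grid

variable {d n : ℕ} {p : Kernel (ℝ × E d) (E d)} {Q c Φ a b T : ℝ} {φ : E d → ℝ} {θ : Fin n → ℝ}

/-- The cells of a uniform partition of `(0, T]`. -/
def cell (n : ℕ) (T : ℝ) (i : Fin n) : Set ℝ := Ioc (T * i / n) (T * (i + 1) / n)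

/-- The indicators of the cells, in reversed time. -/
def rcell (n : ℕ) (T : ℝ) (i : Fin n) (s : ℝ) : ℝ := (cell n T i).indicator 1 (T - s)

lemma measurableSet_cell (i : Fin n) : MeasurableSet (cell n T i) := measurableSet_Ioc

lemma measurable_rcell (i : Fin n) : Measurable (rcell n T i) :=
  (measurable_one.indicator (measurableSet_cell i)).comp (by fun_prop)

lemma rcell_nonneg (i : Fin n) (s : ℝ) : 0 ≤ rcell n T i s :=
  indicator_nonneg (fun _ _ => zero_le_one) _

lemma disjoint_cell (hT : 0 ≤ T) : Pairwise (Function.onFun Disjoint (cell n T)) := by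
  have key : ∀ i j : Fin n, i < j → Disjoint (cell n T i) (cell n T j) := by
    intro i j hij
    refine Set.disjoint_left.2 fun s hs hs' => (hs.2.trans ?_).not_gt hs'.1
    have : (i : ℝ) + 1 ≤ j := by exact_mod_cast hij
    gcongr
  intro i j hij
  rcases lt_or_gt_of_ne hij with h | h
  · exact key i j h
  · exact (key j i h).symm

lemma sum_indicator_cell (hT : 0 ≤ T) (f : Fin n → ℝ) {i : Fin n} {s : ℝ} (hs : s ∈ cell n T i) :
    ∑ j, f j * (cell n T j).indicator 1 s = f i := by
  rw [Finset.sum_eq_single i (fun j _ hj => ?_) (by simp), indicator_of_mem hs, Pi.one_apply, mul_one]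
  rw [indicator_of_notMem (fun h => Set.disjoint_left.1 (disjoint_cell hT hj) h hs), mul_zero]

lemma sum_rcell_mem (hT : 0 ≤ T) (ha : 0 ≤ a) (hb : 0 ≤ b) (hθ : ∀ i, θ i ∈ Icc (-a) b) (s : ℝ) :
    -a ≤ ∑ i, θ i * rcell n T i s ∧ ∑ i, θ i * rcell n T i s ≤ b := by
  by_cases h : ∃ i, T - s ∈ cell n T i
  · obtain ⟨i, hi⟩ := h
    have := sum_indicator_cell hT θ hi
    unfold rcell
    rw [this]
    exact hθ i
  · have : ∑ i, θ i * rcell n T i s = 0 := Finset.sum_eq_zero fun i _ => by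
      rw [rcell, indicator_of_notMem (fun hi => h ⟨i, hi⟩), mul_zero]
    rw [this]
    exact ⟨by linarith, hb⟩

lemma sum_rcell_le_one (hT : 0 ≤ T) (s : ℝ) : ∑ i, rcell n T i s ≤ 1 := by
  simpa using (sum_rcell_mem (θ := fun _ => 1) (n := n) hT le_rfl zero_le_one
    (fun i => ⟨by norm_num, le_rfl⟩) s).2

/-- The solution with a piecewise constant source. -/
def gsol (p : Kernel (ℝ × E d) (E d)) (Q c : ℝ) (φ : E d → ℝ) (n : ℕ) (T : ℝ) (θ : Fin n → ℝ) :
    ℝ → E d → ℝ := Classical.epsilon (Branching p Q c (source (rcell n T) φ θ))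

namespace Setting

lemma measurable_step (θ : Fin n → ℝ) : Measurable fun s => ∑ i, θ i * rcell n T i s :=
  Finset.measurable_sum _ fun i _ => (measurable_rcell i).const_mul _

lemma gsol_spec (h : Setting p Q c Φ φ) (hT : 0 ≤ T) (hb : 0 ≤ b) (hbΦ : b * Φ < Q ^ 2 / (4 * c))
    (hθ : ∀ i, θ i ≤ b) : Branching p Q c (source (rcell n T) φ θ) (gsol p Q c φ n T θ) := by
  have ha : 0 ≤ ∑ i, |θ i| := Finset.sum_nonneg fun i _ => abs_nonneg _
  obtain ⟨B, κ, -, -, H⟩ := h.uniform ha hb hbΦ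
  have hθ' : ∀ i, θ i ∈ Icc (-∑ j, |θ j|) b := fun i => by
    have h1 := Finset.single_le_sum (f := fun j => |θ j|) (fun j _ => abs_nonneg _)
      (Finset.mem_univ i)
    exact ⟨by linarith [neg_abs_le (θ i)], hθ i⟩
  exact Classical.epsilon_spec
    (H _ (measurable_step θ) fun s => sum_rcell_mem hT ha hb hθ' s).1

lemma gsol_envelope (h : Setting p Q c Φ φ) (hT : 0 ≤ T) (ha : 0 ≤ a) (hb : 0 ≤ b)
    (hbΦ : b * Φ < Q ^ 2 / (4 * c)) (hθ : ∀ i, θ i ∈ Icc (-a) b) {t : ℝ} (ht : 0 ≤ t) (x : E d) :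
    blim p Q c φ x (-a) ≤ gsol p Q c φ n T θ t x ∧ gsol p Q c φ n T θ t x ≤ blim p Q c φ x b :=
  h.envelope ha hb hbΦ (measurable_step θ) (sum_rcell_mem hT ha hb hθ)
    (h.gsol_spec hT hb hbΦ fun i => (hθ i).2) ht x

lemma abs_gsol_le (h : Setting p Q c Φ φ) (hT : 0 ≤ T) (ha : 0 ≤ a) (hb : 0 ≤ b)
    (hbΦ : b * Φ < Q ^ 2 / (4 * c)) (hθ : ∀ i, θ i ∈ Icc (-a) b) {t : ℝ} (ht : 0 ≤ t) (x : E d) :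
    |gsol p Q c φ n T θ t x| ≤ |blim p Q c φ x (-a)| + |blim p Q c φ x b| := by
  obtain ⟨h1, h2⟩ := h.gsol_envelope hT ha hb hbΦ hθ ht x
  refine abs_le.2 ⟨?_, ?_⟩
  · linarith [neg_abs_le (blim p Q c φ x (-a)), abs_nonneg (blim p Q c φ x b)]
  · linarith [le_abs_self (blim p Q c φ x b), abs_nonneg (blim p Q c φ x (-a))]

lemma integrable_gsol (h : Setting p Q c Φ φ) (hT : 0 ≤ T) (ha : 0 ≤ a) (hb : 0 ≤ b)
    (hbΦ : b * Φ < Q ^ 2 / (4 * c)) (hθ : ∀ i, θ i ∈ Icc (-a) b) {B : Set (E d)}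
    (i1 : IntegrableOn (blim p Q c φ · (-a)) B) (i2 : IntegrableOn (blim p Q c φ · b) B) :
    Integrable (fun y : ℝ × E d => gsol p Q c φ n T θ y.1 y.2) (slab T B) := by
  have i3 : Integrable (fun y : ℝ × E d => |blim p Q c φ y.2 (-a)| + |blim p Q c φ y.2 b|)
      (slab T B) := (i1.abs.add i2.abs).comp_snd _
  refine i3.mono' ?_ ?_
  · exact (h.gsol_spec hT hb hbΦ fun i => (hθ i).2).locBdd.meas.aestronglyMeasurable
  · filter_upwards [ae_slab T B] with y hy
    exact h.abs_gsol_le hT ha hb hbΦ hθ hy.1.le y.2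

/-- The time integral of a solution with piecewise constant source. -/
lemma integral_gsol (h : Setting p Q c Φ φ) (hn : 0 < n) (ha : 0 ≤ a) (hb : 0 ≤ b)
    (hbΦ : b * Φ < Q ^ 2 / (4 * c)) : ∃ K : ℝ, ∀ T, 0 < T → ∀ θ : Fin n → ℝ,
      (∀ i, θ i ∈ Icc (-a) b) → ∀ x,
        |(∫ t in Ioc 0 T, gsol p Q c φ n T θ t x) - T / n * ∑ i, blim p Q c φ x (θ i)| ≤ K := by
  obtain ⟨B, κ, hB, hκ, -, -, -, H⟩ := h.dist_blim ha hb hbΦ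
  refine ⟨n * (2 * B / κ), fun T hT θ hθ x => ?_⟩
  have hn' : (0 : ℝ) < n := by exact_mod_cast hn
  have hs := h.gsol_spec hT.le hb hbΦ fun i => (hθ i).2
  have hstep := H _ (measurable_step θ) (sum_rcell_mem hT.le ha hb hθ) _ hs
  set v := gsol p Q c φ n T θ with hv
  -- The grid points in reversed time, A 0 = T down to A n = 0. Between A (k+1) and A k the source
  -- is constant, so the distance to the stationary limit decays like 2B e^{-κ(t - A (k+1))}. Each
  -- cell thus costs at most 2B/κ, whatever T is.
  set A : ℕ → ℝ := fun k => T - T * k / n with hA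
  have hA1 : ∀ k, A (k + 1) = A k - T / n := fun k => by simp only [hA]; push_cast; ring
  have hA0 : ∀ k ≤ n, 0 ≤ A k := fun k hk => by
    have : T * k / n ≤ T := by
      rw [div_le_iff₀ hn']
      exact mul_le_mul_of_nonneg_left (by exact_mod_cast hk) hT.le
    simp only [hA]; linarith
  have hAT : ∀ k, A k ≤ T := fun k => by
    have : 0 ≤ T * k / n := by positivity
    simp only [hA]; linarith
  have hA2 : ∀ k, A (k + 1) ≤ A k := fun k => by
    have : 0 ≤ T / n := by positivity
    linarith [hA1 k]
  obtain ⟨C, -, hC⟩ := hs.locBdd.bound T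
  have hi : IntegrableOn (fun t => v t x) (Ioc 0 T) := by
    refine Measure.integrableOn_of_bounded (M := C) (by simp)
      (hs.locBdd.meas.comp measurable_prodMk_right).aestronglyMeasurable ?_
    filter_upwards [ae_restrict_mem measurableSet_Ioc] with t ht using hC t ⟨ht.1.le, ht.2⟩ x
  have hint : ∀ k < n, IntervalIntegrable (fun t => v t x) volume (A k) (A (k + 1)) := fun k hk =>
    intervalIntegrable_iff.2 (hi.mono_set fun s hs => by
      rw [uIoc_of_ge (hA2 k)] at hs
      exact ⟨(hA0 _ hk).trans_lt hs.1, hs.2.trans (hAT k)⟩)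
  have h1 := intervalIntegral.sum_integral_adjacent_intervals hint
  have e0 : A 0 = T := by simp [hA]
  have en : A n = 0 := by simp only [hA]; rw [mul_div_assoc, div_self hn'.ne']; ring
  rw [e0, en, intervalIntegral.integral_symm 0 T, intervalIntegral.integral_of_le hT.le] at h1
  have h2 : (∫ t in Ioc 0 T, v t x) - T / n * ∑ i, blim p Q c φ x (θ i) =
      ∑ i : Fin n, ((∫ t in A (i + 1)..A i, v t x) - T / n * blim p Q c φ x (θ i)) := by
    rw [Finset.sum_sub_distrib, Finset.mul_sum,
      Fin.sum_univ_eq_sum_range (fun k => ∫ t in A (k + 1)..A k, v t x), ← neg_neg (∫ t in Ioc 0 T, v t x),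
      ← h1, ← Finset.sum_neg_distrib]
    simp only [← intervalIntegral.integral_symm]
  rw [h2]
  refine (Finset.abs_sum_le_sum_abs _ _).trans
    ((Finset.sum_le_card_nsmul _ _ (2 * B / κ) fun i _ => ?_).trans (by simp))
  have hAi : A i = A (i + 1) + T / n := by rw [hA1]; ring
  have hAi0 := hA0 (i + 1) i.2
  have e1 : T / n * blim p Q c φ x (θ i) = ∫ t in A (i + 1)..A i, blim p Q c φ x (θ i) := by
    rw [intervalIntegral.integral_const, hAi, add_sub_cancel_left, smul_eq_mul]
  rw [e1, ← intervalIntegral.integral_sub (hint i i.2).symm (by simp)]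
  have hd : ∀ t : ℝ, HasDerivAt (fun t => -(2 * B / κ) * exp (-κ * (t - A (i + 1))))
      (2 * B * exp (-κ * (t - A (i + 1)))) t := fun t => by
    have h3 := ((((hasDerivAt_id t).sub_const (A (i + 1))).const_mul (-κ)).exp).const_mul
      (-(2 * B / κ))
    refine h3.congr_deriv ?_
    rw [id]
    field_simp
  have hcont : Continuous fun t => 2 * B * exp (-κ * (t - A (i + 1))) := by fun_prop
  rw [← Real.norm_eq_abs]
  refine (intervalIntegral.norm_integral_le_of_norm_le (hA2 i)
    (g := fun t => 2 * B * exp (-κ * (t - A (i + 1)))) (ae_of_all _ fun t ht => ?_)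
    (hcont.intervalIntegrable _ _)).trans ?_
  · refine hstep (θ i) (A (i + 1)) (A i) hAi0 (fun s hs => ?_) (hθ i) t ⟨ht.1.le, ht.2⟩ x
    refine sum_indicator_cell hT.le θ ?_
    have e2 : T * (i + 1) / n = T - A (i + 1) := by simp only [hA]; push_cast; ring
    have e3 : T * i / n = T - A i := by simp only [hA]; ring
    rw [cell, e2, e3]
    exact ⟨by linarith [hs.2], by linarith [hs.1]⟩
  · rw [intervalIntegral.integral_eq_sub_of_hasDerivAt (fun t _ => hd t)
      (hcont.intervalIntegrable _ _), sub_self, mul_zero, Real.exp_zero]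
    have : 0 ≤ 2 * B / κ * exp (-κ * (A i - A (i + 1))) := by positivity
    linarith

/-- The asymptotics of the space-time integrals. -/
lemma tendsto_integral_gsol (h : Setting p Q c Φ φ) (hn : 0 < n) (ha : 0 ≤ a) (hb : 0 ≤ b)
    (hbΦ : b * Φ < Q ^ 2 / (4 * c)) (hθ : ∀ i, θ i ∈ Icc (-a) b) {B : Set (E d)}
    (i1 : IntegrableOn (blim p Q c φ · (-a)) B) (i2 : IntegrableOn (blim p Q c φ · b) B) :
    Tendsto (fun T : ℝ => T⁻¹ * ∫ y, gsol p Q c φ n T θ y.1 y.2 ∂(slab T B)) atTop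
      (𝓝 (∑ i, (n : ℝ)⁻¹ * ∫ x in B, blim p Q c φ x (θ i))) := by
  obtain ⟨K, hK⟩ := h.integral_gsol (φ := φ) hn ha hb hbΦ
  have hi : ∀ i, IntegrableOn (blim p Q c φ · (θ i)) B := fun i => by
    refine (i1.abs.add i2.abs).mono' (h.measurable_blim (h.lt_of_le hbΦ (hθ i).2)).aestronglyMeasurable
      (ae_of_all _ fun x => abs_le.2 ⟨?_, ?_⟩)
    · have := h.blim_mono (h.lt_of_le hbΦ (hθ i).2) (hθ i).1 x
      simp only [Pi.add_apply]
      linarith [neg_abs_le (blim p Q c φ x (-a)), abs_nonneg (blim p Q c φ x b)]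
    · have := h.blim_mono hbΦ (hθ i).2 x
      simp only [Pi.add_apply]
      linarith [le_abs_self (blim p Q c φ x b), abs_nonneg (blim p Q c φ x (-a))]
  have e1 : ∑ i, (n : ℝ)⁻¹ * ∫ x in B, blim p Q c φ x (θ i) =
      ∫ x in B, (n : ℝ)⁻¹ * ∑ i, blim p Q c φ x (θ i) := by
    rw [integral_const_mul, integral_finsetSum _ fun i _ => hi i, Finset.mul_sum]
  rw [e1]
  have e2 : ∀ᶠ T : ℝ in atTop, ∫ x in B, T⁻¹ * ∫ t in Ioc 0 T, gsol p Q c φ n T θ t x =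
      T⁻¹ * ∫ y, gsol p Q c φ n T θ y.1 y.2 ∂(slab T B) := by
    filter_upwards [eventually_ge_atTop 0] with T hT
    rw [integral_const_mul, slab, integral_prod_symm _ (h.integrable_gsol hT ha hb hbΦ hθ i1 i2)]
  refine Tendsto.congr' e2 ?_
  have hbd : ∀ᶠ T : ℝ in atTop, ∀ x, |T⁻¹ * ∫ t in Ioc 0 T, gsol p Q c φ n T θ t x| ≤
      |blim p Q c φ x (-a)| + |blim p Q c φ x b| := by
    filter_upwards [eventually_gt_atTop 0] with T hT x
    rw [abs_mul, abs_of_pos (inv_pos.2 hT), inv_mul_le_iff₀ hT]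
    have := norm_setIntegral_le_of_norm_le_const (μ := volume) (s := Ioc 0 T)
      (f := fun t => gsol p Q c φ n T θ t x) (by simp)
      fun t ht => h.abs_gsol_le hT.le ha hb hbΦ hθ ht.1.le x
    simpa [hT.le, mul_comm] using this
  refine tendsto_integral_filter_of_dominated_convergence _ ?_
    (hbd.mono fun T hT => ae_of_all _ hT) (i1.abs.add i2.abs) (ae_of_all _ fun x => ?_)
  · filter_upwards [eventually_ge_atTop 0] with T hT
    have hm := (h.gsol_spec hT hb hbΦ fun i => (hθ i).2).locBdd.meas
    exact ((hm.stronglyMeasurable.integral_prod_left' (μ := volume.restrict (Ioc 0 T))).measurable.const_mul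
      T⁻¹).aestronglyMeasurable
  · rw [tendsto_iff_dist_tendsto_zero]
    have hz : Tendsto (fun T : ℝ => T⁻¹ * K) atTop (𝓝 0) := by
      simpa using tendsto_inv_atTop_zero.mul_const K
    refine squeeze_zero' (Eventually.of_forall fun _ => dist_nonneg) ?_ hz
    filter_upwards [eventually_gt_atTop 0] with T hT
    have e3 : T⁻¹ * (∫ t in Ioc 0 T, gsol p Q c φ n T θ t x) - (n : ℝ)⁻¹ * ∑ i, blim p Q c φ x (θ i) =
        T⁻¹ * ((∫ t in Ioc 0 T, gsol p Q c φ n T θ t x) - T / n * ∑ i, blim p Q c φ x (θ i)) := by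
      field_simp
    rw [Real.dist_eq, e3, abs_mul, abs_of_pos (inv_pos.2 hT)]
    exact mul_le_mul_of_nonneg_left (hK T hT θ hθ x) (inv_pos.2 hT).le

end Setting

end Grid

/-! ### The law of the occupation masses of the cells -/

section CubeMeasures

variable {n : ℕ}

lemma cubeMono_nonneg (u : Fin n → NNReal) (y : Fin n → I) : 0 ≤ cubeMono u y := by
  rw [cubeMono_apply]
  exact Finset.prod_nonneg fun i _ => Real.rpow_nonneg (y i).2.1 _

lemma cubeMono_le_one (u : Fin n → NNReal) (y : Fin n → I) : cubeMono u y ≤ 1 := by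
  rw [cubeMono_apply]
  exact Finset.prod_le_one (fun i _ => Real.rpow_nonneg (y i).2.1 _) fun i _ => Real.rpow_le_one (y i).2.1 (y i).2.2 (u i).2

lemma integrable_cubeMono (u : Fin n → NNReal) (μ : Measure (Fin n → I)) [IsFiniteMeasure μ] :
    Integrable (fun y => cubeMono u y) μ :=
  Integrable.of_bound (cubeMono u).continuous.aestronglyMeasurable 1
    (ae_of_all _ fun y => by
      rw [Real.norm_of_nonneg (cubeMono_nonneg u y)]; exact cubeMono_le_one u y)

/-- The measure with density `∏ y_i ^ v_i`. -/
def tilt (μ : Measure (Fin n → I)) (v : Fin n → NNReal) : Measure (Fin n → I) :=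
  μ.withDensity fun y => ofReal (cubeMono v y)

lemma measurable_cubeMono (v : Fin n → NNReal) : Measurable fun y => cubeMono v y :=
  (cubeMono v).continuous.measurable

instance (μ : Measure (Fin n → I)) [IsFiniteMeasure μ] (v : Fin n → NNReal) :
    IsFiniteMeasure (tilt μ v) :=
  isFiniteMeasure_withDensity_ofReal (integrable_cubeMono v μ).2

lemma setIntegral_tilt (μ : Measure (Fin n → I)) (v : Fin n → NNReal) (f : (Fin n → I) → ℝ)
    {s : Set (Fin n → I)} (hs : MeasurableSet s) :
    ∫ y in s, f y ∂(tilt μ v) = ∫ y in s, cubeMono v y * f y ∂μ := by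
  rw [tilt, setIntegral_withDensity_eq_setIntegral_toReal_smul
    (measurable_cubeMono v).ennreal_ofReal (ae_of_all _ fun _ => ENNReal.ofReal_lt_top) _ hs]
  simp only [ENNReal.toReal_ofReal (cubeMono_nonneg v _), smul_eq_mul]

lemma integral_tilt (μ : Measure (Fin n → I)) (u v : Fin n → NNReal) :
    ∫ y, cubeMono u y ∂(tilt μ v) = ∫ y, cubeMono (v + u) y ∂μ := by
  rw [← setIntegral_univ, setIntegral_tilt μ v _ MeasurableSet.univ, setIntegral_univ, cubeMono_add]
  rfl

/-- The componentwise product on the cube. -/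
def cubeMul (z : (Fin n → I) × (Fin n → I)) : Fin n → I := fun i => z.1 i * z.2 i

lemma measurable_cubeMul : Measurable (cubeMul (n := n)) := by
  refine Continuous.measurable ?_
  unfold cubeMul
  fun_prop

/-- Multiplying the coordinates e^{-X} adds the masses, so monomials play the role of characters for
sums of independent contributions. -/
lemma cubeMono_cubeMul (u : Fin n → NNReal) (z : (Fin n → I) × (Fin n → I)) :
    cubeMono u (cubeMul z) = cubeMono u z.1 * cubeMono u z.2 := by
  simp only [cubeMono_apply, cubeMul, ← Finset.prod_mul_distrib]
  exact Finset.prod_congr rfl fun i _ => Real.mul_rpow (z.1 i).2.1 (z.2 i).2.1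

/-- Independent factors. -/
lemma eq_map_cubeMul {m m₁ m₂ : Measure (Fin n → I)} [IsFiniteMeasure m] [IsFiniteMeasure m₁]
    [IsFiniteMeasure m₂]
    (h : ∀ u, ∫ y, cubeMono u y ∂m = (∫ y, cubeMono u y ∂m₁) * ∫ y, cubeMono u y ∂m₂) :
    m = (m₁.prod m₂).map cubeMul := by
  refine cube_measure_ext fun u => ?_
  rw [h, integral_map measurable_cubeMul.aemeasurable (measurable_cubeMono u).aestronglyMeasurable,
    ← integral_prod_mul]
  simp only [cubeMono_cubeMul]

end CubeMeasures

/-! ### Laplace exponents of regions of immigration -/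

section Law

variable {d n : ℕ} {p : Kernel (ℝ × E d) (E d)} {Q c Φ a b T H : ℝ} {φ : E d → ℝ}

lemma slab_inter (T : ℝ) (B : Set (E d)) {K : Set (E d)} (hK : MeasurableSet K) :
    slab T (K ∩ B) = (slab T B).restrict (univ ×ˢ K) := by
  rw [slab, slab, ← Measure.prod_restrict, Measure.restrict_univ, Measure.restrict_restrict hK]

/-- The Laplace exponents of a region. -/
def laplaceExp (p : Kernel (ℝ × E d) (E d)) (Q c H : ℝ) (φ : E d → ℝ) (n : ℕ) (T : ℝ)
    (B : Set (E d)) (θ : Fin n → ℝ) : ℝ :=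
  H * ∫ y, gsol p Q c φ n T θ y.1 y.2 ∂(slab T B)

namespace Setting

/-- On bounded parts of the region this is `expPos_exp_integral_branching`, which needs a finite
measure; integrability on B allows exhaustion by balls. -/
lemma expPos_laplaceExp (h : Setting p Q c Φ φ) (hT : 0 ≤ T) (hb : 0 ≤ b)
    (hbΦ : b * Φ < Q ^ 2 / (4 * c)) (hH : 0 ≤ H) {B : Set (E d)}
    (hi : ∀ u ≤ b, IntegrableOn (blim p Q c φ · u) B) :
    ExpPos (fun _ : Fin n => b) (fun θ => exp (laplaceExp p Q c H φ n T B θ)) := by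
  refine ExpPos.of_tendsto (l := atTop)
    (g := fun (k : ℕ) θ => exp (laplaceExp p Q c H φ n T (closedBall 0 k ∩ B) θ))
    (Eventually.of_forall fun k => ?_) fun θ hθ => ?_
  · have hfin : IsFiniteMeasure ((volume : Measure (E d)).restrict (closedBall 0 k ∩ B)) :=
      ⟨by
        rw [Measure.restrict_apply_univ]
        exact (measure_mono inter_subset_left).trans_lt measure_closedBall_lt_top⟩
    have := expPos_exp_integral_branching (T := T) h.hp h.hQ h.hc hb hbΦ (χ := rcell n T)
      measurable_rcell rcell_nonneg (sum_rcell_le_one hT) h.meas h.nonneg h.le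
      (v := gsol p Q c φ n T) (fun θ hθ => h.gsol_spec hT hb hbΦ hθ) hH
      (μ := volume.restrict (closedBall 0 k ∩ B))
    rw [← Measure.prod_restrict, Measure.restrict_univ] at this
    exact this
  · have hθ' : ∀ i, θ i ∈ Icc (-∑ j, |θ j|) b := fun i => by
      have h1 := Finset.single_le_sum (f := fun j => |θ j|) (fun j _ => abs_nonneg _)
        (Finset.mem_univ i)
      exact ⟨by linarith [neg_abs_le (θ i)], hθ i⟩
    have ha : 0 ≤ ∑ j, |θ j| := Finset.sum_nonneg fun i _ => abs_nonneg _
    have hint := h.integrable_gsol hT ha hb hbΦ hθ' (hi _ (by linarith)) (hi b le_rfl)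
    have hcb : ∀ k : ℕ, MeasurableSet (closedBall (0 : E d) k) := fun k =>
      Metric.isClosed_closedBall.measurableSet
    simp only [laplaceExp, slab_inter T B (hcb _)]
    refine (Real.continuous_exp.tendsto _).comp (Tendsto.const_mul H ?_)
    have hU : ⋃ k : ℕ, (univ : Set ℝ) ×ˢ closedBall (0 : E d) k = univ := by
      refine eq_univ_of_forall fun y => ?_
      obtain ⟨k, hk⟩ := exists_nat_ge ‖y.2‖
      exact mem_iUnion.2 ⟨k, trivial, mem_closedBall_zero_iff.2 hk⟩
    have := tendsto_setIntegral_of_monotone (μ := slab T B)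
      (s := fun k : ℕ => (univ : Set ℝ) ×ˢ closedBall (0 : E d) k)
      (fun k => MeasurableSet.univ.prod (hcb k)) (fun k l hkl => prod_mono_right
        (Metric.closedBall_subset_closedBall (by exact_mod_cast hkl))) (by rw [hU]; exact hint.integrableOn)
    rwa [hU, setIntegral_univ] at this

/-- The exponential change of measure. -/
lemma exists_cube_measure (h : Setting p Q c Φ φ) (hT : 0 ≤ T) (hb : 0 ≤ b)
    (hbΦ : b * Φ < Q ^ 2 / (4 * c)) (hH : 0 ≤ H) {B : Set (E d)}
    (hi : ∀ u ≤ b, IntegrableOn (blim p Q c φ · u) B) :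
    ∃ μ : Measure (Fin n → I), IsFiniteMeasure μ ∧ ∀ u : Fin n → NNReal,
      ∫ y, cubeMono u y ∂μ = exp (laplaceExp p Q c H φ n T B fun i => b - u i) :=
  (h.expPos_laplaceExp hT hb hbΦ hH hi).exists_measure

/-- The space variable is the place of immigration. Additivity of the exponent expresses that
immigrants inside and outside B contribute independently. -/
lemma laplaceExp_compl (h : Setting p Q c Φ φ) (hT : 0 ≤ T) (hi : ∀ u ≤ 0, Integrable (blim p Q c φ · u))
    {B : Set (E d)} (hB : MeasurableSet B) {θ : Fin n → ℝ} (hθ : ∀ i, θ i ≤ 0) :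
    laplaceExp p Q c H φ n T univ θ = laplaceExp p Q c H φ n T B θ + laplaceExp p Q c H φ n T Bᶜ θ := by
  have hθ' : ∀ i, θ i ∈ Icc (-∑ j, |θ j|) 0 := fun i => by
    have h1 := Finset.single_le_sum (f := fun j => |θ j|) (fun j _ => abs_nonneg _)
      (Finset.mem_univ i)
    exact ⟨by linarith [neg_abs_le (θ i)], hθ i⟩
  have ha : 0 ≤ ∑ j, |θ j| := Finset.sum_nonneg fun i _ => abs_nonneg _
  have hint := h.integrable_gsol (B := univ) hT ha le_rfl (by simpa using h.neg_sub le_rfl) hθ'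
    (hi _ (by linarith)).integrableOn (hi 0 le_rfl).integrableOn
  have e : univ ×ˢ Bᶜ = ((univ : Set ℝ) ×ˢ B)ᶜ := by ext; simp
  rw [laplaceExp, laplaceExp, laplaceExp, slab_eq_restrict T B, slab_eq_restrict T Bᶜ, e, ← mul_add,
    integral_add_compl (MeasurableSet.univ.prod hB) hint]

end Setting

end Law

/-! ### Joint law of the occupation masses -/

section Masses

variable {d n : ℕ} {S : Type*} [MeasurableSpace S] {M : MarkovFamily d S} {V q H T Φ : ℝ}
  {Ω : Type*} [MeasurableSpace Ω] {Pr : Measure Ω} {N : ℝ → Ω → Measure (E d)} {φ : E d → ℝ}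

/-- The occupation mass of a cell. -/
def cellMass (N : ℝ → Ω → Measure (E d)) (φ : E d → ℝ) (n : ℕ) (T : ℝ) (i : Fin n) (ω : Ω) : ℝ≥0∞ :=
  ∫⁻ s in cell n T i, ∫⁻ x, ofReal (φ x) ∂(N s ω)

/-- The negative exponentials of the occupation masses. -/
def expMass (N : ℝ → Ω → Measure (E d)) (φ : E d → ℝ) (n : ℕ) (T : ℝ) (ω : Ω) : Fin n → I :=
  fun i => ⟨(nexp (cellMass N φ n T i ω)).toReal, ENNReal.toReal_nonneg,
    ENNReal.toReal_le_of_le_ofReal zero_le_one (by simpa using nexp_le_one _)⟩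

lemma IsSuperprocess.measurable_cellMass (hN : IsSuperprocess M V q H Pr N) (hφ : Measurable φ)
    (i : Fin n) : Measurable (cellMass N φ n T i) :=
  Measurable.lintegral_prod_left' (f := fun (y : ℝ × Ω) => ∫⁻ x, ofReal (φ x) ∂(N y.1 y.2))
    (hN.measurable_pair hφ.ennreal_ofReal)

lemma IsSuperprocess.measurable_expMass (hN : IsSuperprocess M V q H Pr N) (hφ : Measurable φ) :
    Measurable (expMass N φ n T) :=
  measurable_pi_lambda _ fun i => Measurable.subtype_mk
    (measurable_nexp.comp (hN.measurable_cellMass hφ i)).ennreal_toReal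

lemma nexp_sum {ι : Type*} (s : Finset ι) (f : ι → ℝ≥0∞) : nexp (∑ i ∈ s, f i) = ∏ i ∈ s, nexp (f i) := by
  classical
  induction s using Finset.induction_on with
  | empty => simp [nexp_zero]
  | insert a s ha ih => rw [Finset.sum_insert ha, Finset.prod_insert ha, nexp_add, ih]

lemma nexp_mul_toReal (u : NNReal) (x : ℝ≥0∞) : (nexp (u * x)).toReal = (nexp x).toReal ^ (u : ℝ) := by
  rcases eq_or_ne u 0 with rfl | hu
  · simp [nexp_zero]
  rcases eq_or_ne x ⊤ with rfl | hx
  · rw [ENNReal.mul_top (by simpa using hu), nexp_top, ENNReal.toReal_zero,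
      Real.zero_rpow (by exact_mod_cast hu)]
  lift x to NNReal using hx
  have e : ∀ y : NNReal, nexp y = ofReal (exp (-y)) := fun y => by
    have := nexp_ofReal (r := (y : ℝ)) y.2
    rwa [ENNReal.ofReal_coe_nnreal] at this
  rw [← ENNReal.coe_mul, e, e, ENNReal.toReal_ofReal (Real.exp_nonneg _),
    ENNReal.toReal_ofReal (Real.exp_nonneg _), ← Real.exp_mul]
  push_cast
  congr 1
  ring

lemma cubeMono_expMass (u : Fin n → NNReal) (ω : Ω) :
    cubeMono u (expMass N φ n T ω) = (nexp (∑ i, u i * cellMass N φ n T i ω)).toReal := by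
  rw [nexp_sum, ENNReal.toReal_prod, cubeMono_apply]
  exact Finset.prod_congr rfl fun i _ => (nexp_mul_toReal _ _).symm

lemma cell_subset (hT : 0 ≤ T) (i : Fin n) : cell n T i ⊆ Ioc 0 T := by
  have hn : (0 : ℝ) < n := by exact_mod_cast i.pos
  refine Ioc_subset_Ioc (by positivity) ?_
  rw [div_le_iff₀ hn]
  exact mul_le_mul_of_nonneg_left (by exact_mod_cast i.2) hT

/-- The joint Laplace transform of the masses. -/
lemma IsSuperprocess.lintegral_nexp_cellMass [IsProbabilityMeasure Pr]
    (hN : IsSuperprocess M V q H Pr N) (h : Setting M.transition (Qrate V q) (V * q) Φ φ)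
    (hT : 0 < T) (u : Fin n → NNReal) :
    ∫⁻ ω, nexp (∑ i, u i * cellMass N φ n T i ω) ∂Pr = nexp (ofReal H * ∫⁻ y, ofReal
      (-gsol M.transition (Qrate V q) (V * q) φ n T (fun i => -(u i : ℝ)) y.1 y.2) ∂(slab T univ)) := by
  have hz : (0 : ℝ) * Φ < Qrate V q ^ 2 / (4 * (V * q)) := by simpa using h.neg_sub le_rfl
  have hs := h.gsol_spec (n := n) (θ := fun i => -(u i : ℝ)) hT.le le_rfl hz fun i => by simp
  have hsum : ∀ i, (u i : ℝ) ≤ ∑ j, (u j : ℝ) := fun i =>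
    Finset.single_le_sum (f := fun j => (u j : ℝ)) (fun j _ => (u j).2) (Finset.mem_univ i)
  have hb : ∀ s, 0 ≤ (∑ i, (u i : ℝ) * rcell n T i s) ∧
      (∑ i, (u i : ℝ) * rcell n T i s) ≤ ∑ j, (u j : ℝ) := fun s => by
    have := sum_rcell_mem (a := 0) hT.le le_rfl (Finset.sum_nonneg fun j _ => (u j).2)
      (fun i => ⟨by simp, hsum i⟩) s (n := n) (θ := fun i => (u i : ℝ))
    simpa using this
  have hL := hN.laplace h.hQ h.hc.le hT (b := ∑ j, (u j : ℝ))
    (ρ := fun s => ∑ i, (u i : ℝ) * rcell n T i (T - s))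
    ((Setting.measurable_step (T := T) (fun i => (u i : ℝ))).comp (by fun_prop : Measurable fun s => T - s))
    (fun s => (hb _).1) (fun s => (hb _).2) h.meas h.nonneg h.le hs.locBdd.neg (fun t ht x => ?_)
  · rw [← hL]
    refine lintegral_congr fun ω => ?_
    congr 1
    have hm : Measurable fun s => ∫⁻ x, ofReal (φ x) ∂(N s ω) :=
      (hN.measurable_pair h.meas.ennreal_ofReal).comp (measurable_id.prodMk measurable_const)
    have e1 : ∀ s, ofReal (∑ i, (u i : ℝ) * rcell n T i (T - s)) =
        ∑ i, (u i : ℝ≥0∞) * (cell n T i).indicator 1 s := fun s => by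
      rw [ENNReal.ofReal_sum_of_nonneg (f := fun i => (u i : ℝ) * rcell n T i (T - s))
        fun i _ => mul_nonneg (u i).2 (rcell_nonneg _ _)]
      refine Finset.sum_congr rfl fun i _ => ?_
      rw [ENNReal.ofReal_mul (NNReal.coe_nonneg (u i)), rcell, sub_sub_cancel, ENNReal.ofReal_coe_nnreal]
      by_cases hc : s ∈ cell n T i <;> simp [hc]
    simp only [e1, Finset.sum_mul]
    have hmi : ∀ i ∈ Finset.univ, Measurable fun s => (u i : ℝ≥0∞) *
        (cell n T i).indicator 1 s * ∫⁻ x, ofReal (φ x) ∂(N s ω) := fun i _ =>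
      ((measurable_one.indicator (measurableSet_cell i)).const_mul _).mul hm
    rw [lintegral_finsetSum _ hmi]
    refine Finset.sum_congr rfl fun i _ => ?_
    simp only [mul_assoc]
    have hm2 : Measurable fun s => (cell n T i).indicator (1 : ℝ → ℝ≥0∞) s *
        ∫⁻ x, ofReal (φ x) ∂(N s ω) :=
      (measurable_one.indicator (measurableSet_cell i)).mul hm
    rw [lintegral_const_mul _ hm2, cellMass]
    congr 1
    rw [← Measure.restrict_restrict_of_subset (cell_subset hT.le i),
      ← lintegral_indicator (measurableSet_cell i)]
    refine lintegral_congr fun s => ?_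
    by_cases hc : s ∈ cell n T i <;> simp [hc]
  · have hsrc : LocBdd fun s y => (∑ i, (u i : ℝ) * rcell n T i s) * φ y :=
      h.source_locBdd (a := 0) (Setting.measurable_step fun i => (u i : ℝ))
        fun s => by simpa using hb s
    simp only [sub_sub_cancel]
    rw [hs.eq t ht.1 x, ← duhamel_neg, ← duhamel_add h.hp _ hsrc
      ((hs.locBdd.neg.sq.const_mul (V * q)).neg)]
    congr 1
    ext s y
    simp only [source, neg_mul, Finset.sum_neg_distrib, neg_sq]
    ring

/-- The law of the exponentials of the masses, when the stationary solutions are integrable. -/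
lemma IsSuperprocess.integral_cubeMono_expMass [IsProbabilityMeasure Pr] (hH : 0 ≤ H)
    (hN : IsSuperprocess M V q H Pr N) (h : Setting M.transition (Qrate V q) (V * q) Φ φ)
    (hi : ∀ u ≤ 0, Integrable (blim M.transition (Qrate V q) (V * q) φ · u))
    (hT : 0 < T) (u : Fin n → NNReal) :
    ∫ y, cubeMono u y ∂(Pr.map (expMass N φ n T)) =
      exp (laplaceExp M.transition (Qrate V q) (V * q) H φ n T univ fun i => -(u i : ℝ)) := by
  have hz : (0 : ℝ) * Φ < Qrate V q ^ 2 / (4 * (V * q)) := by simpa using h.neg_sub le_rfl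
  rw [integral_map (hN.measurable_expMass h.meas).aemeasurable
    (measurable_cubeMono u).aestronglyMeasurable]
  simp only [cubeMono_expMass]
  have hm : Measurable fun ω => nexp (∑ i, u i * cellMass N φ n T i ω) :=
    measurable_nexp.comp (Finset.measurable_fun_sum _ fun i _ =>
      (hN.measurable_cellMass h.meas i).const_mul _)
  rw [integral_toReal hm.aemeasurable (ae_of_all _ fun ω =>
    (nexp_le_one _).trans_lt ENNReal.one_lt_top), hN.lintegral_nexp_cellMass h hT]
  have hsum : ∀ i, (u i : ℝ) ≤ ∑ j, (u j : ℝ) := fun i =>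
    Finset.single_le_sum (f := fun j => (u j : ℝ)) (fun j _ => (u j).2) (Finset.mem_univ i)
  have ha : 0 ≤ ∑ j, (u j : ℝ) := Finset.sum_nonneg fun j _ => (u j).2
  have hθ : ∀ i, -(u i : ℝ) ∈ Icc (-∑ j, (u j : ℝ)) 0 := fun i => ⟨by linarith [hsum i], by simp⟩
  have hint := (h.integrable_gsol (B := univ) hT.le ha le_rfl hz hθ
    (hi _ (by linarith)).integrableOn (hi 0 le_rfl).integrableOn).neg
  have h0 : 0 ≤ᵐ[slab T univ] fun y : ℝ × E d =>
      -gsol M.transition (Qrate V q) (V * q) φ n T (fun i => -(u i : ℝ)) y.1 y.2 := by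
    filter_upwards [ae_slab T univ] with y hy
    have := (h.gsol_envelope hT.le ha le_rfl hz hθ hy.1.le y.2).2
    rw [h.blim_zero] at this
    exact neg_nonneg.2 this
  have e2 := ofReal_integral_eq_lintegral_ofReal hint h0
  simp only [Pi.neg_apply] at e2
  rw [← e2, ← ENNReal.ofReal_mul hH, nexp_ofReal (mul_nonneg hH (integral_nonneg_of_ae h0)),
    ENNReal.toReal_ofReal (Real.exp_nonneg _), integral_neg, mul_neg, neg_neg, laplaceExp]

end Masses

/-! ### Boxes in the cube -/

section Boxes

variable {n : ℕ} {T ε : ℝ} {D θ : Fin n → ℝ}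

/-- The points of the cube whose negative logarithms are within `T ε` of `T D`. -/
def box (T : ℝ) (D : Fin n → ℝ) (ε : ℝ) : Set (Fin n → I) :=
  {y | ∀ i, exp (-(T * (D i + ε))) ≤ y i ∧ (y i : ℝ) ≤ exp (-(T * (D i - ε)))}

lemma measurableSet_box : MeasurableSet (box T D ε) := by
  have : box T D ε = ⋂ i, {y : Fin n → I | exp (-(T * (D i + ε))) ≤ y i} ∩
      {y : Fin n → I | (y i : ℝ) ≤ exp (-(T * (D i - ε)))} := by
    ext y
    simp only [box, mem_ofPred_eq, mem_iInter, mem_inter_iff]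
  rw [this]
  refine MeasurableSet.iInter fun i => ?_
  have hm : Measurable fun y : Fin n → I => ((y i : I) : ℝ) := by fun_prop
  exact (measurableSet_le measurable_const hm).inter (measurableSet_le hm measurable_const)

lemma rpow_mem_of_mem_Icc {y D ε : ℝ} (h1 : exp (-(T * (D + ε))) ≤ y)
    (h2 : y ≤ exp (-(T * (D - ε)))) (θ : ℝ) :
    exp (-(T * (θ * D + ε * |θ|))) ≤ y ^ θ ∧ y ^ θ ≤ exp (-(T * (θ * D - ε * |θ|))) := by
  have hy : 0 < y := (Real.exp_pos _).trans_le h1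
  rw [Real.rpow_def_of_pos hy]
  have l1 := (Real.le_log_iff_exp_le hy).2 h1
  have l2 := (Real.log_le_iff_le_exp hy).2 h2
  have l3 : |Real.log y + T * D| ≤ T * ε := abs_le.2 ⟨by linarith, by linarith⟩
  have l4 : |(Real.log y + T * D) * θ| ≤ T * ε * |θ| := by
    rw [abs_mul]
    exact mul_le_mul_of_nonneg_right l3 (abs_nonneg _)
  obtain ⟨l5, l6⟩ := abs_le.1 l4
  exact ⟨Real.exp_le_exp.2 (by linarith), Real.exp_le_exp.2 (by linarith)⟩

/-- On the box the factor y^θ equals e^{-Tθ·D} up to e^{±TεΣ|θ_i|}, so changing the weight from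
exponent w = b - θ to b changes measures of subsets by a nearly constant factor. -/
lemma cubeMono_box {y : Fin n → I} (hy : y ∈ box T D ε) {b w : Fin n → NNReal}
    (hw : ∀ i, (w i : ℝ) = b i - θ i) :
    exp (-(T * (∑ i, θ i * D i + ε * ∑ i, |θ i|))) * cubeMono w y ≤ cubeMono b y ∧
      cubeMono b y ≤ exp (-(T * (∑ i, θ i * D i - ε * ∑ i, |θ i|))) * cubeMono w y := by
  have hy0 : ∀ i, 0 < (y i : ℝ) := fun i => (Real.exp_pos _).trans_le (hy i).1
  have e : cubeMono b y = (∏ i, (y i : ℝ) ^ θ i) * cubeMono w y := by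
    rw [cubeMono_apply, cubeMono_apply, ← Finset.prod_mul_distrib]
    refine Finset.prod_congr rfl fun i _ => ?_
    rw [← Real.rpow_add (hy0 i), hw i]
    congr 1
    ring
  have e1 : -(T * (∑ i, θ i * D i + ε * ∑ i, |θ i|)) = ∑ i, -(T * (θ i * D i + ε * |θ i|)) := by
    rw [Finset.sum_neg_distrib, ← Finset.mul_sum, Finset.sum_add_distrib, Finset.mul_sum _ _ ε]
  have e2 : -(T * (∑ i, θ i * D i - ε * ∑ i, |θ i|)) = ∑ i, -(T * (θ i * D i - ε * |θ i|)) := by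
    rw [Finset.sum_neg_distrib, ← Finset.mul_sum, Finset.sum_sub_distrib, Finset.mul_sum _ _ ε]
  rw [e, e1, e2, Real.exp_sum, Real.exp_sum]
  refine ⟨mul_le_mul_of_nonneg_right ?_ (cubeMono_nonneg w y),
    mul_le_mul_of_nonneg_right ?_ (cubeMono_nonneg w y)⟩
  · exact Finset.prod_le_prod (fun i _ => (Real.exp_pos _).le)
      fun i _ => (rpow_mem_of_mem_Icc (hy i).1 (hy i).2 (θ i)).1
  · exact Finset.prod_le_prod (fun i _ => Real.rpow_nonneg (hy0 i).le _)
      fun i _ => (rpow_mem_of_mem_Icc (hy i).1 (hy i).2 (θ i)).2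

lemma real_tilt (μ : Measure (Fin n → I)) [IsFiniteMeasure μ] (b : Fin n → NNReal)
    {s : Set (Fin n → I)} (hs : MeasurableSet s) :
    (tilt μ b).real s = ∫ y in s, cubeMono b y ∂μ := by
  have := setIntegral_tilt μ b (fun _ => 1) hs
  simpa using this

/-- Chernoff's bound: the weight y^b represents the original law and the weight y^{b-θ} the law
tilted by θ. -/
lemma real_tilt_box_le (μ : Measure (Fin n → I)) [IsFiniteMeasure μ] {b w : Fin n → NNReal}
    (hw : ∀ i, (w i : ℝ) = b i - θ i) :
    (tilt μ b).real (box T D ε) ≤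
      exp (-(T * (∑ i, θ i * D i - ε * ∑ i, |θ i|))) * ∫ y, cubeMono w y ∂μ := by
  rw [real_tilt μ b measurableSet_box, ← integral_const_mul]
  refine (setIntegral_mono_on (integrable_cubeMono b μ).integrableOn
    ((integrable_cubeMono w μ).const_mul _).integrableOn measurableSet_box
    fun y hy => (cubeMono_box hy hw).2).trans (setIntegral_le_integral
      ((integrable_cubeMono w μ).const_mul _) (ae_of_all _ fun y => ?_))
  exact mul_nonneg (Real.exp_pos _).le (cubeMono_nonneg w y)

lemma cubeMono_update_le {y : Fin n → I} {w w' : Fin n → NNReal} {i : Fin n} {K : ℝ}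
    (h : ∀ j ≠ i, w' j = w j) (hi : (y i : ℝ) ^ (w i : ℝ) ≤ K * (y i : ℝ) ^ (w' i : ℝ)) :
    cubeMono w y ≤ K * cubeMono w' y := by
  rw [cubeMono_apply, cubeMono_apply, ← Finset.mul_prod_erase _ _ (Finset.mem_univ i),
    ← Finset.mul_prod_erase _ (fun j => (y j : ℝ) ^ (w' j : ℝ)) (Finset.mem_univ i), ← mul_assoc]
  have e : ∏ j ∈ Finset.univ.erase i, (y j : ℝ) ^ (w' j : ℝ) =
      ∏ j ∈ Finset.univ.erase i, (y j : ℝ) ^ (w j : ℝ) :=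
    Finset.prod_congr rfl fun j hj => by rw [h j (Finset.ne_of_mem_erase hj)]
  rw [e]
  exact mul_le_mul_of_nonneg_right hi (Finset.prod_nonneg fun j _ => Real.rpow_nonneg (y j).2.1 _)

/-- Exponential Chebyshev bounds outside a box. -/
lemma cubeMono_le_indicator_add {s : ℝ} (hs : 0 < s) {w : Fin n → NNReal}
    {wp wm : Fin n → Fin n → NNReal} (hp : ∀ i, ∀ j ≠ i, wp i j = w j)
    (hm : ∀ i, ∀ j ≠ i, wm i j = w j) (hpi : ∀ i, (wp i i : ℝ) = w i - s)
    (hmi : ∀ i, (wm i i : ℝ) = w i + s) (y : Fin n → I) :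
    cubeMono w y ≤ (box T D ε).indicator (cubeMono w) y +
      ∑ i, (exp (-(T * (s * (D i + ε)))) * cubeMono (wp i) y +
        exp (T * (s * (D i - ε))) * cubeMono (wm i) y) := by
  have h0 : ∀ i ∈ Finset.univ, 0 ≤ exp (-(T * (s * (D i + ε)))) * cubeMono (wp i) y +
        exp (T * (s * (D i - ε))) * cubeMono (wm i) y := fun i _ => by
    have := cubeMono_nonneg (wp i) y
    have := cubeMono_nonneg (wm i) y
    positivity
  by_cases hy : y ∈ box T D ε
  · rw [indicator_of_mem hy]
    linarith [Finset.sum_nonneg h0]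
  rw [indicator_of_notMem hy, zero_add]
  simp only [box, mem_ofPred_eq, not_forall, not_and_or, not_le] at hy
  obtain ⟨i, hi⟩ := hy
  refine le_trans ?_ (Finset.single_le_sum h0 (Finset.mem_univ i))
  have hy0 := (y i).2.1
  rcases hi with hi | hi
  · refine le_add_of_le_of_nonneg (cubeMono_update_le (i := i) (hp i) ?_)
      (mul_nonneg (Real.exp_pos _).le (cubeMono_nonneg _ _))
    have hwi : (w i : ℝ) = s + wp i i := by rw [hpi]; ring
    rw [hwi, Real.rpow_add_of_nonneg hy0 hs.le (NNReal.coe_nonneg _)]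
    refine mul_le_mul_of_nonneg_right ?_ (Real.rpow_nonneg hy0 _)
    refine (Real.rpow_le_rpow hy0 hi.le hs.le).trans_eq ?_
    rw [← Real.exp_mul]
    congr 1
    ring
  · refine le_add_of_nonneg_of_le (mul_nonneg (Real.exp_pos _).le (cubeMono_nonneg _ _))
      (cubeMono_update_le (i := i) (hm i) ?_)
    rw [hmi, Real.rpow_add_of_nonneg hy0 (NNReal.coe_nonneg _) hs.le, mul_left_comm]
    refine le_mul_of_one_le_right (Real.rpow_nonneg hy0 _) ?_
    have h1 := Real.rpow_le_rpow (Real.exp_pos _).le hi.le hs.le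
    rw [← Real.exp_mul] at h1
    refine le_trans (le_of_eq ?_) (mul_le_mul_of_nonneg_left h1 (Real.exp_pos _).le)
    rw [← Real.exp_add, eq_comm, Real.exp_eq_one_iff]
    ring

/-- The lower bound for boxes around the mean of an exponential change of measure. -/
lemma eventually_le_real_tilt_box {μ : ℝ → Measure (Fin n → I)} {ℓ : ℝ → (Fin n → ℝ) → ℝ}
    {g : (Fin n → ℝ) → ℝ} {b : NNReal} (hμ : ∀ T, 0 < T → IsFiniteMeasure (μ T))
    (hℓ : ∀ T, 0 < T → ∀ u : Fin n → NNReal,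
      ∫ y, cubeMono u y ∂(μ T) = exp (ℓ T fun i => b - u i))
    {s : ℝ} (hs : 0 < s) (hb : ∀ i, θ i + s ≤ b)
    (t0 : Tendsto (fun T => T⁻¹ * ℓ T θ) atTop (𝓝 (g θ)))
    (tp : ∀ i, Tendsto (fun T => T⁻¹ * ℓ T (Function.update θ i (θ i + s))) atTop
      (𝓝 (g (Function.update θ i (θ i + s)))))
    (tm : ∀ i, Tendsto (fun T => T⁻¹ * ℓ T (Function.update θ i (θ i - s))) atTop
      (𝓝 (g (Function.update θ i (θ i - s)))))
    (gp : ∀ i, g (Function.update θ i (θ i + s)) - g θ < s * (D i + ε))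
    (gm : ∀ i, g (Function.update θ i (θ i - s)) - g θ < -(s * (D i - ε))) {η : ℝ} (hη : 0 < η) :
    ∀ᶠ T in atTop, exp (-(T * (∑ i, θ i * D i + ε * ∑ i, |θ i| - g θ + η))) ≤
      (tilt (μ T) fun _ => b).real (box T D ε) := by
  classical
  -- Relative to the mass e^{ℓ(θ)} of the tilted measure, the Chebyshev terms for a move of one
  -- coordinate by ±s vanish exponentially, since D is within ε of the difference quotients of g.
  have aux : ∀ {θ' : Fin n → ℝ} {k : ℝ}, Tendsto (fun T => T⁻¹ * ℓ T θ') atTop (𝓝 (g θ')) →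
      g θ' - g θ < k → Tendsto (fun T => exp (-(T * k) + (ℓ T θ' - ℓ T θ))) atTop (𝓝 0) := by
    intro θ' k ht hk
    refine Real.tendsto_exp_atBot.comp ?_
    have h1 : Tendsto (fun T : ℝ => -k + (T⁻¹ * ℓ T θ' - T⁻¹ * ℓ T θ)) atTop
        (𝓝 (-k + (g θ' - g θ))) := tendsto_const_nhds.add (ht.sub t0)
    refine (tendsto_id.atTop_mul_neg (by linarith) h1).congr' ?_
    filter_upwards [eventually_gt_atTop 0] with T hT
    simp only [id]
    field_simp
  have hsum : Tendsto (fun T => ∑ i, (exp (-(T * (s * (D i + ε))) +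
      (ℓ T (Function.update θ i (θ i + s)) - ℓ T θ)) + exp (-(T * -(s * (D i - ε))) +
      (ℓ T (Function.update θ i (θ i - s)) - ℓ T θ)))) atTop (𝓝 (∑ i : Fin n, (0 + 0))) :=
    tendsto_finsetSum _ fun i _ => (aux (tp i) (gp i)).add (aux (tm i) (gm i))
  simp only [add_zero, Finset.sum_const_zero] at hsum
  have h2 : Tendsto (fun T : ℝ => exp (-(T * (η / 2)))) atTop (𝓝 0) :=
    Real.tendsto_exp_atBot.comp (tendsto_neg_atTop_atBot.comp
      (tendsto_id.atTop_mul_const (by linarith)))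
  have h3 : ∀ᶠ T in atTop, g θ - η / 2 < T⁻¹ * ℓ T θ := t0.eventually (lt_mem_nhds (by linarith))
  filter_upwards [hsum.eventually (gt_mem_nhds (show (0 : ℝ) < 1 / 2 by norm_num)),
    h2.eventually (gt_mem_nhds (show (0 : ℝ) < 1 / 2 by norm_num)), h3, eventually_gt_atTop 0]
    with T k1 k2 k3 hT
  have := hμ T hT
  set w : Fin n → NNReal := fun i => (b - θ i).toNNReal with hwd
  set wp : Fin n → Fin n → NNReal := fun i => Function.update w i (b - θ i - s).toNNReal with hwp
  set wm : Fin n → Fin n → NNReal := fun i => Function.update w i (b - θ i + s).toNNReal with hwm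
  have hw : ∀ i, (w i : ℝ) = b - θ i := fun i => Real.coe_toNNReal _ (by linarith [hb i])
  have ep : ∀ i, (fun j => (b : ℝ) - wp i j) = Function.update θ i (θ i + s) := fun i => by
    ext j
    rcases eq_or_ne j i with rfl | hj
    · simp only [hwp, Function.update_self]
      rw [Real.coe_toNNReal _ (by linarith [hb j])]; ring
    · simp only [hwp, Function.update_of_ne hj, hw]; ring
  have em : ∀ i, (fun j => (b : ℝ) - wm i j) = Function.update θ i (θ i - s) := fun i => by
    ext j
    rcases eq_or_ne j i with rfl | hj
    · simp only [hwm, Function.update_self]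
      rw [Real.coe_toNNReal _ (by linarith [hb j])]; ring
    · simp only [hwm, Function.update_of_ne hj, hw]; ring
  have e0 : (fun j => (b : ℝ) - w j) = θ := by ext j; rw [hw]; ring
  have hpt := cubeMono_le_indicator_add (T := T) (D := D) (ε := ε) hs (w := w) (wp := wp) (wm := wm)
    (fun i j hj => Function.update_of_ne hj _ _) (fun i j hj => Function.update_of_ne hj _ _)
    (fun i => by
      simp only [hwp, Function.update_self, hw]
      exact Real.coe_toNNReal _ (by linarith [hb i]))
    (fun i => by
      simp only [hwm, Function.update_self, hw]
      exact Real.coe_toNNReal _ (by linarith [hb i]))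
  have hint : ∀ i ∈ Finset.univ, Integrable (fun y => exp (-(T * (s * (D i + ε)))) *
      cubeMono (wp i) y + exp (T * (s * (D i - ε))) * cubeMono (wm i) y) (μ T) := fun i _ =>
    ((integrable_cubeMono _ _).const_mul _).add ((integrable_cubeMono _ _).const_mul _)
  have h4 := integral_mono (integrable_cubeMono w (μ T))
    (((integrable_cubeMono w (μ T)).indicator measurableSet_box).add
      (integrable_finsetSum _ hint)) hpt
  simp only [Pi.add_apply] at h4
  rw [integral_add ((integrable_cubeMono w (μ T)).indicator measurableSet_box)
    (integrable_finsetSum _ hint), integral_finsetSum _ hint,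
    integral_indicator measurableSet_box, hℓ T hT, e0] at h4
  have h5 : ∀ i ∈ Finset.univ, ∫ y, (exp (-(T * (s * (D i + ε)))) * cubeMono (wp i) y +
      exp (T * (s * (D i - ε))) * cubeMono (wm i) y) ∂(μ T) =
      exp (ℓ T θ) * (exp (-(T * (s * (D i + ε))) +
      (ℓ T (Function.update θ i (θ i + s)) - ℓ T θ)) + exp (-(T * -(s * (D i - ε))) +
      (ℓ T (Function.update θ i (θ i - s)) - ℓ T θ))) := fun i _ => by
    rw [integral_add ((integrable_cubeMono _ _).const_mul _) ((integrable_cubeMono _ _).const_mul _),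
      integral_const_mul, integral_const_mul, hℓ T hT, hℓ T hT, ep, em, mul_add (exp (ℓ T θ)), ← Real.exp_add,
      ← Real.exp_add, ← Real.exp_add, ← Real.exp_add]
    congr 2 <;> ring
  rw [Finset.sum_congr rfl h5, ← Finset.mul_sum] at h4
  -- At least half of the tilted mass lies in the box.
  have h6 : exp (ℓ T θ) * (1 / 2) ≤ ∫ y in box T D ε, cubeMono w y ∂(μ T) := by
    have := mul_le_mul_of_nonneg_left k1.le (Real.exp_pos (ℓ T θ)).le
    linarith
  rw [real_tilt (μ T) _ measurableSet_box]
  have h7 : exp (-(T * (∑ i, θ i * D i + ε * ∑ i, |θ i|))) *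
      ∫ y in box T D ε, cubeMono w y ∂(μ T) ≤ ∫ y in box T D ε, cubeMono (fun _ => b) y ∂(μ T) := by
    rw [← integral_const_mul]
    exact setIntegral_mono_on ((integrable_cubeMono w _).const_mul _).integrableOn
      (integrable_cubeMono _ _).integrableOn measurableSet_box fun y hy => (cubeMono_box hy hw).1
  refine le_trans ?_ h7
  have h8 : T * (g θ - η / 2) ≤ ℓ T θ := by
    have := mul_le_mul_of_nonneg_left k3.le hT.le
    rwa [mul_inv_cancel_left₀ hT.ne'] at this
  have h9 : exp (T * (g θ - η / 2)) * exp (-(T * (η / 2))) ≤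
      ∫ y in box T D ε, cubeMono w y ∂(μ T) :=
    (mul_le_mul (Real.exp_le_exp.2 h8) k2.le (Real.exp_pos _).le (Real.exp_pos _).le).trans h6
  refine le_trans (le_of_eq ?_) (mul_le_mul_of_nonneg_left h9 (Real.exp_pos _).le)
  rw [← Real.exp_add, ← Real.exp_add]
  congr 1
  ring

/-- A probability measure with small Laplace exponent charges the points close to `1`. -/
lemma le_real_of_integral_cubeMono (m : Measure (Fin n → I)) [IsProbabilityMeasure m] {δ : ℝ}
    (hδ : exp (-δ) ≤ ∫ y, cubeMono 1 y ∂m) (r : ℝ) :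
    exp (-δ) - exp (-r) ≤ m.real {y | ∀ i, exp (-r) ≤ y i} := by
  have hms : MeasurableSet {y : Fin n → I | ∀ i, exp (-r) ≤ y i} := by
    rw [ofPred_forall]
    exact MeasurableSet.iInter fun i => measurableSet_le measurable_const (by fun_prop)
  have h1 := integral_mono (integrable_cubeMono 1 m)
    (((integrable_const (1 : ℝ)).indicator hms).add (integrable_const (exp (-r)))) fun y => by
      by_cases hy : y ∈ {y : Fin n → I | ∀ i, exp (-r) ≤ y i}
      · simp only [Pi.add_apply, indicator_of_mem hy]
        linarith [cubeMono_le_one 1 y, Real.exp_pos (-r)]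
      · simp only [Pi.add_apply, indicator_of_notMem hy, zero_add]
        simp only [mem_ofPred_eq, not_forall, not_le] at hy
        obtain ⟨i, hi⟩ := hy
        have := cubeMono_update_le (y := y) (w := 1) (w' := Function.update 1 i 0) (i := i)
          (K := exp (-r)) (fun j hj => Function.update_of_ne hj _ _) (by simpa using hi.le)
        exact this.trans (mul_le_of_le_one_right (Real.exp_pos _).le (cubeMono_le_one _ _))
  simp only [Pi.add_apply] at h1
  rw [integral_add ((integrable_const (1 : ℝ)).indicator hms) (integrable_const _),
    integral_indicator hms] at h1
  simp at h1
  linarith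

/-- Multiplication by coordinates in [e^{-Tε}, 1] adds at most Tε to each negative logarithm and
never lowers it, so the product stays in the box of doubled width. -/
lemma real_box_mul_le (m₁ m₂ : Measure (Fin n → I)) [IsFiniteMeasure m₁] [IsFiniteMeasure m₂]
    {ε₁ ε : ℝ} (hε : ε₁ ≤ ε) (hT : 0 ≤ T) :
    m₁.real (box T D ε₁) * m₂.real {y | ∀ i, exp (-(T * ε)) ≤ y i} ≤
      ((m₁.prod m₂).map cubeMul).real (box T D (2 * ε)) := by
  rw [← measureReal_prod_prod, map_measureReal_apply measurable_cubeMul measurableSet_box]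
  refine measureReal_mono fun z hz i => ?_
  obtain ⟨h1, h2⟩ := hz.1 i
  have h3 := hz.2 i
  have h4 := mul_le_mul_of_nonneg_left hε hT
  simp only [cubeMul, Icc.coe_mul]
  constructor
  · refine le_trans ?_ (mul_le_mul h1 h3 (Real.exp_pos _).le (z.1 i).2.1)
    rw [← Real.exp_add]
    exact Real.exp_le_exp.2 (by linarith)
  · have h5 : 0 ≤ T * ε ∨ T * ε < 0 := le_or_gt _ _
    refine (mul_le_of_le_one_right (z.1 i).2.1 (z.2 i).2.2).trans (h2.trans (Real.exp_le_exp.2 ?_))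
    have h6 : 0 ≤ T * ε := by
      have := h3.trans (z.2 i).2.2
      rw [Real.exp_le_one_iff] at this
      linarith
    linarith

end Boxes

/-! ### The Legendre transform on balls -/

section Legendre

variable {d : ℕ} {p : Kernel (ℝ × E d) (E d)} {Q c Φ a b T H α : ℝ} {φ : E d → ℝ}

/-- The limiting exponent of a region. -/
def lam (p : Kernel (ℝ × E d) (E d)) (Q c H : ℝ) (φ : E d → ℝ) (B : Set (E d)) (θ : ℝ) : ℝ :=
  H * ∫ x in B, blim p Q c φ x θ

lemma sum_update_sub {n : ℕ} (f : ℝ → ℝ) (θ : Fin n → ℝ) (i : Fin n) (x : ℝ) :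
    ∑ j, f (Function.update θ i x j) - ∑ j, f (θ j) = f x - f (θ i) := by
  rw [← Finset.sum_sub_distrib, Finset.sum_eq_single i (fun j _ hj => ?_) (by simp),
    Function.update_self]
  rw [Function.update_of_ne hj, sub_self]

/-- The coordinates range independently, so a bound for sums of choices bounds the sum of the
suprema. It splits a bound on discrete Legendre sums into one per cell. -/
lemma sum_sSup_le {n : ℕ} {S : Fin n → Set ℝ} (hS : ∀ i, (S i).Nonempty) {K : ℝ}
    (hK : ∀ x : Fin n → ℝ, (∀ i, x i ∈ S i) → ∑ i, x i ≤ K) :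
    (∀ i, BddAbove (S i)) ∧ ∑ i, sSup (S i) ≤ K := by
  choose x₀ hx₀ using hS
  refine ⟨fun i => ⟨K - ∑ j, x₀ j + x₀ i, fun x hx => ?_⟩, le_of_forall_pos_le_add fun ε hε => ?_⟩
  · have h1 := hK (Function.update x₀ i x) fun j => by
      rcases eq_or_ne j i with rfl | hj
      · rwa [Function.update_self]
      · rw [Function.update_of_ne hj]; exact hx₀ j
    have h2 := sum_update_sub id x₀ i x
    simp only [id] at h2
    linarith
  · have hn : (0 : ℝ) < n + 1 := by positivity
    choose x hx hx' using fun i => exists_lt_of_lt_csSup ⟨x₀ i, hx₀ i⟩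
      (show sSup (S i) - ε / (n + 1) < sSup (S i) by linarith [show 0 < ε / (n + 1) by positivity])
    have h1 : ∑ i, sSup (S i) ≤ ∑ i, (x i + ε / (n + 1)) :=
      Finset.sum_le_sum fun i _ => by linarith [hx' i]
    rw [Finset.sum_add_distrib] at h1
    have h2 : ∑ _i : Fin n, ε / (n + 1) ≤ ε := by
      simp only [Finset.sum_const, Finset.card_univ, Fintype.card_fin, nsmul_eq_mul]
      rw [mul_div_assoc', div_le_iff₀ hn]
      nlinarith
    linarith [hK x hx]

namespace Setting

lemma integrableOn_blim (h : Setting p Q c Φ φ) (hb : b * Φ < Q ^ 2 / (4 * c)) {B : Set (E d)}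
    (hB : volume B ≠ ⊤) : IntegrableOn (blim p Q c φ · b) B := by
  have h0 : max b 0 * Φ < Q ^ 2 / (4 * c) := by
    rcases max_choice b 0 with e | e <;> rw [e]
    · exact hb
    · simpa using h.neg_sub le_rfl
  obtain ⟨C, -, -, -, hC, -⟩ := h.dist_blim (abs_nonneg b) (le_max_right b 0) h0
  exact Measure.integrableOn_of_bounded hB (h.measurable_blim hb).aestronglyMeasurable
    (ae_of_all _ fun x => hC b ⟨neg_abs_le b, le_max_left _ _⟩ x)

/-- Regularity of the exponent of a bounded region. -/
lemma lam_lipschitz (h : Setting p Q c Φ φ) (hH : 0 ≤ H) (ha : 0 ≤ a) (hb : 0 ≤ b)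
    (hbΦ : b * Φ < Q ^ 2 / (4 * c)) {B : Set (E d)} (hB : volume B ≠ ⊤) : ∃ C : ℝ, 0 ≤ C ∧
      (∀ θ₁ ∈ Icc (-a) b, ∀ θ₂ ∈ Icc (-a) b,
        |lam p Q c H φ B θ₁ - lam p Q c H φ B θ₂| ≤ C * |θ₁ - θ₂|) ∧
      ∀ θ s, θ + s ∈ Icc (-a) b → θ - s ∈ Icc (-a) b →
        lam p Q c H φ B (θ + s) + lam p Q c H φ B (θ - s) - 2 * lam p Q c H φ B θ ≤ C * s ^ 2 := by
  obtain ⟨C, hC, h1, h2⟩ := h.blim_lipschitz ha hb hbΦ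
  have hi : ∀ θ ∈ Icc (-a) b, IntegrableOn (blim p Q c φ · θ) B := fun θ hθ =>
    h.integrableOn_blim (h.lt_of_le hbΦ hθ.2) hB
  have hv : 0 ≤ volume.real B := measureReal_nonneg
  have hfin : IsFiniteMeasure ((volume : Measure (E d)).restrict B) :=
    ⟨by rw [Measure.restrict_apply_univ]; exact hB.lt_top⟩
  refine ⟨H * (C * volume.real B), by positivity, fun θ₁ k₁ θ₂ k₂ => ?_, fun θ s k₁ k₂ => ?_⟩
  · rw [lam, lam, ← mul_sub, ← integral_sub (hi _ k₁) (hi _ k₂), abs_mul, abs_of_nonneg hH, mul_assoc]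
    refine mul_le_mul_of_nonneg_left ?_ hH
    refine (norm_integral_le_of_norm_le_const (C := C * |θ₁ - θ₂|)
      (f := fun x => blim p Q c φ x θ₁ - blim p Q c φ x θ₂)
      (ae_of_all _ fun x => h1 θ₁ k₁ θ₂ k₂ x)).trans_eq ?_
    rw [measureReal_restrict_apply_univ]; ring
  · have k₃ : θ ∈ Icc (-a) b := ⟨by linarith [k₁.1, k₂.1], by linarith [k₁.2, k₂.2]⟩
    have hs : Integrable (fun x => blim p Q c φ x (θ + s) + blim p Q c φ x (θ - s))
        (volume.restrict B) := (hi _ k₁).add (hi _ k₂)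
    have h3 := integral_mono (hs.sub ((hi _ k₃).const_mul 2))
      (integrable_const (C * s ^ 2)) fun x => h2 θ s k₁ k₂ x
    simp only [Pi.sub_apply] at h3
    rw [integral_sub hs ((hi _ k₃).const_mul 2),
      integral_add (hi _ k₁) (hi _ k₂), integral_const_mul, integral_const,
      measureReal_restrict_apply_univ, smul_eq_mul] at h3
    rw [lam, lam, lam]
    nlinarith [mul_le_mul_of_nonneg_left h3 hH]

/-- An interior maximizer of `θ ↦ θ α - lam θ`. -/
lemma exists_maximizer (h : Setting p Q c Φ φ) (hH : 0 ≤ H) (hα : 0 < α) {θ' θ₁ : ℝ} (h0 : 0 < θ')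
    (h₁ : θ' < θ₁) (hθ₁ : θ₁ * Φ < Q ^ 2 / (4 * c)) {B : Set (E d)} (hB : volume B ≠ ⊤)
    (hs : α * (θ₁ - θ') < lam p Q c H φ B θ₁ - lam p Q c H φ B θ') :
    ∃ θ < θ₁, ∃ C : ℝ, ∃ s₀ > 0, ∀ s ∈ Ioo 0 s₀, θ + s ≤ θ₁ ∧
      lam p Q c H φ B (θ + s) - lam p Q c H φ B θ ≤ s * α + C * s ^ 2 ∧
      lam p Q c H φ B (θ - s) - lam p Q c H φ B θ ≤ -(s * α) + C * s ^ 2 := by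
  have hc := h.hc
  have hΦ := h.hΦ
  have hv : 0 ≤ volume.real B := measureReal_nonneg
  have hfin : IsFiniteMeasure ((volume : Measure (E d)).restrict B) :=
    ⟨by rw [Measure.restrict_apply_univ]; exact hB.lt_top⟩
  have hlz : lam p Q c H φ B 0 = 0 := by simp [lam, h.blim_zero]
  -- At -w the function θα - lam θ is negative, because lam decreases at most like a square root,
  -- whereas its value at 0 is 0. So the maximum over [-w, θ₁] is not attained at -w. By `hs` it is
  -- not attained at θ₁ either, because the value at θ' is larger.
  set w := (H * volume.real B) ^ 2 * (Φ / c) / α ^ 2 + 1 with hw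
  have hw0 : 0 < w := by positivity
  have hlow : -w * α - lam p Q c H φ B (-w) < 0 := by
    have h2 := integral_mono (integrable_const (-Real.sqrt (w * Φ / c)))
      (h.integrableOn_blim (h.neg_sub hw0.le) hB) fun x => h.blim_lower hw0.le x
    rw [integral_const, measureReal_restrict_apply_univ, smul_eq_mul] at h2
    have h3 : H * (volume.real B * Real.sqrt (w * Φ / c)) < w * α := by
      refine lt_of_pow_lt_pow_left₀ 2 (by positivity) ?_
      have e : (H * (volume.real B * Real.sqrt (w * Φ / c))) ^ 2 =
          w * ((H * volume.real B) ^ 2 * (Φ / c)) := by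
        rw [mul_pow, mul_pow, Real.sq_sqrt (by positivity)]; ring
      have e2 : (H * volume.real B) ^ 2 * (Φ / c) = (w - 1) * α ^ 2 := by
        rw [hw]; field_simp; ring
      rw [e, e2]
      have : 0 < w * α ^ 2 := by positivity
      nlinarith
    have h4 := mul_le_mul_of_nonneg_left h2 hH
    rw [lam]
    nlinarith
  obtain ⟨C, hC, hl, hsc⟩ := h.lam_lipschitz hH hw0.le (h0.trans h₁).le hθ₁ hB
  have hcont : ContinuousOn (fun θ => θ * α - lam p Q c H φ B θ) (Icc (-w) θ₁) := by
    refine ContinuousOn.sub (by fun_prop) ?_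
    exact (LipschitzOnWith.of_dist_le_mul (K := C.toNNReal) fun x hx y hy => by
      rw [Real.coe_toNNReal _ hC]; exact hl x hx y hy).continuousOn
  have hne : (0 : ℝ) ∈ Icc (-w) θ₁ := ⟨by linarith, (h0.trans h₁).le⟩
  obtain ⟨θ, hθ, hmax⟩ := isCompact_Icc.exists_isMaxOn ⟨0, hne⟩ hcont
  have hmx : ∀ x ∈ Icc (-w) θ₁, x * α - lam p Q c H φ B x ≤ θ * α - lam p Q c H φ B θ :=
    fun x hx => hmax hx
  have m1 : θ ≠ -w := by
    rintro rfl
    have := hmx 0 hne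
    rw [hlz] at this
    linarith
  have m2 : θ ≠ θ₁ := by
    rintro rfl
    have := hmx θ' ⟨by linarith, h₁.le⟩
    linarith
  have n1 : -w < θ := lt_of_le_of_ne hθ.1 (Ne.symm m1)
  have n2 : θ < θ₁ := lt_of_le_of_ne hθ.2 m2
  refine ⟨θ, n2, C, min (θ + w) (θ₁ - θ), lt_min (by linarith) (by linarith), fun s hs => ?_⟩
  have l1 := hs.2.le.trans (min_le_left _ _)
  have l2 := hs.2.le.trans (min_le_right _ _)
  have hp : θ + s ∈ Icc (-w) θ₁ := ⟨by linarith [hs.1], by linarith⟩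
  have hm : θ - s ∈ Icc (-w) θ₁ := ⟨by linarith, by linarith [hs.1]⟩
  have k1 := hsc θ s hp hm
  have k2 := hmx _ hp
  have k3 := hmx _ hm
  exact ⟨hp.2, by linarith, by linarith⟩

/-- The suprema over balls converge. -/
lemma eventually_legendre_le (h : Setting p Q c Φ φ) (hH : 0 < H)
    (hi : ∀ u ≤ 0, Integrable (blim p Q c φ · u)) {r : ℝ}
    (hr : ∀ θ, θ * Φ < Q ^ 2 / (4 * c) → Integrable (blim p Q c φ · θ) →
      θ * α - lam p Q c H φ univ θ ≤ r) {θ₁ : ℝ} (h1 : 0 ≤ θ₁)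
    (hθ₁ : θ₁ * Φ < Q ^ 2 / (4 * c)) {δ : ℝ} (hδ : 0 < δ) :
    ∀ᶠ k : ℕ in atTop, ∀ θ ≤ θ₁, θ * α - lam p Q c H φ (closedBall 0 k) θ ≤ r + δ := by
  have hBt : ∀ k : ℕ, volume (closedBall (0 : E d) k) ≠ ⊤ := fun k =>
    measure_closedBall_lt_top.ne
  -- For θ ≤ 0 the stationary limit is nonpositive and integrable, so passing from the whole space
  -- to a ball only lowers the transform; no δ is lost.
  have hneg : ∀ k : ℕ, ∀ θ ≤ 0, θ * α - lam p Q c H φ (closedBall 0 k) θ ≤ r := by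
    intro k θ hθ
    have hD : θ * Φ < Q ^ 2 / (4 * c) := h.lt_of_le hθ₁ (hθ.trans h1)
    refine le_trans ?_ (hr θ hD (hi θ hθ))
    have h2 : ∫ x, -blim p Q c φ x θ ≥ ∫ x in closedBall 0 k, -blim p Q c φ x θ :=
      setIntegral_le_integral (hi θ hθ).neg (ae_of_all _ fun x => neg_nonneg.2 (h.blim_nonpos hθ x))
    rw [integral_neg, integral_neg] at h2
    rw [lam, lam, setIntegral_univ]
    nlinarith
  have hanti : ∀ k l : ℕ, k ≤ l → ∀ θ ∈ Icc 0 θ₁,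
      lam p Q c H φ (closedBall 0 k) θ ≤ lam p Q c H φ (closedBall 0 l) θ := by
    intro k l hkl θ hθ
    have hD := h.lt_of_le hθ₁ hθ.2
    refine mul_le_mul_of_nonneg_left (setIntegral_mono_set (h.integrableOn_blim hD (hBt l))
      (ae_of_all _ fun x => h.blim_nonneg hD hθ.1 x) (LE.le.eventuallyLE
        (Metric.closedBall_subset_closedBall (by exact_mod_cast hkl)))) hH.le
  -- Otherwise some parameters in [0, θ₁] violate the bound on arbitrarily large balls. The ball
  -- integrals increase with the ball for θ ≥ 0, so a limit point θ of these parameters violates it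
  -- on every ball.
  by_contra hcon
  have hex : ∀ k : ℕ, ∃ θ ∈ Icc 0 θ₁, r + δ ≤ θ * α - lam p Q c H φ (closedBall 0 k) θ := by
    intro k
    obtain ⟨l, hkl, hl⟩ := (frequently_atTop.1 (not_eventually.1 hcon)) k
    push Not at hl
    obtain ⟨θ, hθ, hlt⟩ := hl
    have h0 : 0 ≤ θ := by
      by_contra hlt0
      linarith [hneg l θ (not_le.1 hlt0).le]
    exact ⟨θ, ⟨h0, hθ⟩, by linarith [hanti k l hkl θ ⟨h0, hθ⟩]⟩
  choose t ht ht' using hex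
  obtain ⟨θ, hθ, ψ, hψ, hlim⟩ := isCompact_Icc.tendsto_subseq ht
  have hD := h.lt_of_le hθ₁ hθ.2
  have hk : ∀ k : ℕ, r + δ ≤ θ * α - lam p Q c H φ (closedBall 0 k) θ := by
    intro k
    obtain ⟨C, hC, hl, -⟩ := h.lam_lipschitz hH.le le_rfl h1 hθ₁ (hBt k)
    have hcont : ContinuousOn (fun θ => θ * α - lam p Q c H φ (closedBall 0 k) θ)
        (Icc 0 θ₁) := by
      refine ContinuousOn.sub (by fun_prop) ?_
      exact (LipschitzOnWith.of_dist_le_mul (K := C.toNNReal) fun x hx y hy => by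
        rw [Real.coe_toNNReal _ hC]; exact hl x (by simpa using hx) y (by simpa using hy)).continuousOn
    refine ge_of_tendsto ((hcont θ hθ).tendsto.comp (tendsto_nhdsWithin_iff.2
      ⟨hlim, Eventually.of_forall fun j => ht _⟩)) ?_
    filter_upwards [eventually_ge_atTop k] with j hj
    simp only [Function.comp_apply]
    linarith [ht' (ψ j), hanti k (ψ j) (hj.trans (hψ.id_le j)) _ (ht (ψ j))]
  -- The violation bounds the ball integrals at θ uniformly, so `blim` is integrable there by
  -- monotone convergence, and `hr` gives the contradiction.
  have hfin : ∫⁻ x, ofReal (blim p Q c φ x θ) ≤ ofReal ((θ * α - r - δ) / H) := by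
    have hu : ⋃ k : ℕ, closedBall (0 : E d) k = univ := Metric.iUnion_closedBall_nat 0
    rw [← setLIntegral_univ, ← hu, setLIntegral_iUnion_of_directed _
      (Monotone.directed_le fun k l hkl => Metric.closedBall_subset_closedBall (by exact_mod_cast hkl))]
    refine iSup_le fun k => ?_
    rw [← ofReal_integral_eq_lintegral_ofReal (h.integrableOn_blim hD (hBt k))
      (ae_of_all _ fun x => h.blim_nonneg hD hθ.1 x)]
    refine ENNReal.ofReal_le_ofReal ?_
    rw [le_div_iff₀ hH]
    have := hk k
    rw [lam] at this
    linarith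
  have hint : Integrable (blim p Q c φ · θ) := by
    refine ⟨(h.measurable_blim hD).aestronglyMeasurable, ?_⟩
    rw [hasFiniteIntegral_iff_ofReal (ae_of_all _ fun x => h.blim_nonneg hD hθ.1 x)]
    exact hfin.trans_lt ENNReal.ofReal_lt_top
  have h5 := hr θ hD hint
  have h6 : θ * α - lam p Q c H φ univ θ ≥ r + δ := by
    have h7 := tendsto_setIntegral_of_monotone (μ := volume) (f := fun x => blim p Q c φ x θ)
      (s := fun k : ℕ => closedBall (0 : E d) k)
      (fun k => Metric.isClosed_closedBall.measurableSet) (fun k l hkl =>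
        Metric.closedBall_subset_closedBall (by exact_mod_cast hkl))
      (hint.integrableOn)
    rw [Metric.iUnion_closedBall_nat] at h7
    exact ge_of_tendsto' (tendsto_const_nhds.sub (h7.const_mul H)) hk
  linarith

/-- The exponents of large balls have slopes exceeding `α`. -/
lemma eventually_slope (h : Setting p Q c Φ φ) (hH : 0 < H) {θ' θ₁ : ℝ} (h₁ : θ' < θ₁)
    (hθ₁ : θ₁ * Φ < Q ^ 2 / (4 * c))
    (hα : ofReal α < ofReal H * ∫⁻ x, ofReal (deriv (blim p Q c φ x) θ')) :
    ∀ᶠ k : ℕ in atTop, α * (θ₁ - θ') < lam p Q c H φ (closedBall 0 k) θ₁ -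
      lam p Q c H φ (closedBall 0 k) θ' := by
  have hBt : ∀ k : ℕ, volume (closedBall (0 : E d) k) ≠ ⊤ := fun k =>
    measure_closedBall_lt_top.ne
  have hmono : Monotone fun k : ℕ => closedBall (0 : E d) k := fun k l hkl =>
    Metric.closedBall_subset_closedBall (by exact_mod_cast hkl)
  rw [← setLIntegral_univ, ← Metric.iUnion_closedBall_nat (0 : E d),
    setLIntegral_iUnion_of_directed _ hmono.directed_le, ENNReal.mul_iSup] at hα
  obtain ⟨k₀, hk₀⟩ := lt_iSup_iff.1 hα
  filter_upwards [eventually_ge_atTop k₀] with k hk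
  have h2 := hk₀.trans_le (mul_le_mul_right (lintegral_mono_set (hmono hk)) (ofReal H))
  have i1 := h.integrableOn_blim hθ₁ (hBt k)
  have i2 := h.integrableOn_blim (h.lt_of_le hθ₁ h₁.le) (hBt k)
  have hd : 0 < θ₁ - θ' := by linarith
  -- Convexity: the derivative at θ' is at most the difference quotient between θ' and θ₁.
  have h3 : (∫⁻ x in closedBall 0 k, ofReal (deriv (blim p Q c φ x) θ')) *
      ofReal (θ₁ - θ') ≤ ofReal
        (∫ x in closedBall 0 k, (blim p Q c φ x θ₁ - blim p Q c φ x θ')) := by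
    have i3 : Integrable (fun x => blim p Q c φ x θ₁ - blim p Q c φ x θ')
        (volume.restrict (closedBall 0 k)) := i1.sub i2
    rw [ofReal_integral_eq_lintegral_ofReal i3
      (ae_of_all _ fun x => sub_nonneg.2 (h.blim_mono hθ₁ h₁.le x)),
      ← lintegral_mul_const' _ _ ENNReal.ofReal_ne_top]
    refine lintegral_mono fun x => ?_
    rw [← ENNReal.ofReal_mul' hd.le]
    exact ENNReal.ofReal_le_ofReal (h.deriv_blim_mul_le hθ₁ h₁ x)
  have h4 : ofReal (α * (θ₁ - θ')) < ofReal (H *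
      ∫ x in closedBall 0 k, (blim p Q c φ x θ₁ - blim p Q c φ x θ')) := by
    rw [ENNReal.ofReal_mul' hd.le, ENNReal.ofReal_mul hH.le]
    refine lt_of_lt_of_le ?_ (mul_le_mul_right h3 (ofReal H))
    rw [← mul_assoc]
    exact ENNReal.mul_lt_mul_left (by simpa using hd) ENNReal.ofReal_ne_top h2
  have h5 := lt_of_not_ge fun hle => (ENNReal.ofReal_le_ofReal hle).not_gt h4
  rw [lam, lam, ← mul_sub, ← integral_sub i1 i2]
  exact h5

end Setting

end Legendre

/-! ### Large deviation estimates for the law of the masses -/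

section LawBounds

variable {d n : ℕ} {p : Kernel (ℝ × E d) (E d)} {Q c Φ a b H : ℝ} {φ : E d → ℝ}
  {m : ℝ → Measure (Fin n → I)} {D : Fin n → ℝ}

/-- `m` has the Laplace transform of the occupation masses at time `T`. -/
def HasLaplace (p : Kernel (ℝ × E d) (E d)) (Q c H : ℝ) (φ : E d → ℝ) (T : ℝ)
    (m : Measure (Fin n → I)) : Prop :=
  IsFiniteMeasure m ∧ ∀ u : Fin n → NNReal,
    ∫ y, cubeMono u y ∂m = exp (laplaceExp p Q c H φ n T univ fun i => -(u i : ℝ))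

lemma box_mono {T ε ε' : ℝ} (hT : 0 ≤ T) (h : ε ≤ ε') : box T D ε ⊆ box T D ε' := fun y hy i => by
  have h4 := mul_le_mul_of_nonneg_left h hT
  exact ⟨(Real.exp_le_exp.2 (by linarith)).trans (hy i).1,
    (hy i).2.trans (Real.exp_le_exp.2 (by linarith))⟩

namespace Setting

lemma zero_lt (h : Setting p Q c Φ φ) : 0 * Φ < Q ^ 2 / (4 * c) := by simpa using h.neg_sub le_rfl

lemma integrable_of_le (h : Setting p Q c Φ φ) (hi : ∀ u ≤ 0, Integrable (blim p Q c φ · u))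
    (hb : b * Φ < Q ^ 2 / (4 * c)) (hib : Integrable (blim p Q c φ · b)) {u : ℝ} (hu : u ≤ b) :
    Integrable (blim p Q c φ · u) := by
  rcases le_or_gt u 0 with h0 | h0
  · exact hi u h0
  · refine hib.mono' (h.measurable_blim (h.lt_of_le hb hu)).aestronglyMeasurable
      (ae_of_all _ fun x => ?_)
    rw [Real.norm_of_nonneg (h.blim_nonneg (h.lt_of_le hb hu) h0.le x)]
    exact h.blim_mono hb hu x

/-- Each of the n cells has length T/n, whence the rate H/n per cell in the limit. -/
lemma tendsto_laplaceExp (h : Setting p Q c Φ φ) (hn : 0 < n) (hb : 0 ≤ b)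
    (hbΦ : b * Φ < Q ^ 2 / (4 * c)) {θ : Fin n → ℝ} (hθ : ∀ i, θ i ≤ b) {B : Set (E d)}
    (hi : ∀ u ≤ b, IntegrableOn (blim p Q c φ · u) B) :
    Tendsto (fun T : ℝ => T⁻¹ * laplaceExp p Q c H φ n T B θ) atTop
      (𝓝 (∑ i, lam p Q c (H / n) φ B (θ i))) := by
  have hθ' : ∀ i, θ i ∈ Icc (-∑ j, |θ j|) b := fun i => by
    have h1 := Finset.single_le_sum (f := fun j => |θ j|) (fun j _ => abs_nonneg _)
      (Finset.mem_univ i)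
    exact ⟨by linarith [neg_abs_le (θ i)], hθ i⟩
  have ha : 0 ≤ ∑ j, |θ j| := Finset.sum_nonneg fun i _ => abs_nonneg _
  have h1 := (h.tendsto_integral_gsol hn ha hb hbΦ hθ' (hi _ (by linarith)) (hi b le_rfl)).const_mul H
  simp only [laplaceExp, lam]
  convert h1 using 2
  · ring
  · rw [Finset.mul_sum]
    exact Finset.sum_congr rfl fun i _ => by ring

/-- The law is known through nonpositive parameters only, but these moments already determine it. It
must coincide with the reweighted measure, which carries the exponential moments up to order b. -/
lemma hasLaplace_eq_tilt (h : Setting p Q c Φ φ) {T : ℝ} {m μ : Measure (Fin n → I)}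
    (hm : HasLaplace p Q c H φ T m) {b : NNReal} [IsFiniteMeasure μ] (hμ : ∀ u : Fin n → NNReal,
      ∫ y, cubeMono u y ∂μ = exp (laplaceExp p Q c H φ n T univ fun i => b - u i)) :
    m = tilt μ fun _ => b := by
  have := hm.1
  refine cube_measure_ext fun u => ?_
  rw [hm.2, integral_tilt, hμ]
  congr 2
  ext i
  simp

/-- The upper bound for boxes. -/
lemma eventually_box_le (h : Setting p Q c Φ φ) (hn : 0 < n) (hH : 0 ≤ H)
    (hi : ∀ u ≤ 0, Integrable (blim p Q c φ · u)) (hm : ∀ T, 0 < T → HasLaplace p Q c H φ T (m T))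
    {θ : Fin n → ℝ} (hθ : ∀ i, θ i * Φ < Q ^ 2 / (4 * c) ∧ Integrable (blim p Q c φ · (θ i)))
    {ε η : ℝ} (hη : 0 < η) : ∀ᶠ T in atTop, (m T).real (box T D ε) ≤ exp
      (-(T * (∑ i, (θ i * D i - lam p Q c (H / n) φ univ (θ i)) - ε * ∑ i, |θ i| - η))) := by
  obtain ⟨b, hθb, hb0, hbΦ, hib⟩ : ∃ b : NNReal, (∀ i, θ i ≤ b) ∧ 0 ≤ (b : ℝ) ∧
      b * Φ < Q ^ 2 / (4 * c) ∧ Integrable (blim p Q c φ · b) := by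
    have : Nonempty (Fin n) := ⟨⟨0, hn⟩⟩
    obtain ⟨j, hj⟩ := Finite.exists_max θ
    refine ⟨(θ j).toNNReal, fun i => (hj i).trans (Real.le_coe_toNNReal _), NNReal.coe_nonneg _, ?_⟩
    rw [Real.coe_toNNReal']
    rcases max_choice (θ j) 0 with e | e <;> rw [e]
    · exact hθ j
    · exact ⟨h.zero_lt, hi 0 le_rfl⟩
  have hin : ∀ u ≤ (b : ℝ), IntegrableOn (blim p Q c φ · u) univ := fun u hu =>
    (h.integrable_of_le hi hbΦ hib hu).integrableOn
  have ht := h.tendsto_laplaceExp (H := H) hn hb0 hbΦ hθb hin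
  filter_upwards [ht.eventually (gt_mem_nhds (lt_add_of_pos_right _ hη)), eventually_gt_atTop 0]
    with T hT hT0
  obtain ⟨μ, hμ, hμu⟩ := h.exists_cube_measure (n := n) hT0.le hb0 hbΦ hH hin
  set w : Fin n → NNReal := fun i => (b - θ i).toNNReal with hwd
  have hw : ∀ i, (w i : ℝ) = b - θ i := fun i => Real.coe_toNNReal _ (by linarith [hθb i])
  rw [h.hasLaplace_eq_tilt (hm T hT0) hμu]
  refine (real_tilt_box_le μ hw).trans ?_
  rw [hμu]
  simp only [hw, sub_sub_cancel]
  rw [← Real.exp_add, Finset.sum_sub_distrib]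
  rw [inv_mul_lt_iff₀ hT0] at hT
  exact Real.exp_le_exp.2 (by linarith)

lemma gsol_zero (h : Setting p Q c Φ φ) {T : ℝ} (hT : 0 ≤ T) {t : ℝ} (ht : 0 ≤ t) (x : E d) :
    gsol p Q c φ n T (fun _ => 0) t x = 0 := by
  have h1 := h.gsol_envelope (n := n) (a := 0) (b := 0) (θ := fun _ => 0) hT le_rfl le_rfl h.zero_lt
    (fun i => by simp) ht x
  rw [neg_zero, h.blim_zero] at h1
  exact le_antisymm h1.2 h1.1

/-- The masses produced far away are small. -/
lemma eventually_far (h : Setting p Q c Φ φ) (hH : 0 ≤ H)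
    (hi : ∀ u ≤ 0, Integrable (blim p Q c φ · u)) {B : Set (E d)} {ε : ℝ} (hε : 0 < ε)
    (hB : -(ε / 2) ≤ lam p Q c H φ B (-1)) {m₂ : ℝ → Measure (Fin n → I)}
    (hm₂ : ∀ T, 0 < T → ∀ u : Fin n → NNReal, ∫ y, cubeMono u y ∂(m₂ T) =
      exp (laplaceExp p Q c H φ n T B fun i => ((0 : NNReal) : ℝ) - u i)) :
    ∀ᶠ T in atTop, exp (-(T * ε)) ≤ (m₂ T).real {y | ∀ i, exp (-(T * ε)) ≤ y i} := by
  have h2 : Tendsto (fun T : ℝ => exp (-(T * (ε / 2)))) atTop (𝓝 0) :=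
    Real.tendsto_exp_atBot.comp (tendsto_neg_atTop_atBot.comp
      (tendsto_id.atTop_mul_const (by linarith)))
  filter_upwards [eventually_gt_atTop 0,
    h2.eventually (gt_mem_nhds (show (0 : ℝ) < 1 / 2 by norm_num))] with T hT hT2
  have hprob : IsProbabilityMeasure (m₂ T) := by
    have h3 := hm₂ T hT 0
    have h4 : laplaceExp p Q c H φ n T B (fun i => ((0 : NNReal) : ℝ) - (0 : Fin n → NNReal) i) = 0 := by
      simp only [laplaceExp, Pi.zero_apply, sub_self]
      rw [integral_eq_zero_of_ae, mul_zero]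
      filter_upwards [ae_slab T B] with y hy using h.gsol_zero hT.le hy.1.le _
    rw [h4, cubeMono_zero] at h3
    simp only [ContinuousMap.one_apply, integral_const, smul_eq_mul, mul_one, Real.exp_zero] at h3
    exact ⟨by rw [← ENNReal.toReal_eq_one_iff]; exact h3⟩
  have h5 : exp (-(T * (ε / 2))) ≤ ∫ y, cubeMono 1 y ∂(m₂ T) := by
    rw [hm₂ T hT, Real.exp_le_exp, laplaceExp]
    have hi1 : IntegrableOn (blim p Q c φ · (-1)) B := (hi _ (by norm_num)).integrableOn
    have hi0 : IntegrableOn (blim p Q c φ · 0) B := (hi 0 le_rfl).integrableOn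
    have hθ : ∀ i : Fin n, ((0 : NNReal) : ℝ) - (1 : Fin n → NNReal) i ∈ Icc (-1 : ℝ) 0 := fun i => by
      simp
    have h6 : ∫ y, blim p Q c φ y.2 (-1) ∂(slab T B) ≤
        ∫ y, gsol p Q c φ n T (fun i => ((0 : NNReal) : ℝ) - (1 : Fin n → NNReal) i) y.1 y.2 ∂(slab T B) := by
      refine integral_mono_ae (hi1.comp_snd _)
        (h.integrable_gsol hT.le zero_le_one le_rfl h.zero_lt hθ hi1 hi0) ?_
      filter_upwards [ae_slab T B] with y hy
      exact (h.gsol_envelope hT.le zero_le_one le_rfl h.zero_lt hθ hy.1.le _).1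
    rw [slab, integral_fun_snd (fun x => blim p Q c φ x (-1)), measureReal_restrict_apply_univ,
      Real.volume_real_Ioc_of_le hT.le, sub_zero, smul_eq_mul] at h6
    have h7 := mul_le_mul_of_nonneg_left h6 hH
    rw [lam] at hB
    have h8 := mul_le_mul_of_nonneg_left hB hT.le
    rw [slab]
    linarith
  refine le_trans ?_ (le_real_of_integral_cubeMono (m₂ T) h5 (T * ε))
  -- With x = e^{-Tε/2} ≤ 1/2 one has x - x² ≥ x² = e^{-Tε}.
  have e : exp (-(T * ε)) = exp (-(T * (ε / 2))) * exp (-(T * (ε / 2))) := by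
    rw [← Real.exp_add]; congr 1; ring
  rw [e]
  nlinarith [Real.exp_pos (-(T * (ε / 2)))]

/-- The lower bound for boxes. -/
lemma eventually_le_box (h : Setting p Q c Φ φ) (hn : 0 < n) (hH : 0 < H)
    (hi : ∀ u ≤ 0, Integrable (blim p Q c φ · u)) (hm : ∀ T, 0 < T → HasLaplace p Q c H φ T (m T))
    (hD : ∀ i, 0 < D i) {θ' θ₁ : ℝ} (h0 : 0 < θ') (h₁ : θ' < θ₁) (hθ₁ : θ₁ * Φ < Q ^ 2 / (4 * c))
    (hs : ∀ i, ofReal (D i) <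
      ofReal (H / n) * ∫⁻ x, ofReal (deriv (blim p Q c φ x) θ')) {K : ℝ}
    (hK : ∀ θ : Fin n → ℝ, (∀ i, θ i * Φ < Q ^ 2 / (4 * c) ∧ Integrable (blim p Q c φ · (θ i))) →
      ∑ i, (θ i * D i - lam p Q c (H / n) φ univ (θ i)) ≤ K) {ε δ : ℝ} (hε : 0 < ε) (hδ : 0 < δ) :
    ∀ᶠ T in atTop, exp (-(T * (K + δ))) ≤ (m T).real (box T D ε) := by
  have hn' : (0 : ℝ) < n := by exact_mod_cast hn
  have hHn : 0 < H / n := by positivity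
  -- The values of the Legendre functional of one cell at parameters whose stationary limit is
  -- integrable. The bound K splits into suprema of these sets.
  set S : Fin n → Set ℝ := fun i => (fun θ => θ * D i - lam p Q c (H / n) φ univ θ) ''
    {θ | θ * Φ < Q ^ 2 / (4 * c) ∧ Integrable (blim p Q c φ · θ)} with hS
  obtain ⟨hbdd, hsum⟩ := sum_sSup_le (S := S) (K := K)
    (fun i => ⟨_, 0, ⟨h.zero_lt, hi 0 le_rfl⟩, rfl⟩) fun x hx => by
      choose θ hθ hθx using hx
      simpa only [← hθx] using hK θ hθ
  set ε' := min (ε / 2) (δ / 4) with hε'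
  have hε'0 : 0 < ε' := lt_min (by linarith) (by linarith)
  have hBt : ∀ k : ℕ, volume (closedBall (0 : E d) k) ≠ ⊤ := fun k =>
    measure_closedBall_lt_top.ne
  have hfar : ∀ᶠ k : ℕ in atTop, -(ε' / 2) < lam p Q c H φ (closedBall 0 k)ᶜ (-1) := by
    have h7 := tendsto_setIntegral_of_antitone (μ := volume) (f := fun x => blim p Q c φ x (-1))
      (s := fun k : ℕ => (closedBall (0 : E d) k)ᶜ)
      (fun k => Metric.isClosed_closedBall.measurableSet.compl) (fun k l hkl =>
        compl_subset_compl.2 (Metric.closedBall_subset_closedBall (by exact_mod_cast hkl)))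
      ⟨0, (hi (-1) (by norm_num)).integrableOn⟩
    rw [← compl_iUnion, Metric.iUnion_closedBall_nat, compl_univ, setIntegral_empty] at h7
    have h8 := h7.const_mul H
    rw [mul_zero] at h8
    exact h8.eventually (lt_mem_nhds (by linarith))
  have hδn : 0 < δ / (4 * n) := by positivity
  -- A ball so large that the outside contributes little, the slope of its exponent between θ' and
  -- θ₁ exceeds every D i, and its Legendre values are at most the suprema over the whole space plus
  -- δ/(4n).
  obtain ⟨k, hk1, hk2, hk3⟩ := (hfar.and ((eventually_all.2 fun i =>
    h.eventually_slope hHn h₁ hθ₁ (hs i)).and (eventually_all.2 fun i =>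
      h.eventually_legendre_le (r := sSup (S i)) (α := D i) hHn hi
        (fun θ h1 h2 => le_csSup (hbdd i) ⟨θ, ⟨h1, h2⟩, rfl⟩) (h0.trans h₁).le hθ₁ hδn))).exists
  set B := closedBall (0 : E d) k with hB
  have hBm : MeasurableSet B := Metric.isClosed_closedBall.measurableSet
  choose θ hθ C s₀ hs₀ hθs using fun i => h.exists_maximizer hHn.le (hD i) h0 h₁ hθ₁ (hBt k) (hk2 i)
  -- The box used for tilting is narrower still, so that ε₁ Σ|θ_i| costs at most δ/4.
  set ε₁ := min ε' (δ / 4 / (∑ i, |θ i| + 1)) with hε₁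
  have hab : 0 ≤ ∑ i, |θ i| := Finset.sum_nonneg fun i _ => abs_nonneg _
  have hε₁0 : 0 < ε₁ := lt_min hε'0 (by positivity)
  have hε₁s : ε₁ * ∑ i, |θ i| ≤ δ / 4 := by
    have h1 : ε₁ * (∑ i, |θ i| + 1) ≤ δ / 4 := by
      rw [← le_div_iff₀ (by positivity)]; exact min_le_right _ _
    nlinarith
  -- The step s of the Chebyshev estimate is small enough for the quadratic remainder C s² to fall
  -- below s ε₁.
  obtain ⟨s, hs0, hsθ⟩ : ∃ s > 0, ∀ i, s < s₀ i ∧ C i * s < ε₁ := by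
    have h2 : ∀ i, ∀ᶠ s in 𝓝[>] (0 : ℝ), s < s₀ i ∧ C i * s < ε₁ := fun i => by
      have h3 : Tendsto (fun s => C i * s) (𝓝 0) (𝓝 (C i * 0)) := Continuous.tendsto (by fun_prop) 0
      rw [mul_zero] at h3
      exact ((gt_mem_nhds (hs₀ i)).and (h3.eventually (gt_mem_nhds hε₁0))).filter_mono
        nhdsWithin_le_nhds
    obtain ⟨s, h4, h5⟩ := ((eventually_all.2 h2).and self_mem_nhdsWithin).exists
    exact ⟨s, h5, h4⟩
  set b : NNReal := θ₁.toNNReal with hb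
  have hbc : (b : ℝ) = θ₁ := Real.coe_toNNReal _ (h0.trans h₁).le
  have hb0 : 0 ≤ (b : ℝ) := b.2
  have hbΦ : b * Φ < Q ^ 2 / (4 * c) := by rw [hbc]; exact hθ₁
  have hiB : ∀ u ≤ (b : ℝ), IntegrableOn (blim p Q c φ · u) B := fun u hu =>
    h.integrableOn_blim (h.lt_of_le hbΦ hu) (hBt k)
  choose μ hμ using fun T : ℝ => show ∃ μ : Measure (Fin n → I), 0 < T → IsFiniteMeasure μ ∧
      ∀ u : Fin n → NNReal, ∫ y, cubeMono u y ∂μ = exp (laplaceExp p Q c H φ n T B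
        fun i => b - u i) by
    by_cases hT : 0 < T
    · obtain ⟨μ, h1⟩ := h.exists_cube_measure (n := n) hT.le hb0 hbΦ hH.le hiB
      exact ⟨μ, fun _ => h1⟩
    · exact ⟨0, fun h => absurd h hT⟩
  choose m₂ hm₂ using fun T : ℝ => show ∃ μ : Measure (Fin n → I), 0 < T → IsFiniteMeasure μ ∧
      ∀ u : Fin n → NNReal, ∫ y, cubeMono u y ∂μ = exp (laplaceExp p Q c H φ n T Bᶜ
        fun i => ((0 : NNReal) : ℝ) - u i) by
    by_cases hT : 0 < T
    · obtain ⟨μ, h1⟩ := h.exists_cube_measure (n := n) (B := Bᶜ) (b := ((0 : NNReal) : ℝ)) hT.le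
        le_rfl h.zero_lt hH.le fun u hu => (hi u hu).integrableOn
      exact ⟨μ, fun _ => h1⟩
    · exact ⟨0, fun h => absurd h hT⟩
  have hsr : ∀ i, s ∈ Ioo 0 (s₀ i) := fun i => ⟨hs0, (hsθ i).1⟩
  have hθb : ∀ i, θ i + s ≤ b := fun i => by rw [hbc]; exact (hθs i s (hsr i)).1
  have hlim : ∀ {t : Fin n → ℝ}, (∀ i, t i ≤ b) →
      Tendsto (fun T : ℝ => T⁻¹ * laplaceExp p Q c H φ n T B t) atTop
        (𝓝 (∑ i, lam p Q c (H / n) φ B (t i))) := fun ht =>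
    h.tendsto_laplaceExp hn hb0 hbΦ ht hiB
  have hup : ∀ (i : Fin n) (x : ℝ), x ≤ b → ∀ j, Function.update θ i x j ≤ b := fun i x hx j => by
    rcases eq_or_ne j i with rfl | hj
    · rwa [Function.update_self]
    · rw [Function.update_of_ne hj]; linarith [hθb j]
  have hCs : ∀ i, C i * s ^ 2 < s * ε₁ := fun i => by nlinarith [(hsθ i).2]
  have hlow := eventually_le_real_tilt_box (D := D) (θ := θ) (ε := ε₁) (μ := μ)
    (ℓ := fun T => laplaceExp p Q c H φ n T B) (g := fun t => ∑ i, lam p Q c (H / n) φ B (t i))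
    (b := b) (fun T hT => (hμ T hT).1) (fun T hT => (hμ T hT).2) hs0 hθb
    (hlim fun i => by linarith [hθb i]) (fun i => hlim (hup i _ (hθb i)))
    (fun i => hlim (hup i _ (by linarith [hθb i])))
    (fun i => by
      have := (hθs i s (hsr i)).2.1
      simp only [sum_update_sub (fun x => lam p Q c (H / n) φ B x)]
      linarith [hCs i])
    (fun i => by
      have := (hθs i s (hsr i)).2.2
      simp only [sum_update_sub (fun x => lam p Q c (H / n) φ B x)]
      linarith [hCs i]) (η := δ / 4) (by linarith)
  filter_upwards [hlow, h.eventually_far hH.le hi hε'0 hk1.le (fun T hT => (hm₂ T hT).2),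
    eventually_gt_atTop 0] with T e1 e2 hT
  have := (hμ T hT).1
  have := (hm₂ T hT).1
  have := (hm T hT).1
  -- The law is the product of two independent contributions: that of the ball, as a reweighting of
  -- a measure with finite exponential moments, and that of the complement, which is not tilted.
  have hfac : m T = ((tilt (μ T) fun _ => b).prod (m₂ T)).map cubeMul := eq_map_cubeMul fun u => by
    rw [(hm T hT).2, integral_tilt, (hμ T hT).2, (hm₂ T hT).2, ← Real.exp_add,
      h.laplaceExp_compl hT.le hi hBm fun i => by simp]
    congr 3 <;> ext i <;> simp
  have hK2 : ∑ i, θ i * D i - ∑ i, lam p Q c (H / n) φ B (θ i) ≤ K + δ / 4 := by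
    have h1 : ∑ i, (θ i * D i - lam p Q c (H / n) φ B (θ i)) ≤ ∑ i, (sSup (S i) + δ / (4 * n)) :=
      Finset.sum_le_sum fun i _ => hk3 i (θ i) (hθ i).le
    rw [Finset.sum_sub_distrib, Finset.sum_add_distrib] at h1
    have h2 : ∑ _i : Fin n, δ / (4 * n) = δ / 4 := by
      simp only [Finset.sum_const, Finset.card_univ, Fintype.card_fin, nsmul_eq_mul]
      field_simp
    linarith
  have hε'2 : 2 * ε' ≤ ε := by linarith [min_le_left (ε / 2) (δ / 4)]
  calc exp (-(T * (K + δ))) ≤ exp (-(T * (∑ i, θ i * D i + ε₁ * ∑ i, |θ i| -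
        ∑ i, lam p Q c (H / n) φ B (θ i) + δ / 4))) * exp (-(T * ε')) := by
        rw [← Real.exp_add]
        refine Real.exp_le_exp.2 ?_
        have h3 : ε' ≤ δ / 4 := min_le_right _ _
        nlinarith
    _ ≤ (tilt (μ T) fun _ => b).real (box T D ε₁) *
        (m₂ T).real {y | ∀ i, exp (-(T * ε')) ≤ y i} :=
        mul_le_mul e1 e2 (Real.exp_pos _).le measureReal_nonneg
    _ ≤ (m T).real (box T D (2 * ε')) := by
        rw [hfac]
        exact real_box_mul_le _ _ (min_le_left _ _) hT.le
    _ ≤ (m T).real (box T D ε) := measureReal_mono (box_mono hT.le hε'2)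

end Setting

end LawBounds

/-! ### The rate function -/

section SignedMeasures

/-- The Jordan decomposition need not be (μ₁, μ₂), but ν⁺ + μ₂ = μ₁ + ν⁻ as measures, and f is
integrated over both sides. -/
lemma pairing_sub (f : C(I, ℝ)) (μ₁ μ₂ : Measure I) [IsFiniteMeasure μ₁] [IsFiniteMeasure μ₂] :
    pairing f (μ₁.toSignedMeasure - μ₂.toSignedMeasure) = ∫ t, f t ∂μ₁ - ∫ t, f t ∂μ₂ := by
  set ν := μ₁.toSignedMeasure - μ₂.toSignedMeasure with hν
  have h1 : (ν.toJordanDecomposition.posPart + μ₂).toSignedMeasure =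
      (μ₁ + ν.toJordanDecomposition.negPart).toSignedMeasure := by
    rw [Measure.toSignedMeasure_add, Measure.toSignedMeasure_add]
    have h2 := ν.toSignedMeasure_toJordanDecomposition
    rw [JordanDecomposition.toSignedMeasure] at h2
    rw [sub_eq_iff_eq_add.1 h2, hν]
    abel
  have h3 := Measure.toSignedMeasure_eq_toSignedMeasure_iff.1 h1
  have hi : ∀ (μ : Measure I) [IsFiniteMeasure μ], Integrable f μ := fun μ _ =>
    f.continuous.integrable_of_hasCompactSupport (HasCompactSupport.of_compactSpace f)
  have h4 := congrArg (fun μ : Measure I => ∫ t, f t ∂μ) h3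
  simp only [integral_add_measure (hi _) (hi _)] at h4
  rw [pairing]
  linarith

lemma chi_sub (μ₁ μ₂ : Measure I) [IsFiniteMeasure μ₁] [IsFiniteMeasure μ₂] (s : I) :
    chi (μ₁.toSignedMeasure - μ₂.toSignedMeasure) s = μ₁.real (Ioi s) - μ₂.real (Ioi s) := by
  rw [chi, sub_apply, Measure.toSignedMeasure_apply_measurable measurableSet_Ioi,
    Measure.toSignedMeasure_apply_measurable measurableSet_Ioi]

/-- Signed measures with finitely many atoms. -/
lemma exists_atomic {ι : Type*} [Fintype ι] (θ : ι → ℝ) (t : ι → I) : ∃ ν : SignedMeasure I,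
    (∀ f, pairing f ν = ∑ i, θ i * f (t i)) ∧
    ∀ s, chi ν s = ∑ i, θ i * (Iio (t i)).indicator 1 s := by
  have hfin : ∀ a : ι → NNReal, IsFiniteMeasure (∑ i, a i • Measure.dirac (t i)) := fun a =>
    inferInstance
  have hint : ∀ (a : ι → NNReal) (g : I → ℝ), ∫ x, g x ∂(∑ i, a i • Measure.dirac (t i)) =
      ∑ i, (a i : ℝ) * g (t i) := fun a g => by
    rw [integral_finsetSum_measure fun i _ => (integrable_dirac (by simp)).smul_measure_nnreal]
    refine Finset.sum_congr rfl fun i _ => ?_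
    rw [integral_smul_nnreal_measure, integral_dirac, NNReal.smul_def, smul_eq_mul]
  have hsub : ∀ g : I → ℝ, ∑ i, ((θ i).toNNReal : ℝ) * g (t i) -
      ∑ i, ((-θ i).toNNReal : ℝ) * g (t i) = ∑ i, θ i * g (t i) := fun g => by
    rw [← Finset.sum_sub_distrib]
    refine Finset.sum_congr rfl fun i _ => ?_
    rw [← sub_mul, Real.coe_toNNReal', Real.coe_toNNReal', max_zero_sub_max_neg_zero_eq_self]
  refine ⟨(∑ i, (θ i).toNNReal • Measure.dirac (t i)).toSignedMeasure -
    (∑ i, (-θ i).toNNReal • Measure.dirac (t i)).toSignedMeasure, fun f => ?_, fun s => ?_⟩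
  · rw [pairing_sub, hint, hint, hsub]
  · rw [chi_sub, ← integral_indicator_one measurableSet_Ioi,
      ← integral_indicator_one measurableSet_Ioi, hint, hint, hsub]
    refine Finset.sum_congr rfl fun i _ => ?_
    simp [indicator_apply]

lemma eIntegral_of_integrable {α : Type*} [MeasurableSpace α] {μ : Measure α} {f : α → ℝ}
    (hf : Integrable f μ) : eIntegral μ f = ((∫ x, f x ∂μ : ℝ) : EReal) := by
  have h1 : ∫⁻ x, ofReal (f x) ∂μ ≠ ⊤ := hf.lintegral_lt_top.ne
  have h2 : ∫⁻ x, ofReal (-f x) ∂μ ≠ ⊤ := hf.neg.lintegral_lt_top.ne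
  rw [eIntegral, integral_eq_lintegral_pos_part_sub_lintegral_neg_part hf, EReal.coe_sub,
    EReal.coe_ennreal_toReal h1, EReal.coe_ennreal_toReal h2]

/-- The points of the uniform grid. -/
def gridPt (n k : ℕ) : I := projIcc 0 1 zero_le_one ((k : ℝ) / n)

lemma gridPt_mono (n : ℕ) : Monotone (gridPt n) := fun k l hkl =>
  monotone_projIcc _ (by gcongr)

lemma coe_gridPt {n k : ℕ} (h : k ≤ n) : (gridPt n k : ℝ) = (k : ℝ) / n := by
  rw [gridPt, projIcc_of_mem zero_le_one
    ⟨by positivity, div_le_one_of_le₀ (by exact_mod_cast h) (by positivity)⟩]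

lemma gridPt_zero (n : ℕ) : gridPt n 0 = 0 := Subtype.ext (by simp [coe_gridPt])

lemma gridPt_self {n : ℕ} (hn : 0 < n) : gridPt n n = 1 :=
  Subtype.ext (by rw [coe_gridPt le_rfl, div_self (by positivity)]; rfl)

lemma gridPt_succ_sub {n : ℕ} (i : Fin n) : (gridPt n (i + 1) : ℝ) - gridPt n i = (n : ℝ)⁻¹ := by
  rw [coe_gridPt i.2, coe_gridPt i.2.le, ← sub_div]
  push_cast
  rw [add_sub_cancel_left, one_div]

/-- The increments of a path along the grid. -/
def incr (n : ℕ) (f : C(I, ℝ)) (i : Fin n) : ℝ := f (gridPt n (i + 1)) - f (gridPt n i)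

lemma sum_indicator_of_mem {n : ℕ} {A : ℕ → Set I} (hA : Pairwise (Function.onFun Disjoint A))
    (θ : Fin n → ℝ) {s : I} {i : Fin n} (hi : s ∈ A i) :
    ∑ j : Fin n, θ j * (A j).indicator 1 s = θ i := by
  rw [Finset.sum_eq_single i (fun j _ hj => ?_) (by simp), indicator_of_mem hi, Pi.one_apply, mul_one]
  rw [indicator_of_notMem (fun h => Set.disjoint_left.1 (hA (fun e => hj (Fin.ext e))) h hi), mul_zero]

lemma apply_sum_indicator {n : ℕ} {A : ℕ → Set I} (hA : Pairwise (Function.onFun Disjoint A))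
    (g : ℝ → ℝ) (hg : g 0 = 0) (θ : Fin n → ℝ) (s : I) :
    g (∑ i : Fin n, θ i * (A i).indicator 1 s) = ∑ i : Fin n, g (θ i) * (A i).indicator 1 s := by
  by_cases h : ∃ i : Fin n, s ∈ A i
  · obtain ⟨i, hi⟩ := h
    rw [sum_indicator_of_mem hA θ hi, sum_indicator_of_mem hA (fun j => g (θ j)) hi]
  · have hz : ∀ j : Fin n, (A j).indicator (1 : I → ℝ) s = 0 := fun j =>
      indicator_of_notMem (fun hj => h ⟨j, hj⟩) _
    simp [hz, hg]

end SignedMeasures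

/-! ### The rate function and discrete Legendre transforms -/

section Rate

variable {d : ℕ} {S : Type*} [MeasurableSpace S] {M : MarkovFamily d S} {V q H Φ : ℝ} {φ : E d → ℝ}

lemma vLim_eq (hφ : Measurable φ) {C : ℝ} (hC : ∀ x, |φ x| ≤ C) (x : E d) (θ : ℝ) :
    vLim M V q φ x θ = blim M.transition (Qrate V q) (V * q) φ x θ := by
  have e : vTime M V q φ θ = bsol M.transition (Qrate V q) (V * q) φ θ := by
    unfold vTime bsol
    congr 1
    ext w
    exact isMildSolution_branching_iff M _ _ (hφ.const_mul θ) (C := |θ| * C) (fun x => by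
      rw [abs_mul]; exact mul_le_mul_of_nonneg_left (hC x) (abs_nonneg _)) w
  rw [vLim, blim, e]

lemma le_rate {ν : SignedMeasure I} (hν : ⨆ s, chi ν s < threshold V q φ) (f : C(I, ℝ)) :
    ((pairing f ν : ℝ) : EReal) - Lam M V q H φ ν ≤ rate M V q H φ f :=
  le_iSup₂ (f := fun (ν : SignedMeasure I) (_ : ν ∈ {ν : SignedMeasure I |
    ⨆ s, chi ν s < threshold V q φ}) => ((pairing f ν : ℝ) : EReal) - Lam M V q H φ ν) ν hν

namespace Setting

variable (h : Setting M.transition (Qrate V q) (V * q) Φ φ)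
  (hth : ∀ θ, θ < threshold V q φ ↔ θ * Φ < Qrate V q ^ 2 / (4 * (V * q)))
  (hv : ∀ x θ, vLim M V q φ x θ = blim M.transition (Qrate V q) (V * q) φ x θ)
include h hth hv

/-- An atom at 0 is invisible to ν((s, 1]), so it costs nothing while its pairing with f is
arbitrary. -/
lemma rate_eq_top_of_ne {f : C(I, ℝ)} (hf : f 0 ≠ 0) : rate M V q H φ f = ⊤ := by
  rw [EReal.eq_top_iff_forall_lt]
  intro y
  obtain ⟨ν, h1, h2⟩ := exists_atomic (fun _ : Unit => (y + 1) / f 0) fun _ => (0 : I)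
  have h3 : ∀ s, chi ν s = 0 := fun s => by simp [h2]
  have h4 : Lam M V q H φ ν = 0 := by
    have : (fun p : I × E d => vLim M V q φ p.2 (chi ν p.1)) = fun _ => 0 := by
      ext p; rw [h3, hv, h.blim_zero]
    rw [Lam, this]
    simp [eIntegral]
  have h5 := le_rate (M := M) (H := H) (ν := ν) (V := V) (q := q) (φ := φ)
    (by simp only [h3, ciSup_const]; exact (hth 0).2 h.zero_lt) f
  rw [h4, h1] at h5
  simp only [Finset.univ_unique, Finset.sum_const, Finset.card_singleton, one_smul,
    div_mul_cancel₀ _ hf, sub_zero] at h5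
  exact lt_of_lt_of_le (by exact_mod_cast lt_add_one y) h5

/-- The test measure -δ_1 has χ = -1 on [0, 1), so its Λ is -∞ while its pairing with f is finite.
-/
lemma rate_eq_top_of_lintegral (hH : 0 < H) (hw : ∫⁻ x, ofReal
    (-blim M.transition (Qrate V q) (V * q) φ x (-1)) = ⊤) (f : C(I, ℝ)) :
    rate M V q H φ f = ⊤ := by
  obtain ⟨ν, h1, h2⟩ := exists_atomic (fun _ : Unit => -1) fun _ => (1 : I)
  have h3 : ∀ s, chi ν s = -(Iio (1 : I)).indicator 1 s := fun s => by simp [h2]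
  have hle : ∀ s, chi ν s ≤ 0 := fun s => by
    rw [h3]; exact neg_nonpos.2 (indicator_nonneg (fun _ _ => zero_le_one) s)
  have h4 : Lam M V q H φ ν = ⊥ := by
    have e1 : ∫⁻ z, ofReal (vLim M V q φ z.2 (chi ν z.1))
        ∂((volume : Measure I).prod (volume : Measure (E d))) = 0 := by
      refine (lintegral_congr fun z => ?_).trans lintegral_zero
      rw [hv]
      exact ENNReal.ofReal_eq_zero.2 (h.blim_nonpos (hle _) _)
    have e2 : ∫⁻ z, ofReal (-vLim M V q φ z.2 (chi ν z.1))
        ∂((volume : Measure I).prod (volume : Measure (E d))) = ⊤ := by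
      have e3 : ∀ z : I × E d, ofReal (-vLim M V q φ z.2 (chi ν z.1)) =
          (Iio (1 : I)).indicator 1 z.1 * ofReal
            (-blim M.transition (Qrate V q) (V * q) φ z.2 (-1)) := fun z => by
        rw [hv, h3]
        by_cases hz : z.1 ∈ Iio (1 : I)
        · simp only [indicator_of_mem hz, Pi.one_apply, one_mul]
        · simp only [indicator_of_notMem hz, neg_zero, h.blim_zero, ENNReal.ofReal_zero, zero_mul]
      simp only [e3]
      have hm : Measurable fun x => ofReal
          (-blim M.transition (Qrate V q) (V * q) φ x (-1)) :=
        (h.measurable_blim (h.neg_sub zero_le_one)).neg.ennreal_ofReal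
      rw [lintegral_prod_mul (f := (Iio (1 : I)).indicator 1)
        (measurable_one.indicator measurableSet_Iio).aemeasurable hm.aemeasurable, hw,
        lintegral_indicator_one measurableSet_Iio, unitInterval.volume_Iio]
      simp
    rw [Lam, eIntegral, e1, e2]
    simp [EReal.coe_mul_bot_of_pos hH]
  have h5 := le_rate (M := M) (H := H) (ν := ν) (V := V) (q := q) (φ := φ)
    ((ciSup_le hle).trans_lt ((hth 0).2 h.zero_lt)) f
  rw [h4] at h5
  simpa using h5

/-- The rate function dominates the discrete Legendre transforms. -/
lemma sum_le_rate {n : ℕ} (hn : 0 < n) {θ : Fin n → ℝ}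
    (hθ : ∀ i, θ i * Φ < Qrate V q ^ 2 / (4 * (V * q)) ∧
      Integrable (blim M.transition (Qrate V q) (V * q) φ · (θ i))) (f : C(I, ℝ)) :
    ((∑ i, (θ i * incr n f i - lam M.transition (Qrate V q) (V * q) (H / n) φ univ (θ i)) : ℝ) :
      EReal) ≤ rate M V q H φ f := by
  have hn' : (0 : ℝ) < n := by exact_mod_cast hn
  -- Atoms θ_i at the right end and -θ_i at the left end of the i-th grid interval make χ equal to
  -- θ_i on it and turn the pairing with f into a sum over increments.
  obtain ⟨ν, h1, h2⟩ := exists_atomic (Sum.elim θ (fun i => -θ i))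
    (Sum.elim (fun i : Fin n => gridPt n (i + 1)) fun i : Fin n => gridPt n i)
  set A : ℕ → Set I := fun k => Ico (gridPt n k) (gridPt n (k + 1)) with hA
  have hdisj : Pairwise (Function.onFun Disjoint A) := (gridPt_mono n).pairwise_disjoint_on_Ico_succ
  have h3 : ∀ s, chi ν s = ∑ i : Fin n, θ i * (A i).indicator 1 s := fun s => by
    rw [h2, Fintype.sum_sum_type, ← Finset.sum_add_distrib]
    refine Finset.sum_congr rfl fun i _ => ?_
    have hle := gridPt_mono n (Nat.le_succ i)
    simp only [Sum.elim_inl, Sum.elim_inr, hA, indicator_apply, mem_Iio, mem_Ico, Pi.one_apply]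
    rcases lt_or_ge s (gridPt n i) with hs | hs
    · simp [hs, hs.trans_le hle, hs.not_ge]
    · simp [hs, hs.not_gt]
  have h4 : pairing f ν = ∑ i, θ i * incr n f i := by
    rw [h1, Fintype.sum_sum_type, ← Finset.sum_add_distrib]
    refine Finset.sum_congr rfl fun i _ => ?_
    simp only [Sum.elim_inl, Sum.elim_inr, incr]
    ring
  have h5 : ⨆ s, chi ν s < threshold V q φ := by
    have : Nonempty (Fin n) := ⟨⟨0, hn⟩⟩
    obtain ⟨j, hj⟩ := Finite.exists_max θ
    refine (ciSup_le (c := max (θ j) 0) fun s => ?_).trans_lt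
      (max_lt ((hth _).2 (hθ j).1) ((hth 0).2 h.zero_lt))
    rw [h3]
    by_cases hs : ∃ i : Fin n, s ∈ A i
    · obtain ⟨i, hi⟩ := hs
      rw [sum_indicator_of_mem hdisj θ hi]
      exact (hj i).trans (le_max_left _ _)
    · rw [Finset.sum_eq_zero fun i _ => by rw [indicator_of_notMem fun hi => hs ⟨i, hi⟩, mul_zero]]
      exact le_max_right _ _
  have hvol : ∀ i : Fin n, volume.real (A i) = (n : ℝ)⁻¹ := fun i => by
    rw [measureReal_def, unitInterval.volume_Ico, gridPt_succ_sub,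
      ENNReal.toReal_ofReal (by positivity)]
  have hfun : ∀ z : I × E d, vLim M V q φ z.2 (chi ν z.1) = ∑ i : Fin n,
      blim M.transition (Qrate V q) (V * q) φ z.2 (θ i) * (A i).indicator 1 z.1 := fun z => by
    rw [hv, h3]
    exact apply_sum_indicator hdisj _ (h.blim_zero z.2) θ z.1
  have hint : ∀ i ∈ (Finset.univ : Finset (Fin n)), Integrable (fun z : I × E d =>
      blim M.transition (Qrate V q) (V * q) φ z.2 (θ i) * (A i).indicator (1 : I → ℝ) z.1)
      (volume.prod volume) := fun i _ => by
    simp only [mul_comm _ ((A i).indicator _ _)]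
    exact ((integrable_const (1 : ℝ)).indicator measurableSet_Ico).mul_prod (hθ i).2
  have h6 : Lam M V q H φ ν =
      ((∑ i, lam M.transition (Qrate V q) (V * q) (H / n) φ univ (θ i) : ℝ) : EReal) := by
    rw [Lam]
    simp only [hfun]
    rw [eIntegral_of_integrable (integrable_finsetSum _ hint), integral_finsetSum _ hint,
      ← EReal.coe_mul, Finset.mul_sum]
    congr 1
    refine Finset.sum_congr rfl fun i _ => ?_
    simp only [mul_comm _ ((A i).indicator _ _)]
    rw [integral_prod_mul ((A i).indicator (1 : I → ℝ))
      (fun x => blim M.transition (Qrate V q) (V * q) φ x (θ i)), integral_indicator_one measurableSet_Ico,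
      hvol, lam, setIntegral_univ]
    ring
  have h7 := le_rate (M := M) (H := H) h5 f
  rw [h6, h4, ← EReal.coe_sub, ← Finset.sum_sub_distrib] at h7
  exact h7

end Setting

end Rate

/-! ### Sampling a signed measure on a grid -/

section GridChoice

lemma exists_incr_le (f : C(I, ℝ)) {ω : ℝ} (hω : 0 < ω) :
    ∃ n : ℕ, 0 < n ∧ ∀ i : Fin n, |incr n f i| ≤ ω := by
  obtain ⟨δ, hδ, hf⟩ := Metric.uniformContinuous_iff.1
    (CompactSpace.uniformContinuous_of_continuous f.continuous) ω hω
  obtain ⟨n, hn⟩ := exists_nat_one_div_lt hδ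
  refine ⟨n + 1, n.succ_pos, fun i => (hf ?_).le⟩
  rw [Subtype.dist_eq, Real.dist_eq, gridPt_succ_sub, abs_of_pos (by positivity), inv_eq_one_div]
  exact_mod_cast hn

lemma sum_setIntegral_Ioc {g : ℕ → I} (hg : Monotone g) {l : I → ℝ} (hl : Integrable l) (n : ℕ) :
    ∑ k ∈ Finset.range n, ∫ t in Ioc (g k) (g (k + 1)), l t = ∫ t in Ioc (g 0) (g n), l t := by
  induction n with
  | zero => simp
  | succ n ih =>
    rw [Finset.sum_range_succ, ih, ← setIntegral_union (Set.disjoint_left.2 fun t h1 h2 =>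
      h1.2.not_gt h2.1) measurableSet_Ioc hl.integrableOn hl.integrableOn,
      Ioc_union_Ioc_eq_Ioc (hg (Nat.zero_le n)) (hg (Nat.le_succ n))]

/-- A step function interpolating a monotone path. -/
lemma abs_step_sub_le {n : ℕ} (hn : 0 < n) {f : C(I, ℝ)} (hf : Monotone f) (hf0 : f 0 = 0) {ω : ℝ}
    (hω0 : 0 ≤ ω) (hω : ∀ i : Fin n, |incr n f i| ≤ ω) {t : Fin n → I}
    (ht : ∀ i : Fin n, t i ∈ Ioc (gridPt n i) (gridPt n (i + 1))) (s : I) :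
    |∑ i, incr n f i * (Ioi (t i)).indicator 1 s - f s| ≤ ω := by
  have h1 : ∑ i : Fin n, (f (min s (gridPt n (i + 1))) - f (min s (gridPt n i))) = f s := by
    rw [Fin.sum_univ_eq_sum_range (fun i => f (min s (gridPt n (i + 1))) - f (min s (gridPt n i))),
      Finset.sum_range_sub (fun i => f (min s (gridPt n i))), gridPt_self hn, gridPt_zero, min_eq_left (unitInterval.le_one' (t := s)),
      min_eq_right (unitInterval.nonneg' (t := s)), hf0, sub_zero]
  set A : ℕ → Set I := fun k => Ioc (gridPt n k) (gridPt n (k + 1)) with hA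
  have hdisj : Pairwise (Function.onFun Disjoint A) := (gridPt_mono n).pairwise_disjoint_on_Ioc_succ
  have h2 : ∑ i : Fin n, ω * (A i).indicator 1 s ≤ ω := by
    by_cases hs : ∃ i : Fin n, s ∈ A i
    · obtain ⟨i, hi⟩ := hs
      rw [sum_indicator_of_mem hdisj (fun _ => ω) hi]
    · rwa [Finset.sum_eq_zero fun i _ => by rw [indicator_of_notMem fun hi => hs ⟨i, hi⟩, mul_zero]]
  rw [← h1, ← Finset.sum_sub_distrib]
  refine (Finset.abs_sum_le_sum_abs _ _).trans ((Finset.sum_le_sum fun i _ => ?_).trans h2)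
  have hle := gridPt_mono n (Nat.le_succ i)
  have hD := hf hle
  rcases le_or_gt s (gridPt n i) with k1 | k1
  · have hk : s ∉ Ioi (t i) := fun h => (lt_of_lt_of_le h k1).not_gt (ht i).1
    rw [min_eq_left (k1.trans hle), min_eq_left k1, indicator_of_notMem hk]
    rw [sub_self, mul_zero, sub_self, abs_zero]
    exact mul_nonneg hω0 (indicator_nonneg (fun _ _ => zero_le_one) s)
  rw [min_eq_right k1.le]
  rcases le_or_gt s (gridPt n (i + 1)) with k2 | k2
  · rw [min_eq_left k2, indicator_of_mem (show s ∈ A i from ⟨k1, k2⟩), Pi.one_apply, mul_one]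
    have k3 := hf k1.le
    have k4 := hf k2
    have k5 := (abs_le.1 (hω i)).2
    rw [incr] at k5 ⊢
    by_cases k6 : s ∈ Ioi (t i)
    · rw [indicator_of_mem k6, Pi.one_apply, mul_one]
      exact abs_le.2 ⟨by linarith, by linarith⟩
    · rw [indicator_of_notMem k6, mul_zero]
      exact abs_le.2 ⟨by linarith, by linarith⟩
  · rw [min_eq_right k2.le, indicator_of_mem (show s ∈ Ioi (t i) from (ht i).2.trans_lt k2),
      Pi.one_apply, mul_one, incr, sub_self, abs_zero]
    exact mul_nonneg hω0 (indicator_nonneg (fun _ _ => zero_le_one) s)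

/-- Integrating the step function against μ is a summation by parts: the jump at t_i is weighted by
μ((t_i, 1]). -/
lemma abs_sum_sub_integral_le {n : ℕ} {f : C(I, ℝ)} {ω : ℝ} {t : Fin n → I}
    (h : ∀ s, |∑ i, incr n f i * (Ioi (t i)).indicator 1 s - f s| ≤ ω) (μ : Measure I)
    [IsFiniteMeasure μ] :
    |∑ i, incr n f i * μ.real (Ioi (t i)) - ∫ s, f s ∂μ| ≤ ω * μ.real univ := by
  have h1 : ∀ i ∈ Finset.univ,
      Integrable (fun s => incr n f i * (Ioi (t i)).indicator (1 : I → ℝ) s) μ :=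
    fun i _ => ((integrable_const (1 : ℝ)).indicator measurableSet_Ioi).const_mul _
  have h2 : Integrable f μ :=
    f.continuous.integrable_of_hasCompactSupport (HasCompactSupport.of_compactSpace f)
  have h3 : ∑ i, incr n f i * μ.real (Ioi (t i)) - ∫ s, f s ∂μ =
      ∫ s, (∑ i, incr n f i * (Ioi (t i)).indicator 1 s - f s) ∂μ := by
    rw [integral_sub (integrable_finsetSum _ h1) h2, integral_finsetSum _ h1]
    congr 1
    refine Finset.sum_congr rfl fun i _ => ?_
    rw [integral_const_mul, integral_indicator_one measurableSet_Ioi]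
  rw [h3]
  exact norm_integral_le_of_norm_le_const
    (f := fun s => ∑ i, incr n f i * (Ioi (t i)).indicator 1 s - f s) (ae_of_all _ h)

/-- Joint measurability of the stationary solutions along a parameter function. -/
lemma Setting.measurable_blim_comp {X Y : Type*} [MeasurableSpace X] [MeasurableSpace Y]
    {p : Kernel (ℝ × X) X} {Q c Φ a b : ℝ} {φ : X → ℝ} (h : Setting p Q c Φ φ) (ha : 0 ≤ a)
    (hb : 0 ≤ b) (hbΦ : b * Φ < Q ^ 2 / (4 * c)) {g : Y → ℝ} (hg : Measurable g)
    (hgm : ∀ y, g y ∈ Icc (-a) b) : Measurable fun z : Y × X => blim p Q c φ z.2 (g z.1) := by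
  obtain ⟨C, hC, hl, -⟩ := h.blim_lipschitz ha hb hbΦ
  have hab : -a ≤ b := by linarith
  -- With the parameter clamped to [-a, b] this is a Carathéodory function, continuous in θ and
  -- measurable in x.
  have hm : Measurable (Function.uncurry fun (θ : ℝ) (x : X) => blim p Q c φ x (projIcc (-a) b hab θ)) := by
    refine measurable_uncurry_of_continuous_of_measurable (fun x => ?_) fun θ =>
      h.measurable_blim (h.lt_of_le hbΦ (projIcc (-a) b hab θ).2.2)
    have hc : ContinuousOn (blim p Q c φ x) (Icc (-a) b) :=
      (LipschitzOnWith.of_dist_le_mul (f := blim p Q c φ x) (K := C.toNNReal) fun u hu v hv => by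
        rw [Real.coe_toNNReal _ hC]; exact hl u hu v hv x).continuousOn
    exact hc.comp_continuous (continuous_subtype_val.comp continuous_projIcc)
      fun θ => (projIcc (-a) b hab θ).2
  convert hm.comp ((hg.comp measurable_fst).prodMk measurable_snd) using 2 with z
  simp only [Function.comp_apply, Function.uncurry_apply_pair]
  rw [projIcc_of_mem hab (hgm z.1)]

/-- The integrable minorant makes the negative part finite, so an infinite positive part would give
the value +∞. -/
lemma integrable_of_eIntegral_ne_top {α : Type*} [MeasurableSpace α] {μ : Measure α} {F G : α → ℝ}
    {H : ℝ} (hH : 0 < H) (hF : Measurable F) (hG : Integrable G μ) (hGF : ∀ z, G z ≤ F z)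
    (hL : (H : EReal) * eIntegral μ F ≠ ⊤) : Integrable F μ := by
  have hneg : ∫⁻ z, ofReal (-F z) ∂μ ≠ ⊤ :=
    ((lintegral_mono fun z => ENNReal.ofReal_le_ofReal (neg_le_neg (hGF z))).trans_lt
      (Integrable.lintegral_lt_top (f := fun z => -G z) hG.neg)).ne
  have hpos : ∫⁻ z, ofReal (F z) ∂μ ≠ ⊤ := by
    intro htop
    refine hL ?_
    rw [eIntegral, htop, ← EReal.coe_ennreal_toReal hneg, EReal.coe_ennreal_top,
      EReal.top_sub_coe, EReal.coe_mul_top_of_pos hH]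
  refine ⟨hF.aestronglyMeasurable, ?_⟩
  refine (lintegral_mono (g := fun z => ofReal (F z) + ofReal (-F z))
    fun z => ?_).trans_lt ?_
  · rw [Real.enorm_eq_ofReal_abs]
    rcases le_total 0 (F z) with hz | hz
    · rw [abs_of_nonneg hz]; exact le_self_add
    · rw [abs_of_nonpos hz]; exact le_add_self
  · rw [lintegral_add_left hF.ennreal_ofReal]
    exact ENNReal.add_lt_top.2 ⟨hpos.lt_top, hneg.lt_top⟩

/-- Sections of an integrable function with controlled integrals, one for each grid cell. -/
lemma exists_sections {X : Type*} [MeasurableSpace X] {μ : Measure X} [SFinite μ] {F : I × X → ℝ}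
    (hF : Integrable F ((volume : Measure I).prod μ)) {n : ℕ} (hn : 0 < n) : ∃ t : Fin n → I,
    (∀ i : Fin n, t i ∈ Ioc (gridPt n i) (gridPt n (i + 1)) ∧ Integrable (fun x => F (t i, x)) μ) ∧
    ∑ i, ∫ x, F (t i, x) ∂μ ≤ n * ∫ z, F z ∂((volume : Measure I).prod μ) := by
  have hn' : (0 : ℝ) < n := by exact_mod_cast hn
  have hli : Integrable fun t : I => ∫ x, F (t, x) ∂μ := hF.integral_prod_left
  have hex : ∀ i : Fin n, ∃ t ∈ Ioc (gridPt n i) (gridPt n (i + 1)),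
      Integrable (fun x => F (t, x)) μ ∧
      ∫ x, F (t, x) ∂μ ≤ n * ∫ s in Ioc (gridPt n i) (gridPt n (i + 1)), ∫ x, F (s, x) ∂μ := by
    intro i
    have hvol : volume.real (Ioc (gridPt n i) (gridPt n (i + 1))) = (n : ℝ)⁻¹ := by
      rw [measureReal_def, unitInterval.volume_Ioc, gridPt_succ_sub,
        ENNReal.toReal_ofReal (by positivity)]
    have h0 : (volume : Measure I).restrict (Ioc (gridPt n i) (gridPt n (i + 1))) ≠ 0 := by
      intro h0
      rw [Measure.restrict_eq_zero] at h0
      rw [measureReal_def, h0, ENNReal.toReal_zero] at hvol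
      exact (inv_pos.2 hn').ne hvol
    have hae : ∀ᵐ t ∂(volume : Measure I).restrict (Ioc (gridPt n i) (gridPt n (i + 1))),
        t ∈ Ioc (gridPt n i) (gridPt n (i + 1)) ∧ Integrable (fun x => F (t, x)) μ :=
      (ae_restrict_mem measurableSet_Ioc).and (ae_restrict_of_ae hF.prod_right_ae)
    -- In each cell some section with the required properties has an integral at most the average
    -- over the cell. Sampling there makes the discrete exponent no larger than Λ(ν).
    obtain ⟨t, ht, hle⟩ := exists_notMem_null_le_average h0 hli.restrict (ae_iff.1 hae)
    have ht' := not_not.1 ht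
    rw [setAverage_eq, hvol, inv_inv, smul_eq_mul] at hle
    exact ⟨t, ht'.1, ht'.2, hle⟩
  choose t ht hti htl using hex
  refine ⟨t, fun i => ⟨ht i, hti i⟩, (Finset.sum_le_sum fun i _ => htl i).trans_eq ?_⟩
  have h1 : Ioc (gridPt n 0) (gridPt n n) =ᵐ[volume] univ := by
    rw [gridPt_zero, gridPt_self hn]
    refine Ioc_ae_eq_Icc.trans (EventuallyEq.of_eq ?_)
    exact eq_univ_of_forall fun s => ⟨unitInterval.nonneg', unitInterval.le_one'⟩
  rw [← Finset.mul_sum, integral_prod _ hF, ← setIntegral_univ (μ := (volume : Measure I)),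
    ← setIntegral_congr_set h1, ← sum_setIntegral_Ioc (gridPt_mono n) hli,
    ← Fin.sum_univ_eq_sum_range
      (fun k => ∫ t in Ioc (gridPt n k) (gridPt n (k + 1)), ∫ x, F (t, x) ∂μ)]

/-- The total mass of the variation of a signed measure. -/
def totMass (ν : SignedMeasure I) : ℝ :=
  ν.toJordanDecomposition.posPart.real univ + ν.toJordanDecomposition.negPart.real univ

lemma chi_eq (ν : SignedMeasure I) (s : I) : chi ν s =
    ν.toJordanDecomposition.posPart.real (Ioi s) - ν.toJordanDecomposition.negPart.real (Ioi s) := by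
  rw [← chi_sub]
  congr 1
  exact ν.toSignedMeasure_toJordanDecomposition.symm

lemma abs_chi_le (ν : SignedMeasure I) (s : I) : |chi ν s| ≤ totMass ν := by
  have h1 : ∀ (μ : Measure I) [IsFiniteMeasure μ], 0 ≤ μ.real (Ioi s) ∧ μ.real (Ioi s) ≤ μ.real univ :=
    fun μ _ => ⟨measureReal_nonneg, measureReal_mono (subset_univ _)⟩
  have h2 := h1 ν.toJordanDecomposition.posPart
  have h3 := h1 ν.toJordanDecomposition.negPart
  rw [chi_eq, totMass]
  exact abs_le.2 ⟨by linarith, by linarith⟩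

lemma measurable_chi (ν : SignedMeasure I) : Measurable (chi ν) := by
  have hanti : ∀ (μ : Measure I) [IsFiniteMeasure μ], Measurable fun s => μ.real (Ioi s) :=
    fun μ _ => Antitone.measurable fun s t hst => measureReal_mono (Ioi_subset_Ioi hst)
  rw [funext (chi_eq ν)]
  exact (hanti _).sub (hanti _)

lemma abs_sum_chi_sub_pairing_le {n : ℕ} {f : C(I, ℝ)} {ω : ℝ} {t : Fin n → I}
    (h : ∀ s, |∑ i, incr n f i * (Ioi (t i)).indicator 1 s - f s| ≤ ω) (ν : SignedMeasure I) :
    |∑ i, chi ν (t i) * incr n f i - pairing f ν| ≤ ω * totMass ν := by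
  have hp := abs_sum_sub_integral_le h ν.toJordanDecomposition.posPart
  have hm := abs_sum_sub_integral_le h ν.toJordanDecomposition.negPart
  have hθ : ∑ i, chi ν (t i) * incr n f i =
      ∑ i, incr n f i * ν.toJordanDecomposition.posPart.real (Ioi (t i)) -
        ∑ i, incr n f i * ν.toJordanDecomposition.negPart.real (Ioi (t i)) := by
    rw [← Finset.sum_sub_distrib]
    exact Finset.sum_congr rfl fun i _ => by rw [chi_eq]; ring
  rw [hθ, pairing, totMass, mul_add, sub_sub_sub_comm]
  exact (abs_sub _ _).trans (add_le_add hp hm)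

variable {d : ℕ} {S : Type*} [MeasurableSpace S] {M : MarkovFamily d S} {V q H Φ : ℝ} {φ : E d → ℝ}

/-- A signed measure is approximated by its values on a grid. -/
lemma Setting.exists_grid (h : Setting M.transition (Qrate V q) (V * q) Φ φ)
    (hth : ∀ θ, θ < threshold V q φ ↔ θ * Φ < Qrate V q ^ 2 / (4 * (V * q)))
    (hv : ∀ x θ, vLim M V q φ x θ = blim M.transition (Qrate V q) (V * q) φ x θ) (hH : 0 < H)
    (hi : ∀ u ≤ 0, Integrable (blim M.transition (Qrate V q) (V * q) φ · u)) {f : C(I, ℝ)}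
    (hf : Monotone f) (hf0 : f 0 = 0) {ν : SignedMeasure I} (hν : ⨆ s, chi ν s < threshold V q φ)
    (hL : Lam M V q H φ ν ≠ ⊤) {η : ℝ} (hη : 0 < η) :
    ∃ n : ℕ, 0 < n ∧ ∃ θ : Fin n → ℝ, (∀ i, θ i * Φ < Qrate V q ^ 2 / (4 * (V * q)) ∧
      Integrable (blim M.transition (Qrate V q) (V * q) φ · (θ i))) ∧
      ((pairing f ν : ℝ) : EReal) - Lam M V q H φ ν ≤ ((∑ i, (θ i * incr n f i -
        lam M.transition (Qrate V q) (V * q) (H / n) φ univ (θ i)) + η : ℝ) : EReal) := by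
  have ha0 : 0 ≤ totMass ν := add_nonneg measureReal_nonneg measureReal_nonneg
  have hb0 : 0 ≤ max (⨆ s, chi ν s) 0 := le_max_right _ _
  have hbΦ : max (⨆ s, chi ν s) 0 * Φ < Qrate V q ^ 2 / (4 * (V * q)) :=
    (hth _).1 (max_lt hν ((hth 0).2 h.zero_lt))
  have hmem : ∀ s, chi ν s ∈ Icc (-totMass ν) (max (⨆ s, chi ν s) 0) := fun s =>
    ⟨(abs_le.1 (abs_chi_le ν s)).1, (le_ciSup ⟨totMass ν, by
      rintro _ ⟨s, rfl⟩; exact (abs_le.1 (abs_chi_le ν s)).2⟩ s).trans (le_max_left _ _)⟩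
  have hFm := h.measurable_blim_comp ha0 hb0 hbΦ (measurable_chi ν) hmem
  rw [Lam] at hL ⊢
  simp only [hv] at hL ⊢
  have hFi := integrable_of_eIntegral_ne_top hH hFm
    ((hi (-totMass ν) (neg_nonpos.2 ha0)).comp_snd volume)
    (fun z => h.blim_mono (h.lt_of_le hbΦ (hmem z.1).2) (hmem z.1).1 z.2) hL
  -- The mesh makes the pairing error, at most the largest increment times the total variation of ν,
  -- no more than η.
  obtain ⟨n, hn, hω⟩ := exists_incr_le f (show 0 < η / (totMass ν + 1) by positivity)
  have hn' : (0 : ℝ) < n := by exact_mod_cast hn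
  obtain ⟨t, ht, hsum⟩ := exists_sections hFi hn
  refine ⟨n, hn, fun i => chi ν (t i), fun i => ⟨h.lt_of_le hbΦ (hmem _).2, (ht i).2⟩, ?_⟩
  have hp := (abs_le.1 (abs_sum_chi_sub_pairing_le
    (abs_step_sub_le hn hf hf0 (by positivity) hω fun i => (ht i).1) ν)).1
  have hη2 : η / (totMass ν + 1) * totMass ν ≤ η := by
    rw [div_mul_eq_mul_div, div_le_iff₀ (by positivity)]
    nlinarith
  have hlam : ∑ i, lam M.transition (Qrate V q) (V * q) (H / n) φ univ (chi ν (t i)) ≤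
      H * ∫ z : I × E d, blim M.transition (Qrate V q) (V * q) φ z.2 (chi ν z.1)
        ∂(volume.prod volume) := by
    simp only [lam, setIntegral_univ]
    rw [← Finset.mul_sum, div_mul_eq_mul_div, div_le_iff₀ hn', mul_assoc]
    refine mul_le_mul_of_nonneg_left (hsum.trans_eq (mul_comm _ _)) hH.le
  rw [eIntegral_of_integrable hFi, ← EReal.coe_mul, ← EReal.coe_sub, EReal.coe_le_coe_iff,
    Finset.sum_sub_distrib]
  linarith

end GridChoice

/-! ### Paths of the occupation time -/

section Paths

/-- The mean value theorem; the derivative is two-sided at the interior point it provides. -/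
lemma exists_slope_of_mem_slopeSet {b : EReal} {f : C(I, ℝ)} (hf : f ∈ slopeSet 0 b) {s t : I}
    (hst : s < t) : ∃ D : ℝ, 0 < D ∧ (D : EReal) < b ∧ f t - f s = D * ((t : ℝ) - s) := by
  choose D hD using hf
  have hst' : (s : ℝ) < t := hst
  have hg : ∀ x : I, Set.IccExtend (zero_le_one' ℝ) f x = f x := fun x => IccExtend_val _ _ x
  obtain ⟨c, hc, hcD⟩ := exists_hasDerivAt_eq_slope (Set.IccExtend (zero_le_one' ℝ) f)
    (fun x => D (projIcc 0 1 zero_le_one x)) hst' f.continuous.Icc_extend'.continuousOn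
    fun x hx => by
      have hx01 : x ∈ Ioo (0 : ℝ) 1 := ⟨s.2.1.trans_lt hx.1, hx.2.trans_le t.2.2⟩
      have h1 := (hD (projIcc 0 1 zero_le_one x)).1
      rw [projIcc_of_mem zero_le_one (Ioo_subset_Icc_self hx01)] at h1 ⊢
      exact h1.hasDerivAt (Icc_mem_nhds hx01.1 hx01.2)
  refine ⟨_, EReal.coe_pos.1 (hD (projIcc 0 1 zero_le_one c)).2.1,
    (hD (projIcc 0 1 zero_le_one c)).2.2, ?_⟩
  rw [hcD, hg, hg, div_mul_cancel₀ _ (sub_pos.2 hst').ne']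

lemma gridPt_lt_succ {n : ℕ} (i : Fin n) : gridPt n i < gridPt n (i + 1) := by
  have h1 := gridPt_succ_sub i
  have h2 : (0 : ℝ) < (n : ℝ)⁻¹ := inv_pos.2 (by exact_mod_cast i.pos)
  exact Subtype.coe_lt_coe.1 (by linarith)

lemma monotone_of_mem_slopeSet {b : EReal} {f : C(I, ℝ)} (hf : f ∈ slopeSet 0 b) : Monotone f := by
  intro s t hst
  rcases hst.eq_or_lt with rfl | hst
  · exact le_rfl
  obtain ⟨D, h1, -, h3⟩ := exists_slope_of_mem_slopeSet hf hst
  have : (s : ℝ) < t := hst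
  nlinarith

lemma exists_incr_eq {b : EReal} {f : C(I, ℝ)} (hf : f ∈ slopeSet 0 b) {n : ℕ} (i : Fin n) :
    ∃ D : ℝ, 0 < D ∧ (D : EReal) < b ∧ incr n f i = D / n := by
  obtain ⟨D, h1, h2, h3⟩ := exists_slope_of_mem_slopeSet hf (gridPt_lt_succ i)
  exact ⟨D, h1, h2, by rw [incr, h3, gridPt_succ_sub, div_eq_mul_inv]⟩

lemma exists_gridPt {n : ℕ} (hn : 0 < n) (t : I) :
    ∃ i : Fin n, gridPt n i ≤ t ∧ t ≤ gridPt n (i + 1) := by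
  have hn' : (0 : ℝ) < n := by exact_mod_cast hn
  have h1 : ⌈(t : ℝ) * n⌉₊ ≤ n := Nat.ceil_le.2 (by nlinarith [t.2.2])
  have h2 := Nat.le_ceil ((t : ℝ) * n)
  have h3 := Nat.ceil_lt_add_one (mul_nonneg t.2.1 hn'.le)
  have hk : ⌈(t : ℝ) * n⌉₊ - 1 < n := by omega
  refine ⟨⟨_, hk⟩, ?_, ?_⟩
  · refine Subtype.coe_le_coe.1 ?_
    rw [coe_gridPt hk.le, div_le_iff₀ hn']
    rcases Nat.eq_zero_or_pos ⌈(t : ℝ) * n⌉₊ with h0 | h0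
    · rw [h0]
      simpa using mul_nonneg t.2.1 hn'.le
    · rw [Nat.cast_sub h0]
      push_cast
      linarith
  · refine Subtype.coe_le_coe.1 ?_
    rw [coe_gridPt (Nat.succ_le_of_lt hk), le_div_iff₀ hn']
    refine h2.trans ?_
    have h4 : ⌈(t : ℝ) * n⌉₊ ≤ (⌈(t : ℝ) * n⌉₊ - 1).succ := by omega
    exact_mod_cast h4

variable {d n : ℕ} {T ε : ℝ} {Ω : Type*} {N : ℝ → Ω → Measure (E d)} {φ : E d → ℝ} {F : ℝ → ℝ}

lemma rescaledOccupation_succ (i : Fin n) (hT : 0 ≤ T) (ω : Ω) :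
    rescaledOccupation N F φ T (gridPt n (i + 1)) ω = rescaledOccupation N F φ T (gridPt n i) ω +
      (ofReal (F T))⁻¹ * cellMass N φ n T i ω := by
  have hn' : (0 : ℝ) < n := by exact_mod_cast i.pos
  rw [rescaledOccupation, rescaledOccupation, ← mul_add, cellMass, cell, coe_gridPt i.2,
    coe_gridPt i.2.le, ← lintegral_union measurableSet_Ioc
      (Set.disjoint_left.2 fun s h1 h2 => ?_), mul_div_assoc, mul_div_assoc, Ioc_union_Ioc_eq_Ioc]
  · push_cast
    rfl
  · positivity
  · gcongr; linarith
  · have h3 := h2.1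
    rw [mul_div_assoc] at h3
    exact h1.2.not_gt h3

lemma rescaledOccupation_zero (ω : Ω) : rescaledOccupation N F φ T (0 : I) ω = 0 := by
  simp [rescaledOccupation]

/-- Membership forces finite masses, since an infinite mass has coordinate 0 while the lower edge of
the box is positive. -/
lemma expMass_mem_box_iff {D : Fin n → ℝ} {ω : Ω} : expMass N φ n T ω ∈ box T D ε ↔
    ∀ i, ∃ x : ℝ, 0 ≤ x ∧ cellMass N φ n T i ω = ofReal x ∧ |x - T * D i| ≤ T * ε := by
  refine forall_congr' fun i => ?_
  have hval : ((expMass N φ n T ω i : I) : ℝ) = (nexp (cellMass N φ n T i ω)).toReal := rfl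
  rw [hval]
  constructor
  · rintro ⟨h1, h2⟩
    have hX : cellMass N φ n T i ω ≠ ⊤ := fun h => by
      rw [h, nexp_top, ENNReal.toReal_zero] at h1
      exact (Real.exp_pos _).not_ge h1
    refine ⟨_, ENNReal.toReal_nonneg, (ENNReal.ofReal_toReal hX).symm, ?_⟩
    rw [← ENNReal.ofReal_toReal hX, nexp_ofReal ENNReal.toReal_nonneg,
      ENNReal.toReal_ofReal (Real.exp_nonneg _), Real.exp_le_exp] at h1 h2
    exact abs_le.2 ⟨by linarith, by linarith⟩
  · rintro ⟨x, hx, e, h⟩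
    rw [e, nexp_ofReal hx, ENNReal.toReal_ofReal (Real.exp_nonneg _), Real.exp_le_exp,
      Real.exp_le_exp]
    have := abs_le.1 h
    exact ⟨by linarith, by linarith⟩

/-- Both end values of a cell are within r of those of f, so its mass divided by T is within 2r of
the increment of f. Finiteness of the path permits the subtraction. -/
lemma pathEvent_ball_subset (hT : 0 < T) (hF : F T = T) {f : C(I, ℝ)} {r : ℝ} :
    pathEvent N F φ T (Metric.ball f r) ⊆ expMass N φ n T ⁻¹' box T (incr n f) (2 * r) := by
  rintro ω ⟨g, hg, hgY⟩
  refine expMass_mem_box_iff.2 fun i => ?_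
  have hY : ∀ t : I, 0 ≤ g t ∧ rescaledOccupation N F φ T t ω = ofReal (g t) := fun t => by
    have h0 : (0 : EReal) ≤ (g t : ℝ) := (hgY t) ▸ EReal.coe_ennreal_nonneg _
    have h0' : 0 ≤ g t := by exact_mod_cast h0
    refine ⟨h0', EReal.coe_ennreal_injective ?_⟩
    rw [hgY, EReal.coe_ennreal_ofReal, max_eq_left h0']
  have h1 := rescaledOccupation_succ (N := N) (F := F) (φ := φ) i hT.le ω
  rw [(hY _).2, (hY _).2, hF] at h1
  have hm : g (gridPt n i) ≤ g (gridPt n (i + 1)) :=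
    (ENNReal.ofReal_le_ofReal_iff (hY _).1).1 (h1 ▸ le_self_add)
  have h2 : cellMass N φ n T i ω =
      ofReal (T * (g (gridPt n (i + 1)) - g (gridPt n i))) := by
    have h3 : (ofReal T)⁻¹ * cellMass N φ n T i ω =
        ofReal (g (gridPt n (i + 1)) - g (gridPt n i)) := by
      rw [ENNReal.ofReal_sub _ (hY _).1, h1, ENNReal.add_sub_cancel_left ENNReal.ofReal_ne_top]
    rw [ENNReal.ofReal_mul hT.le, ← h3, ← mul_assoc, ENNReal.mul_inv_cancel
      (by simpa using hT) ENNReal.ofReal_ne_top, one_mul]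
  refine ⟨_, mul_nonneg hT.le (sub_nonneg.2 hm), h2, ?_⟩
  rw [← mul_sub, abs_mul, abs_of_pos hT]
  refine mul_le_mul_of_nonneg_left ?_ hT.le
  have h4 : ∀ t, |g t - f t| ≤ r := fun t =>
    (ContinuousMap.dist_apply_le_dist t).trans (Metric.mem_ball.1 hg).le
  have h5 := abs_le.1 (h4 (gridPt n (i + 1)))
  have h6 := abs_le.1 (h4 (gridPt n i))
  rw [incr]
  exact abs_le.2 ⟨by linarith, by linarith⟩

lemma pathEvent_ball_eq_empty {f : C(I, ℝ)} {r : ℝ} (hr : r ≤ |f 0|) :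
    pathEvent N F φ T (Metric.ball f r) = ∅ := by
  refine eq_empty_of_forall_notMem ?_
  rintro ω ⟨g, hg, hgY⟩
  have h0 := hgY 0
  rw [rescaledOccupation_zero] at h0
  have h1 : g 0 = 0 := EReal.coe_eq_zero.1 (h0.symm.trans EReal.coe_ennreal_zero)
  have h2 := (ContinuousMap.dist_apply_le_dist (f := g) (g := f) 0).trans_lt (Metric.mem_ball.1 hg)
  rw [h1, Real.dist_eq, zero_sub, abs_neg] at h2
  exact h2.not_ge hr

variable [MeasurableSpace Ω] {S : Type*} [MeasurableSpace S] {M : MarkovFamily d S} {V q H : ℝ}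
  {Pr : Measure Ω}

lemma continuous_rescaledOccupation (hN : IsSuperprocess M V q H Pr N) (hφ : Measurable φ)
    (hT : 0 < T) {ω : Ω} (hF : F T = T) (hfin : rescaledOccupation N F φ T (1 : I) ω ≠ ⊤) :
    Continuous fun t : I => (rescaledOccupation N F φ T t ω).toReal := by
  have hm : Measurable fun s => ∫⁻ x, ofReal (φ x) ∂(N s ω) :=
    (hN.measurable_pair hφ.ennreal_ofReal).comp (measurable_id.prodMk measurable_const)
  have hfin' : ∫⁻ s in Ioc 0 T, ∫⁻ x, ofReal (φ x) ∂(N s ω) ≠ ⊤ := fun h => by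
    rw [rescaledOccupation, hF] at hfin
    simp [h, ENNReal.mul_top] at hfin
  have hi : IntegrableOn (fun s => (∫⁻ x, ofReal (φ x) ∂(N s ω)).toReal) (Icc 0 T) :=
    (integrableOn_Icc_iff_integrableOn_Ioc).2
      (integrable_toReal_of_lintegral_ne_top hm.aemeasurable hfin')
  have hc := intervalIntegral.continuousOn_primitive hi
  have hs : ∀ t : I, T * (t : ℝ) ∈ Icc 0 T := fun t =>
    ⟨mul_nonneg hT.le t.2.1, mul_le_of_le_one_right hT.le t.2.2⟩
  have he : ∀ t : I, (rescaledOccupation N F φ T t ω).toReal =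
      (ofReal (F T))⁻¹.toReal * ∫ s in Ioc 0 (T * (t : ℝ)),
        (∫⁻ x, ofReal (φ x) ∂(N s ω)).toReal := fun t => by
    have hle := lintegral_mono_set (μ := volume) (f := fun s => ∫⁻ x, ofReal (φ x) ∂(N s ω))
      (Ioc_subset_Ioc_right (hs t).2 : Ioc 0 (T * (t : ℝ)) ⊆ Ioc 0 T)
    rw [integral_toReal hm.aemeasurable (ae_lt_top hm (ne_top_of_le_ne_top hfin' hle)),
      rescaledOccupation, ENNReal.toReal_mul]
  simp only [he]
  exact continuous_const.mul (hc.comp_continuous (by fun_prop) hs)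

lemma rescaledOccupation_mono (ω : Ω) (hT : 0 ≤ T) :
    Monotone fun t : I => rescaledOccupation N F φ T t ω := fun s t hst => by
  refine mul_le_mul_right (lintegral_mono_set (Ioc_subset_Ioc_right ?_)) _
  exact mul_le_mul_of_nonneg_left (Subtype.coe_le_coe.2 hst) hT

/-- Errors of ε'/n per cell add up to at most ε' at grid points. Between grid points both paths are
monotone and f moves by at most ε', so the uniform distance is at most 2ε' < 3ε'. -/
lemma preimage_box_subset_pathEvent (hN : IsSuperprocess M V q H Pr N) (hφ : Measurable φ)
    (hT : 0 < T) (hF : F T = T) {f : C(I, ℝ)} (hf : Monotone f) (hf0 : f 0 = 0) {ε' : ℝ}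
    (hε' : 0 < ε') (hn : 0 < n) (hinc : ∀ i : Fin n, |incr n f i| ≤ ε') {U : Set C(I, ℝ)}
    (hU : Metric.ball f (3 * ε') ⊆ U) :
    expMass N φ n T ⁻¹' box T (incr n f) (ε' / n) ⊆ pathEvent N F φ T U := by
  intro ω hω
  have hω' := expMass_mem_box_iff.1 hω
  have hn' : (0 : ℝ) < n := by exact_mod_cast hn
  have hk : ∀ k : ℕ, k ≤ n → rescaledOccupation N F φ T (gridPt n k) ω ≠ ⊤ ∧
      |(rescaledOccupation N F φ T (gridPt n k) ω).toReal - f (gridPt n k)| ≤ k * (ε' / n) := by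
    intro k
    induction k with
    | zero => intro; simp [gridPt_zero, rescaledOccupation, hf0]
    | succ k ih =>
      intro hkn
      obtain ⟨h1, h2⟩ := ih (by omega)
      obtain ⟨x, hx0, hx, hxD⟩ := hω' ⟨k, hkn⟩
      have hs := rescaledOccupation_succ (N := N) (F := F) (φ := φ) (⟨k, hkn⟩ : Fin n) hT.le ω
      rw [hx, hF, ← ENNReal.ofReal_inv_of_pos hT, ← ENNReal.ofReal_mul (inv_nonneg.2 hT.le)] at hs
      simp only at hs
      rw [hs]
      refine ⟨ENNReal.add_ne_top.2 ⟨h1, ENNReal.ofReal_ne_top⟩, ?_⟩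
      rw [ENNReal.toReal_add h1 ENNReal.ofReal_ne_top,
        ENNReal.toReal_ofReal (mul_nonneg (inv_nonneg.2 hT.le) hx0)]
      have h3 : |T⁻¹ * x - incr n f ⟨k, hkn⟩| ≤ ε' / n := by
        have e : T⁻¹ * x - incr n f ⟨k, hkn⟩ = T⁻¹ * (x - T * incr n f ⟨k, hkn⟩) := by
          field_simp
        rw [e, abs_mul, abs_of_pos (inv_pos.2 hT), inv_mul_le_iff₀ hT]
        exact hxD
      rw [incr] at h3
      have h4 := abs_le.1 h2
      have h5 := abs_le.1 h3
      push_cast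
      exact abs_le.2 ⟨by linarith, by linarith⟩
  have hk' : ∀ k : ℕ, k ≤ n → |(rescaledOccupation N F φ T (gridPt n k) ω).toReal -
      f (gridPt n k)| ≤ ε' := fun k hkn => (hk k hkn).2.trans (by
    rw [mul_div_assoc', div_le_iff₀ hn', mul_comm]
    exact mul_le_mul_of_nonneg_left (by exact_mod_cast hkn) hε'.le)
  have hfin : rescaledOccupation N F φ T (1 : I) ω ≠ ⊤ := gridPt_self hn ▸ (hk n le_rfl).1
  have hmono := rescaledOccupation_mono (N := N) (F := F) (φ := φ) ω hT.le
  have hfin' : ∀ t : I, rescaledOccupation N F φ T t ω ≠ ⊤ := fun t =>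
    ne_top_of_le_ne_top hfin (hmono unitInterval.le_one')
  refine ⟨⟨_, continuous_rescaledOccupation hN hφ hT hF hfin⟩, hU (Metric.mem_ball.2 ?_), fun t =>
    (EReal.coe_ennreal_toReal (hfin' t)).symm⟩
  refine ((ContinuousMap.dist_le (C := 2 * ε') (by positivity)).2 fun t => ?_).trans_lt (by linarith)
  obtain ⟨i, hi1, hi2⟩ := exists_gridPt hn t
  have a1 := abs_le.1 (hk' i i.2.le)
  have a2 := abs_le.1 (hk' (i + 1) i.2)
  have a3 := ENNReal.toReal_mono (hfin' _) (hmono hi1)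
  have a4 := ENNReal.toReal_mono (hfin' _) (hmono hi2)
  have a5 := hf hi1
  have a6 := hf hi2
  have a7 := abs_le.1 (hinc i)
  rw [incr] at a7
  rw [Real.dist_eq]
  exact abs_le.2 ⟨by simp only [ContinuousMap.coe_mk]; linarith,
    by simp only [ContinuousMap.coe_mk]; linarith⟩

end Paths

/-! ### From exponential bounds to logarithmic limits -/

section LogScale

variable {P : ℝ → ℝ≥0∞} {c : ℝ}

lemma logScale_mono {T : ℝ} (hT : 0 < T) : Monotone (logScale T) := fun _ _ hab =>
  mul_le_mul_of_nonneg_left (ENNReal.log_monotone hab) (by exact_mod_cast (inv_pos.2 hT).le)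

lemma logScale_exp {T : ℝ} (hT : 0 < T) (c : ℝ) :
    logScale T (ofReal (exp (-(T * c)))) = ((-c : ℝ) : EReal) := by
  rw [logScale, ENNReal.log_ofReal_of_pos (Real.exp_pos _), Real.log_exp, ← EReal.coe_mul]
  congr 1
  field_simp

lemma limsup_logScale_le (h : ∀ᶠ T in atTop, P T ≤ ofReal (exp (-(T * c)))) :
    limsup (fun T => logScale T (P T)) atTop ≤ ((-c : ℝ) : EReal) :=
  limsup_le_of_le (by isBoundedDefault) (by
    filter_upwards [h, eventually_gt_atTop 0] with T h1 hT
    exact (logScale_mono hT h1).trans_eq (logScale_exp hT c))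

lemma le_liminf_logScale (h : ∀ᶠ T in atTop, ofReal (exp (-(T * c))) ≤ P T) :
    ((-c : ℝ) : EReal) ≤ liminf (fun T => logScale T (P T)) atTop :=
  le_liminf_of_le (by isBoundedDefault) (by
    filter_upwards [h, eventually_gt_atTop 0] with T h1 hT
    exact (logScale_exp hT c).symm.trans_le (logScale_mono hT h1))

end LogScale

/-! ### The large deviation bounds -/

section Bounds

variable {d : ℕ} {S : Type*} [MeasurableSpace S] {M : MarkovFamily d S} {V q H Φ : ℝ} {φ : E d → ℝ}

namespace Setting

/-- The single parameter -1 controls all u ≤ 0: by monotonicity for u ≥ -1, and for u < -1 by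
convexity together with the value 0 at 0, which give |blim(u)| ≤ -u |blim(-1)|. -/
lemma integrable_blim_nonpos {p : Kernel (ℝ × E d) (E d)} {Q c : ℝ} (h : Setting p Q c Φ φ)
    (hw : ∫⁻ x, ofReal (-blim p Q c φ x (-1)) ≠ ⊤) {u : ℝ} (hu : u ≤ 0) :
    Integrable (blim p Q c φ · u) := by
  have hlt : ∀ {v : ℝ}, v ≤ 0 → v * Φ < Q ^ 2 / (4 * c) := fun hv => h.lt_of_le h.zero_lt hv
  have hm : ∀ {v : ℝ}, v ≤ 0 → Measurable (blim p Q c φ · v) := fun hv => h.measurable_blim (hlt hv)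
  have h1 : Integrable (blim p Q c φ · (-1)) := by
    refine ⟨(hm (by norm_num)).aestronglyMeasurable, ?_⟩
    refine (lintegral_congr fun x => ?_).trans_lt hw.lt_top
    rw [Real.enorm_eq_ofReal_abs, abs_of_nonpos (h.blim_nonpos (by norm_num) x)]
  refine (h1.const_mul (max 1 (-u))).mono (hm hu).aestronglyMeasurable (ae_of_all _ fun x => ?_)
  have h2 := h.blim_nonpos hu x
  have h3 := h.blim_nonpos (show (-1 : ℝ) ≤ 0 by norm_num) x
  have hmax : (1 : ℝ) ≤ max 1 (-u) := le_max_left _ _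
  rw [Real.norm_of_nonpos h2, Real.norm_of_nonpos (mul_nonpos_of_nonneg_of_nonpos (by linarith) h3)]
  rcases le_or_gt (-1) u with h4 | h4
  · have h5 := h.blim_mono (hlt hu) h4 x
    nlinarith
  · have h5 := (h.convexOn_blim x).2 (show u ∈ {θ | θ * Φ < Q ^ 2 / (4 * c)} from hlt hu)
      (show (0 : ℝ) ∈ {θ | θ * Φ < Q ^ 2 / (4 * c)} from h.zero_lt)
      (show 0 ≤ 1 / (-u) by apply div_nonneg <;> linarith)
      (show 0 ≤ 1 - 1 / (-u) by rw [sub_nonneg, div_le_one (by linarith)]; linarith) (by ring)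
    have e : (1 / (-u)) • u + (1 - 1 / (-u)) • (0 : ℝ) = -1 := by
      have : u ≠ 0 := by linarith
      simp only [smul_eq_mul, mul_zero, add_zero]
      field_simp
    rw [e, h.blim_zero, smul_zero, add_zero, smul_eq_mul, div_mul_eq_mul_div, one_mul,
      le_div_iff₀ (by linarith)] at h5
    have h6 : -u ≤ max 1 (-u) := le_max_right _ _
    nlinarith

variable (h : Setting M.transition (Qrate V q) (V * q) Φ φ)
  (hth : ∀ θ, θ < threshold V q φ ↔ θ * Φ < Qrate V q ^ 2 / (4 * (V * q)))
  (hv : ∀ x θ, vLim M V q φ x θ = blim M.transition (Qrate V q) (V * q) φ x θ)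

variable {Ω : Type*} [MeasurableSpace Ω] {Pr : Measure Ω} [IsProbabilityMeasure Pr]
  {N : ℝ → Ω → Measure (E d)} {F : ℝ → ℝ}

include h

lemma hasLaplace_expMass (hH : 0 ≤ H) (hN : IsSuperprocess M V q H Pr N)
    (hi : ∀ u ≤ 0, Integrable (blim M.transition (Qrate V q) (V * q) φ · u)) (n : ℕ) (T : ℝ)
    (hT : 0 < T) : HasLaplace M.transition (Qrate V q) (V * q) H φ T
      (Pr.map (expMass N φ n T)) :=
  ⟨inferInstance, fun u => hN.integral_cubeMono_expMass hH h hi hT u⟩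

include hth hv

lemma exists_tilt_of_lt_rate (hH : 0 < H)
    (hi : ∀ u ≤ 0, Integrable (blim M.transition (Qrate V q) (V * q) φ · u)) {f : C(I, ℝ)}
    (hf : Monotone f) (hf0 : f 0 = 0) {a : ℝ} (ha : (a : EReal) < rate M V q H φ f) :
    ∃ n : ℕ, 0 < n ∧ ∃ θ : Fin n → ℝ, (∀ i, θ i * Φ < Qrate V q ^ 2 / (4 * (V * q)) ∧
      Integrable (blim M.transition (Qrate V q) (V * q) φ · (θ i))) ∧
      a < ∑ i, (θ i * incr n f i - lam M.transition (Qrate V q) (V * q) (H / n) φ univ (θ i)) := by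
  rw [rate, lt_iSup_iff] at ha
  obtain ⟨ν, ha⟩ := ha
  obtain ⟨hν, ha⟩ := lt_iSup_iff.1 ha
  -- A measure with Λ(ν) = +∞ contributes -∞ to the supremum, so it cannot be the one that exceeds
  -- a.
  have hL : Lam M V q H φ ν ≠ ⊤ := fun hL => by
    rw [hL, EReal.sub_top] at ha
    exact not_lt_bot ha
  obtain ⟨y, hy1, hy2⟩ := EReal.lt_iff_exists_real_btwn.1 ha
  have hy1' : a < y := by exact_mod_cast hy1
  obtain ⟨n, hn, θ, hθ, hle⟩ := h.exists_grid hth hv hH hi hf hf0 hν hL (sub_pos.2 hy1')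
  refine ⟨n, hn, θ, hθ, ?_⟩
  have h3 : y < _ := EReal.coe_lt_coe_iff.1 (hy2.trans_le hle)
  linarith

/-- The local upper bound, when the stationary solutions are integrable. -/
lemma exists_ball_le (hH : 0 < H) (hN : IsSuperprocess M V q H Pr N) (hF : ∀ T, F T = T)
    (hi : ∀ u ≤ 0, Integrable (blim M.transition (Qrate V q) (V * q) φ · u)) {f : C(I, ℝ)}
    (hf : Monotone f) {a : ℝ} (ha : (a : EReal) < rate M V q H φ f) : ∃ r : ℝ, 0 < r ∧
      ∀ᶠ T in atTop, Pr (pathEvent N F φ T (Metric.ball f r)) ≤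
        ofReal (exp (-(T * a))) := by
  by_cases hf0 : f 0 = 0
  · obtain ⟨n, hn, θ, hθ, hlt⟩ := h.exists_tilt_of_lt_rate hth hv hH hi hf hf0 ha
    set s := ∑ i, (θ i * incr n f i -
      lam M.transition (Qrate V q) (V * q) (H / n) φ univ (θ i)) with hs
    have hab : 0 ≤ ∑ i, |θ i| := Finset.sum_nonneg fun i _ => abs_nonneg _
    -- A ball of radius r sits in a box of half-width 2r, which costs at most (s - a)/2 in the
    -- exponent; the other half of s - a is the parameter η of the box bound.
    set r := (s - a) / (4 * (∑ i, |θ i| + 1)) with hr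
    have hr0 : 0 < r := div_pos (sub_pos.2 hlt) (by positivity)
    refine ⟨r, hr0, ?_⟩
    filter_upwards [eventually_gt_atTop 0, h.eventually_box_le (m := fun T => Pr.map (expMass N φ n T))
      (D := incr n f) (ε := 2 * r) hn hH.le hi (h.hasLaplace_expMass hH.le hN hi n) hθ
      (show 0 < (s - a) / 2 by linarith)] with T hT hbox
    refine (measure_mono (pathEvent_ball_subset (n := n) hT (hF T))).trans ?_
    rw [← Measure.map_apply (hN.measurable_expMass h.meas) measurableSet_box, ← ofReal_measureReal]
    refine ENNReal.ofReal_le_ofReal (hbox.trans (Real.exp_le_exp.2 (neg_le_neg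
      (mul_le_mul_of_nonneg_left ?_ hT.le))))
    have h1 : r * (∑ i, |θ i| + 1) = (s - a) / 4 := by rw [hr]; field_simp
    linarith
  · refine ⟨|f 0|, abs_pos.2 hf0, Eventually.of_forall fun T => ?_⟩
    rw [pathEvent_ball_eq_empty le_rfl, measure_empty]
    exact zero_le

omit hth hv in
/-- The local upper bound, when the stationary solutions are not integrable. -/
lemma eventually_ball_le_of_lintegral (hH : 0 < H) (hN : IsSuperprocess M V q H Pr N)
    (hF : ∀ T, F T = T) (hw : ∫⁻ x, ofReal
      (-blim M.transition (Qrate V q) (V * q) φ x (-1)) = ⊤) (f : C(I, ℝ)) (a : ℝ) :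
    ∀ᶠ T in atTop, Pr (pathEvent N F φ T (Metric.ball f 1)) ≤
      ofReal (exp (-(T * a))) := by
  -- On the event, the whole interval being a single cell, the total mass is at most TK, since the
  -- radius is 1 and the increment deviates by at most 2.
  set K := incr 1 f 0 + 2 with hK
  have hneg : (-1 : ℝ) * Φ < Qrate V q ^ 2 / (4 * (V * q)) := h.neg_sub zero_le_one
  have hmb := h.measurable_blim hneg
  have hBt : ∀ k : ℕ, volume (closedBall (0 : E d) k) ≠ ⊤ := fun k =>
    measure_closedBall_lt_top.ne
  -- As the integral at parameter -1 diverges, a large ball has exponent below -(a + K). Markov's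
  -- inequality for the negative exponential of the total mass then loses only the factor e^{TK}.
  obtain ⟨k, hk⟩ : ∃ k : ℕ,
      lam M.transition (Qrate V q) (V * q) H φ (closedBall 0 k) (-1) < -(a + K) := by
    have h1 := tendsto_measure_iUnion_atTop (μ := volume.withDensity fun x => ofReal
      (-blim M.transition (Qrate V q) (V * q) φ x (-1)))
      (s := fun k : ℕ => closedBall (0 : E d) k) fun k l hkl =>
        Metric.closedBall_subset_closedBall (by exact_mod_cast hkl)
    rw [Metric.iUnion_closedBall_nat, withDensity_apply _ MeasurableSet.univ, setLIntegral_univ,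
      hw] at h1
    obtain ⟨k, hk⟩ := (h1.eventually (lt_mem_nhds
      (ENNReal.ofReal_lt_top (r := (|a + K| + 1) / H)))).exists
    refine ⟨k, ?_⟩
    have h2 := (h.integrableOn_blim hneg (hBt k)).neg
    have h3 := ofReal_integral_eq_lintegral_ofReal h2
      (ae_of_all _ fun x => neg_nonneg.2 (h.blim_nonpos (by norm_num) x))
    simp only [Function.comp_apply, withDensity_apply _ Metric.isClosed_closedBall.measurableSet] at hk
    simp only [Pi.neg_apply] at h3
    rw [← h3, integral_neg, ENNReal.ofReal_lt_ofReal_iff_of_nonneg (by positivity),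
      div_lt_iff₀ hH] at hk
    rw [lam]
    linarith [le_abs_self (a + K)]
  have ht := h.tendsto_laplaceExp (n := 1) (H := H) (b := 0) (θ := fun _ => -1)
    (B := closedBall 0 k) one_pos le_rfl h.zero_lt (fun _ => by norm_num)
    fun u hu => h.integrableOn_blim (h.lt_of_le h.zero_lt hu) (hBt k)
  simp only [Finset.univ_unique, Finset.sum_singleton, Nat.cast_one, div_one] at ht
  filter_upwards [eventually_gt_atTop 0, ht.eventually (gt_mem_nhds hk)] with T hT hlt
  rw [inv_mul_lt_iff₀ hT] at hlt
  have h1 := hN.lintegral_nexp_cellMass h hT (n := 1) fun _ => 1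
  simp only [Finset.univ_unique, Finset.sum_singleton, ENNReal.coe_one, one_mul, NNReal.coe_one,
    Fin.default_eq_zero] at h1
  have hfin := isFiniteMeasure_slab T (hBt k)
  have hθ : ∀ i : Fin 1, (fun _ => (-1 : ℝ)) i ∈ Icc (-1 : ℝ) 0 := fun i => by simp
  have hint := (h.integrable_gsol hT.le zero_le_one le_rfl h.zero_lt hθ
    (h.integrableOn_blim hneg (hBt k)) (h.integrableOn_blim h.zero_lt (hBt k))).neg
  have h0 : 0 ≤ᵐ[slab T (closedBall 0 k)] fun y : ℝ × E d =>
      -gsol M.transition (Qrate V q) (V * q) φ 1 T (fun _ => -1) y.1 y.2 := by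
    filter_upwards [ae_slab T (closedBall 0 k)] with y hy
    have := (h.gsol_envelope hT.le zero_le_one le_rfl h.zero_lt hθ hy.1.le y.2).2
    rw [h.blim_zero] at this
    exact neg_nonneg.2 this
  have e2 := ofReal_integral_eq_lintegral_ofReal hint h0
  simp only [Pi.neg_apply] at e2
  have h2 : ∫⁻ ω, nexp (cellMass N φ 1 T 0 ω) ∂Pr ≤ ofReal (exp
      (laplaceExp M.transition (Qrate V q) (V * q) H φ 1 T (closedBall 0 k) fun _ => -1)) := by
    rw [h1]
    refine (nexp_anti (mul_le_mul_right (lintegral_mono' (slab_le T (closedBall 0 k))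
      le_rfl) _)).trans_eq ?_
    rw [← e2, ← ENNReal.ofReal_mul hH.le, nexp_ofReal (mul_nonneg hH.le (integral_nonneg_of_ae h0)),
      integral_neg, mul_neg, neg_neg, laplaceExp]
  have hsub : pathEvent N F φ T (Metric.ball f 1) ⊆
      {ω | ofReal (exp (-(T * K))) ≤ nexp (cellMass N φ 1 T 0 ω)} := fun ω hω => by
    obtain ⟨x, hx0, hx, hxD⟩ :=
      expMass_mem_box_iff.1 (pathEvent_ball_subset (n := 1) hT (hF T) hω) 0
    have := (abs_le.1 hxD).2
    rw [mem_ofPred_eq, hx, nexp_ofReal hx0]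
    refine ENNReal.ofReal_le_ofReal (Real.exp_le_exp.2 (neg_le_neg ?_))
    rw [hK, mul_add]
    linarith
  have hm : Measurable fun ω => nexp (cellMass N φ 1 T 0 ω) :=
    measurable_nexp.comp (hN.measurable_cellMass h.meas 0)
  have h3 := (mul_meas_ge_le_lintegral hm (ofReal (exp (-(T * K))))).trans h2
  have h4 := mul_le_mul_right h3 (ofReal (exp (T * K)))
  rw [← mul_assoc, ← ENNReal.ofReal_mul (Real.exp_nonneg _), ← Real.exp_add, add_neg_cancel,
    Real.exp_zero, ENNReal.ofReal_one, one_mul, ← ENNReal.ofReal_mul (Real.exp_nonneg _),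
    ← Real.exp_add] at h4
  refine (measure_mono hsub).trans (h4.trans (ENNReal.ofReal_le_ofReal (Real.exp_le_exp.2 ?_)))
  linarith

lemma rate_nonneg
    (hi : ∀ u ≤ 0, Integrable (blim M.transition (Qrate V q) (V * q) φ · u)) (f : C(I, ℝ)) :
    0 ≤ rate M V q H φ f := by
  have h1 := h.sum_le_rate (H := H) hth hv one_pos (θ := fun _ => 0)
    (fun i => ⟨h.zero_lt, hi 0 le_rfl⟩) f
  simpa [lam, h.blim_zero] using h1

/-- The lower bound. -/
lemma eventually_le_pathEvent (hH : 0 < H) (hN : IsSuperprocess M V q H Pr N) (hF : ∀ T, F T = T)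
    (hθ₀ : 0 < threshold V q φ)
    (hi : ∀ u ≤ 0, Integrable (blim M.transition (Qrate V q) (V * q) φ · u)) {f : C(I, ℝ)}
    (hf : f ∈ admissiblePaths M V q H φ) (hf0 : f 0 = 0) {U : Set C(I, ℝ)} (hU : U ∈ 𝓝 f) {K : ℝ}
    (hK : rate M V q H φ f ≤ K) {δ : ℝ} (hδ : 0 < δ) :
    ∀ᶠ T in atTop, ofReal (exp (-(T * (K + δ)))) ≤ Pr (pathEvent N F φ T U) := by
  obtain ⟨ε, hε, hεU⟩ := Metric.mem_nhds_iff.1 hU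
  have hε' : 0 < ε / 3 := by positivity
  obtain ⟨n, hn, hinc⟩ := exists_incr_le f hε'
  have hn' : (0 : ℝ) < n := by exact_mod_cast hn
  choose D hD0 hDA hDn using fun i : Fin n => exists_incr_eq hf i
  have : Nonempty (Fin n) := ⟨⟨0, hn⟩⟩
  obtain ⟨j, hj⟩ := Finite.exists_max D
  have hHD : ∀ y : ℝ≥0∞, ofReal (D j / H) < y → ofReal (D j) < ofReal H * y :=
    fun y hy => by
      rwa [ENNReal.ofReal_div_of_pos hH, ENNReal.div_lt_iff (Or.inl (by simpa using hH))
        (Or.inl ENNReal.ofReal_ne_top), mul_comm] at hy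
  have hA : ofReal (D j / H) < slopeA M V q φ := by
    have h1 := hDA j
    rw [← max_eq_left (hD0 j).le, ← EReal.coe_ennreal_ofReal, EReal.coe_ennreal_lt_coe_ennreal_iff,
      mul_comm] at h1
    rw [ENNReal.ofReal_div_of_pos hH]
    exact ENNReal.div_lt_of_lt_mul h1
  -- D j is the largest of the cell slopes and is less than HA, so below the threshold there is θ'
  -- whose integrated derivative times H exceeds D j, hence every D i. The parameter θ₁ chosen next
  -- leaves room above θ' for an interior maximiser.
  obtain ⟨θ', h0, h1, h2⟩ := h.exists_slope hθ₀ (fun θ hθ => (hth θ).1 hθ)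
    (α := ofReal (D j / H)) (μ := volume) (by simpa only [slopeA, hv] using hA)
  obtain ⟨θ₁, h3, h4⟩ := exists_between h1
  have h5 := h.eventually_le_box (m := fun T => Pr.map (expMass N φ n T)) (D := incr n f) hn hH hi
    (h.hasLaplace_expMass hH.le hN hi n) (fun i => by rw [hDn]; exact div_pos (hD0 i) hn') h0 h3
    ((hth _).1 h4) (fun i => ?_) (K := K) (fun θ hθ => EReal.coe_le_coe_iff.1
      ((h.sum_le_rate hth hv hn hθ f).trans hK)) (div_pos hε' hn') hδ
  · filter_upwards [eventually_gt_atTop 0, h5] with T hT hbox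
    refine (ENNReal.ofReal_le_ofReal hbox).trans ?_
    rw [ofReal_measureReal, Measure.map_apply (hN.measurable_expMass h.meas) measurableSet_box]
    refine measure_mono (preimage_box_subset_pathEvent hN h.meas hT (hF T)
      (monotone_of_mem_slopeSet hf) hf0 hε' hn hinc (by rwa [mul_div_cancel₀ _ three_ne_zero]))
  · rw [hDn, ENNReal.ofReal_div_of_pos hn', ENNReal.ofReal_div_of_pos hn', ENNReal.div_eq_inv_mul,
      ENNReal.div_eq_inv_mul, mul_assoc]
    refine ENNReal.mul_lt_mul_right (by simp) (by simpa using hn.ne') ?_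
    exact (ENNReal.ofReal_le_ofReal (hj i)).trans_lt (hHD _ h2)

end Setting

end Bounds

section Degenerate

variable {d : ℕ} {S : Type*} [MeasurableSpace S] {M : MarkovFamily d S} {V q H : ℝ} {φ : E d → ℝ}

/-- For `φ = 0` there are no admissible paths. -/
lemma admissiblePaths_eq_empty {Φ : ℝ} (h : Setting M.transition (Qrate V q) (V * q) Φ φ)
    (hv : ∀ x θ, vLim M V q φ x θ = blim M.transition (Qrate V q) (V * q) φ x θ)
    (hφ : ∀ x, φ x = 0) : admissiblePaths M V q H φ = ∅ := by
  have hb : ∀ x θ, vLim M V q φ x θ = 0 := fun x θ => by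
    rw [hv, ← h.blim_zero x, blim, blim, bsol, bsol]
    simp only [hφ, mul_zero]
  have hA : slopeA M V q φ = 0 := by
    simp only [slopeA, hb, deriv_const', ENNReal.ofReal_zero, lintegral_zero]
    exact tendsto_const_nhds.limUnder_eq
  refine eq_empty_of_forall_notMem fun f hf => ?_
  obtain ⟨D, -, h1, h2⟩ := hf 0
  rw [hA, mul_zero, EReal.coe_ennreal_zero] at h2
  exact h1.not_gt h2

end Degenerate

end SuperLDP

end

/-! ### The main theorem -/

open SuperLDP in
theorem mainTheorem3 {d : ℕ} {S : Type*} [MeasurableSpace S] (M : SuperLDP.MarkovFamily d S)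
    (hA1 : M.UniformlyStochContinuous) (hA2 : M.SchwartzInDomain) (hA3 : M.FeynmanKacFeller)
    (V q H : ℝ) (hV : 0 < V) (hq : 0 < q) (hq' : q < 1 / 2) (hH : 0 < H)
    {Ω : Type*} [MeasurableSpace Ω] (Pr : Measure Ω) [IsProbabilityMeasure Pr]
    (N : ℝ → Ω → Measure (SuperLDP.E d)) (hN : SuperLDP.IsSuperprocess M V q H Pr N)
    (φ : 𝓢(SuperLDP.E d, ℝ)) (hφ : ∀ x, 0 ≤ φ x)
    (F : ℝ → ℝ) (hF : ∀ T, F T = T) :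
    (∀ U : Set C(I, ℝ), IsOpen U →
      -(⨅ f ∈ U ∩ SuperLDP.admissiblePaths M V q H φ, SuperLDP.rate M V q H φ f) ≤
        liminf (fun T : ℝ => SuperLDP.logScale T (Pr (SuperLDP.pathEvent N F φ T U))) atTop) ∧
    (∀ f ∈ SuperLDP.admissiblePaths M V q H φ,
      (SuperLDP.rate M V q H φ f ≠ ⊤ → ∀ δ : ℝ, 0 < δ → ∃ r : ℝ, 0 < r ∧
        limsup (fun T : ℝ =>
          SuperLDP.logScale T (Pr (SuperLDP.pathEvent N F φ T (Metric.ball f r)))) atTop ≤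
          (δ : EReal) - SuperLDP.rate M V q H φ f) ∧
      (SuperLDP.rate M V q H φ f = ⊤ → ∀ m : ℝ, ∃ r : ℝ, 0 < r ∧
        limsup (fun T : ℝ =>
          SuperLDP.logScale T (Pr (SuperLDP.pathEvent N F φ T (Metric.ball f r)))) atTop ≤
          ((-m : ℝ) : EReal))) := by
  obtain ⟨C, hC⟩ : ∃ C, ∀ x, |φ x| ≤ C := ⟨_, fun x => SchwartzMap.norm_le_seminorm ℝ φ x⟩
  have hbdd : BddAbove (range fun x => |φ x|) := ⟨C, by rintro _ ⟨x, rfl⟩; exact hC x⟩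
  have hle : ∀ x, |φ x| ≤ ⨆ x, |φ x| := fun x => le_ciSup hbdd x
  have hQ : 0 < Qrate V q := mul_pos hV (by linarith)
  have hs : Setting M.transition (Qrate V q) (V * q) (⨆ x, |φ x|) φ :=
    ⟨M.isTransition, hQ, mul_pos hV hq, φ.continuous.measurable, hφ,
      fun x => (le_abs_self _).trans (hle x), Real.iSup_nonneg fun x => abs_nonneg _⟩
  have hv : ∀ x θ, vLim M V q φ x θ = blim M.transition (Qrate V q) (V * q) φ x θ :=
    fun x θ => vLim_eq φ.continuous.measurable hC x θ
  -- For φ = 0 the threshold is a division by zero with value 0. All slopes then vanish, no path is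
  -- admissible, and both claims are empty.
  rcases (Real.iSup_nonneg fun x => abs_nonneg (φ x)).eq_or_lt with h0 | h0
  · have hempty := admissiblePaths_eq_empty (H := H) hs hv fun x =>
      abs_nonpos_iff.1 ((hle x).trans_eq h0.symm)
    rw [hempty]
    exact ⟨fun U _ => by simp, fun f hf => absurd hf (notMem_empty f)⟩
  have hθ₀ : 0 < threshold V q φ := by unfold threshold; positivity
  have hth : ∀ θ, θ < threshold V q φ ↔ θ * (⨆ x, |φ x|) < Qrate V q ^ 2 / (4 * (V * q)) :=
    fun θ => by rw [threshold, lt_div_iff₀ h0, mul_assoc 4 V q]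
  have hupper : ∀ f ∈ admissiblePaths M V q H φ, ∀ a : ℝ, (a : EReal) < rate M V q H φ f →
      ∃ r : ℝ, 0 < r ∧ limsup (fun T : ℝ => logScale T
        (Pr (pathEvent N F φ T (Metric.ball f r)))) atTop ≤ ((-a : ℝ) : EReal) := by
    intro f hf a ha
    -- If the stationary limit at -1 is not integrable, the balls have superexponentially small
    -- probability and radius 1 serves for every a. Otherwise all nonpositive parameters are
    -- integrable and the tilted bound applies.
    by_cases hw : ∫⁻ x, ENNReal.ofReal (-blim M.transition (Qrate V q) (V * q) φ x (-1)) = ⊤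
    · exact ⟨1, one_pos, limsup_logScale_le (hs.eventually_ball_le_of_lintegral hH hN hF hw f a)⟩
    · obtain ⟨r, hr, h1⟩ := hs.exists_ball_le hth hv hH hN hF
        (fun u hu => hs.integrable_blim_nonpos hw hu) (monotone_of_mem_slopeSet hf) ha
      exact ⟨r, hr, limsup_logScale_le h1⟩
  refine ⟨fun U hU => ?_, fun f hf => ⟨fun hR δ hδ => ?_, fun hR m => ?_⟩⟩
  · rw [EReal.neg_le]
    refine le_iInf₂ fun f hf => ?_
    rw [EReal.neg_le]
    rcases eq_or_ne (rate M V q H φ f) ⊤ with hR | hR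
    · rw [hR]
      exact bot_le
    have hw : ∫⁻ x, ENNReal.ofReal (-blim M.transition (Qrate V q) (V * q) φ x (-1)) ≠ ⊤ :=
      fun hw => hR (hs.rate_eq_top_of_lintegral hth hv hH hw f)
    have hi := fun u (hu : u ≤ 0) => hs.integrable_blim_nonpos hw hu
    have hf0 : f 0 = 0 := not_not.1 fun hf0 => hR (hs.rate_eq_top_of_ne hth hv hf0)
    have hK := EReal.coe_toReal hR
      (ne_bot_of_le_ne_bot EReal.zero_ne_bot (hs.rate_nonneg (H := H) hth hv hi f))
    rw [← hK]
    -- It suffices to reach every real z below minus the rate; the gap between the two is the δ of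
    -- the lower bound.
    refine EReal.ge_of_forall_gt_iff_ge.1 fun z hz => ?_
    have hz' : z < -(rate M V q H φ f).toReal := by exact_mod_cast hz
    have h1 := le_liminf_logScale (hs.eventually_le_pathEvent hth hv hH hN hF hθ₀ hi hf.2 hf0
      (hU.mem_nhds hf.1) hK.ge (δ := -(rate M V q H φ f).toReal - z) (by linarith))
    rwa [show -((rate M V q H φ f).toReal + (-(rate M V q H φ f).toReal - z)) = z by ring] at h1
  -- Were the rate -∞, the right-hand side would be +∞ and the bound trivial.
  · rcases eq_or_ne (rate M V q H φ f) ⊥ with hR' | hR'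
    · rw [hR', EReal.coe_sub_bot]
      exact ⟨1, one_pos, le_top⟩
    · have hK := EReal.coe_toReal hR hR'
      obtain ⟨r, hr, h1⟩ := hupper f hf ((rate M V q H φ f).toReal - δ) (by
        conv_rhs => rw [← hK]
        exact_mod_cast sub_lt_self _ hδ)
      refine ⟨r, hr, h1.trans_eq ?_⟩
      conv_rhs => rw [← hK]
      rw [← EReal.coe_sub, neg_sub]
  · obtain ⟨r, hr, h1⟩ := hupper f hf m (hR ▸ EReal.coe_lt_top m)
    exact ⟨r, hr, h1⟩
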